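/- **Setting.** Let $X=\mathcal O_{\mathbb P^1}(-1,-1,0)$ and let $Z=\mathcal O_{\mathbb P^1}(-1,-1)$, with $\iota:Z=Z\times\{0\}\hookrightarrow X$. The torus $T_0=\{t\in(\mathbb C^*)^4: t_0t_1t_2t_3=1\}$ acts on $X$ so that $N_{\mathbb P^1/X}=\mathcal O(-Z_\infty)\otimes t_1^{-1}\oplus\mathcal O(-Z_\infty)\otimes t_2^{-1}\oplus\mathcal O\otimes t_3^{-1}$, where $\mathcal O_{\mathbb P^1}(Z_\infty)$ has sections of weights $1,t_0$; it also acts on $Z$, and this action is the restricted torus $T_0|_Z\cong(\mathbb C^*)^3$. Put $\lambda_i=e_{T_0}(t_i)$, so that $\lambda_0+\lambda_1+\lambda_2+\lambda_3=0$. For $V=\sum_w n_w t^w\in K^{T_0}(pt)$ let $V^\vee=\sum_w n_wt^{-w}$; let $e(V)=\prod_w e(t^w)^{n_w}\in\mathbb Q(\lambda_0,\lambda_1,\lambda_2)$, which is defined when the trivial character has multiplicity $n_0\ge 0$; and let $e(V^\vee\otimes e^m)=\prod_w(m-e(t^w))^{n_w}\in\mathbb Q(\lambda_0,\lambda_1,\lambda_2,m)$.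 A square root of $V$ is an $R\in K^{T_0}(pt)$ with $R+R^\vee=V$. Perverse coherent systems $I=(\mathcal O_X\xrightarrow{s}F)$ on $X$ with $F$ compactly supported are identified, through the derived equivalence given by the tilting bundle $\mathcal O\oplus\mathcal O(1)$, with finite-dimensional representations $(V_0,V_1,V_\infty=\mathbb C)$ of the framed quiver with arrows $a_1,a_2:0\to1$, $b_1,b_2:1\to0$, loops $c$ at $0$ and $d$ at $1$, one arrow $\infty\to0$, and relations $a_2b_ia_1=a_1b_ia_2$, $b_2a_ib_1=b_1a_ib_2$, $da_i=a_ic$, $cb_i=b_id$ $(i=1,2)$. The arrows $a_1,a_2,b_1,b_2,c,d$ have torus weights $t_1,t_2,1,t_0,t_3,t_3$. Here $V_0=\mathrm{Hom}(\mathcal O_X,F)$ and $V_1=\mathrm{Hom}(\mathcal O_X(1),F)$, and $\dim V_0=\chi(F)=n$, $\dim V_1=n-d$, where $d$ is the degree of $F$ over $\mathbb P^1$. Pairs on $Z$ are described in the same way by the quiver without $c,d$, and $I$ is scheme-theoretically supported on $Z$, i.e. $I=(\mathcal O_X\to\iota_*F_Z)$, when $c=d=0$. The classes $\chi_X(E,E')=\sum_k(-1)^k\mathrm{Ext}^k(E,E')$,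 $\chi_X(E)=\chi_X(\mathcal O_X,E)$ and the corresponding classes on $Z$ are equivariant Euler characteristics in $K^{T_0}(pt)$, and $\chi_Z(I,I)_0=\chi_Z(F_Z,F_Z)-\chi_Z(F_Z)-\chi_Z(F_Z,\mathcal O_Z)$. For $\Theta=(\theta_0,\theta_1)\in\mathbb R^2$ put $\Theta(V_0',V_1')=\theta_0\dim V_0'+\theta_1\dim V_1'$. The pair is $\Theta$-stable if $\Theta(V_0',V_1')<0$ for every non-zero subrepresentation $(V_0',V_1',0)$ and $\Theta(V_0',V_1')<\Theta(V_0,V_1)$ for every proper subrepresentation $(V_0',V_1',\mathbb C)$. The walls are the sets of $\Theta$ with $\theta_0\ne\theta_1$ and one of: $k\theta_0+(k-1)\theta_1=0$ for an integer $k\ge1$; $k\theta_0+(k+1)\theta_1=0$ for an integer $k\ge0$; $\theta_0+\theta_1=0$. For $\Theta$ outside the walls, $P_n^\Theta(X,d)^{T_0}$ denotes the set of torus-fixed isomorphism classes of $\Theta$-stable pairs with invariants $(n,d)$; the weights of such a pair are taken for its unique $T_0$-action in which $s$ is invariant. For each fixed point choose a square root $\chi_X(F,F)^{1/2}$ of $\chi_X(F,F)$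 and a sign. Put $\chi_X(I,I)_0^{1/2}=-\chi_X(F)+\chi_X(F,F)^{1/2}$, let $e_{T_0}(\chi_X(I,I)_0^{1/2})$ be its Euler class times the chosen sign, and let $$P^\Theta_{n,d}(e^m)=\sum_{I\in P^\Theta_n(X,d)^{T_0}}e_{T_0}(\chi_X(I,I)_0^{1/2})\cdot e_{T_0\times\mathbb C^*}(\chi_X(F)^\vee\otimes e^m).$$ **Proposition.** Let $\Theta\in\mathbb R^2$ lie outside the walls. Then the sets $P_n^\Theta(X,d)^{T_0}$ are finite, square roots of $\chi_X(F,F)$ exist, and all the Euler pairings and Euler classes in the two claims below are well defined. Moreover: (1) (Dimensional reduction) Let $I\in P^\Theta_n(X,d)^{T_0}$. If $I=(\mathcal O_X\to\iota_*F_Z)$ is scheme-theoretically supported on $Z$, then $\chi_Z(F_Z,F_Z)$ is a square root of $\chi_X(F,F)$; for this square root and the sign $+$, $$e_{T_0}(\chi_X(I,I)_0^{1/2})\cdot e_{T_0\times\mathbb C^*}(\chi_X(F)^\vee\otimes e^m)\big|_{m=\lambda_3}=e_{(\mathbb C^*)^3}(\chi_Z(I,I)_0),$$ and for any other choice the same equality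 holds up to a sign. If $I$ is not scheme-theoretically supported on $Z$, then the left-hand side is $0$ for every choice. (2) (Insertion-free limit) For all choices of square roots and signs, the same choices being used on both sides, $$\lim_{\substack{m\to\infty\\ Q\ \mathrm{fixed}}}\Big(\sum_{n,d}P^\Theta_{n,d}(e^m)q^nt^d\big|_{Q=qm}\Big)=\sum_{n,d}Q^nt^d\sum_{I\in P^\Theta_n(X,d)^{T_0}}e_{T_0}(\chi_X(I,I)_0^{1/2}),$$ as a coefficientwise limit of formal series in $Q$ and $t$. -/

import Mathlib

open CategoryTheory

namespace LocalConifold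

/-! ### The torus, its characters and its equivariant `K`-theory -/

/-- The character lattice of `T₀ = {t₀ t₁ t₂ t₃ = 1}`, with basis the characters `t₀, t₁, t₂`. -/
abbrev Weight : Type := Fin 3 → ℤ

/-- The characters `t₀, t₁, t₂, t₃`; the last one is `(t₀ t₁ t₂)⁻¹`. -/
def tw (i : Fin 4) : Weight :=
  match i with
  | 0 => ![1, 0, 0]
  | 1 => ![0, 1, 0]
  | 2 => ![0, 0, 1]
  | 3 => ![-1, -1, -1]

/-- The complex points of the Calabi-Yau torus `T₀ = {t ∈ (ℂˣ)⁴ : t₀ t₁ t₂ t₃ = 1}`. -/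
abbrev Torus : Type := {t : Fin 4 → ℂˣ // ∏ i, t i = 1}

/-- The value `t^w` of the character `w` at the point `t`. -/
def Torus.char (t : Torus) (w : Weight) : ℂ :=
  ((∏ i : Fin 3, t.1 i.castSucc ^ w i : ℂˣ) : ℂ)

theorem Torus.char_zero (t : Torus) : t.char 0 = 1 := by simp [Torus.char]

theorem Torus.char_add (t : Torus) (w w' : Weight) :
    t.char (w + w') = t.char w * t.char w' := by
  simp [Torus.char, zpow_add, Finset.prod_mul_distrib]

/-- The additive group of `K^{T₀}(pt) = ℤ[t₀^±, t₁^±, t₂^±, t₃^±] / (t₀t₁t₂t₃ - 1)`: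
`V = ∑_w V(w) t^w`. -/
abbrev KT : Type := Weight →₀ ℤ

/-- The involution `t^w ↦ t^{-w}` of `K^{T₀}(pt)`. -/
noncomputable def KT.dual (V : KT) : KT := Finsupp.equivMapDomain (Equiv.neg Weight) V

/-- `R` is a square root of `V`: `R + R^∨ = V`. -/
def KT.IsSquareRoot (R V : KT) : Prop := R + R.dual = V

/-- The field `ℚ(λ₀, λ₁, λ₂, λ₃)/(λ₀ + λ₁ + λ₂ + λ₃) = ℚ(λ₀, λ₁, λ₂)`. -/
abbrev LamField : Type := FractionRing (MvPolynomial (Fin 3) ℚ)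

/-- The equivariant first Chern class of the character `w`; thus `c₁(t_i) = λ_i`. -/
noncomputable def c₁ (w : Weight) : LamField :=
  ∑ i : Fin 3, (w i : LamField) * algebraMap (MvPolynomial (Fin 3) ℚ) LamField (MvPolynomial.X i)

/-- The equivariant parameter `λ_i = e_{T₀}(t_i)`. -/
noncomputable def lam (i : Fin 4) : LamField := c₁ (tw i)

/-- The equivariant Euler class `e_{T₀}(V) = ∏_w c₁(w)^{V(w)}`. It is defined for those `V` in which
the trivial character has multiplicity `≥ 0` (and it is `0` if that multiplicity is positive). -/
noncomputable def euler (V : KT) : LamField := V.prod fun w k => c₁ w ^ k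

/-- The Euler class of `V` is well defined. -/
def KT.EulerDefined (V : KT) : Prop := 0 ≤ V 0

/-- The field `Λ = ℚ(λ₀, λ₁, λ₂, m)`. -/
abbrev Lam : Type := RatFunc LamField

/-- The equivariant parameter `m` in `Λ`. -/
noncomputable def mPar : Lam := RatFunc.X

/-- The Euler class `e_{T₀ × ℂˣ}(V^∨ ⊗ e^m) = ∏_w (m - c₁(w))^{V(w)}`. -/
noncomputable def eulerTaut (V : KT) : Lam := V.prod fun w k => (mPar - RatFunc.C (c₁ w)) ^ k

/-- `f ∈ Λ` is regular at `m = a`, with value `v` there. -/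
def SpecializesTo (f : Lam) (a v : LamField) : Prop :=
  f.denom.eval a ≠ 0 ∧ f.eval (RingHom.id LamField) a = v

open Classical in
/-- `f ∈ Λ` has the limit `v` for `m → ∞`: `f - v` vanishes at the place `m = ∞`. -/
def TendsToAtInfinity (f : Lam) (v : LamField) : Prop :=
  RatFunc.inftyValuation LamField (f - RatFunc.C v) < 1

/-! ### Quivers with relations and torus weights -/

/-- The two vertices `0` and `1`. -/
inductive Vtx : Type
  | v0 | v1

/-- Paths in the quiver with vertices `0, 1` and arrows `A`. -/
abbrev PathOn (A : Vtx → Vtx → Type) (i j : Vtx) : Type := @Quiver.Path Vtx ⟨A⟩ i j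

/-- A quiver on the vertices `0, 1` with a `T₀`-weight on every arrow, and with relations of the
form "path `=` path". -/
structure WQuiver where
  Arrow : Vtx → Vtx → Type
  deg : ∀ {i j : Vtx}, Arrow i j → Weight
  rel : ∀ {i j : Vtx}, PathOn Arrow i j → PathOn Arrow i j → Prop

/-- The vertices of `Q`, as a quiver. -/
def WQuiver.V (_ : WQuiver) : Type := Vtx

instance (Q : WQuiver) : Quiver Q.V := ⟨Q.Arrow⟩

/-- The arrows of the quiver of `X = 𝒪_{ℙ¹}(-1,-1,0)`. -/
inductive ArrowX : Vtx → Vtx → Type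
  | a (i : Fin 2) : ArrowX .v0 .v1
  | b (i : Fin 2) : ArrowX .v1 .v0
  | c : ArrowX .v0 .v0
  | d : ArrowX .v1 .v1

/-- The `T₀`-weights of the arrows. With the convention that the normal bundle of `ℙ¹` in `X` is
`𝒪(-Z_∞) ⊗ t₁⁻¹ ⊕ 𝒪(-Z_∞) ⊗ t₂⁻¹ ⊕ 𝒪 ⊗ t₃⁻¹`, the arrows `b₁, b₂` are the sections of `𝒪(Z_∞)`, of
weights `1, t₀`, the arrows `a₁, a₂` are the fibre coordinates of weights `t₁, t₂`, and `c, d` are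
multiplication by the fibre coordinate of weight `t₃`. -/
def ArrowX.deg : ∀ {i j : Vtx}, ArrowX i j → Weight
  | _, _, .a i => ![tw 1, tw 2] i
  | _, _, .b i => ![0, tw 0] i
  | _, _, .c => tw 3
  | _, _, .d => tw 3

/-- The path "first `e`, then `f`". -/
def path2 {A : Vtx → Vtx → Type} {i j k : Vtx} (e : A i j) (f : A j k) :
    PathOn A i k :=
  @Quiver.Path.cons Vtx ⟨A⟩ i j k (@Quiver.Path.cons Vtx ⟨A⟩ i i j (@Quiver.Path.nil Vtx ⟨A⟩ i) e) f

/-- The path "first `e`, then `f`, then `g`". -/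
def path3 {A : Vtx → Vtx → Type} {i j k l : Vtx} (e : A i j) (f : A j k) (g : A k l) :
    PathOn A i l :=
  @Quiver.Path.cons Vtx ⟨A⟩ i k l (path2 e f) g

/-- The relations `a₂ bᵢ a₁ = a₁ bᵢ a₂`, `b₂ aᵢ b₁ = b₁ aᵢ b₂`, `d aᵢ = aᵢ c`, `c bᵢ = bᵢ d`
(paths are composed from right to left in these formulas). -/
inductive RelX : ∀ {i j : Vtx},
    PathOn ArrowX i j → PathOn ArrowX i j → Prop
  | aba (i : Fin 2) : RelX (path3 (.a 0) (.b i) (.a 1)) (path3 (.a 1) (.b i) (.a 0))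
  | bab (i : Fin 2) : RelX (path3 (.b 0) (.a i) (.b 1)) (path3 (.b 1) (.a i) (.b 0))
  | da (i : Fin 2) : RelX (path2 (.a i) .d) (path2 .c (.a i))
  | cb (i : Fin 2) : RelX (path2 (.b i) .c) (path2 .d (.b i))

/-- The quiver with relations of `X = 𝒪_{ℙ¹}(-1,-1,0)`. -/
def quiverX : WQuiver where
  Arrow := ArrowX
  deg := ArrowX.deg
  rel := RelX

/-- The arrows of the quiver of the resolved conifold `Z = 𝒪_{ℙ¹}(-1,-1)`. -/
inductive ArrowZ : Vtx → Vtx → Type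
  | a (i : Fin 2) : ArrowZ .v0 .v1
  | b (i : Fin 2) : ArrowZ .v1 .v0

/-- The weights of the arrows for the restricted torus `T₀|_Z`, which is `T₀ ≅ (ℂˣ)³` acting
on `Z`. -/
def ArrowZ.deg : ∀ {i j : Vtx}, ArrowZ i j → Weight
  | _, _, .a i => ![tw 1, tw 2] i
  | _, _, .b i => ![0, tw 0] i

/-- The relations `a₂ bᵢ a₁ = a₁ bᵢ a₂`, `b₂ aᵢ b₁ = b₁ aᵢ b₂` of the resolved conifold. -/
inductive RelZ : ∀ {i j : Vtx},
    PathOn ArrowZ i j → PathOn ArrowZ i j → Prop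
  | aba (i : Fin 2) : RelZ (path3 (.a 0) (.b i) (.a 1)) (path3 (.a 1) (.b i) (.a 0))
  | bab (i : Fin 2) : RelZ (path3 (.b 0) (.a i) (.b 1)) (path3 (.b 1) (.a i) (.b 0))

/-- The quiver with relations of the resolved conifold `Z = 𝒪_{ℙ¹}(-1,-1)`. -/
def quiverZ : WQuiver where
  Arrow := ArrowZ
  deg := ArrowZ.deg
  rel := RelZ

/-! ### Framed representations, that is, perverse coherent systems -/

/-- The linear map by which a path acts, given the action of the arrows. -/
noncomputable def pathMap {A : Vtx → Vtx → Type} {δ : Vtx → ℕ}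
    (φ : ∀ ⦃i j : Vtx⦄, A i j → (Fin (δ i) → ℂ) →ₗ[ℂ] (Fin (δ j) → ℂ)) {i j : Vtx}
    (p : PathOn A i j) : (Fin (δ i) → ℂ) →ₗ[ℂ] (Fin (δ j) → ℂ) :=
  @Quiver.Path.rec Vtx ⟨A⟩ i (fun k _ => (Fin (δ i) → ℂ) →ₗ[ℂ] (Fin (δ k) → ℂ))
    LinearMap.id (fun _ e f => φ e ∘ₗ f) j p

/-- A representation of the framed quiver with relations, of dimension vector `δ` at the vertices
`0, 1` and with `V_∞ = ℂ`. Under the derived equivalence given by the tilting bundle `𝒪 ⊕ 𝒪(1)`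
this is a perverse coherent system `I = (s : 𝒪 → F)` with compactly supported `F`, where
`V₀ = Hom(𝒪, F)`, `V₁ = Hom(𝒪(1), F)`, and the framing is the section `s`. -/
@[ext]
structure FramedRep (Q : WQuiver) (δ : Vtx → ℕ) where
  map : ∀ ⦃i j : Vtx⦄, Q.Arrow i j → (Fin (δ i) → ℂ) →ₗ[ℂ] (Fin (δ j) → ℂ)
  framing : Fin (δ .v0) → ℂ
  relation : ∀ {i j : Vtx} (p q : PathOn Q.Arrow i j), Q.rel p q →
    pathMap map p = pathMap map q

namespace FramedRep

variable {Q : WQuiver} {δ : Vtx → ℕ}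

/-- Isomorphisms of framed representations. -/
structure Iso (V W : FramedRep Q δ) where
  g : ∀ i : Vtx, (Fin (δ i) → ℂ) ≃ₗ[ℂ] (Fin (δ i) → ℂ)
  map_comm : ∀ {i j : Vtx} (e : Q.Arrow i j) (v : Fin (δ i) → ℂ),
    g j (V.map e v) = W.map e (g i v)
  framing_comm : g .v0 V.framing = W.framing

/-- `V` and `W` lie in the same orbit of `GL(V₀) × GL(V₁)`. -/
instance setoid (Q : WQuiver) (δ : Vtx → ℕ) : Setoid (FramedRep Q δ) where
  r V W := Nonempty (Iso V W)
  iseqv :=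
    { refl := fun _ => ⟨⟨fun _ => LinearEquiv.refl _ _, fun _ _ => rfl, rfl⟩⟩
      symm := by
        rintro V W ⟨f⟩
        refine ⟨⟨fun i => (f.g i).symm, fun {i j} e v => ?_, ?_⟩⟩
        · rw [LinearEquiv.symm_apply_eq, f.map_comm, LinearEquiv.apply_symm_apply]
        · rw [LinearEquiv.symm_apply_eq, f.framing_comm]
      trans := by
        rintro U V W ⟨f⟩ ⟨h⟩
        refine ⟨⟨fun i => (f.g i).trans (h.g i), fun {i j} e v => ?_, ?_⟩⟩
        · simp [f.map_comm, h.map_comm]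
        · simp [f.framing_comm, h.framing_comm] }

/-- A subrepresentation of the underlying unframed representation. -/
structure Sub (V : FramedRep Q δ) where
  U : ∀ i : Vtx, Submodule ℂ (Fin (δ i) → ℂ)
  map_mem : ∀ {i j : Vtx} (e : Q.Arrow i j) (v : Fin (δ i) → ℂ), v ∈ U i → V.map e v ∈ U j

/-- `Θ(V') = θ₀ dim V₀' + θ₁ dim V₁'`. -/
noncomputable def Sub.slope {V : FramedRep Q δ} (Θ : ℝ × ℝ) (S : V.Sub) : ℝ :=
  Θ.1 * Module.finrank ℂ (S.U .v0) + Θ.2 * Module.finrank ℂ (S.U .v1)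

/-- `Θ`-stability of a framed representation: `Θ(V') < 0` for the non-zero subrepresentations
`(V₀', V₁', 0)`, and `Θ(V') < Θ(V)` for the proper subrepresentations `(V₀', V₁', ℂ)`. -/
def IsStable (Θ : ℝ × ℝ) (V : FramedRep Q δ) : Prop :=
  (∀ S : V.Sub, (∃ i, S.U i ≠ ⊥) → S.slope Θ < 0) ∧
  (∀ S : V.Sub, V.framing ∈ S.U .v0 → (∃ i, S.U i ≠ ⊤) →
    S.slope Θ < Θ.1 * δ .v0 + Θ.2 * δ .v1)

/-- Isomorphisms from `V` to `t · V`, where `t · V` is `V` with every arrow `e` multiplied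
by `t^{deg e}` and with the same framing. -/
structure TwistIso (t : Torus) (V : FramedRep Q δ) where
  g : ∀ i : Vtx, (Fin (δ i) → ℂ) ≃ₗ[ℂ] (Fin (δ i) → ℂ)
  map_comm : ∀ {i j : Vtx} (e : Q.Arrow i j) (v : Fin (δ i) → ℂ),
    g j (V.map e v) = t.char (Q.deg e) • V.map e (g i v)
  framing_comm : g .v0 V.framing = V.framing

/-- The isomorphism class of `V` is a fixed point of the torus: `t · V ≅ V` for all `t ∈ T₀`. -/
def IsFixed (V : FramedRep Q δ) : Prop := ∀ t : Torus, Nonempty (TwistIso t V)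

/-- The subspace of `V_i` of weight `w`. For stable `V` in the fixed locus there is exactly one
isomorphism `g_t : V ≅ t · V` for every `t ∈ T₀`; these define the action of `T₀` on `V`
for which the framing is invariant, and the weight spaces are those of this action. -/
def weightSpace (V : FramedRep Q δ) (i : Vtx) (w : Weight) : Submodule ℂ (Fin (δ i) → ℂ) where
  carrier := {v | ∀ (t : Torus) (f : TwistIso t V), f.g i v = t.char w • v}
  add_mem' := by
    intro x y hx hy t f
    rw [map_add, hx t f, hy t f, smul_add]
  zero_mem' := by
    intro t f
    rw [map_zero, smul_zero]
  smul_mem' := by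
    intro r x hx t f
    rw [map_smul, hx t f, smul_comm]

theorem map_mem_weightSpace (V : FramedRep Q δ) {i j : Vtx} (e : Q.Arrow i j) {w w' : Weight}
    (hw : w' = w + Q.deg e) {v : Fin (δ i) → ℂ} (hv : v ∈ V.weightSpace i w) :
    V.map e v ∈ V.weightSpace j w' := by
  subst hw
  intro t f
  rw [f.map_comm, hv t f, map_smul, smul_smul, t.char_add, mul_comm]

end FramedRep

/-! ### Equivariant modules and the equivariant Euler pairing -/

namespace WQuiver

/-- The vertices of the covering quiver of `Q` given by the `T₀`-weights. -/
structure Cover (Q : WQuiver) where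
  vtx : Vtx
  wt : Weight

variable (Q : WQuiver)

/-- The covering quiver has an arrow `(i, w) → (j, w + deg e)` for every arrow `e : i → j`. -/
instance : Quiver Q.Cover := ⟨fun x y => {e : Q.Arrow x.vtx y.vtx // y.wt = x.wt + Q.deg e}⟩

/-- The projection of the covering quiver to `Q`. -/
def proj : Q.Cover ⥤q Q.V where
  obj x := x.vtx
  map e := e.1

/-- The relations of `Q`, lifted to the covering quiver. -/
def coverRel : HomRel (Paths Q.Cover) :=
  fun x y (p q : @Quiver.Path Q.Cover _ x y) => Q.rel (Q.proj.mapPath p) (Q.proj.mapPath q)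

/-- The category whose objects are the pairs (vertex, weight) and whose morphisms are the paths
of the covering quiver modulo the relations. -/
abbrev CoverCat : Type := CategoryTheory.Quotient Q.coverRel

/-- The abelian category of `T₀`-equivariant (that is, weight-graded) modules over the path algebra
of `Q` modulo its relations: representations over `ℂ` of the covering quiver with relations. -/
abbrev GrMod : Type 1 := Q.CoverCat ⥤ ModuleCat.{0} ℂ

/-- Translation by the weight `u` on the covering quiver. -/
def translate (u : Weight) : Q.Cover ⥤q Q.Cover where
  obj x := ⟨x.vtx, x.wt + u⟩
  map e := ⟨e.1, (congrArg (· + u) e.2).trans (add_right_comm _ _ _)⟩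

theorem proj_mapPath_translate (u : Weight) {x y : Q.Cover} (p : Quiver.Path x y) :
    Q.proj.mapPath ((Q.translate u).mapPath p) = Q.proj.mapPath p := by
  induction p with
  | nil => rfl
  | cons p e ih => exact congrArg (fun r => Quiver.Path.cons r (Q.proj.map e)) ih

/-- Translation by the weight `u` on the covering category. -/
def translateFunctor (u : Weight) : Q.CoverCat ⥤ Q.CoverCat :=
  CategoryTheory.Quotient.lift _
    (Paths.lift (Q.translate u ⋙q Paths.of Q.Cover) ⋙ CategoryTheory.Quotient.functor _)
    (by
      intro x y p q h
      have key : ∀ {x y : Q.Cover} (p : Quiver.Path x y),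
          (Paths.lift (Q.translate u ⋙q Paths.of Q.Cover)).map p = (Q.translate u).mapPath p := by
        intro x y p
        induction p with
        | nil => rfl
        | cons p e ih => 
          rw [Paths.lift_cons, ih]
          rfl
      simp only [Functor.comp_map]
      apply CategoryTheory.Quotient.sound
      change Q.rel (Q.proj.mapPath ((Paths.lift (Q.translate u ⋙q Paths.of Q.Cover)).map p))
        (Q.proj.mapPath ((Paths.lift (Q.translate u ⋙q Paths.of Q.Cover)).map q))
      erw [key p, key q, proj_mapPath_translate, proj_mapPath_translate]
      exact h)

/-- The twist `N ⟨u⟩` of an equivariant module, with `N ⟨u⟩_w = N_{w+u}`; homomorphisms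
`M → N ⟨u⟩` are the homomorphisms `M → N` of weight `u`. -/
def shift (u : Weight) (N : Q.GrMod) : Q.GrMod := Q.translateFunctor u ⋙ N

/-- The equivariant structure sheaf: the projective module of all paths starting at the
vertex `0`. -/
noncomputable def structureSheaf : Q.GrMod :=
  coyoneda.obj (Opposite.op (⟨⟨.v0, 0⟩⟩ : Q.CoverCat)) ⋙ ModuleCat.free ℂ

noncomputable instance : HasExt.{1} Q.GrMod := HasExt.standard _

variable {Q}

/-- The dimension of the weight `u` part of the equivariant vector space `Ext^k(M, N)`, that is,
of the group `Ext^k(M, N ⟨u⟩)` in the category of equivariant modules. -/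
noncomputable def extDim (M N : Q.GrMod) (k : ℕ) (u : Weight) : ℕ :=
  Module.finrank ℂ (Abelian.Ext M (Q.shift u N) k)

/-- All `Ext^k(M, N)` are finite-dimensional, and `Ext^k(M, N) = 0` for `k > n`. -/
def PairingDefined (n : ℕ) (M N : Q.GrMod) : Prop :=
  (∀ k u, Module.Finite ℂ (Abelian.Ext M (Q.shift u N) k)) ∧
  (∀ k, {u : Weight | extDim M N k u ≠ 0}.Finite) ∧
  (∀ k, n < k → ∀ u, extDim M N k u = 0)

open Classical in
/-- The equivariant Euler pairing `χ(M, N) = ∑_{k ≤ n} (-1)^k Ext^k(M, N) ∈ K^{T₀}(pt)` of a smooth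
space of dimension `n`. It is used only where all `Ext^k(M, N)` are finite-dimensional. -/
noncomputable def pairing (n : ℕ) (M N : Q.GrMod) : KT :=
  let f : Weight → ℤ := fun u => ∑ k ∈ Finset.range (n + 1), (-1) ^ k * (extDim M N k u : ℤ)
  if h : f.support.Finite then Finsupp.ofSupportFinite f h else 0

end WQuiver

namespace FramedRep

variable {Q : WQuiver} {δ : Vtx → ℕ}

/-- The weight spaces of `V`, with the action of the arrows. -/
noncomputable def weightPrefunctor (V : FramedRep Q δ) : Q.Cover ⥤q ModuleCat.{0} ℂ where
  obj x := ModuleCat.of ℂ (V.weightSpace x.vtx x.wt)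
  map {x y} e := ModuleCat.ofHom ((V.map e.1).restrict
    (p := V.weightSpace x.vtx x.wt) (q := V.weightSpace y.vtx y.wt)
    (fun _ hv => V.map_mem_weightSpace e.1 e.2 hv))

theorem lift_weightPrefunctor (V : FramedRep Q δ) {x y : Q.Cover} (p : Quiver.Path x y)
    (v : V.weightSpace x.vtx x.wt) :
    Subtype.val (p := fun u => u ∈ V.weightSpace y.vtx y.wt)
      (((Paths.lift V.weightPrefunctor).map p).hom v) =
    pathMap (A := Q.Arrow) (i := x.vtx) (j := y.vtx) V.map (Q.proj.mapPath p) v.1 := by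
  induction p with
  | nil => rfl
  | cons p e ih =>
    rw [Paths.lift_cons]
    exact congrArg (V.map e.1) ih

/-- The equivariant module of `V`: its part at `(i, w)` is the weight space of weight `w` in `V_i`.
For stable `V` in the fixed locus this is the equivariant object `F` of the pair `(𝒪 → F)`. -/
noncomputable def grMod (V : FramedRep Q δ) : Q.GrMod :=
  CategoryTheory.Quotient.lift _ (Paths.lift V.weightPrefunctor) (by
    intro x y p q h
    ext v
    apply Subtype.ext
    exact (V.lift_weightPrefunctor p v).trans
      ((LinearMap.congr_fun (V.relation _ _ h) _).trans (V.lift_weightPrefunctor q v).symm))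

end FramedRep

/-! ### Perverse coherent systems on `Z` and on `X` -/

/-- Extension by zero of the action of the arrows of the quiver of `Z` to that of `X`. -/
def extendByZero {δ : Vtx → ℕ}
    (φ : ∀ ⦃i j : Vtx⦄, ArrowZ i j → (Fin (δ i) → ℂ) →ₗ[ℂ] (Fin (δ j) → ℂ)) :
    ∀ ⦃i j : Vtx⦄, ArrowX i j → (Fin (δ i) → ℂ) →ₗ[ℂ] (Fin (δ j) → ℂ)
  | _, _, .a i => φ (.a i)
  | _, _, .b i => φ (.b i)
  | _, _, .c => 0
  | _, _, .d => 0

/-- The pair `(𝒪_X → ι_* F)` of a pair `(𝒪_Z → F)`, where `ι : Z = Z × {0} → X` is the inclusion: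
the coordinate of the last factor acts as zero. -/
def pushforward {δ : Vtx → ℕ} (J : FramedRep quiverZ δ) : FramedRep quiverX δ where
  map := extendByZero J.map
  framing := J.framing
  relation := by
    intro i j p q h
    cases h with
    | aba i => exact J.relation _ _ (RelZ.aba i)
    | bab i => exact J.relation _ _ (RelZ.bab i)
    | da i => ext; simp [pathMap, path2, extendByZero]
    | cb i => ext; simp [pathMap, path2, extendByZero]

/-- `χ_X(F, F)`. -/
noncomputable def chiXFF {δ : Vtx → ℕ} (V : FramedRep quiverX δ) : KT :=
  WQuiver.pairing 4 V.grMod V.grMod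

/-- `χ_X(F) = χ_X(𝒪_X, F)`. -/
noncomputable def chiXF {δ : Vtx → ℕ} (V : FramedRep quiverX δ) : KT :=
  WQuiver.pairing 4 quiverX.structureSheaf V.grMod

/-- `χ_Z(F, F)`. -/
noncomputable def chiZFF {δ : Vtx → ℕ} (J : FramedRep quiverZ δ) : KT :=
  WQuiver.pairing 3 J.grMod J.grMod

/-- `χ_Z(F) = χ_Z(𝒪_Z, F)`. -/
noncomputable def chiZF {δ : Vtx → ℕ} (J : FramedRep quiverZ δ) : KT :=
  WQuiver.pairing 3 quiverZ.structureSheaf J.grMod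

/-- `χ_Z(F, 𝒪_Z)`. -/
noncomputable def chiZFO {δ : Vtx → ℕ} (J : FramedRep quiverZ δ) : KT :=
  WQuiver.pairing 3 J.grMod quiverZ.structureSheaf

/-- The trace-free part `χ_Z(I, I)₀ = χ_Z(I, I) - χ_Z(𝒪_Z, 𝒪_Z)` for `I = (𝒪_Z → F)`, expanded
with `I = 𝒪_Z - F` in `K`-theory. -/
noncomputable def chiZII₀ {δ : Vtx → ℕ} (J : FramedRep quiverZ δ) : KT :=
  chiZFF J - chiZF J - chiZFO J

/-! ### Walls, fixed loci, tautological invariants -/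

/-- The walls in the space of stability parameters `Θ = (θ₀, θ₁)`. -/
def walls : Set (ℝ × ℝ) :=
  {Θ | Θ.1 ≠ Θ.2 ∧
    ((∃ k : ℕ, 1 ≤ k ∧ (k : ℝ) * Θ.1 + ((k : ℝ) - 1) * Θ.2 = 0) ∨
     (∃ k : ℕ, (k : ℝ) * Θ.1 + ((k : ℝ) + 1) * Θ.2 = 0) ∨
     Θ.1 + Θ.2 = 0)}

/-- The dimension vector `(dim V₀, dim V₁) = (n, n - d)`. -/
def dimVec (n d : ℤ) : Vtx → ℕ
  | .v0 => n.toNat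
  | .v1 => (n - d).toNat

/-- The torus fixed locus `P_n^Θ(X, d)^{T₀}` of the moduli space of `Θ`-stable perverse coherent
systems `(𝒪_X → F)` with `χ(F) = n` and `[F] = d [ℙ¹]`, for `Θ` outside the walls: isomorphism
classes of stable framed representations with dimension vector `(n, n - d)` which are fixed by
the torus. -/
def FixedLocus (Θ : ℝ × ℝ) (n d : ℤ) : Type :=
  {x : _root_.Quotient (FramedRep.setoid quiverX (dimVec n d)) //
    0 ≤ n ∧ d ≤ n ∧ x.out.IsStable Θ ∧ x.out.IsFixed}

/-- A representative of a point of the fixed locus. -/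
noncomputable def FixedLocus.rep {Θ : ℝ × ℝ} {n d : ℤ} (I : FixedLocus Θ n d) :
    FramedRep quiverX (dimVec n d) := I.1.out

/-- The choices on which the invariants depend: a square root of `χ_X(F, F)` and a sign, for every
point of the fixed loci. -/
structure SignChoice (Θ : ℝ × ℝ) where
  root : ∀ {n d : ℤ}, FixedLocus Θ n d → KT
  isSquareRoot : ∀ {n d : ℤ} (I : FixedLocus Θ n d), (root I).IsSquareRoot (chiXFF I.rep)
  sign : ∀ {n d : ℤ}, FixedLocus Θ n d → ℤˣ

namespace SignChoice

variable {Θ : ℝ × ℝ} (o : SignChoice Θ)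

/-- The class `χ_X(I, I)₀^{1/2} = -χ_X(F) + χ_X(F, F)^{1/2}`. -/
noncomputable def halfChi {n d : ℤ} (I : FixedLocus Θ n d) : KT := - chiXF I.rep + o.root I

/-- The Euler class `e_{T₀}(χ_X(I, I)₀^{1/2})`, with the chosen sign. -/
noncomputable def eulerHalf {n d : ℤ} (I : FixedLocus Θ n d) : LamField :=
  ((o.sign I : ℤ) : LamField) * euler (o.halfChi I)

/-- The contribution `e_{T₀}(χ_X(I, I)₀^{1/2}) · e_{T₀ × ℂˣ}(χ_X(F)^∨ ⊗ e^m)` of the point `I`. -/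
noncomputable def contribution {n d : ℤ} (I : FixedLocus Θ n d) : Lam :=
  RatFunc.C (o.eulerHalf I) * eulerTaut (chiXF I.rep)

/-- The tautological invariant `P^Θ_{n,d}(e^m)`; the fixed locus is finite. -/
noncomputable def tautInv (n d : ℤ) : Lam := ∑ᶠ I : FixedLocus Θ n d, o.contribution I

/-- The invariant without insertions. -/
noncomputable def plainInv (n d : ℤ) : LamField := ∑ᶠ I : FixedLocus Θ n d, o.eulerHalf I

end SignChoice

/-- Formal series `∑_{n,d} f(n,d) q^n t^d`. -/
abbrev Series (R : Type) : Type := ℤ → ℤ → R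

/-- The substitution `q = Q / m`: the series `∑ f(n,d) q^n t^d` as a series in `Q` and `t`, where
`Q = q m`. -/
noncomputable def substQ (f : Series Lam) : Series Lam := fun n d => f n d * mPar ^ (-n)

/-- The limit `m → ∞` of formal series (coefficientwise). -/
def SeriesTendsTo (f : Series Lam) (g : Series LamField) : Prop :=
  ∀ n d, TendsToAtInfinity (f n d) (g n d)

end LocalConifold

namespace LocalConifold

section ExtEuler

open Abelian

universe w v u

variable {C : Type u} [Category.{v} C] [Abelian C] [Linear ℂ C] [HasExt.{w} C]

/-- All `Ext^k(M, N)` are finite-dimensional, they vanish for `k > n`, and the alternating sum of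
their dimensions is `e`. -/
def ExtEuler (n : ℕ) (M N : C) (e : ℤ) : Prop :=
  (∀ k, Module.Finite ℂ (Ext M N k)) ∧ (∀ k, n < k → Subsingleton (Ext M N k)) ∧
    ∑ k ∈ Finset.range (n + 1), (-1) ^ k * (Module.finrank ℂ (Ext M N k) : ℤ) = e

/-- All `Ext^k(M, N)` vanish. -/
def ExtAcyclic (M N : C) : Prop := ∀ k, Subsingleton (Ext M N k)

theorem ExtEuler.mono {n n' : ℕ} {M N : C} {e : ℤ} (h : ExtEuler n M N e) (hn : n ≤ n') :
    ExtEuler n' M N e := by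
  refine ⟨h.1, fun k hk => h.2.1 k (by omega), ?_⟩
  rw [← h.2.2]
  symm
  apply Finset.sum_subset
  · intro k hk
    simp only [Finset.mem_range] at *
    omega
  · intro k _ hk'
    simp only [Finset.mem_range] at *
    have := h.2.1 k (by omega)
    simp [Module.finrank_zero_of_subsingleton]

theorem finite_of_exact {A B D : Type*} [AddCommGroup A] [Module ℂ A] [AddCommGroup B] [Module ℂ B]
    [AddCommGroup D] [Module ℂ D] (f : A →ₗ[ℂ] B) (g : B →ₗ[ℂ] D)
    (h : LinearMap.ker g ≤ LinearMap.range f) [Module.Finite ℂ A] [Module.Finite ℂ D] :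
    Module.Finite ℂ B := by
  have h1 : Module.Finite ℂ (LinearMap.range g) := inferInstance
  have h2 : Module.Finite ℂ (LinearMap.ker g) := Submodule.finiteDimensional_of_le h
  have e := g.quotKerEquivRange
  have h3 : Module.Finite ℂ (B ⧸ LinearMap.ker g) := Module.Finite.equiv e.symm
  exact Module.Finite.of_submodule_quotient (LinearMap.ker g)

section SES

variable {S : ShortComplex C} (hS : S.ShortExact) (N : C)

/-- Pullback along `S.X₂ ⟶ S.X₃`. -/
noncomputable def extG (S : ShortComplex C) (N : C) (k : ℕ) : Ext S.X₃ N k →ₗ[ℂ] Ext S.X₂ N k :=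
  Ext.precompOfLinear (Ext.mk₀ S.g) ℂ N (zero_add k)

/-- Pullback along `S.X₁ ⟶ S.X₂`. -/
noncomputable def extF (S : ShortComplex C) (N : C) (k : ℕ) : Ext S.X₂ N k →ₗ[ℂ] Ext S.X₁ N k :=
  Ext.precompOfLinear (Ext.mk₀ S.f) ℂ N (zero_add k)

/-- The connecting map. -/
noncomputable def extD (k : ℕ) : Ext S.X₁ N k →ₗ[ℂ] Ext S.X₃ N (k + 1) :=
  Ext.precompOfLinear hS.extClass ℂ N (add_comm 1 k)

include hS in
theorem ker_extF (k : ℕ) : LinearMap.ker (extF S N k) = LinearMap.range (extG S N k) := by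
  apply le_antisymm
  · intro x hx
    obtain ⟨y, hy⟩ := Ext.contravariant_sequence_exact₂ hS N x hx
    exact ⟨y, hy⟩
  · rintro _ ⟨y, rfl⟩
    change (Ext.mk₀ S.f).comp ((Ext.mk₀ S.g).comp y (zero_add k)) (zero_add k) = 0
    simp only [Ext.mk₀_comp_mk₀_assoc, ShortComplex.zero, Ext.mk₀_zero, Ext.zero_comp]

theorem ker_extD (k : ℕ) : LinearMap.ker (extD hS N k) = LinearMap.range (extF S N k) := by
  apply le_antisymm
  · intro x hx
    obtain ⟨y, hy⟩ := Ext.contravariant_sequence_exact₁ hS N x (add_comm 1 k) hx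
    exact ⟨y, hy⟩
  · rintro _ ⟨y, rfl⟩
    change hS.extClass.comp ((Ext.mk₀ S.f).comp y (zero_add k)) (add_comm 1 k) = 0
    simp only [ShortComplex.ShortExact.extClass_comp_assoc]

theorem ker_extG (k : ℕ) : LinearMap.ker (extG S N (k + 1)) = LinearMap.range (extD hS N k) := by
  apply le_antisymm
  · intro x hx
    obtain ⟨y, hy⟩ := Ext.contravariant_sequence_exact₃ hS N x hx (add_comm 1 k)
    exact ⟨y, hy⟩
  · rintro _ ⟨y, rfl⟩
    change (Ext.mk₀ S.g).comp (hS.extClass.comp y (add_comm 1 k)) (zero_add _) = 0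
    simp only [ShortComplex.ShortExact.comp_extClass_assoc]

include hS in
theorem ker_extG_zero : LinearMap.ker (extG S N 0) = ⊥ := by
  have := hS.epi_g
  exact LinearMap.ker_eq_bot.2 (Ext.precomp_mk₀_injective_of_epi N S.g)

theorem extEuler_aux (hA : ∀ k, Module.Finite ℂ (Ext S.X₁ N k))
    (hB : ∀ k, Module.Finite ℂ (Ext S.X₂ N k)) (hC : ∀ k, Module.Finite ℂ (Ext S.X₃ N k)) (n : ℕ) :
    ∑ k ∈ Finset.range (n + 1), (-1) ^ k * ((Module.finrank ℂ (Ext S.X₃ N k) : ℤ) -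
      Module.finrank ℂ (Ext S.X₂ N k) + Module.finrank ℂ (Ext S.X₁ N k)) =
      (-1) ^ n * (Module.finrank ℂ (LinearMap.range (extD hS N n)) : ℤ) := by
  have hb : ∀ k, Module.finrank ℂ (LinearMap.range (extF S N k)) +
      Module.finrank ℂ (LinearMap.range (extG S N k)) = Module.finrank ℂ (Ext S.X₂ N k) := by
    intro k
    rw [← ker_extF hS]
    exact LinearMap.finrank_range_add_finrank_ker _
  have ha : ∀ k, Module.finrank ℂ (LinearMap.range (extD hS N k)) +
      Module.finrank ℂ (LinearMap.range (extF S N k)) = Module.finrank ℂ (Ext S.X₁ N k) := by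
    intro k
    rw [← ker_extD hS]
    exact LinearMap.finrank_range_add_finrank_ker _
  have hc : ∀ k, Module.finrank ℂ (LinearMap.range (extG S N (k + 1))) +
      Module.finrank ℂ (LinearMap.range (extD hS N k)) =
      Module.finrank ℂ (Ext S.X₃ N (k + 1)) := by
    intro k
    rw [← ker_extG hS]
    exact LinearMap.finrank_range_add_finrank_ker _
  have hc0 : Module.finrank ℂ (LinearMap.range (extG S N 0)) =
      Module.finrank ℂ (Ext S.X₃ N 0) := by
    have := LinearMap.finrank_range_add_finrank_ker (extG S N 0)
    rwa [ker_extG_zero hS, finrank_bot, add_zero] at this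
  induction n with
  | zero =>
    simp only [zero_add, Finset.range_one, Finset.sum_singleton, pow_zero, one_mul]
    have h1 := hb 0
    have h2 := ha 0
    push_cast [← h1, ← h2, ← hc0]
    ring
  | succ n ih =>
    rw [Finset.sum_range_succ, ih]
    have h1 := hb (n + 1)
    have h2 := ha (n + 1)
    have h3 := hc n
    push_cast [← h1, ← h2, ← h3]
    ring

theorem subsingleton_of_exact {A B D : Type*} [AddCommGroup A] [Module ℂ A] [AddCommGroup B]
    [Module ℂ B] [AddCommGroup D] [Module ℂ D] (f : A →ₗ[ℂ] B) (g : B →ₗ[ℂ] D)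
    (h : LinearMap.ker g ≤ LinearMap.range f) [Subsingleton A] [Subsingleton D] :
    Subsingleton B := by
  refine subsingleton_of_forall_eq 0 fun b => ?_
  obtain ⟨a, rfl⟩ := h (show b ∈ LinearMap.ker g from Subsingleton.elim _ _)
  rw [Subsingleton.elim a 0, map_zero]

include hS

theorem ExtEuler.third {nA nB n : ℕ} {eA eB : ℤ} (hA : ExtEuler nA S.X₁ N eA)
    (hB : ExtEuler nB S.X₂ N eB) (h1 : nA + 1 ≤ n) (h2 : nB ≤ n) :
    ExtEuler n S.X₃ N (eB - eA) := by
  have hCf : ∀ k, Module.Finite ℂ (Ext S.X₃ N k) := by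
    rintro (_ | k)
    · have := hB.1 0
      exact Module.Finite.of_injective (extG S N 0) (LinearMap.ker_eq_bot.1 (ker_extG_zero hS N))
    · have := hB.1 (k + 1)
      have := hA.1 k
      exact finite_of_exact (extD hS N k) (extG S N (k + 1)) (ker_extG hS N k).le
  have hCz : ∀ k, n < k → Subsingleton (Ext S.X₃ N k) := by
    rintro (_ | k) hk
    · omega
    · have := hB.2.1 (k + 1) (by omega)
      have := hA.2.1 k (by omega)
      exact subsingleton_of_exact (extD hS N k) (extG S N (k + 1)) (ker_extG hS N k).le
  refine ⟨hCf, hCz, ?_⟩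
  have key := extEuler_aux hS N hA.1 hB.1 hCf n
  have := hCz (n + 1) (by omega)
  rw [Module.finrank_zero_of_subsingleton (M := LinearMap.range (extD hS N n))] at key
  rw [← (hA.mono (n' := n) (by omega)).2.2, ← (hB.mono (n' := n) h2).2.2, ← Finset.sum_sub_distrib]
  rw [← sub_eq_zero, ← Finset.sum_sub_distrib]
  simp only [Nat.cast_zero, mul_zero] at key
  rw [← key]
  exact Finset.sum_congr rfl fun k _ => by ring

theorem ExtEuler.middle {n : ℕ} {eA eC : ℤ} (hA : ExtEuler n S.X₁ N eA)
    (hC : ExtEuler n S.X₃ N eC) : ExtEuler n S.X₂ N (eA + eC) := by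
  have hBf : ∀ k, Module.Finite ℂ (Ext S.X₂ N k) := fun k => by
    have := hA.1 k
    have := hC.1 k
    exact finite_of_exact (extG S N k) (extF S N k) (ker_extF hS N k).le
  have hBz : ∀ k, n < k → Subsingleton (Ext S.X₂ N k) := fun k hk => by
    have := hA.2.1 k hk
    have := hC.2.1 k hk
    exact subsingleton_of_exact (extG S N k) (extF S N k) (ker_extF hS N k).le
  refine ⟨hBf, hBz, ?_⟩
  have key := extEuler_aux hS N hA.1 hBf hC.1 n
  have := hC.2.1 (n + 1) (by omega)
  rw [Module.finrank_zero_of_subsingleton (M := LinearMap.range (extD hS N n))] at key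
  rw [← hA.2.2, ← hC.2.2, ← Finset.sum_add_distrib]
  rw [← sub_eq_zero, ← Finset.sum_sub_distrib, ← neg_eq_zero, ← Finset.sum_neg_distrib]
  simp only [Nat.cast_zero, mul_zero] at key
  rw [← key]
  exact Finset.sum_congr rfl fun k _ => by ring

theorem ExtAcyclic.third (hA : ExtAcyclic S.X₁ N) (hB : ExtAcyclic S.X₂ N) :
    ExtAcyclic S.X₃ N := by
  rintro (_ | k)
  · have := hB 0
    exact (LinearMap.ker_eq_bot.1 (ker_extG_zero hS N)).subsingleton
  · have := hB (k + 1)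
    have := hA k
    exact subsingleton_of_exact (extD hS N k) (extG S N (k + 1)) (ker_extG hS N k).le

theorem ExtAcyclic.middle (hA : ExtAcyclic S.X₁ N) (hC : ExtAcyclic S.X₃ N) :
    ExtAcyclic S.X₂ N := fun k => by
  have := hA k
  have := hC k
  exact subsingleton_of_exact (extG S N k) (extF S N k) (ker_extF hS N k).le

/-- If `S.X₁`, `S.X₂` are projective and `S.X₁ ⟶ S.X₂` induces a bijection on `Hom(-, N)`, then
`S.X₃` is acyclic with respect to `N`. -/
theorem ExtAcyclic.of_projective [Projective S.X₁] [Projective S.X₂]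
    (h : Function.Bijective fun φ : S.X₂ ⟶ N => S.f ≫ φ) : ExtAcyclic S.X₃ N := by
  have hF : Function.Bijective (extF S N 0) := by
    have hc : ∀ φ : S.X₂ ⟶ N, extF S N 0 (Ext.mk₀ φ) = Ext.mk₀ (S.f ≫ φ) := fun φ =>
      Ext.mk₀_comp_mk₀ S.f φ
    constructor
    · intro x y hxy
      obtain ⟨x, rfl⟩ := (Ext.mk₀_bijective S.X₂ N).2 x
      obtain ⟨y, rfl⟩ := (Ext.mk₀_bijective S.X₂ N).2 y
      rw [hc, hc] at hxy
      rw [h.1 ((Ext.mk₀_bijective _ _).1 hxy)]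
    · intro x
      obtain ⟨x, rfl⟩ := (Ext.mk₀_bijective S.X₁ N).2 x
      obtain ⟨y, rfl⟩ := h.2 x
      exact ⟨Ext.mk₀ y, hc y⟩
  rintro (_ | _ | k)
  · have h0 : LinearMap.range (extG S N 0) = ⊥ := by
      rw [← ker_extF hS]
      exact LinearMap.ker_eq_bot.2 hF.1
    refine subsingleton_of_forall_eq 0 fun x => ?_
    have hx : extG S N 0 x = 0 := by
      have : extG S N 0 x ∈ LinearMap.range (extG S N 0) := ⟨x, rfl⟩
      rwa [h0] at this
    have : x ∈ LinearMap.ker (extG S N 0) := hx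
    rwa [ker_extG_zero hS] at this
  · refine subsingleton_of_forall_eq 0 fun x => ?_
    have := Ext.subsingleton_of_projective S.X₂ N 0
    have hx : x ∈ LinearMap.ker (extG S N (0 + 1)) := Subsingleton.elim _ _
    rw [ker_extG hS] at hx
    obtain ⟨y, rfl⟩ := hx
    have hy : y ∈ LinearMap.ker (extD hS N 0) := by
      rw [ker_extD]
      exact hF.2 y
    exact hy
  · have := Ext.subsingleton_of_projective S.X₂ N (k + 1)
    have := Ext.subsingleton_of_projective S.X₁ N k
    exact subsingleton_of_exact (extD hS N (k + 1)) (extG S N (k + 1 + 1)) (ker_extG hS N (k + 1)).le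

end SES

theorem ExtEuler.of_projective (P N : C) [Projective P] [Module.Finite ℂ (P ⟶ N)] :
    ExtEuler 0 P N (Module.finrank ℂ (P ⟶ N)) := by
  have h0 : Module.Finite ℂ (Ext P N 0) := Module.Finite.equiv (Ext.linearEquiv₀ (R := ℂ)).symm
  refine ⟨?_, ?_, ?_⟩
  · rintro (_ | k)
    · exact h0
    · have := Ext.subsingleton_of_projective P N k
      infer_instance
  · rintro (_ | k) hk
    · omega
    · exact Ext.subsingleton_of_projective P N k
  · simp [(Ext.linearEquiv₀ (R := ℂ) (X := P) (Y := N)).finrank_eq]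

theorem ExtEuler.of_iso {n : ℕ} {M M' N : C} {e : ℤ} (h : ExtEuler n M N e) (i : M ≅ M') :
    ExtEuler n M' N e := by
  have f : ∀ k, Ext M N k ≃ₗ[ℂ] Ext M' N k := fun k =>
    LinearEquiv.ofLinearMap (Ext.precompOfLinear (Ext.mk₀ i.inv) ℂ N (zero_add k))
      (Ext.precompOfLinear (Ext.mk₀ i.hom) ℂ N (zero_add k))
      (by ext x; simp) (by ext x; simp)
  refine ⟨fun k => ?_, fun k hk => ?_, ?_⟩
  · have := h.1 k
    exact Module.Finite.equiv (f k)
  · have := h.2.1 k hk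
    exact (f k).symm.injective.subsingleton
  · rw [← h.2.2]
    exact Finset.sum_congr rfl fun k _ => by rw [(f k).finrank_eq]

theorem ExtAcyclic.of_iso {M M' N : C} (h : ExtAcyclic M N) (i : M ≅ M') :
    ExtAcyclic M' N := fun k => by
  have := h k
  refine subsingleton_of_forall_eq 0 fun x => ?_
  have h1 : (Ext.mk₀ i.inv).comp ((Ext.mk₀ i.hom).comp x (zero_add k)) (zero_add k) = x := by simp
  rw [← h1, Subsingleton.elim ((Ext.mk₀ i.hom).comp x (zero_add k)) 0, Ext.comp_zero]

theorem ExtAcyclic.extEuler {M N : C} (h : ExtAcyclic M N) : ExtEuler 0 M N 0 := by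
  refine ⟨fun k => ?_, fun k _ => h k, ?_⟩
  · have := h k
    infer_instance
  · have := h 0
    simp [Module.finrank_zero_of_subsingleton]

end ExtEuler

end LocalConifold

namespace LocalConifold

namespace WQuiver

section General

variable {Q : WQuiver}

/-- The object of the covering category given by a vertex of the covering quiver. -/
abbrev pt (x : Q.Cover) : Q.CoverCat := ⟨x⟩

/-- The morphism of the covering category given by an arrow of the covering quiver. -/
def arr {x y : Q.Cover} (e : x ⟶ y) : pt x ⟶ pt y :=
  (Quotient.functor Q.coverRel).map ((Paths.of Q.Cover).map e)

theorem coverCat_induction {x : Q.Cover} {P : ∀ {y : Q.Cover}, (pt x ⟶ pt y) → Prop}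
    (h1 : P (𝟙 (pt x)))
    (h2 : ∀ {y z : Q.Cover} (f : pt x ⟶ pt y) (e : y ⟶ z), P f → P (f ≫ arr e)) :
    ∀ {y : Q.Cover} (f : pt x ⟶ pt y), P f := by
  have key : ∀ {y : Q.Cover} (f : Quiver.Path x y),
      P ((Quotient.functor Q.coverRel).map (X := x) (Y := y) f) := by
    intro y f
    induction f with
    | nil => exact h1
    | cons p e ih => exact h2 _ e ih
  intro y f
  obtain ⟨f, rfl⟩ := (Quotient.functor Q.coverRel).map_surjective f
  exact key f

theorem hom_naturality {M N : Q.GrMod} (φ : ∀ x : Q.Cover, M.obj (pt x) →ₗ[ℂ] N.obj (pt x))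
    (h : ∀ {x y : Q.Cover} (e : x ⟶ y) (v : M.obj (pt x)),
      φ y (M.map (arr e) v) = N.map (arr e) (φ x v)) {x y : Q.Cover} (f : pt x ⟶ pt y)
    (v : M.obj (pt x)) : φ y (M.map f v) = N.map f (φ x v) := by
  induction f using coverCat_induction with
  | h1 => simp
  | h2 f e ih => simp [h, ih]

/-- A morphism of graded modules from a family of linear maps compatible with the arrows. -/
def mkHom {M N : Q.GrMod} (φ : ∀ x : Q.Cover, M.obj (pt x) →ₗ[ℂ] N.obj (pt x))
    (h : ∀ {x y : Q.Cover} (e : x ⟶ y) (v : M.obj (pt x)),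
      φ y (M.map (arr e) v) = N.map (arr e) (φ x v)) : M ⟶ N where
  app x := ModuleCat.ofHom (φ x.as)
  naturality := by
    rintro ⟨x⟩ ⟨y⟩ f
    ext v
    exact hom_naturality φ h f v

theorem mono_of_injective {M N : Q.GrMod} (f : M ⟶ N)
    (h : ∀ x : Q.Cover, Function.Injective (f.app (pt x))) : Mono f := by
  have : ∀ x : Q.CoverCat, Mono (f.app x) := fun x => (ModuleCat.mono_iff_injective _).2 (h x.as)
  exact NatTrans.mono_of_mono_app f

theorem epi_of_surjective {M N : Q.GrMod} (f : M ⟶ N)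
    (h : ∀ x : Q.Cover, Function.Surjective (f.app (pt x))) : Epi f := by
  have : ∀ x : Q.CoverCat, Epi (f.app x) := fun x => (ModuleCat.epi_iff_surjective _).2 (h x.as)
  exact NatTrans.epi_of_epi_app f

theorem injective_of_mono {M N : Q.GrMod} (f : M ⟶ N) [Mono f] (x : Q.Cover) :
    Function.Injective (f.app (pt x)) :=
  (ModuleCat.mono_iff_injective _).1 ((NatTrans.mono_iff_mono_app f).1 inferInstance (pt x))

theorem surjective_of_epi {M N : Q.GrMod} (f : M ⟶ N) [Epi f] (x : Q.Cover) :
    Function.Surjective (f.app (pt x)) :=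
  (ModuleCat.epi_iff_surjective _).1 ((NatTrans.epi_iff_epi_app f).1 inferInstance (pt x))

theorem shortExact_of_pointwise {A B C : Q.GrMod} (f : A ⟶ B) (g : B ⟶ C) (w : f ≫ g = 0)
    (hf : ∀ x : Q.Cover, Function.Injective (f.app (pt x)))
    (hg : ∀ x : Q.Cover, Function.Surjective (g.app (pt x)))
    (hfg : ∀ (x : Q.Cover) (v : B.obj (pt x)), g.app (pt x) v = 0 →
      ∃ u, f.app (pt x) u = v) : (ShortComplex.mk f g w).ShortExact := by
  have h1 := mono_of_injective f hf
  have h2 := epi_of_surjective g hg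
  refine ShortComplex.ShortExact.mk' ?_ h1 h2
  refine ShortComplex.exact_of_f_is_kernel _ (Limits.KernelFork.IsLimit.ofι' _ _ fun {T} k hk => ?_)
  have hk' : ∀ (x : Q.Cover) (t : T.obj (pt x)), ∃ u, f.app (pt x) u = k.app (pt x) t := by
    intro x t
    apply hfg
    have := congrArg (fun (α : T ⟶ C) => α.app (pt x) t) hk
    simpa using this
  choose u hu using hk'
  refine ⟨mkHom (fun x => ⟨⟨u x, fun s t => hf x ?_⟩, fun c t => hf x ?_⟩) ?_, ?_⟩
  · rw [map_add, hu, hu, hu, map_add]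
  · simp [hu]
  · intro x y e v
    apply hf y
    change f.app (pt y) (u y _) = f.app (pt y) (A.map (arr e) (u x v))
    rw [hu, NatTrans.naturality_apply, NatTrans.naturality_apply, hu]
  · ext x t
    exact hu x.as t

theorem exact_pointwise {A B C : Q.GrMod} {f : A ⟶ B} {g : B ⟶ C} {w : f ≫ g = 0}
    (h : (ShortComplex.mk f g w).ShortExact) (x : Q.Cover) (v : B.obj (pt x))
    (hv : g.app (pt x) v = 0) : ∃ u, f.app (pt x) u = v := by
  have h1 := (h.map_of_exact ((evaluation Q.CoverCat (ModuleCat ℂ)).obj (pt x))).exact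
  rw [ShortComplex.moduleCat_exact_iff] at h1
  exact h1 v hv

/-! ### Projective modules -/

/-- The projective module of all paths starting at a vertex of the covering quiver. -/
noncomputable def proj₀ (x : Q.Cover) : Q.GrMod :=
  coyoneda.obj (Opposite.op (pt x)) ⋙ ModuleCat.free ℂ

/-- Homomorphisms out of `proj₀ x`. -/
noncomputable def proj₀Desc {N : Q.GrMod} {x : Q.Cover} (n : N.obj (pt x)) : proj₀ x ⟶ N where
  app y := ModuleCat.freeDesc (TypeCat.ofHom fun f => N.map f n)
  naturality y z g := by
    apply ModuleCat.free_hom_ext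
    intro f
    simp [proj₀]

noncomputable def proj₀Gen (x : Q.Cover) : (proj₀ x).obj (pt x) := ModuleCat.freeMk (𝟙 (pt x))

theorem proj₀Desc_gen {N : Q.GrMod} {x : Q.Cover} (n : N.obj (pt x)) :
    (proj₀Desc n).app (pt x) (proj₀Gen x) = n := by
  refine (ModuleCat.freeDesc_apply _ _).trans ?_
  change N.map (𝟙 (pt x)) n = n
  simp

theorem proj₀_hom_ext {N : Q.GrMod} {x : Q.Cover} (φ ψ : proj₀ x ⟶ N)
    (h : φ.app (pt x) (proj₀Gen x) = ψ.app (pt x) (proj₀Gen x)) : φ = ψ := by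
  ext y : 2
  apply ModuleCat.free_hom_ext
  intro f
  have key : (ModuleCat.freeMk f : (proj₀ x).obj y) = (proj₀ x).map f (proj₀Gen x) := by
    refine ((ModuleCat.free_map_apply _ _).trans ?_).symm
    exact congrArg ModuleCat.freeMk (Category.id_comp f)
  change φ.app y (ModuleCat.freeMk f : (proj₀ x).obj y) = ψ.app y _
  rw [key, NatTrans.naturality_apply, NatTrans.naturality_apply, h]

/-- `Hom(proj₀ x, N) = N_x`. -/
noncomputable def proj₀HomEquiv (x : Q.Cover) (N : Q.GrMod) : (proj₀ x ⟶ N) ≃ₗ[ℂ] N.obj (pt x) where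
  toFun φ := φ.app (pt x) (proj₀Gen x)
  map_add' _ _ := rfl
  map_smul' _ _ := rfl
  invFun := proj₀Desc
  left_inv φ := proj₀_hom_ext _ _ (proj₀Desc_gen _)
  right_inv n := proj₀Desc_gen n

instance (x : Q.Cover) : Projective (proj₀ x) where
  factors {E X} f e _ := by
    obtain ⟨v, hv⟩ := surjective_of_epi e x (f.app (pt x) (proj₀Gen x))
    refine ⟨proj₀Desc v, proj₀_hom_ext _ _ ?_⟩
    rw [NatTrans.comp_app, ModuleCat.comp_apply, proj₀Desc_gen, hv]

end General

/-! ### Modules given by pieces of ambient representations -/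

/-- The linear map by which a path acts. -/
def gpathMap {A : Vtx → Vtx → Type} {W : Vtx → Type} [∀ i, AddCommGroup (W i)]
    [∀ i, Module ℂ (W i)] (φ : ∀ ⦃i j : Vtx⦄, A i j → W i →ₗ[ℂ] W j) {i j : Vtx}
    (p : PathOn A i j) : W i →ₗ[ℂ] W j :=
  @Quiver.Path.rec Vtx ⟨A⟩ i (fun k _ => W i →ₗ[ℂ] W k) LinearMap.id (fun _ e f => φ e ∘ₗ f) j p

/-- Graded pieces of vector spaces at the vertices, with maps which satisfy the relations on the
graded pieces. -/
structure Pieces (Q : WQuiver) where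
  W : Vtx → Type
  [acg : ∀ i, AddCommGroup (W i)]
  [mod : ∀ i, Module ℂ (W i)]
  map : ∀ ⦃i j : Vtx⦄, Q.Arrow i j → W i →ₗ[ℂ] W j
  piece : ∀ i : Vtx, Weight → Submodule ℂ (W i)
  map_mem : ∀ {i j : Vtx} (e : Q.Arrow i j) {w w' : Weight}, w' = w + Q.deg e → ∀ v ∈ piece i w,
    map e v ∈ piece j w'
  relation : ∀ {i j : Vtx} (p q : PathOn Q.Arrow i j), Q.rel p q → ∀ w, ∀ v ∈ piece i w,
    gpathMap map p v = gpathMap map q v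

attribute [instance] Pieces.acg Pieces.mod

namespace Pieces

variable {Q : WQuiver} (D : Pieces Q)

/-- The pieces, as a representation of the covering quiver. -/
noncomputable def prefunctor : Q.Cover ⥤q ModuleCat.{0} ℂ where
  obj x := ModuleCat.of ℂ (D.piece x.vtx x.wt)
  map {x y} e := ModuleCat.ofHom ((D.map e.1).restrict
    (p := D.piece x.vtx x.wt) (q := D.piece y.vtx y.wt) (fun v hv => D.map_mem e.1 e.2 v hv))

theorem lift_prefunctor {x y : Q.Cover} (p : Quiver.Path x y) (v : D.piece x.vtx x.wt) :
    Subtype.val (p := fun u => u ∈ D.piece y.vtx y.wt)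
      (((Paths.lift D.prefunctor).map p).hom v) =
    gpathMap (A := Q.Arrow) (i := x.vtx) (j := y.vtx) D.map (Q.proj.mapPath p) v.1 := by
  induction p with
  | nil => rfl
  | cons p e ih =>
    rw [Paths.lift_cons]
    exact congrArg (D.map e.1) ih

/-- The graded module given by the pieces. -/
noncomputable def toGrMod : Q.GrMod :=
  CategoryTheory.Quotient.lift _ (Paths.lift D.prefunctor) (by
    intro x y p q h
    ext v
    apply Subtype.ext
    exact (D.lift_prefunctor p v).trans
      ((D.relation _ _ h _ _ v.2).trans (D.lift_prefunctor q v).symm))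

theorem toGrMod_arr {x y : Q.Cover} (e : x ⟶ y) (v : D.piece x.vtx x.wt) :
    Subtype.val (p := fun u => u ∈ D.piece y.vtx y.wt) (D.toGrMod.map (arr e) v) =
      D.map e.1 v.1 := by
  have h : D.toGrMod.map (arr e) = D.prefunctor.map e := Paths.lift_toPath D.prefunctor e
  rw [h]
  rfl

end Pieces

/-! ### Monomial modules -/

/-- The level of a vertex: the number of arrows `a` minus the number of arrows `b` on the paths
which lead from `0` to it. -/
def lev : Vtx → ℤ
  | .v0 => 0
  | .v1 => 1

/-- The exponents of `a₁, a₂, b₁, b₂, c` of a monomial which ends at the vertex `i`, has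
weight `x.1`, and contains `x.2` factors `c` or `d`. -/
def expo (i : Vtx) (x : Weight × ℕ) : ℤ × ℤ × ℤ × ℤ × ℤ :=
  (x.1 1 + x.2, x.1 2 + x.2, x.1 1 + x.1 2 - x.1 0 - lev i + x.2, x.1 0 + x.2, x.2)

/-- The sum of the degrees of the arrows of a path. -/
def pathDeg {A : Vtx → Vtx → Type} (d : ∀ ⦃i j : Vtx⦄, A i j → Weight × ℕ) {i j : Vtx}
    (p : PathOn A i j) : Weight × ℕ :=
  @Quiver.Path.rec Vtx ⟨A⟩ i (fun _ _ => Weight × ℕ) 0 (fun _ e r => r + d e) j p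

/-- Quivers whose arrows increase the exponents, and whose relations are homogeneous. -/
class Toric (Q : WQuiver) where
  cdeg : ∀ ⦃i j : Vtx⦄, Q.Arrow i j → ℕ
  le_arrow : ∀ {i j : Vtx} (e : Q.Arrow i j) (x : Weight × ℕ),
    expo i x ≤ expo j (x + (Q.deg e, cdeg e))
  rel_deg : ∀ {i j : Vtx} {p q : PathOn Q.Arrow i j}, Q.rel p q →
    pathDeg (fun _ _ e => (Q.deg e, cdeg e)) p = pathDeg (fun _ _ e => (Q.deg e, cdeg e)) q

variable {Q : WQuiver} [Toric Q]

/-- The degree of an arrow together with its number of factors `c`. -/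
def adeg (Q : WQuiver) [Toric Q] ⦃i j : Vtx⦄ (e : Q.Arrow i j) : Weight × ℕ :=
  (Q.deg e, Toric.cdeg e)

/-- Sets of monomials which contain everything between two of their elements. -/
structure ConvexSet where
  mem : Vtx → Weight × ℕ → Prop
  convex : ∀ {i j k x y z}, mem i x → mem k z → expo i x ≤ expo j y → expo j y ≤ expo k z → mem j y

open Classical in
/-- The action of an arrow on the monomials in a convex set. -/
noncomputable def ConvexSet.act (Q : WQuiver) [Toric Q] (C : ConvexSet) ⦃i j : Vtx⦄
    (e : Q.Arrow i j) : (Weight × ℕ →₀ ℂ) →ₗ[ℂ] (Weight × ℕ →₀ ℂ) :=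
  Finsupp.lsum ℂ fun x =>
    if C.mem j (x + adeg Q e) then Finsupp.lsingle (x + adeg Q e) else 0

open Classical in
theorem ConvexSet.act_single (C : ConvexSet) {i j : Vtx} (e : Q.Arrow i j) (x : Weight × ℕ)
    (c : ℂ) : C.act Q e (Finsupp.single x c) =
      if C.mem j (x + adeg Q e) then Finsupp.single (x + adeg Q e) c else 0 := by
  simp only [ConvexSet.act, Finsupp.lsum_single]
  split_ifs <;> simp

theorem expo_le_path {i j : Vtx} (p : PathOn Q.Arrow i j) (x : Weight × ℕ) :
    expo i x ≤ expo j (x + pathDeg (adeg Q) p) := by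
  induction p with
  | nil => exact (add_zero x).symm ▸ le_rfl
  | cons p e ih =>
    refine ih.trans ((Toric.le_arrow e _).trans (le_of_eq ?_))
    rw [add_assoc]
    rfl

open Classical in
theorem ConvexSet.path_single (C : ConvexSet) {i j : Vtx} (p : PathOn Q.Arrow i j)
    (x : Weight × ℕ) (hx : C.mem i x) (c : ℂ) :
    gpathMap (W := fun _ => Weight × ℕ →₀ ℂ) (C.act Q) p (Finsupp.single x c) =
      if C.mem j (x + pathDeg (adeg Q) p) then Finsupp.single (x + pathDeg (adeg Q) p) c else 0 := by
  induction p with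
  | nil =>
    have : x + pathDeg (adeg Q) (@Quiver.Path.nil Vtx ⟨Q.Arrow⟩ i) = x := add_zero x
    rw [this, if_pos hx]
    rfl
  | @cons j k p e ih =>
    have h1 : x + pathDeg (adeg Q) (@Quiver.Path.cons Vtx ⟨Q.Arrow⟩ i j k p e) =
        x + pathDeg (adeg Q) p + adeg Q e := (add_assoc _ _ _).symm
    change C.act Q e (gpathMap (W := fun _ => Weight × ℕ →₀ ℂ) (C.act Q) p
      (Finsupp.single x c)) = _
    rw [ih, h1]
    by_cases h : C.mem k (x + pathDeg (adeg Q) p + adeg Q e)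
    · have : C.mem j (x + pathDeg (adeg Q) p) :=
        C.convex hx h (expo_le_path p x) (Toric.le_arrow e _)
      rw [if_pos h, if_pos this, C.act_single, if_pos h]
    · rw [if_neg h]
      split_ifs
      · rw [C.act_single, if_neg h]
      · simp

/-- The graded module spanned by a convex set of monomials. -/
noncomputable def ConvexSet.pieces (Q : WQuiver) [Toric Q] (C : ConvexSet) : Pieces Q where
  W _ := Weight × ℕ →₀ ℂ
  map := C.act Q
  piece i w := Finsupp.supported ℂ ℂ {x | x.1 = w ∧ C.mem i x}
  map_mem := by
    intro i j e w w' hw v hv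
    classical
    rw [Finsupp.mem_supported] at hv
    rw [← Finsupp.sum_single v, Finsupp.sum, map_sum]
    refine Submodule.sum_mem _ fun x hx => ?_
    rw [C.act_single]
    split_ifs with h
    · refine Finsupp.single_mem_supported ℂ _ ⟨?_, h⟩
      rw [hw, ← (hv hx).1]
      rfl
    · exact Submodule.zero_mem _
  relation := by
    intro i j p q h w v hv
    classical
    rw [Finsupp.mem_supported] at hv
    rw [← Finsupp.sum_single v, Finsupp.sum, map_sum, map_sum]
    refine Finset.sum_congr rfl fun x hx => ?_
    rw [C.path_single p x (hv hx).2, C.path_single q x (hv hx).2]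
    have := Toric.rel_deg h
    unfold adeg
    rw [this]

noncomputable def ConvexSet.ind (Q : WQuiver) [Toric Q] (C : ConvexSet) : Q.GrMod :=
  (C.pieces Q).toGrMod

/-- The vector of `C.ind Q` given by a monomial. -/
noncomputable def ConvexSet.basisVec (C : ConvexSet) (x : Q.Cover) (p : ℕ)
    (h : C.mem x.vtx (x.wt, p)) : (C.ind Q).obj (pt x) :=
  ⟨Finsupp.single (x.wt, p) 1, Finsupp.single_mem_supported ℂ _ ⟨rfl, h⟩⟩

end WQuiver

end LocalConifold

namespace LocalConifold

namespace WQuiver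

/-- The quivers of `X` and of `Z`: arrows `a`, `b`, perhaps with a loop at every vertex, subject to
the relations of `X` and of `Z`. -/
class ConifoldQuiver (Q : WQuiver) extends Toric Q where
  hasLoop : Prop
  A : Fin 2 → Q.Arrow .v0 .v1
  B : Fin 2 → Q.Arrow .v1 .v0
  loop : hasLoop → ∀ i : Vtx, Q.Arrow i i
  deg_A : ∀ i, Q.deg (A i) = ![tw 1, tw 2] i
  deg_B : ∀ i, Q.deg (B i) = ![0, tw 0] i
  deg_loop : ∀ h i, Q.deg (loop h i) = tw 3
  cdeg_A : ∀ i, cdeg (A i) = 0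
  cdeg_B : ∀ i, cdeg (B i) = 0
  cdeg_loop : ∀ h i, cdeg (loop h i) = 1
  rel_aba : ∀ i, Q.rel (path3 (A 0) (B i) (A 1)) (path3 (A 1) (B i) (A 0))
  rel_bab : ∀ i, Q.rel (path3 (B 0) (A i) (B 1)) (path3 (B 1) (A i) (B 0))
  rel_loopA : ∀ h i, Q.rel (path2 (A i) (loop h .v1)) (path2 (loop h .v0) (A i))
  rel_loopB : ∀ h i, Q.rel (path2 (B i) (loop h .v0)) (path2 (loop h .v1) (B i))
  arrow_cases : ∀ {P : ∀ i j : Vtx, Q.Arrow i j → Prop}, (∀ i, P _ _ (A i)) → (∀ i, P _ _ (B i)) →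
    (∀ h i, P _ _ (loop h i)) → ∀ {i j} (e : Q.Arrow i j), P i j e

theorem tw_apply : tw 0 0 = 1 ∧ tw 0 1 = 0 ∧ tw 0 2 = 0 ∧ tw 1 0 = 0 ∧ tw 1 1 = 1 ∧ tw 1 2 = 0 ∧
    tw 2 0 = 0 ∧ tw 2 1 = 0 ∧ tw 2 2 = 1 ∧ tw 3 0 = -1 ∧ tw 3 1 = -1 ∧ tw 3 2 = -1 := by
  simp [tw]

theorem lev_v0 : lev .v0 = 0 := rfl

theorem lev_v1 : lev .v1 = 1 := rfl

theorem lev_cases (i : Vtx) : lev i = 0 ∨ lev i = 1 := by cases i <;> simp [lev]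

theorem expo_le_iff {i j : Vtx} {x y : Weight × ℕ} : expo i x ≤ expo j y ↔
    x.1 1 + x.2 ≤ y.1 1 + y.2 ∧ x.1 2 + x.2 ≤ y.1 2 + y.2 ∧
    x.1 1 + x.1 2 - x.1 0 - lev i + x.2 ≤ y.1 1 + y.1 2 - y.1 0 - lev j + y.2 ∧
    x.1 0 + x.2 ≤ y.1 0 + y.2 ∧ x.2 ≤ y.2 := by
  simp [expo]

/-- The number of factors `c` and `d` of an arrow of the quiver of `X`. -/
def ArrowX.cdeg : ∀ ⦃i j : Vtx⦄, ArrowX i j → ℕ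
  | _, _, .a _ => 0
  | _, _, .b _ => 0
  | _, _, .c => 1
  | _, _, .d => 1

instance : ConifoldQuiver quiverX where
  cdeg := ArrowX.cdeg
  le_arrow := by
    intro i j e x
    rw [expo_le_iff]
    rcases e with ⟨i⟩ | ⟨i⟩ | _ | _
    · fin_cases i <;> simp [quiverX, ArrowX.deg, ArrowX.cdeg, tw, lev]
    · fin_cases i <;> simp [quiverX, ArrowX.deg, ArrowX.cdeg, tw, lev]
      omega
    · simp [quiverX, ArrowX.deg, ArrowX.cdeg, tw, lev]; omega
    · simp [quiverX, ArrowX.deg, ArrowX.cdeg, tw, lev]; omega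
  rel_deg := by
    intro i j p q h
    cases h <;> simp only [path2, path3, pathDeg] <;> abel
  hasLoop := True
  A := .a
  B := .b
  loop _ i := match i with
    | .v0 => .c
    | .v1 => .d
  deg_A _ := rfl
  deg_B _ := rfl
  deg_loop _ i := by cases i <;> rfl
  cdeg_A _ := rfl
  cdeg_B _ := rfl
  cdeg_loop _ i := by cases i <;> rfl
  rel_aba := .aba
  rel_bab := .bab
  rel_loopA _ i := .da i
  rel_loopB _ i := .cb i
  arrow_cases := by
    intro P hA hB hL i j e
    rcases e with ⟨i⟩ | ⟨i⟩ | _ | _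
    exacts [hA i, hB i, hL trivial .v0, hL trivial .v1]

instance : ConifoldQuiver quiverZ where
  cdeg _ _ _ := 0
  le_arrow := by
    intro i j e x
    rw [expo_le_iff]
    rcases e with ⟨i⟩ | ⟨i⟩
    · fin_cases i <;> simp [quiverZ, ArrowZ.deg, tw, lev]
    · fin_cases i <;> simp [quiverZ, ArrowZ.deg, tw, lev]
      omega
  rel_deg := by
    intro i j p q h
    cases h <;> simp only [path3, path2, pathDeg] <;> abel
  hasLoop := False
  A := .a
  B := .b
  loop h := h.elim
  deg_A _ := rfl
  deg_B _ := rfl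
  deg_loop h := h.elim
  cdeg_A _ := rfl
  cdeg_B _ := rfl
  cdeg_loop h := h.elim
  rel_aba := .aba
  rel_bab := .bab
  rel_loopA h := h.elim
  rel_loopB h := h.elim
  arrow_cases := by
    intro P hA hB hL i j e
    rcases e with ⟨i⟩ | ⟨i⟩
    exacts [hA i, hB i]

section Thin

variable {Q : WQuiver} [ConifoldQuiver Q]

open ConifoldQuiver

/-- The exponents of the monomials at a vertex of the covering quiver. -/
def ex (x : Q.Cover) (p : ℕ) : ℤ × ℤ × ℤ × ℤ × ℤ := expo x.vtx (x.wt, p)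

/-- The number of loops in a path. -/
def cnt {x : Q.Cover} : ∀ {y : Q.Cover}, Quiver.Path x y → ℕ
  | _, .nil => 0
  | _, .cons P e => cnt P + Toric.cdeg e.1

theorem cnt_comp {x y z : Q.Cover} (P : Quiver.Path x y) (P' : Quiver.Path y z) :
    cnt (P.comp P') = cnt P + cnt P' := by
  induction P' with
  | nil => rfl
  | cons P' e ih => simp only [Quiver.Path.comp_cons, cnt, ih, add_assoc]

theorem ex_le_arrow {x y : Q.Cover} (e : x ⟶ y) (p : ℕ) : ex x p ≤ ex y (p + Toric.cdeg e.1) := by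
  have := Toric.le_arrow e.1 (x.wt, p)
  rwa [Prod.mk_add_mk, ← e.2] at this

theorem ex_le_path {x y : Q.Cover} (P : Quiver.Path x y) (p : ℕ) : ex x p ≤ ex y (p + cnt P) := by
  induction P with
  | nil => exact le_rfl
  | cons P e ih => exact ih.trans (by rw [cnt, ← add_assoc]; exact ex_le_arrow e _)

/-- The sum of the exponents. -/
def ht (x : Q.Cover) (p : ℕ) : ℤ := 2 * x.wt 1 + 2 * x.wt 2 - lev x.vtx + 5 * p

theorem ht_arrow {x y : Q.Cover} (e : x ⟶ y) (p : ℕ) :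
    ht y (p + Toric.cdeg e.1) = ht x p + 1 := by
  obtain ⟨i, w⟩ := x
  obtain ⟨j, w'⟩ := y
  obtain ⟨e, he⟩ := e
  dsimp only at e he
  subst he
  revert w
  refine arrow_cases (P := fun i j e => ∀ w, ht (Q := Q) ⟨j, w + Q.deg e⟩ (p + Toric.cdeg e) =
    ht (Q := Q) ⟨i, w⟩ p + 1) ?_ ?_ ?_ e
  · intro i w
    simp only [deg_A, cdeg_A, ht, lev]
    fin_cases i <;> simp [tw] <;> ring
  · intro i w
    simp only [deg_B, cdeg_B, ht, lev]
    fin_cases i <;> simp [tw] <;> ring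
  · intro h i w
    simp only [deg_loop, cdeg_loop, ht]
    simp [tw]
    ring

theorem ht_path {x y : Q.Cover} (P : Quiver.Path x y) (p : ℕ) :
    ht y (p + cnt P) = ht x p + P.length := by
  induction P with
  | nil => simp [cnt]
  | cons P e ih =>
    rw [cnt, ← add_assoc, ht_arrow, ih, Quiver.Path.length_cons]
    push_cast
    ring

/-- The arrow `a_i` of the covering quiver. -/
def cA (i : Fin 2) (w w' : Weight) (h : w' = w + ![tw 1, tw 2] i) :
    (⟨.v0, w⟩ : Q.Cover) ⟶ ⟨.v1, w'⟩ := ⟨A i, by rw [deg_A]; exact h⟩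

/-- The arrow `b_i` of the covering quiver. -/
def cB (i : Fin 2) (w w' : Weight) (h : w' = w + ![0, tw 0] i) :
    (⟨.v1, w⟩ : Q.Cover) ⟶ ⟨.v0, w'⟩ := ⟨B i, by rw [deg_B]; exact h⟩

/-- The loops of the covering quiver. -/
def cL (hl : hasLoop Q) (i : Vtx) (w w' : Weight) (h : w' = w + tw 3) :
    (⟨i, w⟩ : Q.Cover) ⟶ ⟨i, w'⟩ := ⟨loop hl i, by rw [deg_loop]; exact h⟩

theorem cover_cases {P : ∀ x y : Q.Cover, (x ⟶ y) → Prop}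
    (hA : ∀ i w w' h, P _ _ (cA i w w' h)) (hB : ∀ i w w' h, P _ _ (cB i w w' h))
    (hL : ∀ hl i w w' h, P _ _ (cL hl i w w' h)) {x y : Q.Cover} (e : x ⟶ y) : P x y e := by
  obtain ⟨i, w⟩ := x
  obtain ⟨j, w'⟩ := y
  obtain ⟨e, he⟩ := e
  dsimp only at e he
  revert w w'
  refine arrow_cases (P := fun i j e => ∀ w w' (he : w' = w + Q.deg e),
    P ⟨i, w⟩ ⟨j, w'⟩ ⟨e, he⟩) ?_ ?_ ?_ e
  · exact fun i w w' h => hA i w w' (by rwa [deg_A] at h)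
  · exact fun i w w' h => hB i w w' (by rwa [deg_B] at h)
  · exact fun hl i w w' h => hL hl i w w' (by rwa [deg_loop] at h)

theorem exists_path : ∀ (n : ℕ) (y x : Q.Cover) (p q : ℕ), ht x q = ht y p + n → ex y p ≤ ex x q →
    (hasLoop Q ∨ p = q) → ∃ P : Quiver.Path y x, p + cnt P = q := by
  intro n
  induction n with
  | zero =>
    rintro ⟨i, w⟩ ⟨j, w'⟩ p q hn hle _
    simp only [ex, expo_le_iff] at hle
    simp only [ht, Nat.cast_zero, add_zero] at hn
    have h0 : w = w' := by
      funext k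
      fin_cases k <;> simp only [Fin.zero_eta, Fin.mk_one, Fin.reduceFinMk] <;>
        cases i <;> cases j <;> simp only [lev] at * <;> omega
    subst h0
    have h1 : i = j := by
      cases i <;> cases j <;> first | rfl | (simp only [lev] at *; omega)
    subst h1
    exact ⟨.nil, by simp only [cnt]; omega⟩
  | succ n ih =>
    rintro ⟨i, w⟩ ⟨j, w'⟩ p q hn hle hl
    simp only [ex, expo_le_iff] at hle
    simp only [ht] at hn
    have hi := lev_cases i
    have step : ∀ (z : Q.Cover) (e : z ⟶ ⟨j, w'⟩) (r : ℕ), r + Toric.cdeg e.1 = q →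
        ex (⟨i, w⟩ : Q.Cover) p ≤ ex z r → (hasLoop Q ∨ p = r) →
        ∃ P : Quiver.Path (⟨i, w⟩ : Q.Cover) ⟨j, w'⟩, p + cnt P = q := by
      intro z e r hr h1 h2
      have h3 := ht_arrow e r
      obtain ⟨P, hP⟩ := ih ⟨i, w⟩ z p r (by rw [hr] at h3; simp only [ht] at h3 ⊢; push_cast at hn; linarith)
        h1 h2
      exact ⟨P.cons e, by rw [cnt, ← add_assoc, hP, hr]⟩
    by_cases hpq : p < q
    · obtain ⟨q, rfl⟩ : ∃ q', q = q' + 1 := ⟨q - 1, by omega⟩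
      have hl' : hasLoop Q := hl.resolve_right (by omega)
      refine step ⟨j, w' - tw 3⟩ (cL hl' j _ _ (by simp)) q ?_ ?_ (Or.inl hl')
      · simp only [cL, cdeg_loop]
      · simp only [ex, expo_le_iff]
        simp only [tw_apply, lev_v0, lev_v1, Pi.add_apply, Pi.sub_apply, Pi.zero_apply,
          Matrix.cons_val_zero, Matrix.cons_val_one, Fin.isValue, Nat.cast_add, Nat.cast_one] at hle ⊢
        omega
    have hpq' : p = q := by omega
    subst hpq'
    cases j with
    | v0 =>
      by_cases h0 : w 0 < w' 0
      · refine step ⟨.v1, w' - tw 0⟩ (cB 1 _ _ (by simp)) p ?_ ?_ (Or.inr rfl)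
        · simp [cB, cdeg_B]
        · simp only [ex, expo_le_iff]
          simp only [tw_apply, lev_v0, lev_v1, Pi.add_apply, Pi.sub_apply, Pi.zero_apply,
          Matrix.cons_val_zero, Matrix.cons_val_one, Fin.isValue, Nat.cast_add, Nat.cast_one] at hle hn ⊢
          omega
      · refine step ⟨.v1, w'⟩ (cB 0 _ _ (by simp)) p ?_ ?_ (Or.inr rfl)
        · simp [cB, cdeg_B]
        · simp only [ex, expo_le_iff]
          simp only [tw_apply, lev_v0, lev_v1, Pi.add_apply, Pi.sub_apply, Pi.zero_apply,
          Matrix.cons_val_zero, Matrix.cons_val_one, Fin.isValue, Nat.cast_add, Nat.cast_one] at hle hn ⊢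
          omega
    | v1 =>
      by_cases h0 : w 1 < w' 1
      · refine step ⟨.v0, w' - tw 1⟩ (cA 0 _ _ (by simp)) p ?_ ?_ (Or.inr rfl)
        · simp [cA, cdeg_A]
        · simp only [ex, expo_le_iff]
          simp only [tw_apply, lev_v0, lev_v1, Pi.add_apply, Pi.sub_apply, Pi.zero_apply,
          Matrix.cons_val_zero, Matrix.cons_val_one, Fin.isValue, Nat.cast_add, Nat.cast_one] at hle hn ⊢
          omega
      · refine step ⟨.v0, w' - tw 2⟩ (cA 1 _ _ (by simp)) p ?_ ?_ (Or.inr rfl)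
        · simp [cA, cdeg_A]
        · simp only [ex, expo_le_iff]
          simp only [tw_apply, lev_v0, lev_v1, Pi.add_apply, Pi.sub_apply, Pi.zero_apply,
          Matrix.cons_val_zero, Matrix.cons_val_one, Fin.isValue, Nat.cast_add, Nat.cast_one] at hle hn ⊢
          omega

/-- The morphism of the covering category given by a path. -/
def pmor {x y : Q.Cover} (P : Quiver.Path x y) : pt x ⟶ pt y :=
  (Quotient.functor Q.coverRel).map (X := x) (Y := y) P

omit [ConifoldQuiver Q] in
theorem pmor_cons {x y z : Q.Cover} (P : Quiver.Path x y) (e : y ⟶ z) :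
    pmor (P.cons e) = pmor P ≫ arr e := rfl

omit [ConifoldQuiver Q] in
theorem pmor_comp {x y z : Q.Cover} (P : Quiver.Path x y) (P' : Quiver.Path y z) :
    pmor (P.comp P') = pmor P ≫ pmor P' :=
  (Quotient.functor Q.coverRel).map_comp (X := x) (Y := y) (Z := z) P P'

omit [ConifoldQuiver Q] in
theorem pmor_surjective {x y : Q.Cover} (f : pt x ⟶ pt y) : ∃ P, pmor P = f :=
  (Quotient.functor Q.coverRel).map_surjective f

omit [ConifoldQuiver Q] in
theorem pmor_eq_of_rel {x y : Q.Cover} {P P' : Quiver.Path x y}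
    (h : Q.rel (Q.proj.mapPath P) (Q.proj.mapPath P')) : pmor P = pmor P' :=
  CategoryTheory.Quotient.sound (C := Paths Q.Cover) Q.coverRel (a := x) (b := y) h

theorem cover_cases_to_v1 {w : Weight} {P : ∀ x : Q.Cover, (x ⟶ ⟨.v1, w⟩) → Prop}
    (hA : ∀ i, P _ (cA i (w - ![tw 1, tw 2] i) w (by simp)))
    (hL : ∀ hl, P _ (cL hl .v1 (w - tw 3) w (by simp))) {x : Q.Cover} (e : x ⟶ ⟨.v1, w⟩) :
    P x e := by
  have key : ∀ {x y : Q.Cover} (e : x ⟶ y) (w : Weight) (hy : y = ⟨.v1, w⟩)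
      (P : ∀ x : Q.Cover, (x ⟶ ⟨.v1, w⟩) → Prop)
      (_ : ∀ i, P _ (cA i (w - ![tw 1, tw 2] i) w (by simp)))
      (_ : ∀ hl, P _ (cL hl .v1 (w - tw 3) w (by simp))), P x (hy ▸ e) := by
    intro x y e
    refine cover_cases (P := fun x y e => ∀ (w : Weight) (hy : y = ⟨.v1, w⟩)
      (P : ∀ x : Q.Cover, (x ⟶ ⟨.v1, w⟩) → Prop)
      (_ : ∀ i, P _ (cA i (w - ![tw 1, tw 2] i) w (by simp)))
      (_ : ∀ hl, P _ (cL hl .v1 (w - tw 3) w (by simp))), P x (hy ▸ e)) ?_ ?_ ?_ e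
    · intro i w w' h w'' hy P hA hL
      cases hy
      obtain rfl : w = w' - ![tw 1, tw 2] i := by rw [h, add_sub_cancel_right]
      exact hA i
    · intro i w w' h w'' hy
      cases hy
    · intro hl i w w' h w'' hy P hA hL
      cases hy
      obtain rfl : w = w' - tw 3 := by rw [h, add_sub_cancel_right]
      exact hL hl
  exact key e w rfl P hA hL

theorem cover_cases_to_v0 {w : Weight} {P : ∀ x : Q.Cover, (x ⟶ ⟨.v0, w⟩) → Prop}
    (hB : ∀ i, P _ (cB i (w - ![0, tw 0] i) w (by simp)))
    (hL : ∀ hl, P _ (cL hl .v0 (w - tw 3) w (by simp))) {x : Q.Cover} (e : x ⟶ ⟨.v0, w⟩) :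
    P x e := by
  have key : ∀ {x y : Q.Cover} (e : x ⟶ y) (w : Weight) (hy : y = ⟨.v0, w⟩)
      (P : ∀ x : Q.Cover, (x ⟶ ⟨.v0, w⟩) → Prop)
      (_ : ∀ i, P _ (cB i (w - ![0, tw 0] i) w (by simp)))
      (_ : ∀ hl, P _ (cL hl .v0 (w - tw 3) w (by simp))), P x (hy ▸ e) := by
    intro x y e
    refine cover_cases (P := fun x y e => ∀ (w : Weight) (hy : y = ⟨.v0, w⟩)
      (P : ∀ x : Q.Cover, (x ⟶ ⟨.v0, w⟩) → Prop)
      (_ : ∀ i, P _ (cB i (w - ![0, tw 0] i) w (by simp)))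
      (_ : ∀ hl, P _ (cL hl .v0 (w - tw 3) w (by simp))), P x (hy ▸ e)) ?_ ?_ ?_ e
    · intro i w w' h w'' hy
      cases hy
    · intro i w w' h w'' hy P hB hL
      cases hy
      obtain rfl : w = w' - ![0, tw 0] i := by rw [h, add_sub_cancel_right]
      exact hB i
    · intro hl i w w' h w'' hy P hB hL
      cases hy
      obtain rfl : w = w' - tw 3 := by rw [h, add_sub_cancel_right]
      exact hL hl
  exact key e w rfl P hB hL

/-- Two arrows with the same target fit into a commutative square above `(y, p)`. -/
def Confluent (y : Q.Cover) (p : ℕ) {x z z' : Q.Cover} (e : z ⟶ x) (q : ℕ) (e' : z' ⟶ x)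
    (q' : ℕ) : Prop :=
  ∃ (u : Q.Cover) (f : Quiver.Path u z) (f' : Quiver.Path u z') (r : ℕ), ex y p ≤ ex u r ∧
    r + cnt f = q ∧ r + cnt f' = q' ∧ pmor f ≫ arr e = pmor f' ≫ arr e'

theorem Confluent.symm {y : Q.Cover} {p : ℕ} {x z z' : Q.Cover} {e : z ⟶ x} {q : ℕ} {e' : z' ⟶ x}
    {q' : ℕ} (h : Confluent y p e q e' q') : Confluent y p e' q' e q := by
  obtain ⟨u, f, f', r, h1, h2, h3, h4⟩ := h
  exact ⟨u, f', f, r, h1, h3, h2, h4.symm⟩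

theorem confluent_A {y : Q.Cover} {p q : ℕ} {w w₁ w₂ : Weight} (h₁ : w = w₁ + ![tw 1, tw 2] 0)
    (h₂ : w = w₂ + ![tw 1, tw 2] 1) (hz : ex y p ≤ ex (⟨.v0, w₁⟩ : Q.Cover) q)
    (hz' : ex y p ≤ ex (⟨.v0, w₂⟩ : Q.Cover) q) :
    Confluent y p (cA (Q := Q) 0 w₁ w h₁) q (cA 1 w₂ w h₂) q := by
  have key : ∀ k, ex y p ≤ ex (⟨.v0, w - tw 1 - tw 2 - ![0, tw 0] k⟩ : Q.Cover) q →
      Confluent y p (cA (Q := Q) 0 w₁ w h₁) q (cA 1 w₂ w h₂) q := by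
    intro k hk
    have e₁ : w₁ = w - tw 1 := by rw [h₁]; simp
    have e₂ : w₂ = w - tw 2 := by rw [h₂]; simp
    subst e₁ e₂
    refine ⟨⟨.v0, w - tw 1 - tw 2 - ![0, tw 0] k⟩,
      (Quiver.Path.nil.cons (cA 1 _ (w - tw 1 - ![0, tw 0] k) (by simp; abel))).cons
        (cB k _ _ (by simp)),
      (Quiver.Path.nil.cons (cA 0 _ (w - tw 2 - ![0, tw 0] k) (by simp; abel))).cons
        (cB k _ _ (by simp)), q, hk, by simp [cnt, cA, cB, cdeg_A, cdeg_B],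
        by simp [cnt, cA, cB, cdeg_A, cdeg_B], ?_⟩
    rw [← pmor_cons, ← pmor_cons]
    exact (pmor_eq_of_rel (rel_aba k)).symm
  have hy := lev_cases y.vtx
  subst h₁
  have e₂ : w₂ = w₁ + tw 1 - tw 2 := by rw [eq_sub_iff_add_eq]; exact h₂.symm
  subst e₂
  simp only [ex, expo_le_iff] at hz hz'
  by_cases h : y.wt 0 + p < w₁ 0 + q
  · refine key 1 ?_
    simp only [ex, expo_le_iff]
    simp only [tw_apply, lev_v0, lev_v1, Pi.add_apply, Pi.sub_apply, Pi.zero_apply,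
          Matrix.cons_val_zero, Matrix.cons_val_one, Fin.isValue, Nat.cast_add, Nat.cast_one] at hz hz' ⊢
    omega
  · refine key 0 ?_
    simp only [ex, expo_le_iff]
    simp only [tw_apply, lev_v0, lev_v1, Pi.add_apply, Pi.sub_apply, Pi.zero_apply,
          Matrix.cons_val_zero, Matrix.cons_val_one, Fin.isValue, Nat.cast_add, Nat.cast_one] at hz hz' ⊢
    omega

theorem confluent_B {y : Q.Cover} {p q : ℕ} {w w₁ w₂ : Weight} (h₁ : w = w₁ + ![0, tw 0] 0)
    (h₂ : w = w₂ + ![0, tw 0] 1) (hz : ex y p ≤ ex (⟨.v1, w₁⟩ : Q.Cover) q)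
    (hz' : ex y p ≤ ex (⟨.v1, w₂⟩ : Q.Cover) q) :
    Confluent y p (cB (Q := Q) 0 w₁ w h₁) q (cB 1 w₂ w h₂) q := by
  have key : ∀ k, ex y p ≤ ex (⟨.v1, w - tw 0 - ![tw 1, tw 2] k⟩ : Q.Cover) q →
      Confluent y p (cB (Q := Q) 0 w₁ w h₁) q (cB 1 w₂ w h₂) q := by
    intro k hk
    have e₁ : w₁ = w := by rw [h₁]; simp
    have e₂ : w₂ = w - tw 0 := by rw [h₂]; simp
    subst e₁ e₂
    refine ⟨⟨.v1, w₁ - tw 0 - ![tw 1, tw 2] k⟩,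
      (Quiver.Path.nil.cons (cB 1 _ (w₁ - ![tw 1, tw 2] k) (by simp; abel))).cons
        (cA k _ _ (by simp)),
      (Quiver.Path.nil.cons (cB 0 _ (w₁ - tw 0 - ![tw 1, tw 2] k) (by simp))).cons
        (cA k _ _ (by simp)), q, hk, by simp [cnt, cA, cB, cdeg_A, cdeg_B],
        by simp [cnt, cA, cB, cdeg_A, cdeg_B], ?_⟩
    rw [← pmor_cons, ← pmor_cons]
    exact (pmor_eq_of_rel (rel_bab k)).symm
  have hy := lev_cases y.vtx
  subst h₁
  have e₂ : w₂ = w₁ - tw 0 := by rw [eq_sub_iff_add_eq, ← add_zero w₁]; exact h₂.symm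
  subst e₂
  simp only [ex, expo_le_iff] at hz hz'
  by_cases h : y.wt 1 + p < w₁ 1 + q
  · refine key 0 ?_
    simp only [ex, expo_le_iff]
    simp only [tw_apply, lev_v0, lev_v1, Pi.add_apply, Pi.sub_apply, Pi.zero_apply,
          Matrix.cons_val_zero, Matrix.cons_val_one, Fin.isValue, Nat.cast_add, Nat.cast_one] at hz hz' ⊢
    omega
  · refine key 1 ?_
    simp only [ex, expo_le_iff]
    simp only [tw_apply, lev_v0, lev_v1, Pi.add_apply, Pi.sub_apply, Pi.zero_apply,
          Matrix.cons_val_zero, Matrix.cons_val_one, Fin.isValue, Nat.cast_add, Nat.cast_one] at hz hz' ⊢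
    omega

theorem confluent_AL {y : Q.Cover} {p q : ℕ} {i : Fin 2} {hl : hasLoop Q} {w w₁ w₂ : Weight}
    (h₁ : w = w₁ + ![tw 1, tw 2] i) (h₂ : w = w₂ + tw 3)
    (hz : ex y p ≤ ex (⟨.v0, w₁⟩ : Q.Cover) (q + 1)) (hz' : ex y p ≤ ex (⟨.v1, w₂⟩ : Q.Cover) q) :
    Confluent y p (cA (Q := Q) i w₁ w h₁) (q + 1) (cL hl .v1 w₂ w h₂) q := by
  have e₁ : w₁ = w - ![tw 1, tw 2] i := by rw [h₁]; simp
  have e₂ : w₂ = w - tw 3 := by rw [h₂]; simp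
  refine ⟨⟨.v0, w₁ - tw 3⟩, Quiver.Path.nil.cons (cL hl .v0 _ _ (by simp)),
    Quiver.Path.nil.cons (cA i _ _ (by rw [e₁, e₂]; abel)), q, ?_, by simp [cnt, cL, cdeg_loop],
    by simp [cnt, cA, cdeg_A], ?_⟩
  · subst e₁ e₂
    simp only [ex, expo_le_iff] at *
    fin_cases i <;>
      (simp only [tw_apply, lev_v0, lev_v1, Pi.add_apply, Pi.sub_apply, Pi.zero_apply,
        Matrix.cons_val_zero, Matrix.cons_val_one, Fin.isValue, Nat.cast_add, Nat.cast_one,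
        Fin.zero_eta, Fin.mk_one] at *; omega)
  · rw [← pmor_cons, ← pmor_cons]
    exact (pmor_eq_of_rel (rel_loopA hl i)).symm

theorem confluent_BL {y : Q.Cover} {p q : ℕ} {i : Fin 2} {hl : hasLoop Q} {w w₁ w₂ : Weight}
    (h₁ : w = w₁ + ![0, tw 0] i) (h₂ : w = w₂ + tw 3)
    (hz : ex y p ≤ ex (⟨.v1, w₁⟩ : Q.Cover) (q + 1)) (hz' : ex y p ≤ ex (⟨.v0, w₂⟩ : Q.Cover) q) :
    Confluent y p (cB (Q := Q) i w₁ w h₁) (q + 1) (cL hl .v0 w₂ w h₂) q := by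
  have e₁ : w₁ = w - ![0, tw 0] i := by rw [h₁]; simp
  have e₂ : w₂ = w - tw 3 := by rw [h₂]; simp
  refine ⟨⟨.v1, w₁ - tw 3⟩, Quiver.Path.nil.cons (cL hl .v1 _ _ (by simp)),
    Quiver.Path.nil.cons (cB i _ _ (by rw [e₁, e₂]; abel)), q, ?_, by simp [cnt, cL, cdeg_loop],
    by simp [cnt, cB, cdeg_B], ?_⟩
  · subst e₁ e₂
    simp only [ex, expo_le_iff] at *
    fin_cases i <;>
      (simp only [tw_apply, lev_v0, lev_v1, Pi.add_apply, Pi.sub_apply, Pi.zero_apply,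
        Matrix.cons_val_zero, Matrix.cons_val_one, Fin.isValue, Nat.cast_add, Nat.cast_one,
        Fin.zero_eta, Fin.mk_one] at *; omega)
  · rw [← pmor_cons, ← pmor_cons]
    exact (pmor_eq_of_rel (rel_loopB hl i)).symm

theorem confluent {y : Q.Cover} {p : ℕ} {x z z' : Q.Cover} (e : z ⟶ x) (q : ℕ) (e' : z' ⟶ x)
    (q' : ℕ) (hz : ex y p ≤ ex z q) (hz' : ex y p ≤ ex z' q')
    (hq : q + Toric.cdeg e.1 = q' + Toric.cdeg e'.1) :
    (∃ h : z = z', h ▸ e = e') ∨ Confluent y p e q e' q' := by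
  obtain ⟨i, w⟩ := x
  cases i with
  | v0 =>
    induction e using cover_cases_to_v0 with
    | hB i =>
      induction e' using cover_cases_to_v0 with
      | hB i' =>
        simp only [cB, cdeg_B, add_zero] at hq
        subst hq
        fin_cases i <;> fin_cases i'
        · exact Or.inl ⟨rfl, rfl⟩
        · exact Or.inr (confluent_B _ _ hz hz')
        · exact Or.inr (confluent_B _ _ hz' hz).symm
        · exact Or.inl ⟨rfl, rfl⟩
      | hL hl =>
        simp only [cB, cL, cdeg_B, cdeg_loop, add_zero] at hq
        subst hq
        exact Or.inr (confluent_BL _ _ hz hz')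
    | hL hl =>
      induction e' using cover_cases_to_v0 with
      | hB i' =>
        simp only [cB, cL, cdeg_B, cdeg_loop, add_zero] at hq
        subst hq
        exact Or.inr (confluent_BL _ _ hz' hz).symm
      | hL hl' => exact Or.inl ⟨rfl, rfl⟩
  | v1 =>
    induction e using cover_cases_to_v1 with
    | hA i =>
      induction e' using cover_cases_to_v1 with
      | hA i' =>
        simp only [cA, cdeg_A, add_zero] at hq
        subst hq
        fin_cases i <;> fin_cases i'
        · exact Or.inl ⟨rfl, rfl⟩
        · exact Or.inr (confluent_A _ _ hz hz')
        · exact Or.inr (confluent_A _ _ hz' hz).symm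
        · exact Or.inl ⟨rfl, rfl⟩
      | hL hl =>
        simp only [cA, cL, cdeg_A, cdeg_loop, add_zero] at hq
        subst hq
        exact Or.inr (confluent_AL _ _ hz hz')
    | hL hl =>
      induction e' using cover_cases_to_v1 with
      | hA i' =>
        simp only [cA, cL, cdeg_A, cdeg_loop, add_zero] at hq
        subst hq
        exact Or.inr (confluent_AL _ _ hz' hz).symm
      | hL hl' => exact Or.inl ⟨rfl, rfl⟩

theorem cdeg_eq_zero (h : ¬ hasLoop Q) {i j : Vtx} (e : Q.Arrow i j) : Toric.cdeg e = 0 :=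
  arrow_cases (P := fun i j e => Toric.cdeg (Q := Q) (i := i) (j := j) e = 0) cdeg_A cdeg_B
    (fun hl => (h hl).elim) e

theorem cnt_eq_zero (h : ¬ hasLoop Q) {x y : Q.Cover} (P : Quiver.Path x y) : cnt P = 0 := by
  induction P with
  | nil => rfl
  | cons P e ih => rw [cnt, ih, cdeg_eq_zero h]

/-- A morphism of the covering category is determined by its number of loops. -/
theorem pmor_eq_of_cnt {y x : Q.Cover} (P P' : Quiver.Path y x) (h : cnt P = cnt P') :
    pmor P = pmor P' := by
  have key : ∀ (n : ℕ) {x : Q.Cover} (P P' : Quiver.Path y x), P.length = n → P'.length = n →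
      cnt P = cnt P' → pmor P = pmor P' := by
    intro n
    induction n with
    | zero =>
      intro x P P' h h' _
      obtain rfl := Quiver.Path.eq_of_length_zero P h
      rw [Quiver.Path.eq_nil_of_length_zero P h, Quiver.Path.eq_nil_of_length_zero P' h']
    | succ n ih =>
      intro x P P' h h' hc
      cases P with
      | nil => simp at h
      | @cons z _ P e =>
      cases P' with
      | nil => simp at h'
      | @cons z' _ P' e' =>
        simp only [Quiver.Path.length_cons, add_left_inj] at h h'
        simp only [cnt] at hc
        have h1 := ex_le_path P 0
        have h2 := ex_le_path P' 0
        rw [zero_add] at h1 h2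
        rcases confluent e _ e' _ h1 h2 hc with ⟨rfl, rfl⟩ | ⟨u, f, f', r, h3, h4, h5, h6⟩
        · rw [pmor_cons, pmor_cons, ih P P' h h' (by simpa using hc)]
        · have hn : 0 ≤ ht u r - ht y 0 := by
            simp only [ex, expo_le_iff] at h3
            have hi := lev_cases y.vtx
            have hi' := lev_cases u.vtx
            simp only [ht]
            omega
          obtain ⟨P₀, hP₀⟩ := exists_path (ht u r - ht y 0).toNat y u 0 r
            (by rw [Int.toNat_of_nonneg hn]; ring) h3 (by
              by_cases hl : hasLoop Q
              · exact Or.inl hl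
              · right
                rw [cnt_eq_zero hl P] at h4
                omega)
          rw [zero_add] at hP₀
          have hlen : ∀ {v : Q.Cover} (g : Quiver.Path u v) (R : Quiver.Path y v),
              r + cnt g = cnt R → (P₀.comp g).length = R.length := by
            intro v g R hR
            have e1 := ht_path (P₀.comp g) 0
            have e2 := ht_path R 0
            rw [cnt_comp, hP₀, hR] at e1
            have : ((P₀.comp g).length : ℤ) = R.length := by linarith
            exact_mod_cast this
          have e1 := ih P (P₀.comp f) h ((hlen f P h4).trans h) (by rw [cnt_comp, hP₀, h4])
          have e2 := ih P' (P₀.comp f') h' ((hlen f' P' h5).trans h') (by rw [cnt_comp, hP₀, h5])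
          rw [pmor_cons, pmor_cons, e1, e2, pmor_comp, pmor_comp, Category.assoc, Category.assoc,
            h6]
  have e1 := ht_path P 0
  have e2 := ht_path P' 0
  rw [h] at e1
  have : (P.length : ℤ) = P'.length := by linarith
  exact key _ P P' rfl (by exact_mod_cast this.symm) h

end Thin

end WQuiver

end LocalConifold

namespace LocalConifold

namespace WQuiver

section Monomial

variable {Q : WQuiver} [ConifoldQuiver Q]

open ConifoldQuiver

theorem ConvexSet.act_congr {C C' : ConvexSet} {i j : Vtx} (e : Q.Arrow i j) {v : Weight × ℕ →₀ ℂ}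
    (h : ∀ x ∈ v.support, (C.mem j (x + adeg Q e) ↔ C'.mem j (x + adeg Q e))) :
    C.act Q e v = C'.act Q e v := by
  classical
  rw [← Finsupp.sum_single v, Finsupp.sum, map_sum, map_sum]
  refine Finset.sum_congr rfl fun x hx => ?_
  rw [C.act_single, C'.act_single]
  simp only [h x hx]

open Classical in
/-- Projection to the monomials in a convex set. -/
noncomputable def ConvexSet.pr (B : ConvexSet) (i : Vtx) :
    (Weight × ℕ →₀ ℂ) →ₗ[ℂ] (Weight × ℕ →₀ ℂ) where
  toFun := Finsupp.filter (B.mem i)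
  map_add' _ _ := Finsupp.filter_add
  map_smul' _ _ := Finsupp.filter_smul

/-- The vectors of weight `w` at the vertex `i`. -/
def ConvexSet.space (C : ConvexSet) (i : Vtx) (w : Weight) : Submodule ℂ (Weight × ℕ →₀ ℂ) :=
  Finsupp.supported ℂ ℂ {x | x.1 = w ∧ C.mem i x}

/-- The inclusion of a graded piece into the ambient space. -/
noncomputable def ConvexSet.val (C : ConvexSet) (x : Q.Cover) :
    (C.ind Q).obj (pt x) →ₗ[ℂ] (Weight × ℕ →₀ ℂ) := Submodule.subtype (C.space x.vtx x.wt)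

theorem ConvexSet.val_mem (C : ConvexSet) {x : Q.Cover} (v : (C.ind Q).obj (pt x)) :
    C.val x v ∈ C.space x.vtx x.wt := Subtype.prop (p := fun u => u ∈ C.space x.vtx x.wt) v

theorem ConvexSet.val_injective (C : ConvexSet) (x : Q.Cover) : Function.Injective (C.val x) :=
  Submodule.subtype_injective (C.space x.vtx x.wt)

/-- A linear map to a graded piece. -/
noncomputable def ConvexSet.lift (C : ConvexSet) (x : Q.Cover) {E : Type} [AddCommGroup E]
    [Module ℂ E] (g : E →ₗ[ℂ] (Weight × ℕ →₀ ℂ)) (h : ∀ v, g v ∈ C.space x.vtx x.wt) :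
    E →ₗ[ℂ] (C.ind Q).obj (pt x) := LinearMap.codRestrict (C.space x.vtx x.wt) g h

theorem ConvexSet.val_lift (C : ConvexSet) (x : Q.Cover) {E : Type} [AddCommGroup E]
    [Module ℂ E] (g : E →ₗ[ℂ] (Weight × ℕ →₀ ℂ)) (h : ∀ v, g v ∈ C.space x.vtx x.wt) (v : E) :
    C.val x (C.lift x g h v) = g v := rfl

theorem ConvexSet.exists_val (C : ConvexSet) (x : Q.Cover) {v : Weight × ℕ →₀ ℂ}
    (hv : v ∈ C.space x.vtx x.wt) : ∃ u, C.val x u = v := ⟨⟨v, hv⟩, rfl⟩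

theorem ConvexSet.val_basisVec (C : ConvexSet) (x : Q.Cover) (p : ℕ)
    (h : C.mem x.vtx (x.wt, p)) : C.val x (C.basisVec x p h) = Finsupp.single (x.wt, p) 1 := rfl

theorem ConvexSet.val_arr (C : ConvexSet) {x y : Q.Cover} (e : x ⟶ y) (v : (C.ind Q).obj (pt x)) :
    C.val y ((C.ind Q).map (arr e) v) = C.act Q e.1 (C.val x v) :=
  (C.pieces Q).toGrMod_arr e v

theorem ConvexSet.mem_space (C : ConvexSet) {i : Vtx} {w : Weight} {v : Weight × ℕ →₀ ℂ} :
    v ∈ C.space i w ↔ ∀ x, v x ≠ 0 → x.1 = w ∧ C.mem i x := by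
  rw [ConvexSet.space, Finsupp.mem_supported]
  simp [Set.subset_def]

/-- The monomials in an upper set of a convex set span a submodule, the others a quotient. -/
theorem ConvexSet.shortExact (A C B : ConvexSet) (h : ∀ i x, C.mem i x ↔ A.mem i x ∨ B.mem i x)
    (hd : ∀ i x, A.mem i x → ¬ B.mem i x)
    (hup : ∀ {i x j y}, A.mem i x → C.mem j y → expo i x ≤ expo j y → A.mem j y) :
    ∃ (f : A.ind Q ⟶ C.ind Q) (g : C.ind Q ⟶ B.ind Q) (w : f ≫ g = 0),
      (ShortComplex.mk f g w).ShortExact ∧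
      ∀ x p hA hC, f.app (pt x) (A.basisVec x p hA) = C.basisVec x p hC := by
  classical
  have hAC : ∀ i w, A.space i w ≤ C.space i w := fun i w =>
    Finsupp.supported_mono fun x hx => ⟨hx.1, (h i x).2 (Or.inl hx.2)⟩
  have hBC : ∀ i w, B.space i w ≤ C.space i w := fun i w =>
    Finsupp.supported_mono fun x hx => ⟨hx.1, (h i x).2 (Or.inr hx.2)⟩
  have hprv : ∀ i (v : Weight × ℕ →₀ ℂ) z, B.pr i v z = if B.mem i z then v z else 0 :=
    fun i v z => Finsupp.filter_apply _ _ _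
  have hpr : ∀ i w, ∀ v ∈ C.space i w, B.pr i v ∈ B.space i w := by
    intro i w v hv
    rw [ConvexSet.mem_space] at hv ⊢
    intro x hx
    rw [hprv] at hx
    split_ifs at hx with hB
    · exact ⟨(hv x hx).1, hB⟩
    · exact absurd rfl hx
  let f : A.ind Q ⟶ C.ind Q := mkHom
    (fun x => C.lift x (A.val x) (fun v => hAC _ _ (A.val_mem v))) (by
    intro x y e v
    apply C.val_injective
    rw [C.val_lift, A.val_arr, C.val_arr, C.val_lift]
    refine ConvexSet.act_congr _ fun z hz => ?_
    rw [h]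
    have hz' := A.mem_space.1 (A.val_mem v) z (Finsupp.mem_support_iff.1 hz)
    exact ⟨Or.inl, fun hh => hup hz'.2 ((h _ _).2 hh) (Toric.le_arrow _ _)⟩)
  have hf : ∀ x v, C.val x (f.app (pt x) v) = A.val x v := fun x v => rfl
  let g : C.ind Q ⟶ B.ind Q := mkHom
    (fun x => B.lift x (B.pr x.vtx ∘ₗ C.val x) (fun v => hpr _ _ _ (C.val_mem v))) (by
    intro x y e v
    apply B.val_injective
    rw [B.val_lift, LinearMap.comp_apply, C.val_arr, B.val_arr, B.val_lift, LinearMap.comp_apply]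
    have hv := C.mem_space.1 (C.val_mem v)
    generalize C.val x v = v at hv
    rw [← Finsupp.sum_single v, Finsupp.sum, map_sum, map_sum, map_sum, map_sum]
    refine Finset.sum_congr rfl fun z hz => ?_
    have hz' := (hv z (Finsupp.mem_support_iff.1 hz)).2
    rw [C.act_single]
    simp only [ConvexSet.pr, LinearMap.coe_mk, AddHom.coe_mk]
    by_cases hB : B.mem x.vtx z
    · rw [Finsupp.filter_single_of_pos _ hB, B.act_single]
      by_cases hC : C.mem y.vtx (z + adeg Q e.1)
      · rw [if_pos hC]
        by_cases hB' : B.mem y.vtx (z + adeg Q e.1)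
        · rw [if_pos hB', Finsupp.filter_single_of_pos _ hB']
        · rw [if_neg hB', Finsupp.filter_single_of_neg _ hB']
      · rw [if_neg hC, if_neg fun hh => hC ((h _ _).2 (Or.inr hh)), Finsupp.filter_zero]
    · rw [Finsupp.filter_single_of_neg _ hB, map_zero]
      have hA := ((h _ _).1 hz').resolve_right hB
      split_ifs with hC
      · exact Finsupp.filter_single_of_neg _ (hd _ _ (hup hA hC (Toric.le_arrow _ _)))
      · exact Finsupp.filter_zero _)
  have hg : ∀ x v, B.val x (g.app (pt x) v) = B.pr x.vtx (C.val x v) := fun x v => rfl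
  have hgf : ∀ x v, g.app (pt x) (f.app (pt x) v) = 0 := by
    intro x v
    apply B.val_injective
    rw [hg, hf, map_zero]
    ext z
    rw [hprv]
    split_ifs with hB
    · by_contra h0
      exact hd _ _ (A.mem_space.1 (A.val_mem v) z h0).2 hB
    · rfl
  refine ⟨f, g, ?_, shortExact_of_pointwise f g _ ?_ ?_ ?_, fun x p hA hC => rfl⟩
  · ext x v
    exact hgf x.as v
  · intro x u v huv
    apply A.val_injective
    rw [← hf, ← hf, huv]
  · intro x v
    obtain ⟨u, hu⟩ := C.exists_val x (hBC _ _ (B.val_mem v))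
    refine ⟨u, B.val_injective x ?_⟩
    rw [hg, hu]
    ext z
    rw [hprv]
    split_ifs with hB
    · rfl
    · by_contra h0
      exact hB (B.mem_space.1 (B.val_mem v) z (Ne.symm h0)).2
  · intro x v hv
    have h0 : B.pr x.vtx (C.val x v) = 0 := by rw [← hg, hv, map_zero]
    obtain ⟨u, hu⟩ := A.exists_val x (v := C.val x v) (by
      rw [A.mem_space]
      intro z hz
      have hz' := C.mem_space.1 (C.val_mem v) z hz
      refine ⟨hz'.1, ((h _ _).1 hz'.2).resolve_right fun hB => hz ?_⟩
      have := DFunLike.congr_fun h0 z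
      rwa [hprv, if_pos hB] at this)
    exact ⟨u, C.val_injective x (by rw [hf, hu])⟩

theorem ConvexSet.eq_top_of_basisVec (C : ConvexSet) (x : Q.Cover)
    (S : Submodule ℂ ((C.ind Q).obj (pt x))) (h : ∀ p hp, C.basisVec x p hp ∈ S) : S = ⊤ := by
  rw [eq_top_iff]
  rintro v -
  have hm : ∀ z ∈ (C.val x v).support, z = (x.wt, z.2) ∧ C.mem x.vtx (x.wt, z.2) := by
    intro z hz
    have := C.mem_space.1 (C.val_mem v) z (Finsupp.mem_support_iff.1 hz)
    have e : z = (x.wt, z.2) := Prod.ext this.1 rfl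
    exact ⟨e, e ▸ this.2⟩
  have hv : v = ∑ z ∈ (C.val x v).support.attach,
      C.val x v z.1 • C.basisVec x z.1.2 (hm z.1 z.2).2 := by
    apply C.val_injective
    rw [map_sum]
    simp only [map_smul, C.val_basisVec]
    conv_lhs => rw [← Finsupp.sum_single (C.val x v), Finsupp.sum, ← Finset.sum_attach]
    refine Finset.sum_congr rfl fun z _ => ?_
    rw [← (hm z.1 z.2).1, Finsupp.smul_single, smul_eq_mul, mul_one]
  rw [hv]
  exact Submodule.sum_mem _ fun z _ => S.smul_mem _ (h _ _)

/-- Convex sets which are closed under the arrows. -/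
def ConvexSet.Closed (Q : WQuiver) [Toric Q] (C : ConvexSet) : Prop :=
  ∀ {i j : Vtx} (e : Q.Arrow i j) (x : Weight × ℕ), C.mem i x → C.mem j (x + adeg Q e)

theorem ConvexSet.Closed.path {C : ConvexSet} (hC : C.Closed Q) {x y : Q.Cover}
    (P : Quiver.Path x y) {p : ℕ} (h : C.mem x.vtx (x.wt, p)) :
    C.mem y.vtx (y.wt, p + cnt P) := by
  induction P with
  | nil => exact h
  | cons P e ih =>
    have := hC e.1 _ ih
    rwa [adeg, Prod.mk_add_mk, ← e.2, add_assoc] at this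

theorem ConvexSet.map_basisVec {C : ConvexSet} (hC : C.Closed Q) {x y : Q.Cover}
    (P : Quiver.Path x y) {p : ℕ} (h : C.mem x.vtx (x.wt, p)) :
    (C.ind Q).map (pmor P) (C.basisVec x p h) = C.basisVec y (p + cnt P) (hC.path P h) := by
  induction P with
  | nil =>
    change (C.ind Q).map (𝟙 (pt x)) _ = _
    rw [CategoryTheory.Functor.map_id]
    rfl
  | @cons y z P e ih =>
    rw [pmor_cons, Functor.map_comp, ModuleCat.comp_apply, ih]
    apply C.val_injective
    rw [C.val_arr, C.val_basisVec, C.val_basisVec]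
    have h1 : ((y.wt, p + cnt P) : Weight × ℕ) + adeg Q e.1 = (z.wt, p + cnt (P.cons e)) := by
      rw [adeg, Prod.mk_add_mk, ← e.2, add_assoc]
      rfl
    rw [C.act_single, h1, if_pos (hC.path (P.cons e) h)]

/-- A closed convex set with a smallest element spans a projective module. -/
theorem ConvexSet.nonempty_iso {C : ConvexSet} (hC : C.Closed Q) (x₀ : Q.Cover) (p₀ : ℕ)
    (h₀ : C.mem x₀.vtx (x₀.wt, p₀)) (hmin : ∀ (y : Q.Cover) (q : ℕ), C.mem y.vtx (y.wt, q) →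
      ex x₀ p₀ ≤ ex y q ∧ (hasLoop Q ∨ p₀ = q)) :
    ∃ φ : proj₀ x₀ ≅ C.ind Q, φ.hom.app (pt x₀) (proj₀Gen x₀) = C.basisVec x₀ p₀ h₀ := by
  let φ : proj₀ x₀ ⟶ C.ind Q := proj₀Desc (C.basisVec x₀ p₀ h₀)
  have hφ : ∀ {y : Q.Cover} (P : Quiver.Path x₀ y), φ.app (pt y) (ModuleCat.freeMk (pmor P)) =
      C.basisVec y (p₀ + cnt P) (hC.path P h₀) := by
    intro y P
    refine (ModuleCat.freeDesc_apply _ _).trans ?_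
    exact ConvexSet.map_basisVec hC P h₀
  have hm : Mono φ := by
    apply mono_of_injective
    intro y
    choose P hP using fun f : pt x₀ ⟶ pt y => pmor_surjective f
    let k : (pt x₀ ⟶ pt y) → Weight × ℕ := fun f => (y.wt, p₀ + cnt (P f))
    have hk : Function.Injective k := by
      intro f g hfg
      rw [← hP f, ← hP g]
      exact pmor_eq_of_cnt _ _ (add_left_cancel (congrArg Prod.snd hfg))
    let φ' : ((pt x₀ ⟶ pt y) →₀ ℂ) →ₗ[ℂ] (Weight × ℕ →₀ ℂ) :=
      (C.val y).comp (φ.app (pt y)).hom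
    have h1 : φ' = Finsupp.lmapDomain ℂ ℂ k := by
      refine Finsupp.lhom_ext fun f c => ?_
      rw [← mul_one c, ← smul_eq_mul, ← Finsupp.smul_single, map_smul, map_smul]
      refine congrArg (c • ·) ?_
      have h2 := hφ (P f)
      rw [hP] at h2
      refine (congrArg (fun z => C.val y z) h2).trans ?_
      rw [Finsupp.lmapDomain_apply, Finsupp.mapDomain_single]
      rfl
    intro u v huv
    have h2 : φ' u = φ' v := congrArg (fun z => C.val y z) huv
    rw [h1] at h2
    exact Finsupp.mapDomain_injective hk h2
  have he : Epi φ := by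
    apply epi_of_surjective
    intro y
    have := C.eq_top_of_basisVec y (LinearMap.range (φ.app (pt y)).hom) (by
      intro q hq
      obtain ⟨h1, h2⟩ := hmin y q hq
      have hn : 0 ≤ ht y q - ht x₀ p₀ := by
        simp only [ex, expo_le_iff] at h1
        have hi := lev_cases x₀.vtx
        have hi' := lev_cases y.vtx
        simp only [ht]
        omega
      obtain ⟨P, rfl⟩ := exists_path (ht y q - ht x₀ p₀).toNat x₀ y p₀ q
        (by rw [Int.toNat_of_nonneg hn]; ring) h1 h2
      exact ⟨_, hφ P⟩)
    exact LinearMap.range_eq_top.1 this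
  have : IsIso φ := isIso_of_mono_of_epi φ
  exact ⟨asIso φ, proj₀Desc_gen _⟩

end Monomial

end WQuiver

end LocalConifold

namespace LocalConifold

/-- `ExtEuler n M N e`, and moreover all `Ext^k(M, N)` vanish if `A` holds. -/
def ExtEulerIf {C : Type*} [Category* C] [Abelian C] [Linear ℂ C] [HasExt C] (A : Prop) (n : ℕ)
    (M N : C) (e : ℤ) : Prop := ExtEuler n M N e ∧ (A → ExtAcyclic M N)

section

variable {C : Type*} [Category* C] [Abelian C] [Linear ℂ C] [HasExt C]

theorem ExtEulerIf.third {A : Prop} {nA nB n : ℕ} {eA eB : ℤ} {S : ShortComplex C}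
    (hS : S.ShortExact) {N : C} (hA : ExtEulerIf A nA S.X₁ N eA)
    (hB : ExtEulerIf A nB S.X₂ N eB) (h1 : nA + 1 ≤ n) (h2 : nB ≤ n) :
    ExtEulerIf A n S.X₃ N (eB - eA) :=
  ⟨ExtEuler.third hS N hA.1 hB.1 h1 h2, fun h => ExtAcyclic.third hS N (hA.2 h) (hB.2 h)⟩

theorem ExtEulerIf.middle {A : Prop} {n : ℕ} {eA eC : ℤ} {S : ShortComplex C}
    (hS : S.ShortExact) {N : C} (hA : ExtEulerIf A n S.X₁ N eA)
    (hC : ExtEulerIf A n S.X₃ N eC) : ExtEulerIf A n S.X₂ N (eA + eC) :=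
  ⟨ExtEuler.middle hS N hA.1 hC.1, fun h => ExtAcyclic.middle hS N (hA.2 h) (hC.2 h)⟩

theorem ExtEulerIf.of_iso {A : Prop} {n : ℕ} {M M' N : C} {e : ℤ}
    (h : ExtEulerIf A n M N e) (i : M ≅ M') : ExtEulerIf A n M' N e :=
  ⟨h.1.of_iso i, fun hA => (h.2 hA).of_iso i⟩

theorem ExtEulerIf.weaken {A A' : Prop} {n : ℕ} {M N : C} {e : ℤ}
    (h : ExtEulerIf A n M N e) (hA : A' → A) : ExtEulerIf A' n M N e :=
  ⟨h.1, fun h' => h.2 (hA h')⟩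

end

namespace WQuiver

section Koszul

variable {Q : WQuiver} [ConifoldQuiver Q]

open ConifoldQuiver

/-- The monomials without loops in `U` but not in `U'`, for upper sets `U` and `U'`. -/
def region (U U' : ℤ × ℤ × ℤ × ℤ × ℤ → Prop) (hU : ∀ {a b}, a ≤ b → U a → U b)
    (hU' : ∀ {a b}, a ≤ b → U' a → U' b) : ConvexSet where
  mem i y := y.2 = 0 ∧ U (expo i y) ∧ ¬ U' (expo i y)
  convex := by
    rintro i j k x y z ⟨h1, h2, h3⟩ ⟨h4, h5, h6⟩ h7 h8
    refine ⟨?_, hU h7 h2, fun h => h6 (hU' h8 h)⟩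
    rw [expo_le_iff] at h8
    omega

/-- The monomials without loops above a point. -/
def slab (x : Q.Cover) : ConvexSet :=
  region (ex x 0 ≤ ·) (fun _ => False) (fun h h' => h'.trans h) (fun _ h => h)

theorem mem_slab (x : Q.Cover) (i : Vtx) (y : Weight × ℕ) :
    (slab x).mem i y ↔ y.2 = 0 ∧ ex x 0 ≤ expo i y := by
  simp [slab, region]

/-- All monomials above a point. -/
def cone (x : Q.Cover) (p : ℕ) : ConvexSet where
  mem i y := ex x p ≤ expo i y
  convex h1 _ h3 _ := h1.trans h3

/-- A single monomial. -/
def single (x : Q.Cover) : ConvexSet where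
  mem i y := i = x.vtx ∧ y = (x.wt, 0)
  convex := by
    rintro i j k y z w ⟨rfl, rfl⟩ ⟨rfl, rfl⟩ h1 h2
    have h := le_antisymm h1 h2
    rw [expo_le_iff] at h1 h2
    simp only [Nat.cast_zero, add_zero] at h1 h2
    have hz : z.2 = 0 := by omega
    have hl : lev j = lev x.vtx := by omega
    have hj : j = x.vtx := by
      revert hl
      cases x.vtx <;> cases j <;> simp [lev]
    subst hj
    have hw : z.1 = x.wt := by
      funext l
      fin_cases l <;> simp only [Fin.zero_eta, Fin.mk_one, Fin.reduceFinMk] <;> omega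
    exact ⟨rfl, Prod.ext hw hz⟩

/-- The Koszul resolution of a simple module, from its six projective constituents. -/
theorem koszul {A : Prop} {n : ℕ} {N : Q.GrMod} {ε : Q.Cover → ℤ} {x a a' p p' o : Q.Cover}
    (hx : ExtEulerIf A n ((slab x).ind Q) N (ε x)) (ha : ExtEulerIf A n ((slab a).ind Q) N (ε a))
    (ha' : ExtEulerIf A n ((slab a').ind Q) N (ε a'))
    (hp : ExtEulerIf A n ((slab p).ind Q) N (ε p))
    (hp' : ExtEulerIf A n ((slab p').ind Q) N (ε p'))
    (ho : ExtEulerIf A n ((slab o).ind Q) N (ε o))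
    (h1 : ∀ i (y : Weight × ℕ), ex p 0 ≤ expo i y ∧ ex p' 0 ≤ expo i y ↔ ex o 0 ≤ expo i y)
    (h2 : ∀ i (y : Weight × ℕ), ex a 0 ≤ expo i y ∧ ex a' 0 ≤ expo i y ↔
      ex p 0 ≤ expo i y ∨ ex p' 0 ≤ expo i y)
    (h3 : ex x 0 ≤ ex a 0) (h4 : ex x 0 ≤ ex a' 0)
    (h5 : ∀ i (y : Weight × ℕ), (single x).mem i y ↔ y.2 = 0 ∧ ex x 0 ≤ expo i y ∧
      ¬ (ex a 0 ≤ expo i y ∨ ex a' 0 ≤ expo i y)) :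
    ExtEulerIf A (n + 3) ((single x).ind Q) N
      (ε x - ε a - ε a' + ε p + ε p' - ε o) := by
  let or (s s' : Q.Cover) (z : ℤ × ℤ × ℤ × ℤ × ℤ) : Prop := ex s 0 ≤ z ∨ ex s' 0 ≤ z
  have hor : ∀ s s' {z z'}, z ≤ z' → or s s' z → or s s' z' := fun s s' z z' h h' =>
    h'.imp (fun h'' => h''.trans h) (fun h'' => h''.trans h)
  have hsl : ∀ (s : Q.Cover) {z z'}, z ≤ z' → ex s 0 ≤ z → ex s 0 ≤ z' := fun _ _ _ h h' =>
    h'.trans h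
  let P : ConvexSet := region (or p p') (fun _ => False) (hor p p') (fun _ h => h)
  let B : ConvexSet := region (or a a') (fun _ => False) (hor a a') (fun _ h => h)
  let R : ConvexSet := region (ex p 0 ≤ ·) (ex o 0 ≤ ·) (hsl p) (hsl o)
  let T : ConvexSet := region (ex a 0 ≤ ·) (or p p') (hsl a) (hor p p')
  have hop : ∀ i (y : Weight × ℕ), ex o 0 ≤ expo i y → ex p 0 ≤ expo i y := fun i y h =>
    ((h1 i y).2 h).1
  have hR : ExtEulerIf A (n + 1) (R.ind Q) N (ε p - ε o) := by
    obtain ⟨f, g, w, hS, -⟩ := ConvexSet.shortExact (Q := Q) (slab o) (slab p) R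
      (by
        intro i y
        have := hop i y
        simp only [mem_slab, R, region]
        tauto)
      (by
        intro i y
        simp only [mem_slab, R, region]
        tauto)
      (by
        intro i y j z
        simp only [mem_slab]
        exact fun h h' h'' => ⟨h'.1, h.2.trans h''⟩)
    exact ExtEulerIf.third hS ho hp (by omega) (by omega)
  have hP : ExtEulerIf A (n + 1) (P.ind Q) N (ε p' + (ε p - ε o)) := by
    obtain ⟨f, g, w, hS, -⟩ := ConvexSet.shortExact (Q := Q) (slab p') P R
      (by
        intro i y
        have := h1 i y
        simp only [mem_slab, R, P, region, or]
        tauto)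
      (by
        intro i y
        have := h1 i y
        simp only [mem_slab, R, region]
        tauto)
      (by
        intro i y j z
        simp only [mem_slab]
        exact fun h h' h'' => ⟨h'.1, h.2.trans h''⟩)
    exact ExtEulerIf.middle hS ⟨hp'.1.mono (by omega), hp'.2⟩ hR
  have hT : ExtEulerIf A (n + 2) (T.ind Q) N (ε a - (ε p' + (ε p - ε o))) := by
    obtain ⟨f, g, w, hS, -⟩ := ConvexSet.shortExact (Q := Q) P (slab a) T
      (by
        intro i y
        have := h2 i y
        simp only [mem_slab, T, P, region, or]
        tauto)
      (by
        intro i y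
        simp only [P, T, region]
        tauto)
      (by
        intro i y j z
        simp only [P, region]
        exact fun h h' h'' => ⟨h'.1, hor p p' h'' h.2.1, fun h => h⟩)
    exact ExtEulerIf.third hS hP ha (by omega) (by omega)
  have hB : ExtEulerIf A (n + 2) (B.ind Q) N (ε a' + (ε a - (ε p' + (ε p - ε o)))) := by
    obtain ⟨f, g, w, hS, -⟩ := ConvexSet.shortExact (Q := Q) (slab a') B T
      (by
        intro i y
        have := h2 i y
        simp only [mem_slab, T, B, region, or]
        tauto)
      (by
        intro i y
        have := h2 i y
        simp only [mem_slab, T, region, or]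
        tauto)
      (by
        intro i y j z
        simp only [mem_slab]
        exact fun h h' h'' => ⟨h'.1, h.2.trans h''⟩)
    exact ExtEulerIf.middle hS ⟨ha'.1.mono (by omega), ha'.2⟩ hT
  obtain ⟨f, g, w, hS, -⟩ := ConvexSet.shortExact (Q := Q) B (slab x) (single x)
    (by
      intro i y
      have e1 := h3.trans (c := expo i y)
      have e2 := h4.trans (c := expo i y)
      simp only [mem_slab, h5, B, region, or]
      tauto)
    (by
      intro i y
      simp only [h5, B, region, or]
      tauto)
    (by
      intro i y j z
      simp only [B, region]
      exact fun h h' h'' => ⟨h'.1, hor a a' h'' h.2.1, fun h => h⟩)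
  have := ExtEulerIf.third hS hB hx (n := n + 3) (by omega) (by omega)
  convert this using 1
  ring

/-- The points which enter the Koszul resolution of the simple module at a point. -/
def kz : Q.Cover → Fin 6 → Q.Cover
  | ⟨.v0, w⟩ => ![⟨.v0, w⟩, ⟨.v1, w + tw 1⟩, ⟨.v1, w + tw 2⟩, ⟨.v1, w + tw 1 + tw 2⟩,
      ⟨.v1, w + tw 1 + tw 2 + tw 0⟩, ⟨.v0, w - tw 3⟩]
  | ⟨.v1, w⟩ => ![⟨.v1, w⟩, ⟨.v0, w⟩, ⟨.v0, w + tw 0⟩, ⟨.v0, w + tw 0 + tw 1⟩,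
      ⟨.v0, w + tw 0 + tw 2⟩, ⟨.v1, w - tw 3⟩]

/-- The alternating sum over the Koszul resolution. -/
def kzSum (ε : Q.Cover → ℤ) (x : Q.Cover) : ℤ :=
  ε (kz x 0) - ε (kz x 1) - ε (kz x 2) + ε (kz x 3) + ε (kz x 4) - ε (kz x 5)

theorem kz_spec (x : Q.Cover) :
    (∀ i (y : Weight × ℕ), ex (kz x 3) 0 ≤ expo i y ∧ ex (kz x 4) 0 ≤ expo i y ↔
      ex (kz x 5) 0 ≤ expo i y) ∧
    (∀ i (y : Weight × ℕ), ex (kz x 1) 0 ≤ expo i y ∧ ex (kz x 2) 0 ≤ expo i y ↔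
      ex (kz x 3) 0 ≤ expo i y ∨ ex (kz x 4) 0 ≤ expo i y) ∧
    ex x 0 ≤ ex (kz x 1) 0 ∧ ex x 0 ≤ ex (kz x 2) 0 ∧
    (∀ i (y : Weight × ℕ), (single x).mem i y ↔ y.2 = 0 ∧ ex x 0 ≤ expo i y ∧
      ¬ (ex (kz x 1) 0 ≤ expo i y ∨ ex (kz x 2) 0 ≤ expo i y)) := by
  obtain ⟨i, w⟩ := x
  cases i
  all_goals
    refine ⟨?_, ?_, ?_, ?_, ?_⟩
    · intro i y
      have hi := lev_cases i
      simp only [kz, ex, expo_le_iff, tw_apply, lev_v0, lev_v1, Pi.add_apply, Pi.sub_apply,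
        Matrix.cons_val_zero, Matrix.cons_val_one, Matrix.cons_val, Fin.isValue, Nat.cast_zero]
      constructor
      · omega
      · omega
    · intro i y
      have hi := lev_cases i
      simp only [kz, ex, expo_le_iff, tw_apply, lev_v0, lev_v1, Pi.add_apply, Pi.sub_apply,
        Matrix.cons_val_zero, Matrix.cons_val_one, Matrix.cons_val, Fin.isValue, Nat.cast_zero]
      constructor
      · omega
      · omega
    · simp only [kz, ex, expo_le_iff, tw_apply, lev_v0, lev_v1, Pi.add_apply, Pi.sub_apply,
        Matrix.cons_val_zero, Matrix.cons_val_one, Matrix.cons_val, Fin.isValue, Nat.cast_zero]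
      omega
    · simp only [kz, ex, expo_le_iff, tw_apply, lev_v0, lev_v1, Pi.add_apply, Pi.sub_apply,
        Matrix.cons_val_zero, Matrix.cons_val_one, Matrix.cons_val, Fin.isValue, Nat.cast_zero]
      omega
    · intro i y
      simp only [single, kz, ex, expo_le_iff, tw_apply, lev_v0, lev_v1, Pi.add_apply, Pi.sub_apply,
        Matrix.cons_val_zero, Matrix.cons_val_one, Matrix.cons_val, Fin.isValue, Nat.cast_zero]
      constructor
      · rintro ⟨rfl, rfl⟩
        simp [lev_v0, lev_v1]
      · rintro ⟨hy, hle, hn⟩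
        cases i <;> simp only [lev_v0, lev_v1] at hle hn
        all_goals first
          | (exfalso; omega)
          | (have hw : y.1 = w := by
               funext l
               fin_cases l <;> simp only [Fin.zero_eta, Fin.mk_one, Fin.reduceFinMk] <;> omega
             exact ⟨rfl, Prod.ext hw hy⟩)

theorem kz_zero (x : Q.Cover) : kz x 0 = x := by
  obtain ⟨i, w⟩ := x
  cases i <;> rfl

theorem single_ext {A : Prop} {n : ℕ} {N : Q.GrMod} {ε : Q.Cover → ℤ} (x : Q.Cover)
    (h : ∀ m, ExtEulerIf A n ((slab (kz x m)).ind Q) N (ε (kz x m))) :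
    ExtEulerIf A (n + 3) ((single x).ind Q) N (kzSum ε x) := by
  obtain ⟨h1, h2, h3, h4, h5⟩ := kz_spec x
  have h0 := h 0
  rw [kz_zero] at h0
  rw [kzSum, kz_zero]
  exact koszul h0 (h 1) (h 2) (h 3) (h 4) (h 5) h1 h2 h3 h4 h5

theorem closed_slab (h : ¬ hasLoop Q) (x : Q.Cover) : (slab x).Closed Q := by
  intro i j e y hy
  rw [mem_slab] at hy ⊢
  refine ⟨?_, hy.2.trans (Toric.le_arrow e y)⟩
  rw [adeg, Prod.snd_add, hy.1, cdeg_eq_zero h, zero_add]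

theorem closed_cone (x : Q.Cover) (p : ℕ) : (cone x p).Closed Q :=
  fun e y hy => le_trans (b := expo _ y) hy (Toric.le_arrow e y)

theorem slab_iso_of_not_hasLoop (h : ¬ hasLoop Q) (x : Q.Cover) :
    ∃ φ : proj₀ x ≅ (slab x).ind Q, φ.hom.app (pt x) (proj₀Gen x) =
      (slab x).basisVec x 0 ((mem_slab _ _ _).2 ⟨rfl, le_rfl⟩) :=
  ConvexSet.nonempty_iso (closed_slab h x) x 0 _ fun y q hq => by
    rw [mem_slab] at hq
    exact ⟨by rw [ex]; exact hq.2, Or.inr hq.1.symm⟩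

theorem cone_iso (h : hasLoop Q) (x : Q.Cover) (p : ℕ) :
    ∃ φ : proj₀ x ≅ (cone x p).ind Q, φ.hom.app (pt x) (proj₀Gen x) =
      (cone x p).basisVec x p le_rfl :=
  ConvexSet.nonempty_iso (closed_cone x p) x p _ fun y q hq => ⟨hq, Or.inl h⟩

theorem proj₀_ext (x : Q.Cover) (N : Q.GrMod) [Module.Finite ℂ (N.obj (pt x))] :
    ExtEulerIf (Subsingleton (N.obj (pt x))) 0 (proj₀ x) N (Module.finrank ℂ (N.obj (pt x))) := by
  have : Module.Finite ℂ (proj₀ x ⟶ N) := Module.Finite.equiv (proj₀HomEquiv x N).symm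
  refine ⟨?_, fun h => ?_⟩
  · have := ExtEuler.of_projective (proj₀ x) N
    rwa [(proj₀HomEquiv x N).finrank_eq] at this
  · rintro (_ | k)
    · have : Subsingleton (proj₀ x ⟶ N) := (proj₀HomEquiv x N).injective.subsingleton
      exact (Abelian.Ext.linearEquiv₀ (R := ℂ)).injective.subsingleton
    · exact Abelian.Ext.subsingleton_of_projective _ N k

theorem slab_ext_of_not_hasLoop (h : ¬ hasLoop Q) (x : Q.Cover) (N : Q.GrMod)
    [Module.Finite ℂ (N.obj (pt x))] :
    ExtEulerIf (Subsingleton (N.obj (pt x))) 0 ((slab x).ind Q) N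
      (Module.finrank ℂ (N.obj (pt x))) := by
  obtain ⟨φ, -⟩ := slab_iso_of_not_hasLoop h x
  exact (proj₀_ext x N).of_iso φ

theorem slab_ext_of_hasLoop (h : hasLoop Q) (x y : Q.Cover) (hy : y = ⟨x.vtx, x.wt + tw 3⟩)
    (N : Q.GrMod) [Module.Finite ℂ (N.obj (pt x))] [Module.Finite ℂ (N.obj (pt y))] :
    ExtEulerIf (Subsingleton (N.obj (pt x)) ∧ Subsingleton (N.obj (pt y))) 1 ((slab x).ind Q) N
      (Module.finrank ℂ (N.obj (pt x)) - Module.finrank ℂ (N.obj (pt y))) := by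
  have hxy : ∀ i (z : Weight × ℕ), ex y 1 ≤ expo i z ↔ ex x 0 ≤ expo i z ∧ z.2 ≠ 0 := by
    intro i z
    subst hy
    simp only [ex, expo_le_iff, tw_apply, Pi.add_apply, Nat.cast_one, Nat.cast_zero]
    constructor
    · omega
    · omega
  obtain ⟨f, g, w, hS, -⟩ := ConvexSet.shortExact (Q := Q) (cone y 1) (cone x 0) (slab x)
    (by
      intro i z
      simp only [cone, mem_slab, hxy]
      tauto)
    (by
      intro i z
      simp only [cone, mem_slab, hxy]
      tauto)
    (by
      intro i z j z' h1 _ h3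
      exact le_trans (b := expo i z) h1 h3)
  obtain ⟨φ, -⟩ := cone_iso h x 0
  obtain ⟨ψ, -⟩ := cone_iso h y 1
  exact ExtEulerIf.third hS (((proj₀_ext y N).of_iso ψ).weaken fun h => h.2)
    (((proj₀_ext x N).of_iso φ).weaken fun h => h.1) le_rfl (by omega)

end Koszul

end WQuiver

end LocalConifold

namespace LocalConifold

namespace WQuiver

section Devissage

variable {Q : WQuiver} [ConifoldQuiver Q]

open ConifoldQuiver

/-- A nonzero module of finite support has a nonzero vector killed by all arrows. -/
theorem exists_killed {M : Q.GrMod} (F : Finset Q.Cover)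
    (hF : ∀ x : Q.Cover, x ∉ F → Subsingleton (M.obj (pt x))) (hM : ∃ x, Nontrivial (M.obj (pt x))) :
    ∃ (x : Q.Cover) (v : M.obj (pt x)), v ≠ 0 ∧ ∀ (y : Q.Cover) (e : x ⟶ y),
      M.map (arr e) v = 0 := by
  classical
  have hmem : ∀ (x : Q.Cover) (v : M.obj (pt x)), v ≠ 0 → x ∈ F := by
    intro x v hv
    by_contra h
    have := hF x h
    exact hv (Subsingleton.elim _ _)
  let K (x : Q.Cover) (v : M.obj (pt x)) : Prop :=
    ∀ hl w' h, M.map (arr (cL (Q := Q) hl x.vtx x.wt w' h)) v = 0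
  have h1 : ∃ x ∈ F, ∃ v : M.obj (pt x), v ≠ 0 ∧ K x v := by
    obtain ⟨x, hx⟩ := hM
    obtain ⟨v, hv⟩ := exists_ne (0 : M.obj (pt x))
    obtain ⟨x, hx, hmin⟩ := Finset.exists_min_image
      (F.filter fun x => ∃ v : M.obj (pt x), v ≠ 0) (fun x => x.wt 1)
      ⟨x, Finset.mem_filter.2 ⟨hmem x v hv, v, hv⟩⟩
    obtain ⟨hxF, v, hv⟩ := Finset.mem_filter.1 hx
    refine ⟨x, hxF, v, hv, fun hl w' h => ?_⟩
    by_contra h0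
    have h2 := hmin _ (Finset.mem_filter.2 ⟨hmem _ _ h0, _, h0⟩)
    subst h
    simp only [Pi.add_apply, tw_apply] at h2
    omega
  obtain ⟨x, hx, hmax⟩ := Finset.exists_max_image
    (F.filter fun x => ∃ v : M.obj (pt x), v ≠ 0 ∧ K x v) (fun x => ht x 0)
    (by
      obtain ⟨x, hx, h⟩ := h1
      exact ⟨x, Finset.mem_filter.2 ⟨hx, h⟩⟩)
  obtain ⟨hxF, v, hv, hK⟩ := Finset.mem_filter.1 hx
  refine ⟨x, v, hv, fun y e => ?_⟩
  revert v
  refine cover_cases (P := fun x y e => (∀ y ∈ F.filter (fun x => ∃ v : M.obj (pt x), v ≠ 0 ∧ K x v),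
    ht y 0 ≤ ht x 0) → ∀ v : M.obj (pt x), v ≠ 0 → K x v → M.map (arr e) v = 0) ?_ ?_ ?_ e hmax
  · intro i w w' h hmax v _ hK
    by_contra h0
    have h2 := hmax _ (Finset.mem_filter.2 ⟨hmem _ _ h0, _, h0, fun hl u hu => ?_⟩)
    · have := ht_arrow (cA (Q := Q) i w w' h) 0
      simp only [cA, cdeg_A, add_zero] at this
      omega
    · have hu' : u = (w + tw 3) + ![tw 1, tw 2] i := by subst hu; subst h; exact add_right_comm _ _ _
      have h3 : arr (cA (Q := Q) i w w' h) ≫ arr (cL hl .v1 w' u hu) =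
          arr (cL hl .v0 w (w + tw 3) rfl) ≫ arr (cA i (w + tw 3) u hu') :=
        pmor_eq_of_rel (P := (Quiver.Path.nil.cons (cA i w w' h)).cons (cL hl .v1 w' u hu))
          (P' := (Quiver.Path.nil.cons (cL hl .v0 w (w + tw 3) rfl)).cons
            (cA i (w + tw 3) u hu')) (rel_loopA hl i)
      rw [← ModuleCat.comp_apply, ← Functor.map_comp, h3, Functor.map_comp, ModuleCat.comp_apply,
        hK hl, map_zero]
  · intro i w w' h hmax v _ hK
    by_contra h0
    have h2 := hmax _ (Finset.mem_filter.2 ⟨hmem _ _ h0, _, h0, fun hl u hu => ?_⟩)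
    · have := ht_arrow (cB (Q := Q) i w w' h) 0
      simp only [cB, cdeg_B, add_zero] at this
      omega
    · have hu' : u = (w + tw 3) + ![0, tw 0] i := by subst hu; subst h; exact add_right_comm _ _ _
      have h3 : arr (cB (Q := Q) i w w' h) ≫ arr (cL hl .v0 w' u hu) =
          arr (cL hl .v1 w (w + tw 3) rfl) ≫ arr (cB i (w + tw 3) u hu') :=
        pmor_eq_of_rel (P := (Quiver.Path.nil.cons (cB i w w' h)).cons (cL hl .v0 w' u hu))
          (P' := (Quiver.Path.nil.cons (cL hl .v1 w (w + tw 3) rfl)).cons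
            (cB i (w + tw 3) u hu')) (rel_loopB hl i)
      rw [← ModuleCat.comp_apply, ← Functor.map_comp, h3, Functor.map_comp, ModuleCat.comp_apply,
        hK hl, map_zero]
  · exact fun hl i w w' h _ v _ hK => hK hl w' h

theorem ne_of_arrow {x y : Q.Cover} (e : x ⟶ y) : y ≠ x := by
  rintro rfl
  have := ht_arrow e 0
  simp only [ht] at this
  have h2 := ex_le_arrow e 0
  rw [ex, ex, expo_le_iff] at h2
  push_cast at *
  omega

/-- The homomorphism from a simple module given by a vector killed by all arrows. -/
theorem exists_single_hom {M : Q.GrMod} (x : Q.Cover) (v : M.obj (pt x))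
    (hv : ∀ (y : Q.Cover) (e : x ⟶ y), M.map (arr e) v = 0) :
    ∃ f : (single x).ind Q ⟶ M, ∀ u, f.app (pt x) u = (single x).val x u (x.wt, 0) • v := by
  classical
  have hz : ∀ (y : Q.Cover) (u : ((single x).ind Q).obj (pt y)), y ≠ x → u = 0 := by
    intro y u hy
    apply (single x).val_injective
    rw [map_zero]
    ext z
    by_contra h
    have h1 := (single x).mem_space.1 ((single x).val_mem u) z h
    obtain ⟨i, w⟩ := y
    obtain ⟨j, w'⟩ := x
    obtain ⟨h2, h3, h4⟩ := h1
    subst h4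
    exact hy (by rw [show i = j from h3, show w = w' from h2.symm])
  let φ (y : Q.Cover) : ((single x).ind Q).obj (pt y) →ₗ[ℂ] M.obj (pt y) :=
    if h : y = x then
      h ▸ (LinearMap.toSpanSingleton ℂ _ v).comp ((Finsupp.lapply (x.wt, 0)).comp ((single x).val x))
    else 0
  have hφ : ∀ u, φ x u = (single x).val x u (x.wt, 0) • v := by
    intro u
    simp [φ]
  refine ⟨mkHom φ ?_, hφ⟩
  intro y z e u
  by_cases h : y = x
  · subst h
    rw [hφ, map_smul, hv, smul_zero, hz z (((single y).ind Q).map (arr e) u) (ne_of_arrow e), map_zero]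
  · rw [hz y u h]
    simp only [map_zero]

theorem finrank_middle {S : ShortComplex Q.GrMod} (hS : S.ShortExact) (x : Q.Cover)
    [Module.Finite ℂ (S.X₂.obj (pt x))] : Module.finrank ℂ (S.X₂.obj (pt x)) =
      Module.finrank ℂ (S.X₁.obj (pt x)) + Module.finrank ℂ (S.X₃.obj (pt x)) := by
  have := hS.mono_f
  have := hS.epi_g
  have h1 := LinearMap.finrank_range_add_finrank_ker (S.g.app (pt x)).hom
  have h2 : LinearMap.ker (S.g.app (pt x)).hom = LinearMap.range (S.f.app (pt x)).hom := by
    apply le_antisymm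
    · intro v hv
      exact exact_pointwise hS x v hv
    · rintro _ ⟨u, rfl⟩
      change ((S.f ≫ S.g).app (pt x)).hom u = 0
      rw [S.zero]
      rfl
  rw [h2, LinearMap.finrank_range_of_inj (injective_of_mono S.f x), LinearMap.range_eq_top.2
    (surjective_of_epi S.g x), finrank_top] at h1
  omega

/-- The Euler form is additive over the composition factors. -/
theorem devissage {A : Prop} {n : ℕ} {N : Q.GrMod} {E : Q.Cover → ℤ} (F : Finset Q.Cover)
    (hE : ∀ x ∈ F, ExtEulerIf A n ((single x).ind Q) N (E x)) :
    ∀ (d : ℕ) (M : Q.GrMod), (∀ x : Q.Cover, x ∉ F → Subsingleton (M.obj (pt x))) →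
      (∀ x : Q.Cover, Module.Finite ℂ (M.obj (pt x))) →
      ∑ x ∈ F, Module.finrank ℂ (M.obj (pt x)) = d →
      ExtEulerIf A n M N (∑ x ∈ F, Module.finrank ℂ (M.obj (pt x)) * E x) := by
  classical
  intro d
  induction d with
  | zero =>
    intro M hF hfin hd
    have hz : ∀ x : Q.Cover, Subsingleton (M.obj (pt x)) := by
      intro x
      by_cases hx : x ∈ F
      · exact Module.finrank_zero_iff.1 (Finset.sum_eq_zero_iff.1 hd x hx)
      · exact hF x hx
    have h0 : 𝟙 M = 0 := by
      ext x v
      exact Subsingleton.elim (h := hz x.as) _ _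
    have hac : ExtAcyclic M N := by
      intro k
      refine subsingleton_of_forall_eq 0 fun x => ?_
      rw [← Abelian.Ext.mk₀_id_comp x, h0, Abelian.Ext.mk₀_zero, Abelian.Ext.zero_comp]
    have h1 : ∑ x ∈ F, (Module.finrank ℂ (M.obj (pt x)) : ℤ) * E x = 0 :=
      Finset.sum_eq_zero fun x hx => by
        rw [Finset.sum_eq_zero_iff.1 hd x hx, Nat.cast_zero, zero_mul]
    rw [h1]
    exact ⟨hac.extEuler.mono (Nat.zero_le _), fun _ => hac⟩
  | succ d ih =>
    intro M hF hfin hd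
    obtain ⟨x, v, hv, hk⟩ := exists_killed F hF (by
      by_contra! h
      have : ∑ x ∈ F, Module.finrank ℂ (M.obj (pt x)) = 0 :=
        Finset.sum_eq_zero fun x _ => Module.finrank_zero_iff.2
          (h x)
      omega)
    obtain ⟨f, hf⟩ := exists_single_hom x v hk
    have hxF : x ∈ F := by
      by_contra h
      have := hF x h
      exact hv (Subsingleton.elim _ _)
    have hval : ∀ (y : Q.Cover) (u : ((single x).ind Q).obj (pt y)), (y = x → (single x).val y u (x.wt, 0) = 0) →
        u = 0 := by
      intro y u h
      apply (single x).val_injective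
      rw [map_zero]
      ext z
      by_contra h0
      have h1 := (single x).mem_space.1 ((single x).val_mem u) z h0
      obtain ⟨i, w⟩ := y
      obtain ⟨h2, h3, h4⟩ := h1
      subst h4
      exact h0 (h (by cases x; simp_all))
    have hm : Mono f := by
      apply mono_of_injective
      intro y
      rw [← LinearMap.ker_eq_bot (f := (f.app (pt y)).hom), LinearMap.ker_eq_bot']
      intro u hu
      refine hval y u ?_
      rintro rfl
      have h2 : (single y).val y u (y.wt, 0) • v = 0 := (hf u).symm.trans hu
      exact (smul_eq_zero.1 h2).resolve_right hv
    let S := ShortComplex.mk f (Limits.cokernel.π f) (Limits.cokernel.condition f)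
    have hS : S.ShortExact := ShortComplex.ShortExact.mk'
      (ShortComplex.exact_of_g_is_cokernel _ (Limits.cokernelIsCokernel f)) hm inferInstance
    have hdim := fun y => finrank_middle hS y
    have hsurj := fun y => surjective_of_epi (Limits.cokernel.π f) y
    have h1 : ∀ y, Module.finrank ℂ (((single x).ind Q).obj (pt y)) = if y = x then 1 else 0 := by
      intro y
      split_ifs with hy
      · subst hy
        have hb : (single y).mem y.vtx (y.wt, 0) := ⟨rfl, rfl⟩
        refine finrank_eq_one_iff_of_nonzero' ((single y).basisVec y 0 hb) ?_ |>.2 ?_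
        · intro h
          have h0 := congrArg (fun u => (single y).val y u (y.wt, 0)) h
          simp only [map_zero, ConvexSet.val_basisVec, Finsupp.single_eq_same, Finsupp.zero_apply]
            at h0
          exact one_ne_zero h0
        · intro u
          refine ⟨(single y).val y u (y.wt, 0), ?_⟩
          rw [← sub_eq_zero]
          refine hval y _ fun _ => ?_
          rw [map_sub, map_smul, ConvexSet.val_basisVec]
          simp
      · have : Subsingleton (((single x).ind Q).obj (pt y)) :=
          subsingleton_of_forall_eq 0 fun u => hval y u fun h => absurd h hy
        exact Module.finrank_zero_of_subsingleton
    have key := ih (Limits.cokernel f) (fun y hy => by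
        have := hF y hy
        exact (hsurj y).subsingleton) (fun y => Module.Finite.of_surjective
        ((Limits.cokernel.π f).app (pt y)).hom (hsurj y)) (by
        have : ∑ y ∈ F, Module.finrank ℂ (M.obj (pt y)) = ∑ y ∈ F, ((if y = x then 1 else 0) +
            Module.finrank ℂ ((Limits.cokernel f).obj (pt y))) :=
          Finset.sum_congr rfl fun y _ => by rw [← h1 y]; exact hdim y
        rw [Finset.sum_add_distrib, Finset.sum_ite_eq' F x, if_pos hxF] at this
        omega)
    have h2 := ExtEulerIf.middle hS (N := N) (hE x hxF) key
    have h3 : ∑ y ∈ F, (Module.finrank ℂ (M.obj (pt y)) : ℤ) * E y = E x +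
        ∑ y ∈ F, (Module.finrank ℂ ((Limits.cokernel f).obj (pt y)) : ℤ) * E y := by
      have : E x = ∑ y ∈ F, (if y = x then 1 else 0) * E y := by simp [hxF]
      rw [this, ← Finset.sum_add_distrib]
      refine Finset.sum_congr rfl fun y _ => ?_
      have h4 : Module.finrank ℂ (M.obj (pt y)) = _ := hdim y
      rw [h4, ← add_mul]
      congr 1
      push_cast
      congr 1
      exact_mod_cast h1 y
    rw [h3]
    exact h2

end Devissage

end WQuiver

end LocalConifold

namespace LocalConifold

namespace WQuiver

section Pairing

variable {Q : WQuiver}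

theorem shift_obj (u : Weight) (N : Q.GrMod) (x : Q.Cover) :
    (Q.shift u N).obj (pt x) = N.obj (pt ⟨x.vtx, x.wt + u⟩) := rfl

theorem pairing_of_ext {n : ℕ} {M N : Q.GrMod} {A : Weight → Prop} {e : Weight → ℤ}
    (h : ∀ u, ExtEulerIf (A u) n M (Q.shift u N) (e u)) (hA : {u | ¬ A u}.Finite) :
    PairingDefined n M N ∧ ∀ u, pairing n M N u = e u := by
  have h0 : ∀ k u, A u → extDim M N k u = 0 := by
    intro k u hu
    have := (h u).2 hu k
    exact Module.finrank_zero_of_subsingleton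
  refine ⟨⟨fun k u => (h u).1.1 k, fun k => hA.subset fun u hu hA' => hu (h0 k u hA'),
    fun k hk u => ?_⟩, fun u => ?_⟩
  · have := (h u).1.2.1 k hk
    exact Module.finrank_zero_of_subsingleton
  · have hf : (Function.support fun u : Weight =>
        ∑ k ∈ Finset.range (n + 1), (-1) ^ k * (extDim M N k u : ℤ)).Finite := by
      refine hA.subset fun u hu hA' => hu ?_
      exact Finset.sum_eq_zero fun k _ => by rw [h0 k u hA', Nat.cast_zero, mul_zero]
    rw [pairing]
    simp only [dif_pos hf]
    exact (h u).1.2.2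

/-- Modules of finite total dimension. -/
def FiniteSupport (M : Q.GrMod) : Prop :=
  (∀ x : Q.Cover, Module.Finite ℂ (M.obj (pt x))) ∧
    ∀ i : Vtx, {w : Weight | ¬ Subsingleton (M.obj (pt ⟨i, w⟩))}.Finite

open Classical in
/-- The graded dimension of a module at a vertex. -/
noncomputable def gdim (M : Q.GrMod) (i : Vtx) : KT :=
  if h : (Function.support fun w : Weight => (Module.finrank ℂ (M.obj (pt ⟨i, w⟩)) : ℤ)).Finite then
    Finsupp.ofSupportFinite _ h else 0

theorem FiniteSupport.gdim_apply {M : Q.GrMod} (h : FiniteSupport M) (i : Vtx) (w : Weight) :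
    gdim M i w = Module.finrank ℂ (M.obj (pt ⟨i, w⟩)) := by
  have hf : (Function.support fun w : Weight =>
      (Module.finrank ℂ (M.obj (pt ⟨i, w⟩)) : ℤ)).Finite := by
    refine (h.2 i).subset fun w hw hs => hw ?_
    have := Module.finrank_zero_of_subsingleton (R := ℂ) (M := M.obj (pt ⟨i, w⟩))
    simp [this]
  rw [gdim, dif_pos hf]
  rfl

/-- The correlation `∑_w f(w) g(w + s)`. -/
noncomputable def corr (f g : KT) (s : Weight) : ℤ := f.sum fun w k => k * g (w + s)

theorem corr_eq_sum (f g : KT) (s : Weight) {W : Finset Weight} (h : f.support ⊆ W) :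
    corr f g s = ∑ w ∈ W, f w * g (w + s) :=
  Finsupp.sum_of_support_subset f h _ fun _ _ => zero_mul _

theorem corr_symm (f g : KT) (s : Weight) : corr f g s = corr g f (-s) := by
  classical
  rw [corr_eq_sum f g s (W := f.support ∪ g.support.image fun w => w + -s)
      Finset.subset_union_left,
    corr_eq_sum g f (-s) (W := g.support ∪ f.support.image fun w => w + s)
      Finset.subset_union_left]
  refine Finset.sum_bij (fun w _ => w + s) ?_ ?_ ?_ ?_
  · intro w hw
    simp only [Finset.mem_union, Finset.mem_image] at hw ⊢
    rcases hw with hw | ⟨w', hw', rfl⟩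
    · exact Or.inr ⟨w, hw, rfl⟩
    · left
      rwa [neg_add_cancel_right]
  · intro w _ w' _ h
    exact add_right_cancel h
  · intro w hw
    refine ⟨w + -s, ?_, neg_add_cancel_right w s⟩
    simp only [Finset.mem_union, Finset.mem_image] at hw ⊢
    rcases hw with hw | ⟨w', hw', rfl⟩
    · exact Or.inr ⟨w, hw, rfl⟩
    · left
      rwa [add_neg_cancel_right]
  · intro w _
    rw [add_neg_cancel_right, mul_comm]

/-- The Euler form of modules over the quiver of `Z`, in terms of graded dimensions. -/
noncomputable def eulerForm (f g : Vtx → KT) (u : Weight) : ℤ :=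
  corr (f .v0) (g .v0) u - corr (f .v0) (g .v1) (u + tw 1) - corr (f .v0) (g .v1) (u + tw 2) +
    corr (f .v0) (g .v1) (u + tw 1 + tw 2) + corr (f .v0) (g .v1) (u + tw 1 + tw 2 + tw 0) -
    corr (f .v0) (g .v0) (u - tw 3) +
  (corr (f .v1) (g .v1) u - corr (f .v1) (g .v0) u - corr (f .v1) (g .v0) (u + tw 0) +
    corr (f .v1) (g .v0) (u + tw 0 + tw 1) + corr (f .v1) (g .v0) (u + tw 0 + tw 2) -
    corr (f .v1) (g .v1) (u - tw 3))

theorem tw_sum : tw 0 + tw 1 + tw 2 + tw 3 = 0 := by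
  funext l
  fin_cases l <;> simp [tw]

theorem tw_three : tw 3 = -(tw 0 + tw 1 + tw 2) := (neg_eq_of_add_eq_zero_right tw_sum).symm

theorem eulerForm_symm (f g : Vtx → KT) (u : Weight) :
    eulerForm f g (u + tw 3) = - eulerForm g f (-u) := by
  simp only [eulerForm, tw_three]
  rw [corr_symm (f .v0) (g .v0), corr_symm (f .v0) (g .v1), corr_symm (f .v0) (g .v1),
    corr_symm (f .v0) (g .v1), corr_symm (f .v0) (g .v1), corr_symm (f .v0) (g .v0),
    corr_symm (f .v1) (g .v1), corr_symm (f .v1) (g .v0), corr_symm (f .v1) (g .v0),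
    corr_symm (f .v1) (g .v0), corr_symm (f .v1) (g .v0), corr_symm (f .v1) (g .v1)]
  generalize tw 0 = a
  generalize tw 1 = b
  generalize tw 2 = c
  have e1 : -(u + -(a + b + c)) = -u - -(a + b + c) := by abel
  have e2 : -(u + -(a + b + c) + b) = -u + a + c := by abel
  have e3 : -(u + -(a + b + c) + c) = -u + a + b := by abel
  have e4 : -(u + -(a + b + c) + b + c) = -u + a := by abel
  have e5 : -(u + -(a + b + c) + b + c + a) = -u := by abel
  have e6 : -(u + -(a + b + c) - -(a + b + c)) = -u := by abel
  have e7 : -(u + -(a + b + c) + a) = -u + b + c := by abel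
  have e8 : -(u + -(a + b + c) + a + b) = -u + c := by abel
  have e9 : -(u + -(a + b + c) + a + c) = -u + b := by abel
  have e10 : -(u + -(a + b + c)) = -u + b + c + a := by abel
  rw [e2, e3, e4, e5, e6, e7, e8, e9]
  have h1 : corr (g .v0) (f .v1) (-(u + -(a + b + c))) = corr (g .v0) (f .v1) (-u + b + c + a) := by
    rw [e10]
  rw [h1, e1]
  ring

variable [ConifoldQuiver Q]

open ConifoldQuiver

theorem FiniteSupport.devissage {A : Prop} {n : ℕ} {M N : Q.GrMod} {E : Q.Cover → ℤ}
    (hM : FiniteSupport M)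
    (hE : ∀ x : Q.Cover, ¬ Subsingleton (M.obj (pt x)) → ExtEulerIf A n ((single x).ind Q) N (E x)) :
    ExtEulerIf A n M N (((gdim M .v0).sum fun w k => k * E ⟨.v0, w⟩) +
      (gdim M .v1).sum fun w k => k * E ⟨.v1, w⟩) := by
  classical
  let W (i : Vtx) : Finset Weight := (hM.2 i).toFinset
  have hW : ∀ i w, w ∈ W i ↔ ¬ Subsingleton (M.obj (pt ⟨i, w⟩)) := fun i w => by simp [W]
  let m (i : Vtx) : Weight ↪ Q.Cover := ⟨fun w => ⟨i, w⟩, by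
    intro w w' h
    exact congrArg Cover.wt h⟩
  let F : Finset Q.Cover := (W .v0).map (m .v0) ∪ (W .v1).map (m .v1)
  have hF : ∀ x : Q.Cover, x ∈ F ↔ ¬ Subsingleton (M.obj (pt x)) := by
    rintro ⟨i, w⟩
    rw [← hW i w]
    have hm : ∀ j, (⟨i, w⟩ : Q.Cover) ∈ (W j).map (m j) ↔ i = j ∧ w ∈ W j := by
      intro j
      rw [Finset.mem_map]
      constructor
      · rintro ⟨w', hw', h⟩
        obtain ⟨rfl, rfl⟩ := Cover.mk.inj h
        exact ⟨rfl, hw'⟩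
      · rintro ⟨rfl, hw⟩
        exact ⟨w, hw, rfl⟩
    rw [Finset.mem_union, hm, hm]
    cases i <;> simp
  have key := WQuiver.devissage (N := N) (A := A) (n := n) (E := E) F
    (fun x hx => hE x ((hF x).1 hx)) _ M (fun x hx => not_not.1 fun h => hx ((hF x).2 h)) hM.1 rfl
  have hd : Disjoint ((W .v0).map (m .v0)) ((W .v1).map (m .v1)) := by
    rw [Finset.disjoint_left]
    intro x hx hx'
    simp only [Finset.mem_map, m, Function.Embedding.coeFn_mk] at hx hx'
    obtain ⟨w, _, rfl⟩ := hx
    obtain ⟨w', _, h⟩ := hx'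
    cases h
  have hsum : ∀ i, (gdim M i).sum (fun w k => k * E ⟨i, w⟩) =
      ∑ w ∈ W i, (Module.finrank ℂ (M.obj (pt ⟨i, w⟩)) : ℤ) * E ⟨i, w⟩ := by
    intro i
    rw [Finsupp.sum_of_support_subset _ (s := W i) ?_ _ fun _ _ => zero_mul _]
    · exact Finset.sum_congr rfl fun w _ => by rw [hM.gdim_apply]
    · intro w hw
      rw [Finsupp.mem_support_iff, hM.gdim_apply] at hw
      rw [hW]
      intro h
      exact hw (by rw [Module.finrank_zero_of_subsingleton, Nat.cast_zero])
  rw [Finset.sum_union hd, Finset.sum_map, Finset.sum_map] at key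
  rw [hsum, hsum]
  exact key

/-- The weights `u` for which the Koszul resolutions of the composition factors of `M` meet the
support of `N`, after translation by `u`. -/
theorem finite_of_support {M N : Q.GrMod} (hM : FiniteSupport M) (hN : FiniteSupport N)
    (s : Weight) :
    {u | ∃ x : Q.Cover, ¬ Subsingleton (M.obj (pt x)) ∧ ∃ m, ∃ y : Q.Cover, y = kz x m ∧
      ¬ Subsingleton (N.obj (pt ⟨y.vtx, y.wt + u + s⟩))}.Finite := by
  have h1 : {x : Q.Cover | ¬ Subsingleton (M.obj (pt x))}.Finite := by
    refine ((hM.2 .v0).image (fun w => (⟨.v0, w⟩ : Q.Cover)) |>.union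
      ((hM.2 .v1).image (fun w => (⟨.v1, w⟩ : Q.Cover)))).subset ?_
    rintro ⟨i, w⟩ h
    cases i
    · exact Or.inl ⟨w, h, rfl⟩
    · exact Or.inr ⟨w, h, rfl⟩
  have h2 : (⋃ i, {w : Weight | ¬ Subsingleton (N.obj (pt ⟨i, w⟩))}).Finite := by
    refine ((hN.2 .v0).union (hN.2 .v1)).subset ?_
    intro w hw
    obtain ⟨i, hi⟩ := Set.mem_iUnion.1 hw
    cases i
    · exact Or.inl hi
    · exact Or.inr hi
  have h3 : (Set.univ : Set (Fin 6)).Finite := Set.toFinite _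
  refine (((h1.prod h3).prod h2).image fun q => q.2 - s - (kz q.1.1 q.1.2).wt).subset ?_
  rintro u ⟨x, hx, m, y, rfl, hy⟩
  refine ⟨((x, m), (kz x m).wt + u + s), ⟨⟨hx, trivial⟩, Set.mem_iUnion.2 ⟨_, hy⟩⟩, ?_⟩
  simp

theorem kzSum_v0 (ε : Q.Cover → ℤ) (w : Weight) : kzSum ε ⟨.v0, w⟩ = ε ⟨.v0, w⟩ - ε ⟨.v1, w + tw 1⟩ -
    ε ⟨.v1, w + tw 2⟩ + ε ⟨.v1, w + tw 1 + tw 2⟩ + ε ⟨.v1, w + tw 1 + tw 2 + tw 0⟩ -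
    ε ⟨.v0, w - tw 3⟩ := rfl

theorem kzSum_v1 (ε : Q.Cover → ℤ) (w : Weight) : kzSum ε ⟨.v1, w⟩ = ε ⟨.v1, w⟩ - ε ⟨.v0, w⟩ -
    ε ⟨.v0, w + tw 0⟩ + ε ⟨.v0, w + tw 0 + tw 1⟩ + ε ⟨.v0, w + tw 0 + tw 2⟩ -
    ε ⟨.v1, w - tw 3⟩ := rfl

theorem sum_kzSum (f g : Vtx → KT) (u : Weight) :
    ((f .v0).sum fun w k => k * kzSum (fun y : Q.Cover => g y.vtx (y.wt + u)) ⟨.v0, w⟩) +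
      ((f .v1).sum fun w k => k * kzSum (fun y : Q.Cover => g y.vtx (y.wt + u)) ⟨.v1, w⟩) =
      eulerForm f g u := by
  simp only [kzSum_v0, kzSum_v1, eulerForm, corr, Finsupp.sum]
  simp only [← Finset.sum_sub_distrib, ← Finset.sum_add_distrib]
  congr 1
  · refine Finset.sum_congr rfl fun w _ => ?_
    have e1 : w + tw 1 + u = w + (u + tw 1) := by abel
    have e2 : w + tw 2 + u = w + (u + tw 2) := by abel
    have e3 : w + tw 1 + tw 2 + u = w + (u + tw 1 + tw 2) := by abel
    have e4 : w + tw 1 + tw 2 + tw 0 + u = w + (u + tw 1 + tw 2 + tw 0) := by abel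
    have e5 : w - tw 3 + u = w + (u - tw 3) := by abel
    rw [e1, e2, e3, e4, e5]
    ring
  · refine Finset.sum_congr rfl fun w _ => ?_
    have e2 : w + tw 0 + u = w + (u + tw 0) := by abel
    have e3 : w + tw 0 + tw 1 + u = w + (u + tw 0 + tw 1) := by abel
    have e4 : w + tw 0 + tw 2 + u = w + (u + tw 0 + tw 2) := by abel
    have e5 : w - tw 3 + u = w + (u - tw 3) := by abel
    rw [e2, e3, e4, e5]
    ring

theorem pairing_of_not_hasLoop (hl : ¬ hasLoop Q) {M N : Q.GrMod} (hM : FiniteSupport M)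
    (hN : FiniteSupport N) : PairingDefined 3 M N ∧
      ∀ u, pairing 3 M N u = eulerForm (gdim M) (gdim N) u := by
  refine pairing_of_ext (A := fun u => ∀ x : Q.Cover, ¬ Subsingleton (M.obj (pt x)) →
    ∀ m, ∀ y : Q.Cover, y = kz x m → Subsingleton (N.obj (pt ⟨y.vtx, y.wt + u + 0⟩)))
    (fun u => ?_) ((finite_of_support hM hN 0).subset ?_)
  · rw [← sum_kzSum (Q := Q)]
    refine hM.devissage (E := kzSum (fun y : Q.Cover => gdim N y.vtx (y.wt + u))) fun x hx => ?_
    refine single_ext (n := 0) (N := Q.shift u N) (ε := fun y => gdim N y.vtx (y.wt + u)) x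
      fun m => ?_
    have : Module.Finite ℂ ((Q.shift u N).obj (pt (kz x m))) := hN.1 _
    have h := slab_ext_of_not_hasLoop hl (kz x m) (Q.shift u N)
    rw [hN.gdim_apply]
    refine h.weaken fun hA => ?_
    have := hA x hx m _ rfl
    rwa [add_zero] at this
  · intro u hu
    simp only [Set.mem_setOf_eq] at hu ⊢
    push Not at hu
    obtain ⟨x, hx, m, y, hy, h⟩ := hu
    exact ⟨x, not_subsingleton_iff_nontrivial.2 hx, m, y, hy, not_subsingleton_iff_nontrivial.2 h⟩

theorem pairing_of_hasLoop (hl : hasLoop Q) {M N : Q.GrMod} (hM : FiniteSupport M)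
    (hN : FiniteSupport N) : PairingDefined 4 M N ∧
      ∀ u, pairing 4 M N u = eulerForm (gdim M) (gdim N) u + eulerForm (gdim N) (gdim M) (-u) := by
  refine pairing_of_ext (A := fun u => ∀ x : Q.Cover, ¬ Subsingleton (M.obj (pt x)) →
    ∀ m, ∀ y : Q.Cover, y = kz x m → Subsingleton (N.obj (pt ⟨y.vtx, y.wt + u + 0⟩)) ∧
      Subsingleton (N.obj (pt ⟨y.vtx, y.wt + u + tw 3⟩)))
    (fun u => ?_) (((finite_of_support hM hN 0).union (finite_of_support hM hN (tw 3))).subset ?_)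
  · have e0 : eulerForm (gdim M) (gdim N) u + eulerForm (gdim N) (gdim M) (-u) =
        ((gdim M .v0).sum fun w k => k * kzSum (fun y : Q.Cover => gdim N y.vtx (y.wt + u) -
          gdim N y.vtx (y.wt + (u + tw 3))) ⟨.v0, w⟩) +
        ((gdim M .v1).sum fun w k => k * kzSum (fun y : Q.Cover => gdim N y.vtx (y.wt + u) -
          gdim N y.vtx (y.wt + (u + tw 3))) ⟨.v1, w⟩) := by
      have h1 : ∀ x : Q.Cover, kzSum (fun y : Q.Cover => gdim N y.vtx (y.wt + u) -
          gdim N y.vtx (y.wt + (u + tw 3))) x = kzSum (fun y => gdim N y.vtx (y.wt + u)) x -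
          kzSum (fun y => gdim N y.vtx (y.wt + (u + tw 3))) x := by
        intro x
        simp only [kzSum]
        ring
      rw [← neg_neg (eulerForm (gdim N) (gdim M) (-u)), ← eulerForm_symm, ← sub_eq_add_neg,
        ← sum_kzSum (Q := Q), ← sum_kzSum (Q := Q)]
      simp only [h1, mul_sub, Finsupp.sum_sub]
      ring
    rw [e0]
    refine hM.devissage (E := kzSum (fun y : Q.Cover => gdim N y.vtx (y.wt + u) -
          gdim N y.vtx (y.wt + (u + tw 3)))) fun x hx => ?_
    refine single_ext (n := 1) (N := Q.shift u N) (ε := fun y => gdim N y.vtx (y.wt + u) -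
          gdim N y.vtx (y.wt + (u + tw 3))) x fun m => ?_
    have : Module.Finite ℂ ((Q.shift u N).obj (pt (kz x m))) := hN.1 _
    have : Module.Finite ℂ ((Q.shift u N).obj (pt ⟨(kz x m).vtx, (kz x m).wt + tw 3⟩)) := hN.1 _
    have h := slab_ext_of_hasLoop hl (kz x m) _ rfl (Q.shift u N)
    have e2 : (kz x m).wt + tw 3 + u = (kz x m).wt + (u + tw 3) := by abel
    have e3 : gdim N (kz x m).vtx ((kz x m).wt + (u + tw 3)) = Module.finrank ℂ
        ((Q.shift u N).obj (pt ⟨(kz x m).vtx, (kz x m).wt + tw 3⟩)) := by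
      rw [← e2, hN.gdim_apply]
      rfl
    rw [hN.gdim_apply, e3]
    refine h.weaken fun hA => ?_
    have := hA x hx m _ rfl
    rw [add_zero, add_assoc, ← e2] at this
    exact this
  · intro u hu
    simp only [Set.mem_setOf_eq] at hu
    push Not at hu
    obtain ⟨x, hx, m, y, hy, h⟩ := hu
    by_cases h0 : Subsingleton (N.obj (pt ⟨y.vtx, y.wt + u + 0⟩))
    · exact Or.inr ⟨x, not_subsingleton_iff_nontrivial.2 hx, m, y, hy,
        not_subsingleton_iff_nontrivial.2 (h h0)⟩
    · exact Or.inl ⟨x, not_subsingleton_iff_nontrivial.2 hx, m, y, hy, h0⟩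

theorem pairing_proj₀ (n : ℕ) {N : Q.GrMod} (hN : FiniteSupport N) :
    PairingDefined n (proj₀ (⟨.v0, 0⟩ : Q.Cover)) N ∧
      ∀ u, pairing n (proj₀ (⟨.v0, 0⟩ : Q.Cover)) N u = gdim N .v0 u := by
  refine pairing_of_ext (A := fun u => Subsingleton (N.obj (pt ⟨.v0, u⟩))) (fun u => ?_) (hN.2 .v0)
  have : Module.Finite ℂ ((Q.shift u N).obj (pt ⟨.v0, 0⟩)) := hN.1 _
  have h := proj₀_ext (⟨.v0, 0⟩ : Q.Cover) (Q.shift u N)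
  have e : ((Q.shift u N).obj (pt (⟨.v0, 0⟩ : Q.Cover))) = N.obj (pt ⟨.v0, u⟩) := by
    rw [shift_obj, zero_add]
  rw [e] at h
  rw [hN.gdim_apply]
  exact ⟨h.1.mono (Nat.zero_le n), h.2⟩

end Pairing

end WQuiver

end LocalConifold

namespace LocalConifold

namespace WQuiver

section StructureSheaf

variable {Q : WQuiver} [ConifoldQuiver Q]

open ConifoldQuiver

theorem subsingleton_hom (hl : ¬ hasLoop Q) (x y : Q.Cover) : Subsingleton (pt x ⟶ pt y) := by
  refine ⟨fun f g => ?_⟩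
  obtain ⟨P, rfl⟩ := pmor_surjective f
  obtain ⟨P', rfl⟩ := pmor_surjective g
  exact pmor_eq_of_cnt _ _ (by rw [cnt_eq_zero hl, cnt_eq_zero hl])

theorem nonempty_path_iff (hl : ¬ hasLoop Q) (x y : Q.Cover) :
    Nonempty (Quiver.Path x y) ↔ ex x 0 ≤ ex y 0 := by
  constructor
  · rintro ⟨P⟩
    have := ex_le_path P 0
    rwa [cnt_eq_zero hl] at this
  · intro h
    have hn : 0 ≤ ht y 0 - ht x 0 := by
      simp only [ex, expo_le_iff] at h
      have hi := lev_cases x.vtx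
      have hi' := lev_cases y.vtx
      simp only [ht]
      omega
    obtain ⟨P, -⟩ := exists_path (ht y 0 - ht x 0).toNat x y 0 0
      (by rw [Int.toNat_of_nonneg hn]; ring) h (Or.inr rfl)
    exact ⟨P⟩

theorem nonempty_hom_iff (hl : ¬ hasLoop Q) (x y : Q.Cover) :
    Nonempty (pt x ⟶ pt y) ↔ ex x 0 ≤ ex y 0 := by
  rw [← nonempty_path_iff hl]
  constructor
  · rintro ⟨f⟩
    obtain ⟨P, -⟩ := pmor_surjective f
    exact ⟨P⟩
  · rintro ⟨P⟩
    exact ⟨pmor P⟩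

/-- `Hom(slab s, N) = N_s`. -/
theorem slab_hom_bijective (hl : ¬ hasLoop Q) (s : Q.Cover) (N : Q.GrMod) :
    Function.Bijective fun φ : (slab s).ind Q ⟶ N =>
      φ.app (pt s) ((slab s).basisVec s 0 ((mem_slab _ _ _).2 ⟨rfl, le_rfl⟩)) := by
  obtain ⟨ψ, hψ⟩ := slab_iso_of_not_hasLoop hl s
  have h : (fun φ : (slab s).ind Q ⟶ N =>
      φ.app (pt s) ((slab s).basisVec s 0 ((mem_slab _ _ _).2 ⟨rfl, le_rfl⟩))) =
      proj₀HomEquiv s N ∘ fun φ => ψ.hom ≫ φ := by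
    funext φ
    rw [← hψ]
    rfl
  rw [h]
  refine (proj₀HomEquiv s N).bijective.comp ⟨fun φ φ' h => (cancel_epi ψ.hom).1 h, fun φ =>
    ⟨ψ.inv ≫ φ, by simp⟩⟩

theorem projective_slab (hl : ¬ hasLoop Q) (s : Q.Cover) : Projective ((slab s).ind Q) := by
  obtain ⟨ψ, -⟩ := slab_iso_of_not_hasLoop hl s
  exact Projective.of_iso ψ inferInstance

/-- The monomials above `s` but not above `s'`. -/
def slabDiff (s s' : Q.Cover) : ConvexSet :=
  region (ex s 0 ≤ ·) (ex s' 0 ≤ ·) (fun h h' => h'.trans h) (fun h h' => h'.trans h)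

theorem slabDiff_acyclic (hl : ¬ hasLoop Q) {s s' : Q.Cover} (P : Quiver.Path s s') (N : Q.GrMod)
    (h : Function.Bijective (N.map (pmor P))) : ExtAcyclic ((slabDiff s s').ind Q) N := by
  have hle : ex s 0 ≤ ex s' 0 := (nonempty_path_iff hl s s').1 ⟨P⟩
  obtain ⟨f, g, w, hS, hf⟩ := ConvexSet.shortExact (Q := Q) (slab s') (slab s) (slabDiff s s')
    (by
      intro i y
      have := hle.trans (c := expo i y)
      simp only [mem_slab, slabDiff, region]
      tauto)
    (by
      intro i y
      simp only [mem_slab, slabDiff, region]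
      tauto)
    (by
      intro i y j z
      simp only [mem_slab]
      exact fun h h' h'' => ⟨h'.1, h.2.trans h''⟩)
  have h1 := projective_slab hl s
  have h2 := projective_slab hl s'
  refine @ExtAcyclic.of_projective _ _ _ _ _ _ hS N h2 h1 ?_
  have hb := slab_hom_bijective hl s N
  have hb' := slab_hom_bijective hl s' N
  refine (Function.Bijective.of_comp_iff' hb' _).1 ?_
  have hcomp : ((fun φ : (slab s').ind Q ⟶ N =>
      φ.app (pt s') ((slab s').basisVec s' 0 ((mem_slab _ _ _).2 ⟨rfl, le_rfl⟩))) ∘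
      fun φ : (slab s).ind Q ⟶ N => f ≫ φ) = (N.map (pmor P)) ∘ (fun φ : (slab s).ind Q ⟶ N =>
      φ.app (pt s) ((slab s).basisVec s 0 ((mem_slab _ _ _).2 ⟨rfl, le_rfl⟩))) := by
    funext φ
    have e1 := ConvexSet.map_basisVec (closed_slab hl s) P (p := 0)
      ((mem_slab _ _ _).2 ⟨rfl, le_rfl⟩)
    simp only [cnt_eq_zero hl P, add_zero] at e1
    have e2 : f.app (pt s') ((slab s').basisVec s' 0 ((mem_slab _ _ _).2 ⟨rfl, le_rfl⟩)) =
        (slab s).basisVec s' 0 ((mem_slab _ _ _).2 ⟨rfl, hle⟩) := hf _ _ _ _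
    simp only [Function.comp_apply]
    rw [← NatTrans.naturality_apply, e1, NatTrans.comp_app, ModuleCat.comp_apply]
    exact congrArg _ e2
  exact hcomp ▸ h.comp hb

/-- If `N` does not change along the edges of a suitable decomposition of the Koszul complex, then
the simple module is acyclic. -/
theorem single_acyclic (hl : ¬ hasLoop Q) {N : Q.GrMod} {x a a' p p' o : Q.Cover}
    (hN : ∀ s s' (P : Quiver.Path s s'), (s, s') = (x, a) ∨ (s, s') = (a', p) ∨ (s, s') = (p', o) →
      Function.Bijective (N.map (pmor P)))
    (h1 : ∀ i (y : Weight × ℕ), ex p 0 ≤ expo i y ∧ ex p' 0 ≤ expo i y ↔ ex o 0 ≤ expo i y)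
    (h2 : ∀ i (y : Weight × ℕ), ex a 0 ≤ expo i y ∧ ex a' 0 ≤ expo i y ↔
      ex p 0 ≤ expo i y ∨ ex p' 0 ≤ expo i y)
    (h3 : ex x 0 ≤ ex a 0) (h4 : ex x 0 ≤ ex a' 0)
    (h5 : ∀ i (y : Weight × ℕ), (single x).mem i y ↔ y.2 = 0 ∧ ex x 0 ≤ expo i y ∧
      ¬ (ex a 0 ≤ expo i y ∨ ex a' 0 ≤ expo i y)) :
    ExtAcyclic ((single x).ind Q) N := by
  have ha'p : ex a' 0 ≤ ex p 0 := ((h2 p.vtx (p.wt, 0)).2 (Or.inl le_rfl)).2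
  have ha'p' : ex a' 0 ≤ ex p' 0 := ((h2 p'.vtx (p'.wt, 0)).2 (Or.inr le_rfl)).2
  have hp'o : ex p' 0 ≤ ex o 0 := ((h1 o.vtx (o.wt, 0)).2 le_rfl).2
  obtain ⟨P1⟩ := (nonempty_path_iff hl x a).2 h3
  obtain ⟨P2⟩ := (nonempty_path_iff hl a' p).2 ha'p
  obtain ⟨P3⟩ := (nonempty_path_iff hl p' o).2 hp'o
  have A1 := slabDiff_acyclic hl P1 N (hN _ _ P1 (Or.inl rfl))
  have A2 := slabDiff_acyclic hl P2 N (hN _ _ P2 (Or.inr (Or.inl rfl)))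
  have A3 := slabDiff_acyclic hl P3 N (hN _ _ P3 (Or.inr (Or.inr rfl)))
  have A4 : ExtAcyclic ((slabDiff a' a).ind Q) N := by
    obtain ⟨f, g, w, hS, -⟩ := ConvexSet.shortExact (Q := Q) (slabDiff p' o) (slabDiff a' p)
      (slabDiff a' a)
      (by
        intro i y
        have e1 := h1 i y
        have e2 := h2 i y
        have e3 := ha'p'.trans (c := expo i y)
        simp only [slabDiff, region]
        tauto)
      (by
        intro i y
        have e2 := h2 i y
        simp only [slabDiff, region]
        tauto)
      (by
        rintro i y j z ⟨b1, b2, b3⟩ ⟨b4, b5, b6⟩ h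
        refine ⟨b4, b2.trans h, fun h' => b6 ((h1 j z).2 h').1⟩)
    exact ExtAcyclic.third hS N A3 A2
  obtain ⟨f, g, w, hS, -⟩ := ConvexSet.shortExact (Q := Q) (slabDiff a' a) (slabDiff x a) (single x)
    (by
      intro i y
      have e4 := h4.trans (c := expo i y)
      simp only [slabDiff, region, h5]
      tauto)
    (by
      intro i y
      simp only [slabDiff, region, h5]
      tauto)
    (by
      rintro i y j z ⟨b1, b2, b3⟩ ⟨b4, b5, b6⟩ h
      exact ⟨b4, b2.trans h, b6⟩)
  exact ExtAcyclic.third hS N A4 A1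

theorem proj₀_map_bijective (hl : ¬ hasLoop Q) (z : Q.Cover) {x y : Q.Cover} (f : pt x ⟶ pt y)
    (h : ex z 0 ≤ ex x 0 ↔ ex z 0 ≤ ex y 0) : Function.Bijective ((proj₀ z).map f) := by
  have := subsingleton_hom hl z x
  have := subsingleton_hom hl z y
  rw [← nonempty_hom_iff hl, ← nonempty_hom_iff hl] at h
  have hb : Function.Bijective fun g : pt z ⟶ pt x => g ≫ f := by
    refine ⟨fun _ _ _ => Subsingleton.elim _ _, fun g => ?_⟩
    obtain ⟨g'⟩ := h.2 ⟨g⟩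
    exact ⟨g', Subsingleton.elim _ _⟩
  have : IsIso ((coyoneda.obj (Opposite.op (pt z))).map f) := (isIso_iff_bijective _).2 hb
  have : IsIso ((proj₀ z).map f) := by
    change IsIso ((ModuleCat.free ℂ).map ((coyoneda.obj (Opposite.op (pt z))).map f))
    infer_instance
  exact ConcreteCategory.bijective_of_isIso _

theorem finrank_proj₀ (hl : ¬ hasLoop Q) (z x : Q.Cover) :
    Module.Finite ℂ ((proj₀ z).obj (pt x)) ∧ (ex z 0 ≤ ex x 0 → Module.finrank ℂ
      ((proj₀ z).obj (pt x)) = 1) ∧ (¬ ex z 0 ≤ ex x 0 → Module.finrank ℂ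
      ((proj₀ z).obj (pt x)) = 0) := by
  have := subsingleton_hom hl z x
  rw [← nonempty_hom_iff hl]
  have : Finite (pt z ⟶ pt x) := Finite.of_subsingleton
  have := Fintype.ofFinite (pt z ⟶ pt x)
  refine ⟨inferInstanceAs (Module.Finite ℂ ((pt z ⟶ pt x) →₀ ℂ)), fun h => ?_, fun h => ?_⟩
  · have : Unique (pt z ⟶ pt x) := { default := h.some, uniq := fun _ => Subsingleton.elim _ _ }
    refine (Module.finrank_finsupp_self ℂ (ι := pt z ⟶ pt x)).trans ?_
    exact Fintype.card_unique
  · have := not_nonempty_iff.1 h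
    refine (Module.finrank_finsupp_self ℂ (ι := pt z ⟶ pt x)).trans ?_
    exact Fintype.card_eq_zero

end StructureSheaf

end WQuiver

end LocalConifold

namespace LocalConifold

namespace WQuiver

section StructureSheaf

variable {Q : WQuiver} [ConifoldQuiver Q]

open ConifoldQuiver

/-- The translate of a point by a weight lies above the origin. -/
def Pos (x : Q.Cover) (u : Weight) : Prop :=
  ex (⟨.v0, 0⟩ : Q.Cover) 0 ≤ ex (⟨x.vtx, x.wt + u⟩ : Q.Cover) 0

theorem pos_iff (i : Vtx) (w u : Weight) : Pos (⟨i, w⟩ : Q.Cover) u ↔ 0 ≤ w 1 + u 1 ∧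
    0 ≤ w 2 + u 2 ∧ 0 ≤ w 1 + u 1 + (w 2 + u 2) - (w 0 + u 0) - lev i ∧ 0 ≤ w 0 + u 0 := by
  simp [Pos, ex, expo_le_iff, lev_v0]

theorem single_acyclic_of_pos (hl : ¬ hasLoop Q) (x : Q.Cover) (u : Weight) {s s' t t' : Fin 6}
    (hs : s = 1 ∧ s' = 2 ∨ s = 2 ∧ s' = 1) (ht : t = 3 ∧ t' = 4 ∨ t = 4 ∧ t' = 3)
    (h1 : Pos (kz x 0) u ↔ Pos (kz x s) u) (h2 : Pos (kz x s') u ↔ Pos (kz x t) u)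
    (h3 : Pos (kz x t') u ↔ Pos (kz x 5) u) :
    ExtAcyclic ((single x).ind Q) (Q.shift u (proj₀ (⟨.v0, 0⟩ : Q.Cover))) := by
  obtain ⟨e1, e2, e3, e4, e5⟩ := kz_spec x
  rw [kz_zero] at h1
  refine single_acyclic hl (x := x) (a := kz x s) (a' := kz x s') (p := kz x t) (p' := kz x t')
    (o := kz x 5) ?_ ?_ ?_ ?_ ?_ ?_
  · intro y y' P hP
    have hy : Pos y u ↔ Pos y' u := by
      rcases hP with hP | hP | hP <;> obtain ⟨rfl, rfl⟩ := Prod.mk.inj hP <;> assumption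
    exact proj₀_map_bijective hl _ ((Q.translateFunctor u).map (pmor P)) hy
  · rcases ht with ⟨rfl, rfl⟩ | ⟨rfl, rfl⟩
    · exact e1
    · exact fun i y => and_comm.trans (e1 i y)
  · rcases hs with ⟨rfl, rfl⟩ | ⟨rfl, rfl⟩ <;> rcases ht with ⟨rfl, rfl⟩ | ⟨rfl, rfl⟩
    · exact e2
    · exact fun i y => (e2 i y).trans or_comm
    · exact fun i y => and_comm.trans (e2 i y)
    · exact fun i y => (and_comm.trans (e2 i y)).trans or_comm
  · rcases hs with ⟨rfl, rfl⟩ | ⟨rfl, rfl⟩ <;> assumption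
  · rcases hs with ⟨rfl, rfl⟩ | ⟨rfl, rfl⟩ <;> assumption
  · rcases hs with ⟨rfl, rfl⟩ | ⟨rfl, rfl⟩
    · exact e5
    · intro i y
      rw [e5, or_comm]

theorem single_acyclic_structureSheaf (hl : ¬ hasLoop Q) (x : Q.Cover) (u : Weight)
    (h : ¬ (x.vtx = .v0 ∧ x.wt - tw 3 + u = 0)) :
    ExtAcyclic ((single x).ind Q) (Q.shift u (proj₀ (⟨.v0, 0⟩ : Q.Cover))) := by
  obtain ⟨i, w⟩ := x
  have key : ∀ {s s' t t' : Fin 6} (_ : s = 1 ∧ s' = 2 ∨ s = 2 ∧ s' = 1)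
      (_ : t = 3 ∧ t' = 4 ∨ t = 4 ∧ t' = 3), ((Pos (kz (⟨i, w⟩ : Q.Cover) 0) u ↔
        Pos (kz (⟨i, w⟩ : Q.Cover) s) u) ∧ (Pos (kz (⟨i, w⟩ : Q.Cover) s') u ↔
        Pos (kz (⟨i, w⟩ : Q.Cover) t) u) ∧ (Pos (kz (⟨i, w⟩ : Q.Cover) t') u ↔
        Pos (kz (⟨i, w⟩ : Q.Cover) 5) u)) →
      ExtAcyclic ((single ⟨i, w⟩).ind Q) (Q.shift u (proj₀ (⟨.v0, 0⟩ : Q.Cover))) :=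
    fun hs ht hh => single_acyclic_of_pos hl _ u hs ht hh.1 hh.2.1 hh.2.2
  have k1 := key (Or.inl ⟨rfl, rfl⟩) (Or.inl ⟨rfl, rfl⟩)
  have k2 := key (Or.inl ⟨rfl, rfl⟩) (Or.inr ⟨rfl, rfl⟩)
  have k3 := key (Or.inr ⟨rfl, rfl⟩) (Or.inl ⟨rfl, rfl⟩)
  have k4 := key (Or.inr ⟨rfl, rfl⟩) (Or.inr ⟨rfl, rfl⟩)
  clear key
  cases i
  · have h' : ¬ (w 0 + u 0 = -1 ∧ w 1 + u 1 = -1 ∧ w 2 + u 2 = -1) := by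
      rintro ⟨b0, b1, b2⟩
      refine h ⟨rfl, ?_⟩
      funext l
      fin_cases l <;> simp only [Fin.zero_eta, Fin.mk_one, Fin.reduceFinMk, Pi.add_apply,
        Pi.sub_apply, Pi.zero_apply, tw_apply] <;> omega
    simp only [kz, pos_iff, Matrix.cons_val_zero, Matrix.cons_val_one, Matrix.cons_val,
      Pi.add_apply, Pi.sub_apply, tw_apply, lev_v0, lev_v1] at k1 k2 k3 k4
    by_cases b1 : w 1 + u 1 = -1
    · by_cases b2 : w 1 + u 1 + (w 2 + u 2) - (w 0 + u 0) = -1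
      · exact k4 ⟨by omega, by omega, by omega⟩
      · exact k3 ⟨by omega, by omega, by omega⟩
    · by_cases b2 : w 1 + u 1 + (w 2 + u 2) - (w 0 + u 0) = -1
      · exact k2 ⟨by omega, by omega, by omega⟩
      · exact k1 ⟨by omega, by omega, by omega⟩
  · simp only [kz, pos_iff, Matrix.cons_val_zero, Matrix.cons_val_one, Matrix.cons_val,
      Pi.add_apply, Pi.sub_apply, tw_apply, lev_v0, lev_v1] at k1 k2 k3 k4
    by_cases b1 : w 1 + u 1 = -1
    · by_cases b2 : w 1 + u 1 + (w 2 + u 2) - (w 0 + u 0) - 1 = -1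
      · by_cases b3 : w 0 + u 0 = -1
        · first
            | exact k2 ⟨by omega, by omega, by omega⟩
            | exact k1 ⟨by omega, by omega, by omega⟩
        · first
            | exact k4 ⟨by omega, by omega, by omega⟩
            | exact k3 ⟨by omega, by omega, by omega⟩
      · first
          | exact k2 ⟨by omega, by omega, by omega⟩
          | exact k1 ⟨by omega, by omega, by omega⟩
    · by_cases b2 : w 1 + u 1 + (w 2 + u 2) - (w 0 + u 0) - 1 = -1
      · by_cases b3 : w 0 + u 0 = -1
        · first
            | exact k2 ⟨by omega, by omega, by omega⟩
            | exact k1 ⟨by omega, by omega, by omega⟩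
        · first
            | exact k4 ⟨by omega, by omega, by omega⟩
            | exact k3 ⟨by omega, by omega, by omega⟩
      · first
          | exact k1 ⟨by omega, by omega, by omega⟩
          | exact k2 ⟨by omega, by omega, by omega⟩

theorem pairing_structureSheaf (hl : ¬ hasLoop Q) {M : Q.GrMod} (hM : FiniteSupport M) :
    PairingDefined 3 M (proj₀ (⟨.v0, 0⟩ : Q.Cover)) ∧
      ∀ u, pairing 3 M (proj₀ (⟨.v0, 0⟩ : Q.Cover)) u = - gdim M .v0 (tw 3 - u) := by
  classical
  let X (x : Q.Cover) (u : Weight) : Prop := x.vtx = .v0 ∧ x.wt - tw 3 + u = 0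
  refine pairing_of_ext (A := fun u => ∀ x : Q.Cover, ¬ Subsingleton (M.obj (pt x)) → ¬ X x u)
    (fun u => ?_) (((hM.2 .v0).image fun w => tw 3 - w).subset ?_)
  · have e1 : - gdim M .v0 (tw 3 - u) =
        ((gdim M .v0).sum fun w k => k * (if X ⟨.v0, w⟩ u then -1 else 0)) +
        ((gdim M .v1).sum fun w k => k * (if X ⟨.v1, w⟩ u then -1 else 0)) := by
      have h1 : ∀ w, X ⟨.v1, w⟩ u ↔ False := fun w => iff_false_intro fun h => by cases h.1
      have h0 : ∀ w, X ⟨.v0, w⟩ u ↔ w = tw 3 - u := by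
        intro w
        change (_ ∧ _) ↔ _
        rw [and_iff_right rfl, sub_add, sub_eq_zero]
      simp only [h1, h0, if_false, mul_zero, mul_ite, mul_neg, mul_one]
      rw [Finsupp.sum, Finsupp.sum, Finset.sum_const_zero, add_zero, Finset.sum_ite_eq']
      split_ifs with hs
      · rfl
      · rw [Finsupp.notMem_support_iff.1 hs, neg_zero]
    rw [e1]
    refine hM.devissage (E := fun x => if X x u then -1 else 0) fun x hx => ?_
    by_cases hX : X x u
    · rw [if_pos hX]
      have hfin := fun y : Q.Cover => (finrank_proj₀ hl (⟨.v0, 0⟩ : Q.Cover) ⟨y.vtx, y.wt + u⟩)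
      have h := single_ext (A := False) (n := 0)
        (N := Q.shift u (proj₀ (⟨.v0, 0⟩ : Q.Cover)))
        (ε := fun y => Module.finrank ℂ ((Q.shift u (proj₀ (⟨.v0, 0⟩ : Q.Cover))).obj (pt y))) x
        (fun m => by
          have := (hfin (kz x m)).1
          have : Module.Finite ℂ ((Q.shift u (proj₀ (⟨.v0, 0⟩ : Q.Cover))).obj (pt (kz x m))) := this
          exact (slab_ext_of_not_hasLoop hl _ _).weaken fun h => h.elim)
      obtain ⟨i, w⟩ := x
      obtain ⟨rfl, hw⟩ : i = .v0 ∧ w - tw 3 + u = 0 := hX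
      have h1 : ∀ i w', (Module.finrank ℂ ((Q.shift u (proj₀ (⟨.v0, 0⟩ : Q.Cover))).obj
          (pt ⟨i, w'⟩)) : ℤ) = if Pos (⟨i, w'⟩ : Q.Cover) u then 1 else 0 := by
        intro i w'
        split_ifs with hp
        · exact_mod_cast (hfin ⟨i, w'⟩).2.1 hp
        · exact_mod_cast (hfin ⟨i, w'⟩).2.2 hp
      have b0 := congrFun hw 0
      have b1 := congrFun hw 1
      have b2 := congrFun hw 2
      simp only [Pi.add_apply, Pi.sub_apply, Pi.zero_apply, tw_apply] at b0 b1 b2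
      rw [kzSum_v0] at h
      simp only [h1, pos_iff, Pi.add_apply, Pi.sub_apply, tw_apply, lev_v0, lev_v1] at h
      rw [if_neg (by omega), if_neg (by omega), if_neg (by omega), if_neg (by omega),
        if_neg (by omega), if_pos (by omega)] at h
      refine ⟨h.1, fun hA => absurd ?_ (hA _ hx)⟩
      exact ⟨rfl, hw⟩
    · rw [if_neg hX]
      have h := single_acyclic_structureSheaf hl x u hX
      exact ⟨h.extEuler.mono (Nat.zero_le _), fun _ => h⟩
  · intro u hu
    simp only [Set.mem_setOf_eq] at hu
    push Not at hu
    obtain ⟨⟨i, w⟩, hx, hX⟩ := hu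
    obtain ⟨rfl, hw⟩ : i = .v0 ∧ w - tw 3 + u = 0 := hX
    refine ⟨w, not_subsingleton_iff_nontrivial.2 hx, ?_⟩
    simp only
    rw [sub_add, sub_eq_zero] at hw
    rw [hw, sub_sub_cancel]

end StructureSheaf

end WQuiver

end LocalConifold

namespace LocalConifold

namespace WQuiver

section Numeric

/-- Translation by `s`. -/
noncomputable def tr (s : Weight) (f : KT) : KT := Finsupp.equivMapDomain (Equiv.addRight s) f

theorem tr_apply (s : Weight) (f : KT) (w : Weight) : tr s f w = f (w - s) := by
  rw [tr, Finsupp.equivMapDomain_apply, sub_eq_add_neg]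
  rfl

theorem tr_tr (s s' : Weight) (f : KT) : tr s (tr s' f) = tr (s + s') f := by
  ext w
  rw [tr_apply, tr_apply, tr_apply, sub_sub]

theorem tr_sub (s : Weight) (f g : KT) : tr s (f - g) = tr s f - tr s g := by
  ext w
  simp only [tr_apply, Finsupp.sub_apply]

theorem tr_zero (f : KT) : tr 0 f = f := by
  ext w
  rw [tr_apply, sub_zero]

/-- The sum `∑_w f(w) ψ(w)`. -/
noncomputable def ev (f : KT) (ψ : Weight → ℤ) : ℤ := f.sum fun w k => k * ψ w

theorem ev_eq_sum (f : KT) (ψ : Weight → ℤ) {W : Finset Weight} (h : f.support ⊆ W) :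
    ev f ψ = ∑ w ∈ W, f w * ψ w :=
  Finsupp.sum_of_support_subset f h _ fun _ _ => zero_mul _

theorem corr_eq_ev (f g : KT) (s : Weight) : corr f g s = ev f fun w => g (w + s) := rfl

theorem ev_add (f g : KT) (ψ : Weight → ℤ) : ev (f + g) ψ = ev f ψ + ev g ψ :=
  Finsupp.sum_add_index' (fun _ => zero_mul _) fun _ _ _ => add_mul _ _ _

theorem ev_sub (f g : KT) (ψ : Weight → ℤ) : ev (f - g) ψ = ev f ψ - ev g ψ :=
  Finsupp.sum_sub_index fun _ _ _ => sub_mul _ _ _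

theorem ev_add' (f : KT) (ψ χ : Weight → ℤ) : ev f (fun w => ψ w + χ w) = ev f ψ + ev f χ := by
  simp only [ev, mul_add, Finsupp.sum_add]

theorem ev_sub' (f : KT) (ψ χ : Weight → ℤ) : ev f (fun w => ψ w - χ w) = ev f ψ - ev f χ := by
  simp only [ev, mul_sub, Finsupp.sum_sub]

theorem ev_tr (s : Weight) (f : KT) (ψ : Weight → ℤ) :
    ev (tr s f) ψ = ev f fun w => ψ (w + s) := by
  rw [ev, tr, Finsupp.sum_equivMapDomain]
  rfl

theorem corr_sub_right (f g g' : KT) (s : Weight) : corr f (g - g') s = corr f g s - corr f g' s :=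
  ev_sub' _ _ _

theorem corr_add_right (f g g' : KT) (s : Weight) : corr f (g + g') s = corr f g s + corr f g' s :=
  ev_add' _ _ _

theorem corr_sub_left (f f' g : KT) (s : Weight) : corr (f - f') g s = corr f g s - corr f' g s :=
  ev_sub _ _ _

theorem corr_add_left (f f' g : KT) (s : Weight) : corr (f + f') g s = corr f g s + corr f' g s :=
  ev_add _ _ _

theorem corr_tr_left (f g : KT) (s u : Weight) : corr (tr s f) g u = corr f g (u + s) := by
  rw [corr_eq_ev, ev_tr]
  simp only [corr_eq_ev, add_assoc, add_comm s u]

theorem corr_tr_right (f g : KT) (s u : Weight) : corr f (tr s g) u = corr f g (u - s) := by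
  simp only [corr_eq_ev, tr_apply, add_sub_assoc]

/-- The Euler form of a pair of graded dimensions with itself, in weight `0`. -/
noncomputable def eulerSq (f g : KT) : ℤ :=
  corr f f 0 - corr f g (tw 1) - corr f g (tw 2) + corr f g (tw 1 + tw 2) +
    corr f g (tw 0 + tw 1 + tw 2) - corr f f (tw 0 + tw 1 + tw 2) +
  (corr g g 0 - corr g f 0 - corr g f (tw 0) + corr g f (tw 0 + tw 1) + corr g f (tw 0 + tw 2) -
    corr g g (tw 0 + tw 1 + tw 2))

theorem eulerForm_self (f : Vtx → KT) : eulerForm f f 0 = eulerSq (f .v0) (f .v1) := by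
  have e1 : (0 : Weight) - tw 3 = tw 0 + tw 1 + tw 2 := by rw [tw_three]; abel
  have e2 : tw 1 + tw 2 + tw 0 = tw 0 + tw 1 + tw 2 := by abel
  simp only [eulerForm, eulerSq, e1, zero_add, e2]

/-- Invariance under mutation. -/
theorem eulerSq_mutation (f g : KT) :
    eulerSq (f + tr (tw 0) (f - g)) f = eulerSq f g := by
  have hs : ∀ s, corr g f s = corr f g (-s) := fun s => corr_symm g f s
  have hf : ∀ s, corr f f (-s) = corr f f s := fun s => (corr_symm f f s).symm
  have hg : ∀ s, corr g g (-s) = corr g g s := fun s => (corr_symm g g s).symm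
  simp only [eulerSq, tr_sub, corr_add_left, corr_add_right, corr_sub_left, corr_sub_right,
    corr_tr_left, corr_tr_right, hs]
  generalize tw 0 = a
  generalize tw 1 = b
  generalize tw 2 = c
  have f1 := hf a
  have f2 := hf b
  have f3 := hf c
  have f4 := hf (b + c)
  have f5 := hf (a + b)
  have f6 := hf (a + c)
  have f7 := hf (a + b + c)
  have f8 := hf (a + a + b + c)
  ring_nf at *

/-- The graded dimensions of the mutations of a pair. -/
noncomputable def mutDim (L U : KT) (ρ : ℤ) : KT :=
  U + ∑ i ∈ Finset.Icc 0 ρ, tr (i • tw 0) (L - U) - ∑ i ∈ Finset.Ioo ρ 0, tr (i • tw 0) (L - U)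

theorem mutDim_succ (L U : KT) (ρ : ℤ) :
    mutDim L U (ρ + 1) = mutDim L U ρ + tr ((ρ + 1) • tw 0) (L - U) := by
  rw [mutDim, mutDim]
  by_cases h : -1 ≤ ρ
  · have h1 : Finset.Icc 0 (ρ + 1) = insert (ρ + 1) (Finset.Icc 0 ρ) := by
      ext i
      simp only [Finset.mem_Icc, Finset.mem_insert]
      omega
    have h2 : Finset.Ioo ρ 0 = ∅ := by
      ext i
      simp only [Finset.mem_Ioo, Finset.notMem_empty, iff_false]
      omega
    have h3 : Finset.Ioo (ρ + 1) 0 = ∅ := by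
      ext i
      simp only [Finset.mem_Ioo, Finset.notMem_empty, iff_false]
      omega
    rw [h1, h2, h3, Finset.sum_insert (by simp)]
    abel
  · have h1 : Finset.Icc 0 (ρ + 1) = ∅ := by
      ext i
      simp only [Finset.mem_Icc, Finset.notMem_empty, iff_false]
      omega
    have h2 : Finset.Icc 0 ρ = ∅ := by
      ext i
      simp only [Finset.mem_Icc, Finset.notMem_empty, iff_false]
      omega
    have h3 : Finset.Ioo ρ 0 = insert (ρ + 1) (Finset.Ioo (ρ + 1) 0) := by
      ext i
      simp only [Finset.mem_Ioo, Finset.mem_insert]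
      omega
    rw [h1, h2, h3, Finset.sum_insert (by simp)]
    abel

theorem mutDim_mutation (L U : KT) (ρ : ℤ) : mutDim L U (ρ + 1) =
    mutDim L U ρ + tr (tw 0) (mutDim L U ρ - mutDim L U (ρ - 1)) := by
  have h := mutDim_succ L U (ρ - 1)
  rw [sub_add_cancel] at h
  rw [mutDim_succ, h, add_sub_cancel_left, tr_tr, add_smul, one_smul, add_comm (tw 0)]

theorem mutDim_zero (L U : KT) : mutDim L U 0 = L := by
  simp [mutDim, tr_zero]

theorem mutDim_neg_one (L U : KT) : mutDim L U (-1) = U := by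
  have h : Finset.Ioo (-1 : ℤ) 0 = ∅ := by
    ext i
    simp only [Finset.mem_Ioo, Finset.notMem_empty, iff_false]
    omega
  rw [mutDim, h]
  simp

/-- Functions of an integer which do not change from one argument to the next are constant. -/
theorem eq_of_succ {α : Type*} {f : ℤ → α} (h : ∀ n, f (n + 1) = f n) (n : ℤ) : f n = f 0 := by
  induction n using Int.induction_on with
  | zero => rfl
  | succ n ih => rw [h, ih]
  | pred n ih => rw [← ih, ← h (-n - 1), sub_add_cancel]

theorem eulerSq_mutDim (L U : KT) (ρ : ℤ) :
    eulerSq (mutDim L U ρ) (mutDim L U (ρ - 1)) = eulerSq L U := by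
  have := eq_of_succ (f := fun ρ => eulerSq (mutDim L U ρ) (mutDim L U (ρ - 1))) (fun ρ => by
    rw [add_sub_cancel_right, mutDim_mutation, eulerSq_mutation]) ρ
  rw [this, mutDim_zero, zero_sub, mutDim_neg_one]

/-- The contribution of the framing, at the level `m`. -/
def psi (m : ℤ) (w : Weight) : ℤ :=
  if w 1 = 0 ∧ w 2 = 0 then
    (if 0 < w 1 + w 2 - w 0 - m then 1 else 0) + (if 0 < w 0 then 1 else 0) - 1
  else 0

theorem psi_mutation (m : ℤ) (w : Weight) :
    psi m w = psi (m - 1) w + psi (m - 1) (w + tw 0) - psi (m - 2) (w + tw 0) := by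
  simp only [psi, Pi.add_apply, tw_apply, add_zero]
  split_ifs <;> omega

theorem ev_psi_mutDim (L U : KT) (j₀ ρ : ℤ) :
    ev (mutDim L U ρ) (psi (j₀ - ρ)) -
      ev (mutDim L U (ρ - 1)) (fun w => psi (j₀ - ρ - 1) (w + tw 0)) =
    ev L (psi j₀) - ev U (fun w => psi (j₀ - 1) (w + tw 0)) := by
  have := eq_of_succ (f := fun ρ => ev (mutDim L U ρ) (psi (j₀ - ρ)) -
      ev (mutDim L U (ρ - 1)) (fun w => psi (j₀ - ρ - 1) (w + tw 0))) (fun ρ => by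
    have e1 : j₀ - (ρ + 1) = j₀ - ρ - 1 := by ring
    have e2 : j₀ - (ρ + 1) - 1 = j₀ - ρ - 2 := by ring
    have h : psi (j₀ - ρ) = fun w => psi (j₀ - ρ - 1) w + psi (j₀ - ρ - 1) (w + tw 0) -
      psi (j₀ - ρ - 2) (w + tw 0) := funext fun w => psi_mutation _ w
    rw [add_sub_cancel_right, mutDim_mutation, e2, e1, tr_sub, ev_add, ev_sub, ev_tr, ev_tr]
    rw [h, ev_sub', ev_add']
    ring) ρ
  rw [this, mutDim_zero, zero_sub, mutDim_neg_one, sub_zero]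

theorem ev_psi_zero (L U : KT) :
    ev L (psi 0) - ev U (fun w => psi (0 - 1) (w + tw 0)) = - L 0 := by
  have h1 : psi 0 = fun w => if w = 0 then -1 else 0 := by
    funext w
    have hw : w = 0 ↔ w 0 = 0 ∧ w 1 = 0 ∧ w 2 = 0 := by
      constructor
      · rintro rfl
        simp
      · rintro ⟨h0, h1, h2⟩
        funext l
        fin_cases l <;> assumption
    simp only [psi, hw]
    split_ifs <;> omega
  have h2 : (fun w => psi (0 - 1) (w + tw 0)) = fun _ => 0 := by
    funext w
    simp only [psi, Pi.add_apply, tw_apply, add_zero]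
    split_ifs <;> omega
  rw [h1, h2]
  simp only [ev, mul_zero, Finsupp.sum, Finset.sum_const_zero, sub_zero, mul_ite, mul_neg, mul_one]
  rw [Finset.sum_ite_eq']
  split_ifs with h
  · rfl
  · rw [Finsupp.notMem_support_iff.1 h, neg_zero]

theorem ev_psi_neg_one (L U : KT) :
    ev L (psi (-1)) - ev U (fun w => psi (-1 - 1) (w + tw 0)) = - U 0 := by
  have h1 : (fun w => psi (-1 - 1) (w + tw 0)) = fun w => if w = 0 then 1 else 0 := by
    funext w
    have hw : w = 0 ↔ w 0 = 0 ∧ w 1 = 0 ∧ w 2 = 0 := by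
      constructor
      · rintro rfl
        simp
      · rintro ⟨h0, h1, h2⟩
        funext l
        fin_cases l <;> assumption
    simp only [psi, hw, Pi.add_apply, tw_apply, add_zero]
    split_ifs <;> omega
  have h2 : psi (-1) = fun _ => 0 := by
    funext w
    simp only [psi]
    split_ifs <;> omega
  rw [h1, h2]
  simp only [ev, mul_zero, Finsupp.sum, Finset.sum_const_zero, zero_sub, mul_ite, mul_one]
  rw [Finset.sum_ite_eq']
  split_ifs with h
  · rfl
  · rw [Finsupp.notMem_support_iff.1 h]

/-- The total dimension. -/
noncomputable def tot (f : KT) : ℤ := ev f fun _ => 1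

/-- The squares of the differences of `f` and `g` along the edges of weight `s`, expressed
linearly by means of the differences of `q` and `q'`. -/
def EdgeSquares (f g : KT) (q q' : Weight → ℤ) (s : Weight) : Prop :=
  ∀ w, (f w - g (w + s)) ^ 2 = (f w - g (w + s)) - 2 * (q w - q' (w + s)) * (f w - g (w + s))

theorem EdgeSquares.corr {f g : KT} {q q' : Weight → ℤ} {s : Weight} (h : EdgeSquares f g q q' s) :
    corr f f 0 + corr g g 0 - 2 * corr f g s = tot f - tot g -
      2 * (ev f (fun w => q w - q' (w + s)) + ev g (fun w => q' w - q (w - s))) := by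
  classical
  have hg : g = tr s (tr (-s) g) := by rw [tr_tr, add_neg_cancel, tr_zero]
  have h' : ∀ w, (f w - tr (-s) g w) ^ 2 = (f w - tr (-s) g w) -
      2 * (q w - q' (w + s)) * (f w - tr (-s) g w) := fun w => by
    rw [tr_apply, sub_neg_eq_add]
    exact h w
  generalize tr (-s) g = g' at *
  subst hg
  rw [corr_tr_left, corr_tr_right, corr_tr_right, tot, tot, ev_tr, ev_tr, zero_add, sub_self]
  simp only [add_sub_cancel_right, corr_eq_ev, add_zero]
  have e1 : ∀ ψ, ev f ψ = ∑ w ∈ f.support ∪ g'.support, f w * ψ w := fun ψ =>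
    ev_eq_sum f ψ Finset.subset_union_left
  have e2 : ∀ ψ, ev g' ψ = ∑ w ∈ f.support ∪ g'.support, g' w * ψ w := fun ψ =>
    ev_eq_sum g' ψ Finset.subset_union_right
  simp only [e1, e2, Finset.mul_sum, ← Finset.sum_add_distrib, ← Finset.sum_sub_distrib]
  refine Finset.sum_congr rfl fun w _ => ?_
  linear_combination h' w

theorem eulerSq_of_edgeSquares {f g : KT} {q q' : Weight → ℤ}
    (h : ∀ s ∈ [tw 1, tw 2, tw 0 + tw 1 + tw 2, tw 1 + tw 2], EdgeSquares f g q q' s)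
    (h' : ∀ s ∈ [0, tw 0, tw 0 + tw 2, tw 0 + tw 1], EdgeSquares g f q' q s)
    (hf : EdgeSquares f f q q (tw 0 + tw 1 + tw 2))
    (hg : EdgeSquares g g q' q' (tw 0 + tw 1 + tw 2)) :
    eulerSq f g = -
      (ev f (fun w => (q w - q' (w + tw 1)) + (q w - q' (w + tw 2))
        - (q w - q' (w + (tw 0 + tw 1 + tw 2))) - (q w - q' (w + (tw 1 + tw 2)))
        + (q w - q (w + (tw 0 + tw 1 + tw 2))) + (q w - q (w - (tw 0 + tw 1 + tw 2)))
        + (q w - q' (w - 0)) + (q w - q' (w - tw 0))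
        - (q w - q' (w - (tw 0 + tw 2))) - (q w - q' (w - (tw 0 + tw 1)))) +
      ev g (fun w => (q' w - q (w - tw 1)) + (q' w - q (w - tw 2))
        - (q' w - q (w - (tw 0 + tw 1 + tw 2))) - (q' w - q (w - (tw 1 + tw 2)))
        + (q' w - q' (w + (tw 0 + tw 1 + tw 2))) + (q' w - q' (w - (tw 0 + tw 1 + tw 2)))
        + (q' w - q (w + 0)) + (q' w - q (w + tw 0))
        - (q' w - q (w + (tw 0 + tw 2))) - (q' w - q (w + (tw 0 + tw 1))))) := by
  simp only [List.forall_mem_cons, List.not_mem_nil, false_imp_iff, implies_true, and_true] at h h'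
  obtain ⟨a1, a2, a3, a4⟩ := h
  obtain ⟨b1, b2, b3, b4⟩ := h'
  have a1 := a1.corr
  have a2 := a2.corr
  have a3 := a3.corr
  have a4 := a4.corr
  have b1 := b1.corr
  have b2 := b2.corr
  have b3 := b3.corr
  have b4 := b4.corr
  have hf := hf.corr
  have hg := hg.corr
  have e1 : tw 0 + tw 2 = tw 2 + tw 0 := add_comm _ _
  simp only [ev_add', ev_sub'] at *
  rw [eulerSq]
  linarith

/-- `max(0, -k, -i, -j)`. -/
def mx (i j k : ℤ) : ℤ := max (max 0 (-k)) (max (-i) (-j))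

theorem mx_diff (i j k : ℤ) : mx i j k - mx (i + 1) j k - mx i (j + 1) k + mx (i + 1) (j + 1) k =
    if i = j ∧ i < 0 ∧ i < k then -1 else 0 := by
  unfold mx
  split_ifs <;> omega

theorem mx_diff_diff (i j k : ℤ) :
    (mx i j k - mx (i + 1) j k - mx i (j + 1) k + mx (i + 1) (j + 1) k) -
    (mx (i - 1) (j - 1) (k - 1) - mx i (j - 1) (k - 1) - mx (i - 1) j (k - 1) +
      mx i j (k - 1)) = if i = 0 ∧ j = 0 ∧ 0 < k then 1 else 0 := by
  have h := mx_diff (i - 1) (j - 1) (k - 1)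
  rw [sub_add_cancel, sub_add_cancel] at h
  rw [h, mx_diff]
  split_ifs <;> omega

/-- The sum of the functions `max(-k, lo)` and `max(-l, lo)` minus `lo`, where
`lo = max(0, -i, -j)`, at the level `m`. -/
def mxx (m : ℤ) (w : Weight) : ℤ :=
  mx (w 1) (w 2) (w 1 + w 2 - w 0 - m) + mx (w 1) (w 2) (w 0) - mx (w 1) (w 2) 0

theorem mxx_eq {i j k l : ℤ} (m : ℤ) (w : Weight) (h1 : w 1 = i) (h2 : w 2 = j) (h0 : w 0 = l)
    (h : k + l + m = i + j) : mxx m w = mx i j k + mx i j l - mx i j 0 := by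
  rw [mxx, h1, h2, h0, show i + j - l - m = k by omega]

theorem mxx_lower (m : ℤ) (w : Weight) :
    (mxx m w - mxx (m + 1) (w + tw 1)) + (mxx m w - mxx (m + 1) (w + tw 2))
        - (mxx m w - mxx (m + 1) (w + (tw 0 + tw 1 + tw 2)))
        - (mxx m w - mxx (m + 1) (w + (tw 1 + tw 2)))
        + (mxx m w - mxx m (w + (tw 0 + tw 1 + tw 2)))
        + (mxx m w - mxx m (w - (tw 0 + tw 1 + tw 2)))
        + (mxx m w - mxx (m + 1) (w - 0)) + (mxx m w - mxx (m + 1) (w - tw 0))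
        - (mxx m w - mxx (m + 1) (w - (tw 0 + tw 2)))
        - (mxx m w - mxx (m + 1) (w - (tw 0 + tw 1))) = psi m w := by
  obtain ⟨i, hi⟩ : ∃ i, w 1 = i := ⟨_, rfl⟩
  obtain ⟨j, hj⟩ : ∃ j, w 2 = j := ⟨_, rfl⟩
  obtain ⟨l, hl⟩ : ∃ l, w 0 = l := ⟨_, rfl⟩
  obtain ⟨k, hk⟩ : ∃ k, k = i + j - l - m := ⟨_, rfl⟩
  rw [mxx_eq (i := i) (j := j) (k := k) (l := l) m (w)
    (by simp [tw_apply, hi]) (by simp [tw_apply, hj]) (by simp [tw_apply, hl]) (by omega)]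
  rw [mxx_eq (i := i + 1) (j := j) (k := k) (l := l) (m + 1) (w + tw 1)
    (by simp [tw_apply, hi]) (by simp [tw_apply, hj]) (by simp [tw_apply, hl]) (by omega)]
  rw [mxx_eq (i := i) (j := j + 1) (k := k) (l := l) (m + 1) (w + tw 2)
    (by simp [tw_apply, hi]) (by simp [tw_apply, hj]) (by simp [tw_apply, hl]) (by omega)]
  rw [mxx_eq (i := i + 1) (j := j + 1) (k := k) (l := l + 1) (m + 1) (w + (tw 0 + tw 1 + tw 2))
    (by simp [tw_apply, hi]) (by simp [tw_apply, hj]) (by simp [tw_apply, hl]) (by omega)]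
  rw [mxx_eq (i := i + 1) (j := j + 1) (k := k + 1) (l := l) (m + 1) (w + (tw 1 + tw 2))
    (by simp [tw_apply, hi]) (by simp [tw_apply, hj]) (by simp [tw_apply, hl]) (by omega)]
  rw [mxx_eq (i := i + 1) (j := j + 1) (k := k + 1) (l := l + 1) m (w + (tw 0 + tw 1 + tw 2))
    (by simp [tw_apply, hi]) (by simp [tw_apply, hj]) (by simp [tw_apply, hl]) (by omega)]
  rw [mxx_eq (i := i - 1) (j := j - 1) (k := k - 1) (l := l - 1) m (w - (tw 0 + tw 1 + tw 2))
    (by simp [tw_apply, hi]) (by simp [tw_apply, hj]) (by simp [tw_apply, hl]) (by omega)]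
  rw [mxx_eq (i := i) (j := j) (k := k - 1) (l := l) (m + 1) (w - 0)
    (by simp [tw_apply, hi]) (by simp [tw_apply, hj]) (by simp [tw_apply, hl]) (by omega)]
  rw [mxx_eq (i := i) (j := j) (k := k) (l := l - 1) (m + 1) (w - tw 0)
    (by simp [tw_apply, hi]) (by simp [tw_apply, hj]) (by simp [tw_apply, hl]) (by omega)]
  rw [mxx_eq (i := i) (j := j - 1) (k := k - 1) (l := l - 1) (m + 1) (w - (tw 0 + tw 2))
    (by simp [tw_apply, hi]) (by simp [tw_apply, hj]) (by simp [tw_apply, hl]) (by omega)]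
  rw [mxx_eq (i := i - 1) (j := j) (k := k - 1) (l := l - 1) (m + 1) (w - (tw 0 + tw 1))
    (by simp [tw_apply, hi]) (by simp [tw_apply, hj]) (by simp [tw_apply, hl]) (by omega)]
  have hk' := mx_diff_diff i j k
  have hl' := mx_diff_diff i j l
  have h0 := mx_diff i j 0
  have h1 := mx_diff (i - 1) (j - 1) 0
  rw [sub_add_cancel, sub_add_cancel] at h1
  simp only [psi, Pi.add_apply, hi, hj, hl, tw_apply]
  split_ifs at * <;> omega

theorem mxx_upper (m : ℤ) (w : Weight) :
    (mxx (m + 1) w - mxx m (w - tw 1)) + (mxx (m + 1) w - mxx m (w - tw 2))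
        - (mxx (m + 1) w - mxx m (w - (tw 0 + tw 1 + tw 2)))
        - (mxx (m + 1) w - mxx m (w - (tw 1 + tw 2)))
        + (mxx (m + 1) w - mxx (m + 1) (w + (tw 0 + tw 1 + tw 2)))
        + (mxx (m + 1) w - mxx (m + 1) (w - (tw 0 + tw 1 + tw 2)))
        + (mxx (m + 1) w - mxx m (w + 0)) + (mxx (m + 1) w - mxx m (w + tw 0))
        - (mxx (m + 1) w - mxx m (w + (tw 0 + tw 2)))
        - (mxx (m + 1) w - mxx m (w + (tw 0 + tw 1))) = - psi (m - 1) (w + tw 0) := by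
  obtain ⟨i, hi⟩ : ∃ i, w 1 = i := ⟨_, rfl⟩
  obtain ⟨j, hj⟩ : ∃ j, w 2 = j := ⟨_, rfl⟩
  obtain ⟨l, hl⟩ : ∃ l, w 0 = l := ⟨_, rfl⟩
  obtain ⟨k, hk⟩ : ∃ k, k = i + j - l - (m + 1) := ⟨_, rfl⟩
  rw [mxx_eq (i := i) (j := j) (k := k) (l := l) (m + 1) (w)
    (by simp [tw_apply, hi]) (by simp [tw_apply, hj]) (by simp [tw_apply, hl]) (by omega)]
  rw [mxx_eq (i := i - 1) (j := j) (k := k) (l := l) m (w - tw 1)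
    (by simp [tw_apply, hi]) (by simp [tw_apply, hj]) (by simp [tw_apply, hl]) (by omega)]
  rw [mxx_eq (i := i) (j := j - 1) (k := k) (l := l) m (w - tw 2)
    (by simp [tw_apply, hi]) (by simp [tw_apply, hj]) (by simp [tw_apply, hl]) (by omega)]
  rw [mxx_eq (i := i - 1) (j := j - 1) (k := k) (l := l - 1) m (w - (tw 0 + tw 1 + tw 2))
    (by simp [tw_apply, hi]) (by simp [tw_apply, hj]) (by simp [tw_apply, hl]) (by omega)]
  rw [mxx_eq (i := i - 1) (j := j - 1) (k := k - 1) (l := l) m (w - (tw 1 + tw 2))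
    (by simp [tw_apply, hi]) (by simp [tw_apply, hj]) (by simp [tw_apply, hl]) (by omega)]
  rw [mxx_eq (i := i + 1) (j := j + 1) (k := k + 1) (l := l + 1) (m + 1) (w + (tw 0 + tw 1 + tw 2))
    (by simp [tw_apply, hi]) (by simp [tw_apply, hj]) (by simp [tw_apply, hl]) (by omega)]
  rw [mxx_eq (i := i - 1) (j := j - 1) (k := k - 1) (l := l - 1) (m + 1) (w - (tw 0 + tw 1 + tw 2))
    (by simp [tw_apply, hi]) (by simp [tw_apply, hj]) (by simp [tw_apply, hl]) (by omega)]
  rw [mxx_eq (i := i) (j := j) (k := k + 1) (l := l) m (w + 0)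
    (by simp [tw_apply, hi]) (by simp [tw_apply, hj]) (by simp [tw_apply, hl]) (by omega)]
  rw [mxx_eq (i := i) (j := j) (k := k) (l := l + 1) m (w + tw 0)
    (by simp [tw_apply, hi]) (by simp [tw_apply, hj]) (by simp [tw_apply, hl]) (by omega)]
  rw [mxx_eq (i := i) (j := j + 1) (k := k + 1) (l := l + 1) m (w + (tw 0 + tw 2))
    (by simp [tw_apply, hi]) (by simp [tw_apply, hj]) (by simp [tw_apply, hl]) (by omega)]
  rw [mxx_eq (i := i + 1) (j := j) (k := k + 1) (l := l + 1) m (w + (tw 0 + tw 1))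
    (by simp [tw_apply, hi]) (by simp [tw_apply, hj]) (by simp [tw_apply, hl]) (by omega)]
  have hk' := mx_diff_diff i j (k + 1)
  have hl' := mx_diff_diff i j (l + 1)
  rw [add_sub_cancel_right] at hk' hl'
  have h0 := mx_diff i j 0
  have h1 := mx_diff (i - 1) (j - 1) 0
  rw [sub_add_cancel, sub_add_cancel] at h1
  simp only [psi, Pi.add_apply, hi, hj, hl, tw_apply]
  split_ifs at * <;> omega

/-- The edge condition for all the edges of the lattice between two adjacent levels. -/
structure AllEdgeSquares (f g : KT) (q q' : Weight → ℤ) : Prop where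
  up : ∀ s ∈ [tw 1, tw 2, tw 0 + tw 1 + tw 2, tw 1 + tw 2], EdgeSquares f g q q' s
  down : ∀ s ∈ [0, tw 0, tw 0 + tw 2, tw 0 + tw 1], EdgeSquares g f q' q s
  left : EdgeSquares f f q q (tw 0 + tw 1 + tw 2)
  right : EdgeSquares g g q' q' (tw 0 + tw 1 + tw 2)

theorem AllEdgeSquares.eulerSq_eq {f g : KT} {m : ℤ}
    (h : AllEdgeSquares f g (mxx m) (mxx (m + 1))) :
    eulerSq f g = - (ev f (psi m) - ev g fun w => psi (m - 1) (w + tw 0)) := by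
  rw [eulerSq_of_edgeSquares h.up h.down h.left h.right]
  simp only [mxx_lower, mxx_upper]
  simp only [ev, mul_neg, Finsupp.sum, Finset.sum_neg_distrib]
  ring

/-- The function `min(-k, lo) + min(-l, lo) - lo` at the level `m`. -/
def mnn (m : ℤ) (w : Weight) : ℤ := - (w 1 + w 2 - m) - mxx m w

theorem AllEdgeSquares.eulerSq_eq_of_mnn {f g : KT} {m : ℤ}
    (h : AllEdgeSquares f g (mnn m) (mnn (m + 1))) :
    eulerSq f g = ev f (psi m) - ev g fun w => psi (m - 1) (w + tw 0) := by
  have e1 : ∀ w, _ := fun w => mxx_lower m w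
  have e2 : ∀ w, _ := fun w => mxx_upper m w
  rw [eulerSq_of_edgeSquares h.up h.down h.left h.right]
  have h1 : ∀ (f : KT) (ψ χ : Weight → ℤ), (∀ w, ψ w = - χ w) → ev f ψ = - ev f χ := by
    intro f ψ χ h
    simp only [ev, h, mul_neg, Finsupp.sum, Finset.sum_neg_distrib]
  rw [h1 f _ (psi m), h1 g _ fun w => - psi (m - 1) (w + tw 0), h1 g _ _ fun w => rfl]
  · ring
  · intro w
    rw [← e2]
    simp only [mnn, Pi.add_apply, Pi.sub_apply, Pi.zero_apply, tw_apply]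
    ring
  · intro w
    rw [← e1]
    simp only [mnn, Pi.add_apply, Pi.sub_apply, Pi.zero_apply, tw_apply]
    ring

theorem eulerSq_neg (f g : KT) : eulerSq (-f) (-g) = eulerSq f g := by
  have h : ∀ f g : KT, ∀ s, corr (-f) (-g) s = corr f g s := by
    intro f g s
    have := corr_sub_left 0 f (-g) s
    have h2 := corr_sub_right 0 0 g s
    have h3 := corr_sub_right f 0 g s
    have h4 : ∀ s (g : KT), corr 0 g s = 0 := fun s g => Finsupp.sum_zero_index
    have h5 : ∀ s, corr f 0 s = 0 := fun s => by
      simp [corr, Finsupp.sum]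
    simp only [zero_sub, h4, h5] at *
    linarith
  simp only [eulerSq, h]

theorem ev_neg (f : KT) (ψ : Weight → ℤ) : ev (-f) ψ = - ev f ψ := by
  simp [ev, Finsupp.sum_neg_index]

/-- The Euler form of a pair of graded dimensions, in terms of one of the mutations. -/
theorem AllEdgeSquares.eulerSq_mutDim {L U : KT} {j₀ ρ : ℤ}
    (h : AllEdgeSquares (mutDim L U ρ) (mutDim L U (ρ - 1)) (mxx (j₀ - ρ)) (mxx (j₀ - ρ + 1))) :
    eulerSq L U = - (ev L (psi j₀) - ev U fun w => psi (j₀ - 1) (w + tw 0)) := by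
  rw [← WQuiver.eulerSq_mutDim L U ρ, h.eulerSq_eq, ev_psi_mutDim]

theorem AllEdgeSquares.eulerSq_mutDim_of_mnn {L U : KT} {j₀ ρ : ℤ}
    (h : AllEdgeSquares (-mutDim L U ρ) (-mutDim L U (ρ - 1)) (mnn (j₀ - ρ)) (mnn (j₀ - ρ + 1))) :
    eulerSq L U = - (ev L (psi j₀) - ev U fun w => psi (j₀ - 1) (w + tw 0)) := by
  rw [← WQuiver.eulerSq_mutDim L U ρ, ← eulerSq_neg, h.eulerSq_eq_of_mnn, ev_neg, ev_neg,
    ← ev_psi_mutDim]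
  ring

end Numeric

end WQuiver

end LocalConifold

namespace LocalConifold

section Strings

variable {L U : Type} [AddCommGroup L] [Module ℂ L] [AddCommGroup U] [Module ℂ U]

theorem finrank_map_add_finrank_ker {E F : Type*} [AddCommGroup E] [Module ℂ E] [AddCommGroup F]
    [Module ℂ F] (f : E →ₗ[ℂ] F) (P : Submodule ℂ E) [FiniteDimensional ℂ P] :
    Module.finrank ℂ (P.map f) + Module.finrank ℂ ↥(LinearMap.ker f ⊓ P) = Module.finrank ℂ P := by
  have h := LinearMap.finrank_range_add_finrank_ker (f.domRestrict P)
  have h1 : LinearMap.range (f.domRestrict P) = P.map f := by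
    rw [LinearMap.domRestrict, LinearMap.range_comp, Submodule.range_subtype]
  have h2 : (LinearMap.ker (f.domRestrict P)).map P.subtype = LinearMap.ker f ⊓ P := by
    ext x
    simp [and_comm]
  rw [← h2, Submodule.finrank_map_subtype_eq, ← h1, h]

/-- The span of the elements of a closed string of length at most `n`, and its images. -/
theorem closed_string_finrank [FiniteDimensional ℂ U] {B B' : U →ₗ[ℂ] L} {x : ℤ → U} {p : ℤ} {N : ℕ}
    (hx : ∀ i, x i ≠ 0 → p ≤ i ∧ i < p + N) (h : ∀ i, B (x (i - 1)) = B' (x i))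
    (h0 : ∃ i, x i ≠ 0) :
    Module.finrank ℂ ↥((Submodule.span ℂ (Set.range x)).map B ⊔
      (Submodule.span ℂ (Set.range x)).map B') + 1 ≤
      Module.finrank ℂ (Submodule.span ℂ (Set.range x)) ∧
    Module.finrank ℂ (Submodule.span ℂ (Set.range x)) ≤ N := by
  classical
  constructor
  · have h1 : (Submodule.span ℂ (Set.range x)).map B' = (Submodule.span ℂ (Set.range x)).map B := by
      rw [Submodule.map_span, Submodule.map_span]
      congr 1
      ext y
      constructor
      · rintro ⟨_, ⟨i, rfl⟩, rfl⟩
        exact ⟨x (i - 1), ⟨_, rfl⟩, h i⟩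
      · rintro ⟨_, ⟨i, rfl⟩, rfl⟩
        refine ⟨x (i + 1), ⟨_, rfl⟩, ?_⟩
        rw [← h, add_sub_cancel_right]
    rw [h1, sup_idem, ← finrank_map_add_finrank_ker B]
    have h2 : ∃ i, x i ≠ 0 ∧ x (i + 1) = 0 := by
      by_contra hc
      push Not at hc
      obtain ⟨i, hi⟩ := h0
      have h3 : ∀ n : ℕ, x (i + n) ≠ 0 := fun n => by
        induction n with
        | zero => simpa using hi
        | succ n ih =>
          have := hc _ ih
          push_cast
          rwa [← add_assoc]
      have h4 := (hx _ hi).1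
      have h5 := (hx _ (h3 N)).2
      omega
    obtain ⟨i, hi, hi'⟩ := h2
    have h3 : 0 < Module.finrank ℂ ↥(LinearMap.ker B ⊓ Submodule.span ℂ (Set.range x)) := by
      have : Nontrivial ↥(LinearMap.ker B ⊓ Submodule.span ℂ (Set.range x)) := by
        refine ⟨⟨⟨x i, ?_, Submodule.subset_span ⟨i, rfl⟩⟩, 0, fun hc => hi (congrArg Subtype.val hc)⟩⟩
        have := h (i + 1)
        rw [add_sub_cancel_right, hi', map_zero] at this
        exact this
      exact Module.finrank_pos
    omega
  · have h1 : Submodule.span ℂ (Set.range x) =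
        Submodule.span ℂ ((Finset.Ico p (p + N)).image x : Set U) := by
      apply le_antisymm
      · rw [Submodule.span_le]
        rintro _ ⟨i, rfl⟩
        by_cases hi : x i = 0
        · rw [hi]
          exact Submodule.zero_mem _
        · exact Submodule.subset_span (Finset.mem_coe.2
            (Finset.mem_image_of_mem _ (Finset.mem_Ico.2 (hx i hi))))
      · apply Submodule.span_mono
        intro y hy
        obtain ⟨i, -, rfl⟩ := Finset.mem_image.1 (Finset.mem_coe.1 hy)
        exact ⟨i, rfl⟩
    rw [h1]
    refine (finrank_span_finset_le_card _).trans (Finset.card_image_le.trans ?_)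
    simp

theorem finrank_supported (N : ℕ) :
    Module.finrank ℂ (Finsupp.supported ℂ ℂ (Set.Iio N)) = N := by
  rw [(Finsupp.supportedEquivFinsupp (M := ℂ) (R := ℂ) (Set.Iio N)).finrank_eq,
    Module.finrank_finsupp_self]
  simp

instance (N : ℕ) : FiniteDimensional ℂ (Finsupp.supported ℂ ℂ (Set.Iio N)) :=
  Module.Finite.equiv (Finsupp.supportedEquivFinsupp (M := ℂ) (R := ℂ) (Set.Iio N)).symm

theorem mapDomain_succ_iterate_apply (c : ℕ →₀ ℂ) (n i : ℕ) :
    (Finsupp.mapDomain Nat.succ)^[n] c (i + n) = c i := by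
  induction n with
  | zero => rfl
  | succ n ih =>
    rw [Function.iterate_succ_apply', ← add_assoc, ← ih]
    exact Finsupp.mapDomain_apply Nat.succ_injective _ _

/-- The span of the elements of an open string, and its images. -/
theorem open_string_finrank {B B' : U →ₗ[ℂ] L} {x : ℕ → U} {N : ℕ} (hN : 0 < N)
    (h : ∀ i, i + 1 < N → B (x i) = B' (x (i + 1))) :
    (Module.finrank ℂ (Submodule.span ℂ (x '' Set.Iio N)) = N ∧
      Module.finrank ℂ ↥((Submodule.span ℂ (x '' Set.Iio N)).map B ⊔
        (Submodule.span ℂ (x '' Set.Iio N)).map B') ≤ N + 1) ∨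
    Module.finrank ℂ ↥((Submodule.span ℂ (x '' Set.Iio N)).map B ⊔
        (Submodule.span ℂ (x '' Set.Iio N)).map B') ≤
      Module.finrank ℂ (Submodule.span ℂ (x '' Set.Iio N)) := by
  let y : ℕ → L := fun n => Nat.casesOn n (B' (x 0)) fun i => B (x i)
  have hy : ∀ i < N, y i = B' (x i) := by
    intro i hi
    cases i with
    | zero => rfl
    | succ i => exact h i hi
  have hS : (Submodule.span ℂ (x '' Set.Iio N)).map B ⊔ (Submodule.span ℂ (x '' Set.Iio N)).map B' =
      Submodule.span ℂ (y '' Set.Iio (N + 1)) := by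
    rw [Submodule.map_span, Submodule.map_span, ← Submodule.span_union]
    congr 1
    ext z
    constructor
    · rintro (⟨_, ⟨i, hi, rfl⟩, rfl⟩ | ⟨_, ⟨i, hi, rfl⟩, rfl⟩)
      · exact ⟨i + 1, Nat.succ_lt_succ hi, rfl⟩
      · exact ⟨i, Nat.lt_succ_of_lt hi, hy i hi⟩
    · rintro ⟨i, hi, rfl⟩
      cases i with
      | zero => exact Or.inr ⟨_, ⟨0, hN, rfl⟩, rfl⟩
      | succ i => exact Or.inl ⟨_, ⟨i, Nat.lt_of_succ_lt_succ hi, rfl⟩, rfl⟩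
  rw [hS, Finsupp.span_image_eq_map_linearCombination, Finsupp.span_image_eq_map_linearCombination]
  have e1 := finrank_map_add_finrank_ker (Finsupp.linearCombination ℂ x)
    (Finsupp.supported ℂ ℂ (Set.Iio N))
  have e2 := finrank_map_add_finrank_ker (Finsupp.linearCombination ℂ y)
    (Finsupp.supported ℂ ℂ (Set.Iio (N + 1)))
  rw [finrank_supported] at e1 e2
  set K := LinearMap.ker (Finsupp.linearCombination ℂ x) ⊓ Finsupp.supported ℂ ℂ (Set.Iio N) with hK
  set K' := LinearMap.ker (Finsupp.linearCombination ℂ y) ⊓ Finsupp.supported ℂ ℂ (Set.Iio (N + 1))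
    with hK'
  by_cases hK0 : K = ⊥
  · left
    rw [hK0, finrank_bot] at e1
    omega
  · right
    have hle : K ≤ K' := by
      rintro c ⟨hc, hc'⟩
      refine ⟨?_, Finsupp.supported_mono (Set.Iio_subset_Iio (Nat.le_succ N)) hc'⟩
      have h1 : Finsupp.linearCombination ℂ y c = B' (Finsupp.linearCombination ℂ x c) := by
        rw [Finsupp.linearCombination_apply, Finsupp.linearCombination_apply, map_finsuppSum]
        refine Finset.sum_congr rfl fun i hi => ?_
        dsimp only
        rw [map_smul, hy i (hc' hi)]
      exact LinearMap.mem_ker.2 (by rw [h1, LinearMap.mem_ker.1 hc, map_zero])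
    have hsucc : ∀ c ∈ K, Finsupp.mapDomain Nat.succ c ∈ K' := by
      rintro c ⟨hc, hc'⟩
      constructor
      · have h1 : Finsupp.linearCombination ℂ y (Finsupp.mapDomain Nat.succ c) =
            B (Finsupp.linearCombination ℂ x c) := by
          rw [Finsupp.linearCombination_mapDomain, Finsupp.linearCombination_apply,
            Finsupp.linearCombination_apply, map_finsuppSum]
          refine Finset.sum_congr rfl fun i hi => ?_
          dsimp only
          rw [map_smul]
          rfl
        exact LinearMap.mem_ker.2 (by rw [h1, LinearMap.mem_ker.1 hc, map_zero])
      · intro i hi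
        obtain ⟨j, hj, rfl⟩ := Finset.mem_image.1 (Finsupp.mapDomain_support hi)
        exact Nat.succ_lt_succ (hc' hj)
    have hne : K ≠ K' := by
      intro heq
      obtain ⟨c, hc, hc0⟩ := Submodule.exists_mem_ne_zero_of_ne_bot hK0
      have h1 : ∀ n, (Finsupp.mapDomain Nat.succ)^[n] c ∈ K := fun n => by
        induction n with
        | zero => exact hc
        | succ n ih =>
          rw [Function.iterate_succ_apply', heq]
          exact hsucc _ ih
      obtain ⟨i, hi⟩ := Finsupp.ne_iff.1 hc0
      have h2 : i + N ∈ ((Finsupp.mapDomain Nat.succ)^[N] c).support := by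
        rw [Finsupp.mem_support_iff, mapDomain_succ_iterate_apply]
        exact hi
      have h3 : i + N < N := (h1 N).2 h2
      omega
    have : FiniteDimensional ℂ K' := Submodule.finiteDimensional_of_le inf_le_right
    have hlt := Submodule.finrank_lt_finrank_of_lt (lt_of_le_of_ne hle hne)
    omega

/-- Commuting nilpotent operators have a common annihilated element outside of an invariant
subspace. -/
theorem exists_notMem_of_commute {E : Type*} [AddCommGroup E] [Module ℂ E]
    (l : List (Module.End ℂ E)) (hcomm : ∀ S ∈ l, ∀ T ∈ l, Commute S T)
    (hnil : ∀ T ∈ l, IsNilpotent T) (C : Set E) (H : Submodule ℂ E)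
    (hC : ∀ T ∈ l, ∀ x ∈ C, T x ∈ C) (hH : ∀ T ∈ l, ∀ x ∈ H, T x ∈ H)
    (h : ∃ x ∈ C, x ∉ H) : ∃ x ∈ C, x ∉ H ∧ ∀ T ∈ l, T x ∈ H := by
  induction l with
  | nil =>
    obtain ⟨x, hx, hx'⟩ := h
    exact ⟨x, hx, hx', by simp⟩
  | cons T l ih =>
    obtain ⟨x, hx, hx', hl⟩ := ih (fun S hS T hT => hcomm S (.tail _ hS) T (.tail _ hT))
      (fun T hT => hnil T (.tail _ hT)) (fun T hT => hC T (.tail _ hT))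
      (fun T hT => hH T (.tail _ hT))
    obtain ⟨n, hn⟩ := hnil T (.head _)
    have hex : ∃ n, (T ^ n) x ∈ H := ⟨n, by rw [hn]; exact H.zero_mem⟩
    classical
    obtain ⟨k, hk⟩ : ∃ k, Nat.find hex = k + 1 := by
      refine Nat.exists_eq_succ_of_ne_zero fun h0 => hx' ?_
      have := Nat.find_spec hex
      rwa [h0, pow_zero] at this
    have hpow : ∀ n, (T ^ n) x ∈ C := fun n => by
      induction n with
      | zero => exact hx
      | succ n ih =>
        rw [pow_succ']
        exact hC T (.head _) _ ih
    refine ⟨(T ^ k) x, hpow k, Nat.find_min hex (by omega), ?_⟩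
    have hT : T ((T ^ k) x) ∈ H := by
      have := Nat.find_spec hex
      rwa [hk, pow_succ'] at this
    intro S hS
    rcases List.mem_cons.1 hS with rfl | hS'
    · exact hT
    · have hcm : S ((T ^ k) x) = (T ^ k) (S x) :=
        LinearMap.congr_fun ((hcomm S hS T (.head _)).pow_right k).eq x
      rw [hcm]
      have : ∀ n, ∀ y ∈ H, (T ^ n) y ∈ H := fun n => by
        induction n with
        | zero => exact fun y hy => hy
        | succ n ih =>
          intro y hy
          rw [pow_succ']
          exact hH T (.head _) _ (ih y hy)
      exact this k _ (hl S hS')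

end Strings

end LocalConifold

namespace LocalConifold

/-- Representations of the quiver with two vertices, arrows `a₁, a₂` from the first to the
second, `b₁, b₂` back, and a loop at each vertex, with the relations of `X`, such that the loops
and the cycles of length two act nilpotently. -/
structure KRep (L U : Type) [AddCommGroup L] [Module ℂ L] [AddCommGroup U] [Module ℂ U] where
  a : Fin 2 → L →ₗ[ℂ] U
  b : Fin 2 → U →ₗ[ℂ] L
  cL : Module.End ℂ L
  cU : Module.End ℂ U
  aba : ∀ i j k x, a i (b k (a j x)) = a j (b k (a i x))
  bab : ∀ i j k x, b i (a k (b j x)) = b j (a k (b i x))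
  ca : ∀ i x, cU (a i x) = a i (cL x)
  cb : ∀ i x, cL (b i x) = b i (cU x)
  nil_ab : ∀ i j, IsNilpotent (a i ∘ₗ b j : Module.End ℂ U)
  nil_ba : ∀ i j, IsNilpotent (b j ∘ₗ a i : Module.End ℂ L)
  nil_cL : IsNilpotent cL
  nil_cU : IsNilpotent cU

/-- Subrepresentations. -/
structure KSub {L U : Type} [AddCommGroup L] [Module ℂ L] [AddCommGroup U] [Module ℂ U]
    (K : KRep L U) where
  SL : Submodule ℂ L
  SU : Submodule ℂ U
  a_mem : ∀ i, ∀ x ∈ SL, K.a i x ∈ SU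
  b_mem : ∀ i, ∀ x ∈ SU, K.b i x ∈ SL
  cL_mem : ∀ x ∈ SL, K.cL x ∈ SL
  cU_mem : ∀ x ∈ SU, K.cU x ∈ SU

/-- The numerical condition for closed strings of length at most `N`. -/
def ClosedCond (θL θU : ℝ) (N : ℕ) : Prop :=
  θL < 0 ∧ ∀ n : ℕ, 1 ≤ n → n ≤ N → 0 < ((n : ℝ) - 1) * θL + n * θU

/-- The numerical condition for open strings of length `N`. -/
def OpenCond (θL θU : ℝ) (N : ℕ) : Prop :=
  θL < 0 ∧ 0 < θL + θU ∧ 0 < ((N : ℝ) + 1) * θL + N * θU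

section

variable {L U : Type} [AddCommGroup L] [Module ℂ L] [AddCommGroup U] [Module ℂ U]

theorem finrank_comap_mkQ [FiniteDimensional ℂ U] (H : Submodule ℂ U) (S : Submodule ℂ (U ⧸ H)) :
    Module.finrank ℂ (S.comap H.mkQ) = Module.finrank ℂ S + Module.finrank ℂ H := by
  have h := finrank_map_add_finrank_ker H.mkQ (S.comap H.mkQ)
  have h1 : LinearMap.ker H.mkQ ⊓ S.comap H.mkQ = H := by
    rw [Submodule.ker_mkQ, inf_eq_left]
    intro x hx
    rw [Submodule.mem_comap, Submodule.mkQ_apply, (Submodule.Quotient.mk_eq_zero H).2 hx]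
    exact S.zero_mem
  rw [h1, Submodule.map_comap_eq_of_surjective (Submodule.mkQ_surjective H)] at h
  exact h.symm

namespace KSub

variable {K : KRep L U}

/-- The slope function. -/
noncomputable def theta (θL θU : ℝ) (X : KSub K) : ℝ :=
  θL * Module.finrank ℂ X.SL + θU * Module.finrank ℂ X.SU

instance : LE (KSub K) := ⟨fun X Y => X.SL ≤ Y.SL ∧ X.SU ≤ Y.SU⟩

instance : Top (KSub K) := ⟨⟨⊤, ⊤, by simp, by simp, by simp, by simp⟩⟩

instance : Bot (KSub K) := ⟨⟨⊥, ⊥, by simp, by simp, by simp, by simp⟩⟩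

/-- The subrepresentation generated by a space of elements which are killed by the cycles modulo
a subrepresentation `H`. -/
theorem theta_killed_le [FiniteDimensional ℂ L] [FiniteDimensional ℂ U] {θL θU : ℝ} {H M : KSub K}
    (hΘ : ∀ X : KSub K, H ≤ X → X ≤ M → X.theta θL θU ≤ H.theta θL θU) (hHM : H ≤ M)
    (S : Submodule ℂ U) (hSM : S ≤ M.SU) (hab : ∀ i j, ∀ x ∈ S, K.a i (K.b j x) ∈ H.SU)
    (hc : ∀ x ∈ S, K.cU x ∈ H.SU) :
    θL * Module.finrank ℂ ↥((S.map H.SU.mkQ).map (H.SU.mapQ H.SL (K.b 0) (H.b_mem 0)) ⊔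
      (S.map H.SU.mkQ).map (H.SU.mapQ H.SL (K.b 1) (H.b_mem 1))) +
      θU * Module.finrank ℂ (S.map H.SU.mkQ) ≤ 0 := by
  set S' := S.map H.SU.mkQ with hS'
  set T := S'.map (H.SU.mapQ H.SL (K.b 0) (H.b_mem 0)) ⊔
    S'.map (H.SU.mapQ H.SL (K.b 1) (H.b_mem 1)) with hT
  have hb : ∀ i, ∀ x, H.SU.mkQ x ∈ S' → H.SL.mkQ (K.b i x) ∈ T := by
    intro i x hx
    have h1 : H.SL.mkQ (K.b i x) = H.SU.mapQ H.SL (K.b i) (H.b_mem i) (H.SU.mkQ x) := rfl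
    rw [h1]
    fin_cases i
    · exact Submodule.mem_sup_left (Submodule.mem_map_of_mem hx)
    · exact Submodule.mem_sup_right (Submodule.mem_map_of_mem hx)
  have hS : ∀ x, H.SU.mkQ x ∈ S' → ∃ y ∈ S, ∃ z ∈ H.SU, x = y + z := by
    rintro x ⟨y, hy, hxy⟩
    refine ⟨y, hy, x - y, ?_, by abel⟩
    exact (Submodule.Quotient.eq H.SU).1 hxy.symm
  have hTx : ∀ x, H.SL.mkQ x ∈ T → ∃ y ∈ S, ∃ y' ∈ S, ∃ z ∈ H.SL, x = K.b 0 y + K.b 1 y' + z := by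
    intro x hx
    obtain ⟨_, ⟨_, ⟨y, hy, rfl⟩, rfl⟩, _, ⟨_, ⟨y', hy', rfl⟩, rfl⟩, h⟩ := Submodule.mem_sup.1 hx
    refine ⟨y, hy, y', hy', x - (K.b 0 y + K.b 1 y'), ?_, by abel⟩
    exact (Submodule.Quotient.eq H.SL).1 h.symm
  let X : KSub K :=
    { SL := T.comap H.SL.mkQ
      SU := S'.comap H.SU.mkQ
      a_mem := by
        intro i x hx
        obtain ⟨y, hy, y', hy', z, hz, rfl⟩ := hTx x hx
        rw [map_add, map_add]
        have h1 := H.SU.add_mem (H.SU.add_mem (hab i 0 y hy) (hab i 1 y' hy')) (H.a_mem i z hz)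
        rw [Submodule.mem_comap, Submodule.mkQ_apply, (Submodule.Quotient.mk_eq_zero _).2 h1]
        exact S'.zero_mem
      b_mem := fun i x hx => hb i x hx
      cL_mem := by
        intro x hx
        obtain ⟨y, hy, y', hy', z, hz, rfl⟩ := hTx x hx
        rw [map_add, map_add, K.cb, K.cb]
        have h1 := H.SL.add_mem (H.SL.add_mem (H.b_mem 0 _ (hc y hy)) (H.b_mem 1 _ (hc y' hy')))
          (H.cL_mem z hz)
        rw [Submodule.mem_comap, Submodule.mkQ_apply, (Submodule.Quotient.mk_eq_zero _).2 h1]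
        exact T.zero_mem
      cU_mem := by
        intro x hx
        obtain ⟨y, hy, z, hz, rfl⟩ := hS x hx
        rw [map_add]
        have h1 := H.SU.add_mem (hc y hy) (H.cU_mem z hz)
        rw [Submodule.mem_comap, Submodule.mkQ_apply, (Submodule.Quotient.mk_eq_zero _).2 h1]
        exact S'.zero_mem }
  have hX := hΘ X
    ⟨fun x hx => by
      rw [Submodule.mem_comap, Submodule.mkQ_apply, (Submodule.Quotient.mk_eq_zero _).2 hx]
      exact T.zero_mem,
    fun x hx => by
      rw [Submodule.mem_comap, Submodule.mkQ_apply, (Submodule.Quotient.mk_eq_zero _).2 hx]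
      exact S'.zero_mem⟩
    ⟨fun x hx => by
      obtain ⟨y, hy, y', hy', z, hz, rfl⟩ := hTx x hx
      exact M.SL.add_mem (M.SL.add_mem (M.b_mem 0 _ (hSM hy)) (M.b_mem 1 _ (hSM hy'))) (hHM.1 hz),
    fun x hx => by
      obtain ⟨y, hy, z, hz, rfl⟩ := hS x hx
      exact M.SU.add_mem (hSM hy) (hHM.2 hz)⟩
  have e1 : Module.finrank ℂ X.SL = Module.finrank ℂ T + Module.finrank ℂ H.SL :=
    finrank_comap_mkQ H.SL T
  have e2 : Module.finrank ℂ X.SU = Module.finrank ℂ S' + Module.finrank ℂ H.SU :=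
    finrank_comap_mkQ H.SU S'
  rw [theta, theta, e1, e2] at hX
  push_cast at hX
  linarith

/-- Strings modulo `H` all of whose elements are not in `H` can be modified such that they are
killed by the cycles. -/
theorem exists_killed (H M : KSub K) (J I : Set ℤ)
    (h : ∃ x : ℤ → U, ((∀ i, x i ∈ M.SU) ∧ (∀ i ∉ J, x i = 0) ∧
      ∀ i ∈ I, K.b 0 (x (i - 1)) - K.b 1 (x i) ∈ H.SL) ∧ ∃ i, x i ∉ H.SU) :
    ∃ x : ℤ → U, ((∀ i, x i ∈ M.SU) ∧ (∀ i ∉ J, x i = 0) ∧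
      ∀ i ∈ I, K.b 0 (x (i - 1)) - K.b 1 (x i) ∈ H.SL) ∧ (∃ i, x i ∉ H.SU) ∧
      (∀ i j n, K.a i (K.b j (x n)) ∈ H.SU) ∧ ∀ n, K.cU (x n) ∈ H.SU := by
  let l : List (Module.End ℂ (ℤ → U)) :=
    K.cU.compLeft ℤ :: ([(0, 0), (0, 1), (1, 0), (1, 1)] : List (Fin 2 × Fin 2)).map
      fun p => (K.a p.1 ∘ₗ K.b p.2 : Module.End ℂ U).compLeft ℤ
  have hl : ∀ T ∈ l, (∃ i j, T = (K.a i ∘ₗ K.b j : Module.End ℂ U).compLeft ℤ) ∨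
      T = K.cU.compLeft ℤ := by
    intro T hT
    rcases List.mem_cons.1 hT with rfl | hT
    · exact Or.inr rfl
    · obtain ⟨p, -, rfl⟩ := List.mem_map.1 hT
      exact Or.inl ⟨_, _, rfl⟩
  have hnil : ∀ T : Module.End ℂ U, IsNilpotent T → IsNilpotent (T.compLeft ℤ) := by
    rintro T ⟨n, hn⟩
    refine ⟨n, ?_⟩
    have h1 : ∀ n : ℕ, ∀ x : ℤ → U, ((T.compLeft ℤ) ^ n) x = fun i => (T ^ n) (x i) := by
      intro n
      induction n with
      | zero => exact fun x => rfl
      | succ n ih =>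
        intro x
        rw [pow_succ', pow_succ', Module.End.mul_apply, ih]
        rfl
    ext x i
    rw [h1, hn]
    rfl
  have hcomm : ∀ S ∈ l, ∀ T ∈ l, Commute S T := by
    have hab : ∀ i j k m x, K.a i (K.b j (K.a k (K.b m x))) = K.a k (K.b m (K.a i (K.b j x))) := by
      intro i j k m x
      rw [K.aba i k j, K.bab j m i]
    intro S hS T hT
    rcases hl S hS with ⟨i, j, rfl⟩ | rfl <;> rcases hl T hT with ⟨k, m, rfl⟩ | rfl
    · exact LinearMap.ext fun x => funext fun n => hab i j k m (x n)
    · refine LinearMap.ext fun x => funext fun n => ?_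
      change K.a i (K.b j (K.cU (x n))) = K.cU (K.a i (K.b j (x n)))
      rw [K.ca, K.cb]
    · refine LinearMap.ext fun x => funext fun n => ?_
      change K.cU (K.a k (K.b m (x n))) = K.a k (K.b m (K.cU (x n)))
      rw [K.ca, K.cb]
    · rfl
  obtain ⟨x, hx, hx', hT⟩ := exists_notMem_of_commute l hcomm
    (fun T hT => by
      rcases hl T hT with ⟨i, j, rfl⟩ | rfl
      · exact hnil _ (K.nil_ab i j)
      · exact hnil _ K.nil_cU)
    {x | (∀ i, x i ∈ M.SU) ∧ (∀ i ∉ J, x i = 0) ∧ ∀ i ∈ I, K.b 0 (x (i - 1)) - K.b 1 (x i) ∈ H.SL}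
    (Submodule.pi Set.univ fun _ => H.SU)
    (fun T hT x hx => by
      obtain ⟨h1, h2, h3⟩ := hx
      rcases hl T hT with ⟨i, j, rfl⟩ | rfl
      · refine ⟨fun n => M.a_mem i _ (M.b_mem j _ (h1 n)), fun n hn => ?_, fun n hn => ?_⟩
        · change K.a i (K.b j (x n)) = 0
          rw [h2 n hn, map_zero, map_zero]
        · change K.b 0 (K.a i (K.b j (x (n - 1)))) - K.b 1 (K.a i (K.b j (x n))) ∈ H.SL
          rw [K.bab 0 j i, K.bab 1 j i, ← map_sub, ← map_sub]
          exact H.b_mem _ _ (H.a_mem _ _ (h3 n hn))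
      · refine ⟨fun n => M.cU_mem _ (h1 n), fun n hn => ?_, fun n hn => ?_⟩
        · change K.cU (x n) = 0
          rw [h2 n hn, map_zero]
        · change K.b 0 (K.cU (x (n - 1))) - K.b 1 (K.cU (x n)) ∈ H.SL
          rw [← K.cb, ← K.cb, ← map_sub]
          exact H.cL_mem _ (h3 n hn))
    (fun T hT x hx n hn => by
      rcases hl T hT with ⟨i, j, rfl⟩ | rfl
      · exact H.a_mem _ _ (H.b_mem _ _ (hx n hn))
      · exact H.cU_mem _ (hx n hn))
    (by
      obtain ⟨x, hx, i, hi⟩ := h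
      exact ⟨x, hx, fun hc => hi (hc i trivial)⟩)
  refine ⟨x, hx, ?_, ?_, ?_⟩
  · by_contra hc
    push Not at hc
    exact hx' fun i _ => hc i
  · intro i j n
    have : (K.a i ∘ₗ K.b j : Module.End ℂ U).compLeft ℤ ∈ l := by
      refine List.mem_cons_of_mem _ (List.mem_map.2 ⟨(i, j), ?_, rfl⟩)
      fin_cases i <;> fin_cases j <;> simp
    exact hT _ this n trivial
  · intro n
    exact hT _ (.head _) n trivial

theorem killed_of_span {H : KSub K} {x : ℤ → U} (h1 : ∀ i j n, K.a i (K.b j (x n)) ∈ H.SU)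
    (h2 : ∀ n, K.cU (x n) ∈ H.SU) (I : Set ℤ) :
    (∀ i j, ∀ y ∈ Submodule.span ℂ (x '' I), K.a i (K.b j y) ∈ H.SU) ∧
      ∀ y ∈ Submodule.span ℂ (x '' I), K.cU y ∈ H.SU := by
  constructor
  · intro i j y hy
    have : Submodule.span ℂ (x '' I) ≤ H.SU.comap (K.a i ∘ₗ K.b j) := by
      rw [Submodule.span_le]
      rintro _ ⟨n, -, rfl⟩
      exact h1 i j n
    exact this hy
  · intro y hy
    have : Submodule.span ℂ (x '' I) ≤ H.SU.comap K.cU := by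
      rw [Submodule.span_le]
      rintro _ ⟨n, -, rfl⟩
      exact h2 n
    exact this hy

theorem mem_of_closed_string [FiniteDimensional ℂ L] [FiniteDimensional ℂ U] {θL θU : ℝ}
    {H M : KSub K} (hΘ : ∀ X : KSub K, H ≤ X → X ≤ M → X.theta θL θU ≤ H.theta θL θU)
    (hHM : H ≤ M) {p : ℤ} {N : ℕ} (hN : ClosedCond θL θU N) {x : ℤ → U} (hxM : ∀ i, x i ∈ M.SU)
    (hx : ∀ i, ¬ (p ≤ i ∧ i < p + N) → x i = 0)
    (h : ∀ i, K.b 0 (x (i - 1)) - K.b 1 (x i) ∈ H.SL) (i : ℤ) : x i ∈ H.SU := by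
  by_contra hi
  obtain ⟨x, ⟨h1, h2, h3⟩, ⟨n, hn⟩, h4, h5⟩ := exists_killed H M {i | p ≤ i ∧ i < p + N} Set.univ
    ⟨x, ⟨hxM, hx, fun i _ => h i⟩, i, hi⟩
  obtain ⟨h6, h7⟩ := killed_of_span h4 h5 Set.univ
  have h8 := theta_killed_le hΘ hHM (Submodule.span ℂ (x '' Set.univ))
    (by rw [Submodule.span_le]; rintro _ ⟨n, -, rfl⟩; exact h1 n) h6 h7
  rw [Submodule.map_span, ← Set.image_comp, Set.image_univ] at h8
  obtain ⟨h9, h10⟩ := closed_string_finrank (x := H.SU.mkQ ∘ x) (p := p) (N := N)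
    (B := H.SU.mapQ H.SL (K.b 0) (H.b_mem 0)) (B' := H.SU.mapQ H.SL (K.b 1) (H.b_mem 1))
    (fun i hi => by
      by_contra hc
      exact hi (by rw [Function.comp_apply, h2 i hc, map_zero]))
    (fun i => (Submodule.Quotient.eq H.SL).2 (h3 i trivial))
    ⟨n, fun hc => hn ((Submodule.Quotient.mk_eq_zero _).1 hc)⟩
  have h11 := hN.2 _ (by omega) h10
  have h12 := mul_le_mul_of_nonpos_left (Nat.cast_le (α := ℝ).2 h9) hN.1.le
  push_cast at h12
  linarith

theorem mem_of_open_string [FiniteDimensional ℂ L] [FiniteDimensional ℂ U] {θL θU : ℝ}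
    {H M : KSub K} (hΘ : ∀ X : KSub K, H ≤ X → X ≤ M → X.theta θL θU ≤ H.theta θL θU)
    (hHM : H ≤ M) {p : ℤ} {N : ℕ} (hN : OpenCond θL θU N) {x : ℤ → U} (hxM : ∀ i, x i ∈ M.SU)
    (hx : ∀ i, ¬ (p ≤ i ∧ i < p + N) → x i = 0)
    (h : ∀ i, p < i → i < p + N → K.b 0 (x (i - 1)) - K.b 1 (x i) ∈ H.SL) (i : ℤ) :
    x i ∈ H.SU := by
  by_contra hi
  obtain ⟨x, ⟨h1, h2, h3⟩, ⟨n, hn⟩, h4, h5⟩ := exists_killed H M {i | p ≤ i ∧ i < p + N}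
    {i | p < i ∧ i < p + N} ⟨x, ⟨hxM, hx, fun i hi => h i hi.1 hi.2⟩, i, hi⟩
  have hn' : p ≤ n ∧ n < p + N := by
    by_contra hc
    exact hn (by rw [h2 n hc]; exact H.SU.zero_mem)
  obtain ⟨h6, h7⟩ := killed_of_span h4 h5 ((fun k : ℕ => p + k) '' Set.Iio N)
  have h8 := theta_killed_le hΘ hHM (Submodule.span ℂ (x '' ((fun k : ℕ => p + k) '' Set.Iio N)))
    (by rw [Submodule.span_le]; rintro _ ⟨n, -, rfl⟩; exact h1 n) h6 h7
  rw [Submodule.map_span, ← Set.image_comp, ← Set.image_comp, Function.comp_assoc] at h8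
  have hmem : (H.SU.mkQ ∘ x ∘ fun k : ℕ => p + k) (n - p).toNat ∈ Submodule.span ℂ
      ((H.SU.mkQ ∘ x ∘ fun k : ℕ => p + k) '' Set.Iio N) :=
    Submodule.subset_span ⟨_, by rw [Set.mem_Iio]; omega, rfl⟩
  have hne : (H.SU.mkQ ∘ x ∘ fun k : ℕ => p + k) (n - p).toNat ≠ 0 := by
    have : p + ((n - p).toNat : ℤ) = n := by omega
    rw [Function.comp_apply, Function.comp_apply, this]
    exact fun hc => hn ((Submodule.Quotient.mk_eq_zero _).1 hc)
  have hpos : 0 < Module.finrank ℂ (Submodule.span ℂ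
      ((H.SU.mkQ ∘ x ∘ fun k : ℕ => p + k) '' Set.Iio N)) := by
    have : Nontrivial (Submodule.span ℂ ((H.SU.mkQ ∘ x ∘ fun k : ℕ => p + k) '' Set.Iio N)) :=
      ⟨⟨⟨_, hmem⟩, 0, fun hc => hne (congrArg Subtype.val hc)⟩⟩
    exact Module.finrank_pos
  have hpos' := Nat.cast_le (α := ℝ).2 (Nat.succ_le_of_lt hpos)
  push_cast at hpos'
  obtain ⟨c1, c2, c3⟩ := hN
  have hop := open_string_finrank (x := H.SU.mkQ ∘ x ∘ fun k : ℕ => p + k) (N := N)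
    (B := H.SU.mapQ H.SL (K.b 0) (H.b_mem 0)) (B' := H.SU.mapQ H.SL (K.b 1) (H.b_mem 1))
    (by omega) (fun i hi => (Submodule.Quotient.eq H.SL).2 (by
      have := h3 (p + (i + 1 : ℕ)) ⟨by push_cast; omega, by omega⟩
      rwa [show p + ((i + 1 : ℕ) : ℤ) - 1 = p + i by push_cast; ring] at this))
  rcases hop with ⟨h9, h10⟩ | h9
  · have h12 := mul_le_mul_of_nonpos_left (Nat.cast_le (α := ℝ).2 h10) c1.le
    push_cast at h12
    rw [h9] at h8
    linarith
  · have h12 := mul_le_mul_of_nonpos_left (Nat.cast_le (α := ℝ).2 h9) c1.le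
    have h13 : 0 < (θL + θU) * (Module.finrank ℂ (Submodule.span ℂ
      ((H.SU.mkQ ∘ x ∘ fun k : ℕ => p + k) '' Set.Iio N)) : ℝ) := mul_pos c2 (by linarith)
    linarith

end KSub

end

end LocalConifold

namespace LocalConifold

section

variable {L U : Type} [AddCommGroup L] [Module ℂ L] [AddCommGroup U] [Module ℂ U]

theorem isNilpotent_dualMap {T : Module.End ℂ L} (h : IsNilpotent T) :
    IsNilpotent (LinearMap.dualMap T : Module.End ℂ (Module.Dual ℂ L)) := by
  obtain ⟨n, hn⟩ := h
  refine ⟨n, ?_⟩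
  have h1 : ∀ n : ℕ, ∀ (f : Module.Dual ℂ L) x,
      ((LinearMap.dualMap T : Module.End ℂ (Module.Dual ℂ L)) ^ n) f x = f ((T ^ n) x) := by
    intro n
    induction n with
    | zero => exact fun f x => rfl
    | succ n ih =>
      intro f x
      rw [pow_succ, Module.End.mul_apply, ih, pow_succ', Module.End.mul_apply]
      rfl
  ext f x
  rw [h1, hn]
  exact map_zero f

namespace KRep

/-- The dual representation. The vertices and the arrows `b₁, b₂` are interchanged. -/
def dual (K : KRep L U) : KRep (Module.Dual ℂ U) (Module.Dual ℂ L) where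
  a i := (K.a i).dualMap
  b i := (K.b (Fin.rev i)).dualMap
  cL := K.cU.dualMap
  cU := K.cL.dualMap
  aba i j k f := LinearMap.ext fun x => congrArg f (K.aba j i _ x)
  bab i j k f := LinearMap.ext fun x => congrArg f (K.bab _ _ k x)
  ca i f := LinearMap.ext fun x => congrArg f (K.ca i x).symm
  cb i f := LinearMap.ext fun x => congrArg f (K.cb _ x).symm
  nil_ab i j := isNilpotent_dualMap (K.nil_ba i _)
  nil_ba i j := isNilpotent_dualMap (K.nil_ab i _)
  nil_cL := isNilpotent_dualMap K.nil_cU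
  nil_cU := isNilpotent_dualMap K.nil_cL

end KRep

namespace KSub

variable {K : KRep L U}

/-- The annihilator of a subrepresentation. -/
def perp (X : KSub K) : KSub K.dual where
  SL := X.SU.dualAnnihilator
  SU := X.SL.dualAnnihilator
  a_mem i f hf := (Submodule.mem_dualAnnihilator _).2 fun x hx =>
    (Submodule.mem_dualAnnihilator _).1 hf _ (X.a_mem i x hx)
  b_mem i f hf := (Submodule.mem_dualAnnihilator _).2 fun x hx =>
    (Submodule.mem_dualAnnihilator _).1 hf _ (X.b_mem _ x hx)
  cL_mem f hf := (Submodule.mem_dualAnnihilator _).2 fun x hx =>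
    (Submodule.mem_dualAnnihilator _).1 hf _ (X.cU_mem x hx)
  cU_mem f hf := (Submodule.mem_dualAnnihilator _).2 fun x hx =>
    (Submodule.mem_dualAnnihilator _).1 hf _ (X.cL_mem x hx)

/-- The subrepresentation annihilated by a subrepresentation of the dual. -/
def coperp (Z : KSub K.dual) : KSub K where
  SL := Z.SU.dualCoannihilator
  SU := Z.SL.dualCoannihilator
  a_mem i x hx := (Submodule.mem_dualCoannihilator _).2 fun f hf =>
    (Submodule.mem_dualCoannihilator _).1 hx _ (Z.a_mem i f hf)
  b_mem i x hx := (Submodule.mem_dualCoannihilator _).2 fun f hf => by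
    have := (Submodule.mem_dualCoannihilator _).1 hx _ (Z.b_mem (Fin.rev i) f hf)
    change f (K.b (Fin.rev (Fin.rev i)) x) = 0 at this
    rwa [Fin.rev_rev] at this
  cL_mem x hx := (Submodule.mem_dualCoannihilator _).2 fun f hf =>
    (Submodule.mem_dualCoannihilator _).1 hx _ (Z.cU_mem f hf)
  cU_mem x hx := (Submodule.mem_dualCoannihilator _).2 fun f hf =>
    (Submodule.mem_dualCoannihilator _).1 hx _ (Z.cL_mem f hf)

theorem theta_bot (θL θU : ℝ) : (⊥ : KSub K).theta θL θU = 0 := by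
  rw [theta, show (⊥ : KSub K).SL = ⊥ from rfl, show (⊥ : KSub K).SU = ⊥ from rfl, finrank_bot,
    finrank_bot]
  simp

theorem theta_top (θL θU : ℝ) : (⊤ : KSub K).theta θL θU =
    θL * Module.finrank ℂ L + θU * Module.finrank ℂ U := by
  rw [theta, show (⊤ : KSub K).SL = ⊤ from rfl, show (⊤ : KSub K).SU = ⊤ from rfl, finrank_top,
    finrank_top]

theorem theta_dual_le [FiniteDimensional ℂ L] [FiniteDimensional ℂ U] {θL θU : ℝ} {A : KSub K}
    (hA : ∀ X : KSub K, A ≤ X → X.theta θL θU ≤ (⊤ : KSub K).theta θL θU) (Z : KSub K.dual)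
    (hZ : Z ≤ A.perp) : Z.theta (-θU) (-θL) ≤ 0 := by
  have h := hA Z.coperp
    ⟨fun x hx => (Submodule.mem_dualCoannihilator _).2 fun f hf =>
      (Submodule.mem_dualAnnihilator _).1 (hZ.2 hf) x hx,
    fun x hx => (Submodule.mem_dualCoannihilator _).2 fun f hf =>
      (Submodule.mem_dualAnnihilator _).1 (hZ.1 hf) x hx⟩
  have h1 := Subspace.finrank_add_finrank_dualCoannihilator_eq Z.SL
  have h2 := Subspace.finrank_add_finrank_dualCoannihilator_eq Z.SU
  rw [theta_top, theta, ← h1, ← h2] at h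
  rw [theta]
  change θL * (Module.finrank ℂ Z.SU.dualCoannihilator : ℝ) +
    θU * (Module.finrank ℂ Z.SL.dualCoannihilator : ℝ) ≤ _ at h
  push_cast at h
  linarith

/-- Functional chains which vanish on a destabilising subrepresentation vanish. -/
theorem eq_zero_of_chain_closed [FiniteDimensional ℂ L] [FiniteDimensional ℂ U] {θL θU : ℝ}
    {A : KSub K} (hA : ∀ X : KSub K, A ≤ X → X.theta θL θU ≤ (⊤ : KSub K).theta θL θU)
    {p : ℤ} {N : ℕ} (hN : ClosedCond (-θU) (-θL) N) {f : ℤ → Module.Dual ℂ L}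
    (hfA : ∀ i, ∀ x ∈ A.SL, f i x = 0) (hf : ∀ i, ¬ (p ≤ i ∧ i < p + N) → f i = 0)
    (h : ∀ i u, f i (K.b 0 u) = f (i - 1) (K.b 1 u)) (i : ℤ) : f i = 0 := by
  have := mem_of_closed_string (K := K.dual) (H := ⊥) (M := A.perp)
    (fun X _ hX => by rw [theta_bot]; exact theta_dual_le hA X hX) ⟨bot_le, bot_le⟩ hN
    (x := f) (fun i => (Submodule.mem_dualAnnihilator _).2 (hfA i)) hf
    (fun i => by
      rw [show (⊥ : KSub K.dual).SL = ⊥ from rfl, Submodule.mem_bot, sub_eq_zero]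
      exact LinearMap.ext fun u => (h i u).symm) i
  exact this

theorem eq_zero_of_chain_open [FiniteDimensional ℂ L] [FiniteDimensional ℂ U] {θL θU : ℝ}
    {A : KSub K} (hA : ∀ X : KSub K, A ≤ X → X.theta θL θU ≤ (⊤ : KSub K).theta θL θU)
    {p : ℤ} {N : ℕ} (hN : OpenCond (-θU) (-θL) N) {f : ℤ → Module.Dual ℂ L}
    (hfA : ∀ i, ∀ x ∈ A.SL, f i x = 0) (hf : ∀ i, ¬ (p ≤ i ∧ i < p + N) → f i = 0)
    (h : ∀ i u, p < i → i < p + N → f i (K.b 0 u) = f (i - 1) (K.b 1 u)) (i : ℤ) : f i = 0 := by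
  have := mem_of_open_string (K := K.dual) (H := ⊥) (M := A.perp)
    (fun X _ hX => by rw [theta_bot]; exact theta_dual_le hA X hX) ⟨bot_le, bot_le⟩ hN
    (x := f) (fun i => (Submodule.mem_dualAnnihilator _).2 (hfA i)) hf
    (fun i hi hi' => by
      rw [show (⊥ : KSub K.dual).SL = ⊥ from rfl, Submodule.mem_bot, sub_eq_zero]
      exact LinearMap.ext fun u => (h i u hi hi').symm) i
  exact this

end KSub

/-- The index set of the mutation `ρ`. -/
noncomputable def idx (ρ : ℤ) : Finset ℤ := Finset.Icc 0 ρ ∪ Finset.Ioo ρ 0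

theorem mem_idx {ρ i : ℤ} : i ∈ idx ρ ↔ (0 ≤ i ∧ i ≤ ρ) ∨ (ρ < i ∧ i < 0) := by
  simp [idx]

/-- The numerical conditions for the mutation `ρ`. -/
def GoodIdx (θL θU : ℝ) (ρ : ℤ) : Prop :=
  (0 ≤ ρ ∧ ClosedCond θL θU ρ.toNat ∧ OpenCond (-θU) (-θL) (ρ + 1).toNat) ∨
    (ρ < 0 ∧ OpenCond θL θU (-ρ).toNat ∧ ClosedCond (-θU) (-θL) (-ρ - 1).toNat)

/-- Chains of linear functionals. -/
structure IsChain (K : KRep L U) (ρ : ℤ) (f : ℤ → Module.Dual ℂ L) : Prop where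
  eq_zero : ∀ i ∉ idx ρ, f i = 0
  comm : ∀ i ∈ idx (ρ - 1), ∀ u, f (i + 1) (K.b 0 u) = f i (K.b 1 u)

/-- Chains of elements are determined modulo a subrepresentation by their images. -/
theorem mem_of_chain [FiniteDimensional ℂ L] [FiniteDimensional ℂ U] {K : KRep L U} {θL θU : ℝ}
    {ρ : ℤ} (hρ : GoodIdx θL θU ρ) {H : KSub K}
    (hΘ : ∀ X : KSub K, H ≤ X → X.theta θL θU ≤ H.theta θL θU) {x : ℤ → U}
    (hx : ∀ i ∉ idx (ρ - 1), x i = 0)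
    (h : ∀ i ∈ idx ρ, K.b 0 (x (i - 1)) - K.b 1 (x i) ∈ H.SL) (i : ℤ) : x i ∈ H.SU := by
  rcases hρ with ⟨h0, h1, -⟩ | ⟨h0, h1, -⟩
  · refine KSub.mem_of_closed_string (M := ⊤) (p := 0) (fun X hX _ => hΘ X hX) ⟨le_top, le_top⟩ h1
      (fun i => Submodule.mem_top) (fun i hi => hx i (by rw [mem_idx]; omega)) (fun i => ?_) i
    by_cases hi : i ∈ idx ρ
    · exact h i hi
    · rw [hx i (by rw [mem_idx] at *; omega), hx (i - 1) (by rw [mem_idx] at *; omega), map_zero,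
        map_zero, sub_zero]
      exact H.SL.zero_mem
  · exact KSub.mem_of_open_string (M := ⊤) (p := ρ) (fun X hX _ => hΘ X hX) ⟨le_top, le_top⟩ h1
      (fun i => Submodule.mem_top) (fun i hi => hx i (by rw [mem_idx]; omega))
      (fun i hi hi' => h i (by rw [mem_idx]; omega)) i

theorem IsChain.eq_zero_of_vanish [FiniteDimensional ℂ L] [FiniteDimensional ℂ U] {K : KRep L U}
    {θL θU : ℝ} {ρ : ℤ} (hρ : GoodIdx θL θU ρ) {A : KSub K}
    (hA : ∀ X : KSub K, A ≤ X → X.theta θL θU ≤ (⊤ : KSub K).theta θL θU)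
    {f : ℤ → Module.Dual ℂ L} (hf : IsChain K ρ f) (hfA : ∀ i, ∀ x ∈ A.SL, f i x = 0) (i : ℤ) :
    f i = 0 := by
  rcases hρ with ⟨h0, -, h1⟩ | ⟨h0, -, h1⟩
  · refine KSub.eq_zero_of_chain_open (p := 0) hA h1 hfA (fun i hi => hf.eq_zero i ?_)
      (fun i u hi hi' => ?_) i
    · rw [mem_idx]; omega
    · have := hf.comm (i - 1) (by rw [mem_idx]; omega) u
      rwa [sub_add_cancel] at this
  · refine KSub.eq_zero_of_chain_closed (p := ρ + 1) hA h1 hfA (fun i hi => hf.eq_zero i ?_)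
      (fun i u => ?_) i
    · rw [mem_idx]; omega
    · by_cases hi : i - 1 ∈ idx (ρ - 1)
      · have := hf.comm (i - 1) hi u
        rwa [sub_add_cancel] at this
      · rw [hf.eq_zero i (by rw [mem_idx] at *; omega), hf.eq_zero (i - 1) (by rw [mem_idx] at *; omega)]
        rfl

end

end LocalConifold

namespace LocalConifold

open WQuiver

/-- A space which is spanned by vectors which are shifted by an operator (defined on the dual)
and which finally vanish. -/
theorem exists_finrank_eq_of_shift {W : Type*} [AddCommGroup W] [Module ℂ W]
    [FiniteDimensional ℂ W] (w : ℕ → W)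
    (hspan : ∀ g : Module.Dual ℂ W, (∀ n, g (w n) = 0) → g = 0)
    (hshift : ∀ g : Module.Dual ℂ W, ∃ g' : Module.Dual ℂ W, ∀ n, g' (w n) = g (w (n + 1)))
    (hzero : ∃ n, w n = 0) :
    ∃ h : ℕ, Module.finrank ℂ W = h ∧ ∀ n, w n = 0 ↔ h ≤ n := by
  classical
  have hsucc : ∀ n, w n = 0 → w (n + 1) = 0 := by
    intro n hn
    rw [← Module.forall_dual_apply_eq_zero_iff ℂ]
    intro g
    obtain ⟨g', hg'⟩ := hshift g
    rw [← hg', hn, map_zero]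
  have hle : ∀ n k, w n = 0 → w (n + k) = 0 := by
    intro n k hn
    induction k with
    | zero => exact hn
    | succ k ih => exact hsucc _ ih
  refine ⟨Nat.find hzero, ?_, fun n => ⟨fun hn => Nat.find_le hn, fun hn => ?_⟩⟩
  · set h := Nat.find hzero with hh
    have hker : LinearMap.ker (Finsupp.linearCombination ℂ w) ⊓
        Finsupp.supported ℂ ℂ (Set.Iio h) = ⊥ := by
      rw [eq_bot_iff]
      rintro l ⟨hl, hl'⟩
      rw [Submodule.mem_bot]
      by_contra hl0
      have hk : ∀ k, Finsupp.linearCombination ℂ (fun n => w (n + k)) l = 0 := by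
        intro k
        induction k with
        | zero => exact hl
        | succ k ih =>
          rw [← Module.forall_dual_apply_eq_zero_iff ℂ]
          intro g
          obtain ⟨g', hg'⟩ := hshift g
          have := congrArg g' ih
          rw [map_zero, Finsupp.linearCombination_apply, map_finsuppSum] at this
          rw [Finsupp.linearCombination_apply, map_finsuppSum, ← this]
          refine Finset.sum_congr rfl fun n _ => ?_
          dsimp only
          rw [map_smul, map_smul, hg', add_assoc]
      have hne := Finsupp.support_nonempty_iff.2 hl0
      set n₀ := l.support.min' hne with hn₀
      have hmem : n₀ ∈ l.support := Finset.min'_mem _ _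
      have hlt : n₀ < h := hl' hmem
      have h1 := hk (h - 1 - n₀)
      rw [Finsupp.linearCombination_apply, Finsupp.sum, Finset.sum_eq_single_of_mem n₀ hmem] at h1
      · rcases smul_eq_zero.1 h1 with h2 | h2
        · exact (Finsupp.mem_support_iff.1 hmem) h2
        · rw [show n₀ + (h - 1 - n₀) = h - 1 by omega] at h2
          exact Nat.find_min hzero (by omega) h2
      · intro n hn hne
        have h3 : n₀ < n := lt_of_le_of_ne (Finset.min'_le _ _ hn) (Ne.symm hne)
        have h4 := hle h (n + (h - 1 - n₀) - h) (Nat.find_spec hzero)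
        rw [show h + (n + (h - 1 - n₀) - h) = n + (h - 1 - n₀) by omega] at h4
        rw [h4, smul_zero]
    have h1 := finrank_map_add_finrank_ker (Finsupp.linearCombination ℂ w)
      (Finsupp.supported ℂ ℂ (Set.Iio h))
    rw [hker, finrank_bot, finrank_supported, add_zero,
      ← Finsupp.span_image_eq_map_linearCombination] at h1
    have htop : Submodule.span ℂ (w '' Set.Iio h) = ⊤ := by
      rw [← Subspace.dualAnnihilator_inj, Submodule.dualAnnihilator_top, eq_bot_iff]
      intro g hg
      refine hspan g fun n => ?_
      by_cases hn : n < h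
      · exact (Submodule.mem_dualAnnihilator g).1 hg _ (Submodule.subset_span ⟨n, hn, rfl⟩)
      · have := hle h (n - h) (Nat.find_spec hzero)
        rw [show h + (n - h) = n by omega] at this
        rw [this, map_zero]
    rw [← finrank_top ℂ W, ← htop, h1]
  · have := hle (Nat.find hzero) (n - Nat.find hzero) (Nat.find_spec hzero)
    rwa [show Nat.find hzero + (n - Nat.find hzero) = n by omega] at this

/-- The monomials of the arrows from the framed vertex to the vertex at the level `m`:
the exponents of a monomial of weight `w` with `e` loops are non-negative. -/
def dom (m : ℤ) (w : Weight) (e : ℤ) : Prop :=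
  0 ≤ e ∧ 0 ≤ w 1 + e ∧ 0 ≤ w 2 + e ∧ 0 ≤ w 1 + w 2 - w 0 - m + e ∧ 0 ≤ w 0 + e

/-- The weight of the product of the four arrows `a₁, a₂, b₁, b₂`. -/
def one : Weight := tw 0 + tw 1 + tw 2

/-- Graded framed representations, given by the projections to the weight spaces and by the
images of the framing under the monomials in the arrows. The first vertex has the level `j₀`. -/
structure GRep (j₀ : ℤ) (L U : Type) [AddCommGroup L] [Module ℂ L] [AddCommGroup U]
    [Module ℂ U] extends KRep L U where
  prL : Weight → Module.End ℂ L
  prU : Weight → Module.End ℂ U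
  prL_prL : ∀ w x, prL w (prL w x) = prL w x
  prU_prU : ∀ w x, prU w (prU w x) = prU w x
  prL_ne : ∀ w w' x, w ≠ w' → prL w (prL w' x) = 0
  prU_ne : ∀ w w' x, w ≠ w' → prU w (prU w' x) = 0
  sumL : ∃ S : Finset Weight, ∀ x, ∑ w ∈ S, prL w x = x
  sumU : ∃ S : Finset Weight, ∀ x, ∑ w ∈ S, prU w x = x
  prL_b : ∀ i w x, prL (w + ![0, tw 0] i) (b i x) = b i (prU w x)
  prU_a : ∀ i w x, prU (w + ![tw 1, tw 2] i) (a i x) = a i (prL w x)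
  prL_c : ∀ w x, prL (w - one) (cL x) = cL (prL w x)
  prU_c : ∀ w x, prU (w - one) (cU x) = cU (prU w x)
  mL : Weight → ℤ → L
  mU : Weight → ℤ → U
  prL_mL : ∀ w e, dom j₀ w e → prL w (mL w e) = mL w e
  prU_mU : ∀ w e, dom (j₀ + 1) w e → prU w (mU w e) = mU w e
  a_mL : ∀ i w e, dom j₀ w e → a i (mL w e) = mU (w + ![tw 1, tw 2] i) e
  b_mU : ∀ i w e, dom (j₀ + 1) w e → b i (mU w e) = mL (w + ![0, tw 0] i) e
  cL_mL : ∀ w e, dom j₀ w e → cL (mL w e) = mL (w - one) (e + 1)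
  cU_mU : ∀ w e, dom (j₀ + 1) w e → cU (mU w e) = mU (w - one) (e + 1)

theorem dom_a {m : ℤ} {w : Weight} {e : ℤ} (h : dom m w e) (i : Fin 2) :
    dom (m + 1) (w + ![tw 1, tw 2] i) e := by
  unfold dom at *
  fin_cases i <;> simp [tw_apply] <;> omega

theorem dom_b {m : ℤ} {w : Weight} {e : ℤ} (h : dom (m + 1) w e) (i : Fin 2) :
    dom m (w + ![0, tw 0] i) e := by
  unfold dom at *
  fin_cases i <;> simp [tw_apply] <;> omega

theorem dom_c {m : ℤ} {w : Weight} {e : ℤ} (h : dom m w e) : dom m (w - one) (e + 1) := by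
  unfold dom at *
  simp [one, tw_apply]
  omega

theorem map_mem_span {E F : Type*} [AddCommGroup E] [Module ℂ E] [AddCommGroup F] [Module ℂ F]
    (T : E →ₗ[ℂ] F) {s : Set E} {t : Set F} (h : ∀ x ∈ s, T x ∈ Submodule.span ℂ t) :
    ∀ x ∈ Submodule.span ℂ s, T x ∈ Submodule.span ℂ t :=
  (Submodule.span_le (p := (Submodule.span ℂ t).comap T)).2 h

namespace GRep

variable {L U : Type} [AddCommGroup L] [Module ℂ L] [AddCommGroup U] [Module ℂ U] {j₀ : ℤ}

/-- The subrepresentation generated by the framing. -/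
def gen (K : GRep j₀ L U) : KSub K.toKRep where
  SL := Submodule.span ℂ {x | ∃ w e, dom j₀ w e ∧ K.mL w e = x}
  SU := Submodule.span ℂ {x | ∃ w e, dom (j₀ + 1) w e ∧ K.mU w e = x}
  a_mem i := map_mem_span _ <| by
    rintro _ ⟨w, e, h, rfl⟩
    exact Submodule.subset_span ⟨_, _, dom_a h i, (K.a_mL i w e h).symm⟩
  b_mem i := map_mem_span _ <| by
    rintro _ ⟨w, e, h, rfl⟩
    exact Submodule.subset_span ⟨_, _, dom_b h i, (K.b_mU i w e h).symm⟩
  cL_mem := map_mem_span _ <| by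
    rintro _ ⟨w, e, h, rfl⟩
    exact Submodule.subset_span ⟨_, _, dom_c h, (K.cL_mL w e h).symm⟩
  cU_mem := map_mem_span _ <| by
    rintro _ ⟨w, e, h, rfl⟩
    exact Submodule.subset_span ⟨_, _, dom_c h, (K.cU_mU w e h).symm⟩

/-- Semistability. -/
structure Semistable (K : GRep j₀ L U) (θL θU : ℝ) : Prop where
  theta_le_zero : ∀ X : KSub K.toKRep, X.theta θL θU ≤ 0
  theta_le_top : ∀ X : KSub K.toKRep, K.gen ≤ X → X.theta θL θU ≤ (⊤ : KSub K.toKRep).theta θL θU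

variable (K : GRep j₀ L U)

theorem finite_prL : {w | K.prL w ≠ 0}.Finite := by
  obtain ⟨S, hS⟩ := K.sumL
  refine S.finite_toSet.subset fun w hw => ?_
  by_contra hc
  refine hw (LinearMap.ext fun x => ?_)
  rw [← hS x, map_sum]
  exact Finset.sum_eq_zero fun w' hw' => K.prL_ne _ _ _ fun h => hc (h ▸ hw')

theorem finite_prU : {w | K.prU w ≠ 0}.Finite := by
  obtain ⟨S, hS⟩ := K.sumU
  refine S.finite_toSet.subset fun w hw => ?_
  by_contra hc
  refine hw (LinearMap.ext fun x => ?_)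
  rw [← hS x, map_sum]
  exact Finset.sum_eq_zero fun w' hw' => K.prU_ne _ _ _ fun h => hc (h ▸ hw')

/-- The graded dimension at the first vertex. -/
noncomputable def gL : KT :=
  Finsupp.ofSupportFinite (fun w => (Module.finrank ℂ (LinearMap.range (K.prL w)) : ℤ))
    (K.finite_prL.subset fun w hw hc => hw (by
      dsimp only
      rw [hc, LinearMap.range_zero, finrank_bot]
      rfl))

/-- The graded dimension at the second vertex. -/
noncomputable def gU : KT :=
  Finsupp.ofSupportFinite (fun w => (Module.finrank ℂ (LinearMap.range (K.prU w)) : ℤ))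
    (K.finite_prU.subset fun w hw hc => hw (by
      dsimp only
      rw [hc, LinearMap.range_zero, finrank_bot]
      rfl))

/-- The class of the monomial with `e` loops vanishes in the mutation `ρ` at the weight `y`. -/
def van (ρ : ℤ) (y : Weight) (e : ℤ) : Prop :=
  ∀ f : ℤ → Module.Dual ℂ L, IsChain K.toKRep ρ f → ∀ i ∈ idx ρ,
    dom j₀ (y - i • tw 0) e → f i (K.mL (y - i • tw 0) e) = 0

variable {K}

theorem chain_step {ρ : ℤ} {f : ℤ → Module.Dual ℂ L} (hf : IsChain K.toKRep ρ f) {i : ℤ}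
    (hi : i ∈ idx (ρ - 1)) {y : Weight} {e : ℤ} (h : dom (j₀ + 1) (y - (i + 1) • tw 0) e) :
    f (i + 1) (K.mL (y - (i + 1) • tw 0) e) = f i (K.mL (y - i • tw 0) e) := by
  have h1 := K.b_mU 0 _ _ h
  have h2 := K.b_mU 1 _ _ h
  rw [show y - (i + 1) • tw 0 + ![0, tw 0] 0 = y - (i + 1) • tw 0 from add_zero _] at h1
  rw [show y - (i + 1) • tw 0 + ![0, tw 0] 1 = y - i • tw 0 by
    rw [Matrix.cons_val_one, Matrix.cons_val_fin_one, add_smul, one_smul]; abel] at h2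
  rw [← h1, ← h2]
  exact hf.comm i hi _

theorem dom_sub_smul {m : ℤ} {y : Weight} {i e : ℤ} : dom m (y - i • tw 0) e ↔
    0 ≤ e ∧ 0 ≤ y 1 + e ∧ 0 ≤ y 2 + e ∧ 0 ≤ y 1 + y 2 - (y 0 - i) - m + e ∧ 0 ≤ y 0 - i + e := by
  simp [dom, tw_apply]

theorem chain_indep {ρ : ℤ} {f : ℤ → Module.Dual ℂ L} (hf : IsChain K.toKRep ρ f) {i i' : ℤ}
    (hi : i ∈ idx ρ) (hi' : i' ∈ idx ρ) {y : Weight} {e : ℤ} (h : dom j₀ (y - i • tw 0) e)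
    (h' : dom j₀ (y - i' • tw 0) e) :
    f i (K.mL (y - i • tw 0) e) = f i' (K.mL (y - i' • tw 0) e) := by
  wlog hle : i ≤ i' generalizing i i'
  · exact (this hi' hi h' h (le_of_not_ge hle)).symm
  have h1 : ∀ n : ℕ, i + n ≤ i' → f (i + n) (K.mL (y - (i + n) • tw 0) e) =
      f i (K.mL (y - i • tw 0) e) := by
    intro n
    induction n with
    | zero => intro _; simp
    | succ n ih =>
      intro hn
      push_cast at hn
      rw [← ih (by omega)]
      push_cast
      rw [← add_assoc]
      refine chain_step hf ?_ ?_
      · rw [mem_idx] at *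
        omega
      · rw [dom_sub_smul] at *
        omega
  have := h1 (i' - i).toNat (by omega)
  rw [show i + ((i' - i).toNat : ℤ) = i' by omega] at this
  exact this.symm

theorem van_of_pos {ρ : ℤ} (hρ : ρ < 0) {y : Weight} {e : ℤ}
    (h : 0 ≤ y 0 + e ∨ 0 ≤ y 1 + y 2 - y 0 - (j₀ - ρ) + e) : K.van ρ y e := by
  intro f hf i hi hd
  rcases h with h | h
  · have h1 : ∀ n : ℕ, ∀ i ∈ idx ρ, i = - (n + 1) → dom j₀ (y - i • tw 0) e →
        f i (K.mL (y - i • tw 0) e) = 0 := by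
      intro n
      induction n with
      | zero =>
        intro i hi hin hd
        rw [← chain_step hf (by rw [mem_idx] at *; omega) (by rw [dom_sub_smul] at *; omega),
          hf.eq_zero (i + 1) (by rw [mem_idx]; omega)]
        rfl
      | succ n ih =>
        intro i hi hin hd
        push_cast at hin
        rw [← chain_step hf (by rw [mem_idx] at *; omega) (by rw [dom_sub_smul] at *; omega)]
        exact ih _ (by rw [mem_idx] at *; omega) (by omega) (by rw [dom_sub_smul] at *; omega)
    exact h1 (-i - 1).toNat i hi (by rw [mem_idx] at hi; omega) hd
  · have h1 : ∀ n : ℕ, ∀ i ∈ idx ρ, i = ρ + (n + 1) → dom j₀ (y - i • tw 0) e →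
        f i (K.mL (y - i • tw 0) e) = 0 := by
      intro n
      induction n with
      | zero =>
        intro i hi hin hd
        have := chain_step hf (K := K) (i := i - 1) (y := y) (e := e)
          (by rw [mem_idx] at *; omega) (by rw [dom_sub_smul] at *; omega)
        rw [sub_add_cancel] at this
        rw [this, hf.eq_zero (i - 1) (by rw [mem_idx]; omega)]
        rfl
      | succ n ih =>
        intro i hi hin hd
        push_cast at hin
        have := chain_step hf (K := K) (i := i - 1) (y := y) (e := e)
          (by rw [mem_idx] at *; omega) (by rw [dom_sub_smul] at *; omega)
        rw [sub_add_cancel] at this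
        rw [this]
        exact ih _ (by rw [mem_idx] at *; omega) (by omega) (by rw [dom_sub_smul] at *; omega)
    exact h1 (i - ρ - 1).toNat i hi (by rw [mem_idx] at hi; omega) hd

end GRep

end LocalConifold

namespace LocalConifold

open WQuiver

namespace GRep

variable {L U : Type} [AddCommGroup L] [Module ℂ L] [AddCommGroup U] [Module ℂ U] {j₀ : ℤ}
variable (K : GRep j₀ L U) (ρ : ℤ) (y : Weight)

/-- The source of the map whose cokernel is the mutation. -/
abbrev ChainU : Type := (i : idx (ρ - 1)) → LinearMap.range (K.prU (y - ((i : ℤ) + 1) • tw 0))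

/-- The target of the map whose cokernel is the mutation. -/
abbrev ChainL : Type := (i : idx ρ) → LinearMap.range (K.prL (y - (i : ℤ) • tw 0))

open Classical in
/-- The element of a chain with index `i`. -/
noncomputable def extU (i : ℤ) : ChainU K ρ y →ₗ[ℂ] U :=
  if h : i ∈ idx (ρ - 1) then
    (LinearMap.range (K.prU (y - (i + 1) • tw 0))).subtype ∘ₗ LinearMap.proj (⟨i, h⟩ : idx (ρ - 1))
  else 0

theorem extU_of_mem {i : ℤ} (h : i ∈ idx (ρ - 1)) (u : ChainU K ρ y) :
    extU K ρ y i u = u ⟨i, h⟩ := by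
  rw [extU, dif_pos h]
  rfl

theorem extU_of_notMem {i : ℤ} (h : i ∉ idx (ρ - 1)) (u : ChainU K ρ y) : extU K ρ y i u = 0 := by
  rw [extU, dif_neg h]
  rfl

theorem prU_extU (i : ℤ) (u : ChainU K ρ y) :
    K.prU (y - (i + 1) • tw 0) (extU K ρ y i u) = extU K ρ y i u := by
  by_cases h : i ∈ idx (ρ - 1)
  · rw [extU_of_mem K ρ y h]
    obtain ⟨x, hx⟩ := (u ⟨i, h⟩).2
    rw [← hx, K.prU_prU]
  · rw [extU_of_notMem K ρ y h, map_zero]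

variable {K ρ y} in
theorem prL_b0 (i : ℤ) (u : U) : K.prL (y - i • tw 0) (K.b 0 u) = K.b 0 (K.prU (y - i • tw 0) u) := by
  have := K.prL_b 0 (y - i • tw 0) u
  rwa [show y - i • tw 0 + ![0, tw 0] 0 = y - i • tw 0 from add_zero _] at this

variable {K ρ y} in
theorem prL_b1 (i : ℤ) (u : U) :
    K.prL (y - i • tw 0) (K.b 1 u) = K.b 1 (K.prU (y - (i + 1) • tw 0) u) := by
  have := K.prL_b 1 (y - (i + 1) • tw 0) u
  rwa [show y - (i + 1) • tw 0 + ![0, tw 0] 1 = y - i • tw 0 by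
    rw [Matrix.cons_val_one, Matrix.cons_val_fin_one, add_smul, one_smul]; abel] at this

/-- The map whose cokernel is the mutation. -/
noncomputable def chainMap : ChainU K ρ y →ₗ[ℂ] ChainL K ρ y :=
  LinearMap.pi fun k => LinearMap.codRestrict _
    (K.b 0 ∘ₗ extU K ρ y ((k : ℤ) - 1) - K.b 1 ∘ₗ extU K ρ y k) fun u => by
      refine ⟨K.b 0 (extU K ρ y ((k : ℤ) - 1) u) - K.b 1 (extU K ρ y k u), ?_⟩
      have h1 := prU_extU K ρ y ((k : ℤ) - 1) u
      rw [sub_add_cancel] at h1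
      rw [map_sub, prL_b0, prL_b1, h1, prU_extU]
      rfl

theorem chainMap_apply (u : ChainU K ρ y) (k : idx ρ) : (chainMap K ρ y u k : L) =
    K.b 0 (extU K ρ y ((k : ℤ) - 1) u) - K.b 1 (extU K ρ y k u) := rfl

/-- The pairing of chains of functionals and chains of elements. -/
noncomputable def chainPair (f : ℤ → Module.Dual ℂ L) : Module.Dual ℂ (ChainL K ρ y) :=
  ∑ i : idx ρ, f i ∘ₗ (LinearMap.range (K.prL (y - (i : ℤ) • tw 0))).subtype ∘ₗ LinearMap.proj i

theorem chainPair_apply (f : ℤ → Module.Dual ℂ L) (x : ChainL K ρ y) :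
    chainPair K ρ y f x = ∑ i : idx ρ, f i (x i : L) := by
  rw [chainPair, LinearMap.sum_apply]
  rfl

theorem chainPair_single (f : ℤ → Module.Dual ℂ L) (i : idx ρ)
    (x : LinearMap.range (K.prL (y - (i : ℤ) • tw 0))) :
    chainPair K ρ y f (LinearMap.single ℂ _ i x) = f i x := by
  classical
  rw [chainPair_apply, Finset.sum_eq_single_of_mem i (Finset.mem_univ i)]
  · rw [LinearMap.single_apply, Pi.single_eq_same]
  · intro j _ hj
    rw [LinearMap.single_apply, Pi.single_eq_of_ne hj]
    exact map_zero _

theorem chainPair_chainMap {f : ℤ → Module.Dual ℂ L} (hf : ∀ i ∉ idx ρ, f i = 0)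
    (u : ChainU K ρ y) : chainPair K ρ y f (chainMap K ρ y u) =
      ∑ i ∈ idx (ρ - 1), (f (i + 1) (K.b 0 (extU K ρ y i u)) - f i (K.b 1 (extU K ρ y i u))) := by
  rw [chainPair_apply]
  simp only [chainMap_apply, map_sub]
  rw [Finset.sum_coe_sort (idx ρ) fun k => f k (K.b 0 (extU K ρ y (k - 1) u)) -
    f k (K.b 1 (extU K ρ y k u)), Finset.sum_sub_distrib, Finset.sum_sub_distrib]
  congr 1
  · rw [← finsum_eq_sum_of_support_subset (s := idx ρ), ← finsum_eq_sum_of_support_subset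
      (s := idx (ρ - 1)), ← finsum_comp_equiv (Equiv.addRight (1 : ℤ))]
    · simp only [Equiv.coe_addRight, add_sub_cancel_right]
    · intro i hi
      by_contra hc
      exact hi (by simp only [extU_of_notMem K ρ y hc, map_zero])
    · intro i hi
      by_contra hc
      exact hi (by simp only [hf i hc, LinearMap.zero_apply])
  · rw [← finsum_eq_sum_of_support_subset (s := idx ρ), ← finsum_eq_sum_of_support_subset
      (s := idx (ρ - 1))]
    · intro i hi
      by_contra hc
      exact hi (by simp only [extU_of_notMem K ρ y hc, map_zero])
    · intro i hi
      by_contra hc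
      exact hi (by simp only [hf i hc, LinearMap.zero_apply])

open Classical in
/-- The chain of functionals of a functional. -/
noncomputable def toChain (g : Module.Dual ℂ (ChainL K ρ y)) (i : ℤ) : Module.Dual ℂ L :=
  if h : i ∈ idx ρ then
    g ∘ₗ LinearMap.single ℂ (fun i : idx ρ => LinearMap.range (K.prL (y - (i : ℤ) • tw 0))) ⟨i, h⟩ ∘ₗ
      (K.prL (y - i • tw 0)).rangeRestrict
  else 0

theorem toChain_prL (g : Module.Dual ℂ (ChainL K ρ y)) (i : ℤ) (x : L) :
    toChain K ρ y g i (K.prL (y - i • tw 0) x) = toChain K ρ y g i x := by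
  rw [toChain]
  split_ifs
  · rw [LinearMap.comp_apply, LinearMap.comp_apply, LinearMap.comp_apply, LinearMap.comp_apply]
    congr 2
    exact Subtype.ext (K.prL_prL _ _)
  · rfl

theorem toChain_of_notMem (g : Module.Dual ℂ (ChainL K ρ y)) {i : ℤ} (hi : i ∉ idx ρ) :
    toChain K ρ y g i = 0 := by
  rw [toChain, dif_neg hi]

theorem chainPair_toChain (g : Module.Dual ℂ (ChainL K ρ y)) :
    chainPair K ρ y (toChain K ρ y g) = g := by
  classical
  refine LinearMap.pi_ext' fun i => LinearMap.ext fun x => ?_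
  rw [LinearMap.comp_apply, LinearMap.comp_apply, chainPair_single, toChain, dif_pos i.2]
  rw [LinearMap.comp_apply, LinearMap.comp_apply]
  congr 2
  obtain ⟨z, hz⟩ := x.2
  refine Subtype.ext ?_
  rw [LinearMap.codRestrict_apply, ← hz, K.prL_prL]

theorem isChain_toChain (g : Module.Dual ℂ (ChainL K ρ y))
    (hg : ∀ u, g (chainMap K ρ y u) = 0) : IsChain K.toKRep ρ (toChain K ρ y g) := by
  classical
  refine ⟨fun i hi => toChain_of_notMem K ρ y g hi, fun i hi u => ?_⟩
  have h := hg (LinearMap.single ℂ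
    (fun i : idx (ρ - 1) => LinearMap.range (K.prU (y - ((i : ℤ) + 1) • tw 0))) ⟨i, hi⟩
    ⟨K.prU (y - (i + 1) • tw 0) u, u, rfl⟩)
  rw [← chainPair_toChain K ρ y g, chainPair_chainMap K ρ y fun i hi =>
    toChain_of_notMem K ρ y g hi, Finset.sum_eq_single_of_mem i hi] at h
  · rw [extU_of_mem K ρ y hi, LinearMap.single_apply, Pi.single_eq_same, sub_eq_zero] at h
    rw [← toChain_prL, ← toChain_prL K ρ y g i, prL_b0, prL_b1]
    exact h
  · intro j hj hne
    rw [extU_of_mem K ρ y hj, LinearMap.single_apply, Pi.single_eq_of_ne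
      (fun hc => hne (congrArg Subtype.val hc))]
    simp

variable {K ρ y}

theorem chainMap_injective [FiniteDimensional ℂ L] [FiniteDimensional ℂ U] {θL θU : ℝ}
    (hK : K.Semistable θL θU) (hρ : GoodIdx θL θU ρ) : Function.Injective (chainMap K ρ y) := by
  rw [injective_iff_map_eq_zero]
  intro u hu
  have h := mem_of_chain hρ (H := (⊥ : KSub K.toKRep))
    (fun X _ => by rw [KSub.theta_bot]; exact hK.theta_le_zero X)
    (x := fun i => extU K ρ y i u) (fun i hi => extU_of_notMem K ρ y hi u) (fun i hi => by
      have := congrArg (fun x : ChainL K ρ y => (x ⟨i, hi⟩ : L)) hu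
      rw [chainMap_apply] at this
      rw [this]
      exact Submodule.zero_mem _)
  funext i
  have hi := h i
  rw [extU_of_mem K ρ y i.2] at hi
  exact Subtype.ext hi

theorem exists_monomial_eq_zero {E : Type*} [AddCommGroup E] [Module ℂ E] {T : Module.End ℂ E}
    (hT : IsNilpotent T) {v : Weight → ℤ → E} {m : ℤ}
    (hv : ∀ w e, dom m w e → T (v w e) = v (w - one) (e + 1)) :
    ∃ N : ℕ, ∀ w e, (N : ℤ) ≤ e → dom m w e → v w e = 0 := by
  obtain ⟨N, hN⟩ := hT
  refine ⟨N, fun w e he hd => ?_⟩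
  have h : ∀ n : ℕ, (n : ℤ) ≤ e → (T ^ n) (v (w + (n : ℤ) • one) (e - n)) = v w e := by
    intro n
    induction n with
    | zero => intro _; simp
    | succ n ih =>
      intro hn
      push_cast at hn
      rw [← ih (by omega), pow_succ, Module.End.mul_apply, hv]
      · push_cast
        rw [add_smul, one_smul]
        congr 2
        · abel
        · ring
      · unfold dom at *
        simp [one, tw_apply]
        omega
  rw [← h N he, hN]
  rfl

theorem loop_mL {w : Weight} {e : ℤ} (h : dom j₀ w e) :
    K.b 1 (K.a 1 (K.b 0 (K.a 0 (K.cL (K.mL w e))))) = K.mL w (e + 1) := by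
  rw [K.cL_mL _ _ h]
  have h := dom_c h
  rw [K.a_mL _ _ _ h]
  have h := dom_a h 0
  rw [K.b_mU _ _ _ h]
  have h := dom_b h 0
  rw [K.a_mL _ _ _ h]
  have h := dom_a h 1
  rw [K.b_mU _ _ _ h]
  congr 1
  simp [one]
  abel

theorem isChain_loop {f : ℤ → Module.Dual ℂ L} (hf : IsChain K.toKRep ρ f) :
    IsChain K.toKRep ρ fun i => f i ∘ₗ (K.b 1 ∘ₗ K.a 1 ∘ₗ K.b 0 ∘ₗ K.a 0 ∘ₗ K.cL) := by
  refine ⟨fun i hi => by rw [hf.eq_zero i hi, LinearMap.zero_comp], fun i hi u => ?_⟩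
  have h := hf.comm i hi (K.a 1 (K.b 1 (K.a 0 (K.b 0 (K.cU u)))))
  simp only [LinearMap.comp_apply, K.cb]
  have e1 := K.bab 1 0 1 (K.a 0 (K.b 0 (K.cU u)))
  have e2 := K.bab 0 1 0 (K.cU u)
  rw [e1, e2]
  exact h

/-- The dimension of a mutation is the number of the monomials which do not vanish. -/
theorem exists_count [FiniteDimensional ℂ L] [FiniteDimensional ℂ U] {θL θU : ℝ}
    (hK : K.Semistable θL θU) (hρ : GoodIdx θL θU ρ) (y : Weight) {q : ℤ}
    (hq : ∀ i ∈ idx ρ, ∀ e, dom j₀ (y - i • tw 0) e → q ≤ e)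
    (hne : ∀ e, q ≤ e → (∃ i ∈ idx ρ, dom j₀ (y - i • tw 0) e) ∨ K.van ρ y (e + 1)) :
    ∃ h, q ≤ h ∧ ∑ i ∈ idx ρ, K.gL (y - i • tw 0) -
      ∑ i ∈ idx (ρ - 1), K.gU (y - (i + 1) • tw 0) = h - q ∧ ∀ e, q ≤ e → (K.van ρ y e ↔ h ≤ e) := by
  classical
  let W := ChainL K ρ y ⧸ LinearMap.range (chainMap K ρ y)
  let w : ℕ → W := fun n => if h : ∃ i ∈ idx ρ, dom j₀ (y - i • tw 0) (q + n) then
    Submodule.mkQ _ (LinearMap.single ℂ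
      (fun i : idx ρ => LinearMap.range (K.prL (y - (i : ℤ) • tw 0))) ⟨h.choose, h.choose_spec.1⟩
      ⟨K.mL (y - h.choose • tw 0) (q + n), _, K.prL_mL _ _ h.choose_spec.2⟩) else 0
  have hw : ∀ (g : Module.Dual ℂ W) (f : ℤ → Module.Dual ℂ L), IsChain K.toKRep ρ f →
      (∀ x, chainPair K ρ y f x = g (Submodule.mkQ _ x)) → ∀ n : ℕ, ∀ i ∈ idx ρ,
      dom j₀ (y - i • tw 0) (q + n) → g (w n) = f i (K.mL (y - i • tw 0) (q + n)) := by
    intro g f hf hfg n i hi hd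
    have h : ∃ i ∈ idx ρ, dom j₀ (y - i • tw 0) (q + n) := ⟨i, hi, hd⟩
    rw [show w n = _ from dif_pos h, ← hfg, chainPair_single]
    exact chain_indep hf h.choose_spec.1 hi h.choose_spec.2 hd
  have hw0 : ∀ n : ℕ, (¬ ∃ i ∈ idx ρ, dom j₀ (y - i • tw 0) (q + n)) → w n = 0 := fun n h => dif_neg h
  have hchain : ∀ g : Module.Dual ℂ W, ∃ f : ℤ → Module.Dual ℂ L, IsChain K.toKRep ρ f ∧
      (∀ x, chainPair K ρ y f x = g (Submodule.mkQ _ x)) ∧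
      ∀ i x, f i (K.prL (y - i • tw 0) x) = f i x := by
    intro g
    refine ⟨toChain K ρ y (g ∘ₗ Submodule.mkQ _), isChain_toChain K ρ y _ fun u => ?_, fun x => ?_,
      fun i x => toChain_prL _ _ _ _ _ _⟩
    · rw [LinearMap.comp_apply, Submodule.mkQ_apply, (Submodule.Quotient.mk_eq_zero _).2
        (LinearMap.mem_range_self (chainMap K ρ y) u),
        map_zero]
    · rw [chainPair_toChain]
      rfl
  have hfun : ∀ f : ℤ → Module.Dual ℂ L, IsChain K.toKRep ρ f → ∃ g : Module.Dual ℂ W,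
      ∀ x, chainPair K ρ y f x = g (Submodule.mkQ _ x) := by
    intro f hf
    refine ⟨Submodule.liftQ _ (chainPair K ρ y f) ?_, fun x => (Submodule.liftQ_apply _ _ _).symm⟩
    rintro _ ⟨u, rfl⟩
    rw [LinearMap.mem_ker, chainPair_chainMap K ρ y hf.eq_zero]
    exact Finset.sum_eq_zero fun i hi => by rw [hf.comm i hi, sub_self]
  have hvan : ∀ n : ℕ, w n = 0 ↔ K.van ρ y (q + n) := by
    intro n
    constructor
    · intro h f hf i hi hd
      obtain ⟨g, hg⟩ := hfun f hf
      rw [← hw g f hf hg n i hi hd, h, map_zero]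
    · intro h
      by_cases hex : ∃ i ∈ idx ρ, dom j₀ (y - i • tw 0) (q + n)
      · obtain ⟨i, hi, hd⟩ := hex
        rw [← Module.forall_dual_apply_eq_zero_iff ℂ]
        intro g
        obtain ⟨f, hf, hfg, -⟩ := hchain g
        rw [hw g f hf hfg n i hi hd]
        exact h f hf i hi hd
      · exact hw0 n hex
  obtain ⟨h, h1, h2⟩ := exists_finrank_eq_of_shift w (fun g hg => by
      obtain ⟨f, hf, hfg, hpr⟩ := hchain g
      have hf0 := hf.eq_zero_of_vanish hρ hK.theta_le_top (fun i => by
        have : K.gen.SL ≤ LinearMap.ker (f i) := by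
          refine Submodule.span_le.2 ?_
          rintro _ ⟨v, e, hd, rfl⟩
          rw [SetLike.mem_coe, LinearMap.mem_ker]
          by_cases hi : i ∈ idx ρ
          · by_cases hv : v = y - i • tw 0
            · subst hv
              have hqe := hq i hi e hd
              have h3 := hw g f hf hfg (e - q).toNat i hi
              rw [show q + ((e - q).toNat : ℤ) = e by omega] at h3
              rw [← h3 hd, hg]
            · rw [← hpr, ← K.prL_mL _ _ hd, K.prL_ne _ _ _ (Ne.symm hv), map_zero]
          · rw [hf.eq_zero i hi]
            rfl
        exact fun x hx => this hx)
      refine LinearMap.ext fun x => ?_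
      obtain ⟨x, rfl⟩ := Submodule.mkQ_surjective _ x
      rw [← hfg, chainPair_apply]
      exact Finset.sum_eq_zero fun i _ => by rw [hf0]; rfl)
    (fun g => by
      obtain ⟨f, hf, hfg, -⟩ := hchain g
      obtain ⟨g', hg'⟩ := hfun _ (isChain_loop hf)
      refine ⟨g', fun n => ?_⟩
      by_cases hex : ∃ i ∈ idx ρ, dom j₀ (y - i • tw 0) (q + n)
      · obtain ⟨i, hi, hd⟩ := hex
        have hd' : dom j₀ (y - i • tw 0) (q + (n + 1 : ℕ)) := by
          unfold dom at *
          push_cast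
          omega
        rw [hw g f hf hfg (n + 1) i hi hd', hw g' _ (isChain_loop hf) hg' n i hi hd]
        push_cast
        rw [← add_assoc, ← loop_mL hd]
        rfl
      · rw [hw0 n hex, map_zero]
        have := (hvan (n + 1)).2 (by
          have := (hne (q + n) (by omega)).resolve_left hex
          push_cast
          rwa [← add_assoc])
        rw [this, map_zero])
    (by
      obtain ⟨N, hN⟩ := exists_monomial_eq_zero K.nil_cL K.cL_mL
      refine ⟨(N - q).toNat, (hvan _).2 fun f hf i hi hd => ?_⟩
      rw [hN _ _ (by omega) hd, map_zero])
  refine ⟨q + h, by omega, ?_, fun e he => ?_⟩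
  · have e1 := Submodule.finrank_quotient_add_finrank (LinearMap.range (chainMap K ρ y))
    rw [LinearMap.finrank_range_of_inj (chainMap_injective hK hρ), h1,
      Module.finrank_pi_fintype, Module.finrank_pi_fintype,
      Finset.sum_coe_sort (idx (ρ - 1)) fun i : ℤ =>
        Module.finrank ℂ (LinearMap.range (K.prU (y - (i + 1) • tw 0))),
      Finset.sum_coe_sort (idx ρ) fun i : ℤ =>
        Module.finrank ℂ (LinearMap.range (K.prL (y - i • tw 0)))] at e1
    have e2 := congrArg (Nat.cast : ℕ → ℤ) e1
    push_cast at e2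
    change ∑ i ∈ idx ρ, (Module.finrank ℂ (LinearMap.range (K.prL (y - i • tw 0))) : ℤ) -
      ∑ i ∈ idx (ρ - 1), (Module.finrank ℂ (LinearMap.range (K.prU (y - (i + 1) • tw 0))) : ℤ) = _
    omega
  · have := hvan (e - q).toNat
    rw [show q + ((e - q).toNat : ℤ) = e by omega] at this
    rw [← this, h2]
    omega

end GRep

end LocalConifold

namespace LocalConifold

open WQuiver

/-- The values of `F` count the numbers `e ≥ q` which do not satisfy an upward closed condition. -/
def IsCount (F q : Weight → ℤ) (v : Weight → ℤ → Prop) : Prop :=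
  ∀ y, ∃ h, q y ≤ h ∧ F y = h - q y ∧ ∀ e, q y ≤ e → (v y e ↔ h ≤ e)

/-- The condition `v` implies `v'`. -/
def Move (v : ℤ → Prop) (q : ℤ) (v' : ℤ → Prop) (q' : ℤ) : Prop :=
  q' ≤ q ∧ ∀ e, q ≤ e → v e → v' e

theorem Move.trans {v v' v'' : ℤ → Prop} {q q' q'' : ℤ} (h : Move v q v' q')
    (h' : Move v' q' v'' q'') : Move v q v'' q'' :=
  ⟨h'.1.trans h.1, fun e he hv => h'.2 e (h.1.trans he) (h.2 e he hv)⟩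

theorem Move.refl (v : ℤ → Prop) (q : ℤ) : Move v q v q := ⟨le_rfl, fun _ _ h => h⟩

theorem edgeSquares_of_count {f g : KT} {q q' : Weight → ℤ} {v v' : Weight → ℤ → Prop} {s : Weight}
    (hf : IsCount f q v) (hg : IsCount g q' v')
    (h1 : ∀ y, Move (v y) (q y) (v' (y + s)) (q' (y + s)))
    (h2 : ∀ y, Move (v' (y + s)) (q' (y + s)) (v (y + one)) (q (y + one)))
    (h3 : ∀ y, q y ≤ q (y + one) + 1 ∧ ∀ e, q (y + one) ≤ e → v (y + one) e → v y (e + 1)) :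
    EdgeSquares f g q q' s := by
  intro y
  obtain ⟨h, hq, hfy, hv⟩ := hf y
  obtain ⟨h', hq', hgy, hv'⟩ := hg (y + s)
  have a1 := (hv' h ((h1 y).1.trans hq)).1 ((h1 y).2 h hq ((hv h hq).2 le_rfl))
  have b1 := (h2 y).1
  have b2 := (h3 y).1
  have a2 := (hv (h' + 1) (by omega)).1 ((h3 y).2 h' (b1.trans hq')
    ((h2 y).2 h' hq' ((hv' h' hq').2 le_rfl)))
  have b3 := (h1 y).1
  rw [hfy, hgy]
  have c1 : h = h' ∨ h = h' + 1 := by omega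
  have c2 : q y = q' (y + s) ∨ q y = q' (y + s) + 1 := by omega
  rcases c1 with c1 | c1 <;> rcases c2 with c2 | c2 <;> rw [c1, c2] <;> ring

/-- Counting functions at two adjacent levels. -/
structure CountSystem (f g : KT) (q q' : Weight → ℤ) (v v' : Weight → ℤ → Prop) : Prop where
  count : IsCount f q v
  count' : IsCount g q' v'
  a : ∀ j y, Move (v y) (q y) (v' (y + ![tw 1, tw 2] j)) (q' (y + ![tw 1, tw 2] j))
  b : ∀ j y, Move (v' y) (q' y) (v (y + ![0, tw 0] j)) (q (y + ![0, tw 0] j))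
  c : ∀ y, q (y - one) ≤ q y + 1 ∧ ∀ e, q y ≤ e → v y e → v (y - one) (e + 1)
  c' : ∀ y, q' (y - one) ≤ q' y + 1 ∧ ∀ e, q' y ≤ e → v' y e → v' (y - one) (e + 1)

theorem CountSystem.allEdgeSquares {f g : KT} {q q' : Weight → ℤ} {v v' : Weight → ℤ → Prop}
    (h : CountSystem f g q q' v v') : AllEdgeSquares f g q q' := by
  have a : ∀ (j : Fin 2) {y y' : Weight}, y' = y + ![tw 1, tw 2] j →
      Move (v y) (q y) (v' y') (q' y') := fun j y y' hy => hy ▸ h.a j y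
  have b : ∀ (j : Fin 2) {y y' : Weight}, y' = y + ![0, tw 0] j →
      Move (v' y) (q' y) (v y') (q y') := fun j y y' hy => hy ▸ h.b j y
  have c : ∀ y, q y ≤ q (y + one) + 1 ∧ ∀ e, q (y + one) ≤ e → v (y + one) e → v y (e + 1) :=
    fun y => by simpa only [add_sub_cancel_right] using h.c (y + one)
  have c' : ∀ y, q' y ≤ q' (y + one) + 1 ∧ ∀ e, q' (y + one) ≤ e → v' (y + one) e → v' y (e + 1) :=
    fun y => by simpa only [add_sub_cancel_right] using h.c' (y + one)
  have hone : one = tw 0 + tw 1 + tw 2 := rfl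
  refine ⟨?_, ?_, ?_, ?_⟩
  · simp only [List.forall_mem_cons, List.not_mem_nil, false_imp_iff, implies_true, and_true]
    refine ⟨?_, ?_, ?_, ?_⟩
    · exact edgeSquares_of_count h.count h.count' (fun y => a 0 rfl)
        (fun y => (b 0 rfl).trans ((a 1 rfl).trans (b 1 (by simp [hone]; abel)))) c
    · exact edgeSquares_of_count h.count h.count' (fun y => a 1 rfl)
        (fun y => (b 0 rfl).trans ((a 0 rfl).trans (b 1 (by simp [hone]; abel)))) c
    · exact edgeSquares_of_count h.count h.count'
        (fun y => (a 0 rfl).trans ((b 1 rfl).trans (a 1 (by simp; abel))))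
        (fun y => b 0 (by simp [hone])) c
    · exact edgeSquares_of_count h.count h.count'
        (fun y => (a 0 rfl).trans ((b 0 rfl).trans (a 1 (by simp; abel))))
        (fun y => b 1 (by simp [hone]; abel)) c
  · simp only [List.forall_mem_cons, List.not_mem_nil, false_imp_iff, implies_true, and_true]
    refine ⟨?_, ?_, ?_, ?_⟩
    · exact edgeSquares_of_count h.count' h.count (fun y => b 0 rfl)
        (fun y => (a 0 rfl).trans ((b 1 rfl).trans (a 1 (by simp [hone]; abel)))) c'
    · exact edgeSquares_of_count h.count' h.count (fun y => b 1 rfl)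
        (fun y => (a 0 rfl).trans ((b 0 rfl).trans (a 1 (by simp [hone]; abel)))) c'
    · exact edgeSquares_of_count h.count' h.count
        (fun y => (b 0 rfl).trans ((a 1 rfl).trans (b 1 (by simp; abel))))
        (fun y => a 0 (by simp [hone]; abel)) c'
    · exact edgeSquares_of_count h.count' h.count
        (fun y => (b 0 rfl).trans ((a 0 rfl).trans (b 1 (by simp; abel))))
        (fun y => a 1 (by simp [hone]; abel)) c'
  · exact edgeSquares_of_count h.count h.count
      (fun y => (a 0 rfl).trans ((b 0 rfl).trans ((a 1 rfl).trans (b 1 (by simp; abel)))))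
      (fun y => Move.refl _ _) c
  · exact edgeSquares_of_count h.count' h.count'
      (fun y => (b 0 rfl).trans ((a 0 rfl).trans ((b 1 rfl).trans (a 1 (by simp; abel)))))
      (fun y => Move.refl _ _) c'

namespace GRep

variable {L U : Type} [AddCommGroup L] [Module ℂ L] [AddCommGroup U] [Module ℂ U] {j₀ : ℤ}
variable {K : GRep j₀ L U} {ρ : ℤ} {y : Weight} {e : ℤ}

theorem van_a (hρ : ρ ≠ 0) (h : K.van ρ y e) (j : Fin 2)
    (hne : (∃ i ∈ idx ρ, dom j₀ (y - i • tw 0) e) ∨ K.van (ρ - 1) (y + ![tw 1, tw 2] j) e) :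
    K.van (ρ - 1) (y + ![tw 1, tw 2] j) e := by
  classical
  rcases hne with ⟨i', hi', hd'⟩ | hv
  swap
  · exact hv
  intro g hg i hi hd
  let f : ℤ → Module.Dual ℂ L := fun i => if i ∈ idx ρ then
    (if i ∈ idx (ρ - 1) then g i ∘ₗ K.b 0 ∘ₗ K.a j else g (i - 1) ∘ₗ K.b 1 ∘ₗ K.a j) else 0
  have f1 : ∀ i ∈ idx ρ, i ∈ idx (ρ - 1) → ∀ x, f i x = g i (K.b 0 (K.a j x)) := by
    intro i h1 h2 x
    simp only [f, if_pos h1, if_pos h2]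
    rfl
  have f2 : ∀ i ∈ idx ρ, i ∉ idx (ρ - 1) → ∀ x, f i x = g (i - 1) (K.b 1 (K.a j x)) := by
    intro i h1 h2 x
    simp only [f, if_pos h1, if_neg h2]
    rfl
  have f3 : ∀ i ∉ idx ρ, f i = 0 := fun i h1 => if_neg h1
  have hf : IsChain K.toKRep ρ f := by
    refine ⟨f3, fun i hi u => ?_⟩
    have e1 : f (i + 1) (K.b 0 u) = g i (K.b 1 (K.a j (K.b 0 u))) := by
      by_cases h1 : i + 1 ∈ idx ρ
      · by_cases h2 : i + 1 ∈ idx (ρ - 1)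
        · rw [f1 _ h1 h2, hg.comm i (by rw [mem_idx] at *; omega)]
        · rw [f2 _ h1 h2, add_sub_cancel_right]
      · rw [f3 _ h1, ← hg.comm i (by rw [mem_idx] at *; omega),
          hg.eq_zero (i + 1) (by rw [mem_idx] at *; omega)]
        rfl
    rw [e1]
    by_cases h1 : i ∈ idx ρ
    · rw [f1 _ h1 hi, K.bab]
    · have := hg.comm (i - 1) (by rw [mem_idx] at *; omega) (K.a j (K.b 1 u))
      rw [sub_add_cancel, hg.eq_zero (i - 1) (by rw [mem_idx] at *; omega)] at this
      rw [f3 _ h1, K.bab, this]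
      rfl
  have h0 := h f hf i' hi' hd'
  have hda := dom_a hd' j
  by_cases h1 : i' ∈ idx (ρ - 1)
  · rw [f1 _ hi' h1, K.a_mL _ _ _ hd', K.b_mU _ _ _ hda,
      show y - i' • tw 0 + ![tw 1, tw 2] j + ![0, tw 0] 0 = y + ![tw 1, tw 2] j - i' • tw 0 by
        simp; abel] at h0
    rw [← h0]
    refine chain_indep hg hi h1 hd ?_
    have := dom_b hda 0
    rwa [show y - i' • tw 0 + ![tw 1, tw 2] j + ![0, tw 0] 0 = y + ![tw 1, tw 2] j - i' • tw 0 by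
        simp; abel] at this
  · rw [f2 _ hi' h1, K.a_mL _ _ _ hd', K.b_mU _ _ _ hda,
      show y - i' • tw 0 + ![tw 1, tw 2] j + ![0, tw 0] 1 = y + ![tw 1, tw 2] j - (i' - 1) • tw 0 by
        simp [sub_smul]; abel] at h0
    rw [← h0]
    refine chain_indep hg hi (by rw [mem_idx] at *; omega) hd ?_
    have := dom_b hda 1
    rwa [show y - i' • tw 0 + ![tw 1, tw 2] j + ![0, tw 0] 1 =
      y + ![tw 1, tw 2] j - (i' - 1) • tw 0 by simp [sub_smul]; abel] at this

theorem van_b0 (h : K.van (ρ - 1) y e)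
    (hne : (∃ i ∈ idx (ρ - 1), dom j₀ (y - i • tw 0) e) ∨ K.van ρ y e) : K.van ρ y e := by
  classical
  rcases hne with ⟨i', hi', hd'⟩ | hv
  swap
  · exact hv
  intro g hg i hi hd
  let f : ℤ → Module.Dual ℂ L := fun i => if i ∈ idx (ρ - 1) then g i else 0
  have f1 : ∀ i ∈ idx (ρ - 1), f i = g i := fun i h1 => if_pos h1
  have f2 : ∀ i ∉ idx (ρ - 1), f i = 0 := fun i h1 => if_neg h1
  have hf : IsChain K.toKRep (ρ - 1) f := by
    refine ⟨f2, fun i hi u => ?_⟩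
    by_cases h1 : i + 1 ∈ idx (ρ - 1)
    · rw [f1 _ h1]
      by_cases h2 : i ∈ idx (ρ - 1)
      · rw [f1 _ h2, hg.comm _ h2]
      · rw [f2 _ h2, hg.eq_zero _ (by rw [mem_idx] at *; omega)]
        rfl
    · rw [f2 _ h1, f1 i (by rw [mem_idx] at *; omega), ← hg.comm _ (by rw [mem_idx] at *; omega),
        hg.eq_zero (i + 1) (by rw [mem_idx] at *; omega)]
  by_cases h1 : i ∈ idx (ρ - 1)
  · rw [← f1 _ h1]
    exact h f hf i h1 hd
  · have h0 := h f hf i' hi' hd'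
    rw [f1 _ hi'] at h0
    rw [← h0]
    exact chain_indep hg hi (by rw [mem_idx] at *; omega) hd hd'

theorem van_b1 (h : K.van (ρ - 1) y e)
    (hne : (∃ i ∈ idx (ρ - 1), dom j₀ (y - i • tw 0) e) ∨ K.van ρ (y + tw 0) e) :
    K.van ρ (y + tw 0) e := by
  classical
  rcases hne with ⟨i', hi', hd'⟩ | hv
  swap
  · exact hv
  intro g hg i hi hd
  let f : ℤ → Module.Dual ℂ L := fun i => if i ∈ idx (ρ - 1) then g (i + 1) else 0
  have f1 : ∀ i ∈ idx (ρ - 1), f i = g (i + 1) := fun i h1 => if_pos h1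
  have f2 : ∀ i ∉ idx (ρ - 1), f i = 0 := fun i h1 => if_neg h1
  have hf : IsChain K.toKRep (ρ - 1) f := by
    refine ⟨f2, fun i hi u => ?_⟩
    by_cases h1 : i + 1 ∈ idx (ρ - 1)
    · rw [f1 _ h1, hg.comm _ h1]
      by_cases h2 : i ∈ idx (ρ - 1)
      · rw [f1 _ h2]
      · rw [f2 _ h2, hg.eq_zero _ (by rw [mem_idx] at *; omega)]
    · rw [f2 _ h1, f1 i (by rw [mem_idx] at *; omega),
        hg.eq_zero (i + 1) (by rw [mem_idx] at *; omega)]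
      rfl
  have e1 : ∀ i : ℤ, y + tw 0 - (i + 1) • tw 0 = y - i • tw 0 := fun i => by
    rw [add_smul, one_smul]
    abel
  by_cases h1 : i - 1 ∈ idx (ρ - 1)
  · have h0 := h f hf _ h1 (by rw [← e1, sub_add_cancel]; exact hd)
    rwa [f1 _ h1, ← e1, sub_add_cancel] at h0
  · have h0 := h f hf i' hi' hd'
    rw [f1 _ hi', ← e1] at h0
    rw [← h0]
    exact chain_indep hg hi (by rw [mem_idx] at *; omega) hd (by rw [e1]; exact hd')

theorem van_c (h : K.van ρ y e) (hne : (∃ i ∈ idx ρ, dom j₀ (y - i • tw 0) e) ∨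
    K.van ρ (y - one) (e + 1)) : K.van ρ (y - one) (e + 1) := by
  rcases hne with ⟨i', hi', hd'⟩ | hv
  swap
  · exact hv
  intro g hg i hi hd
  have h0 := h (fun i => g i ∘ₗ K.cL) ⟨fun i hi => by rw [hg.eq_zero i hi]; rfl, fun i hi u => by
    simp only [LinearMap.comp_apply, K.cb]
    exact hg.comm i hi _⟩ i' hi' hd'
  rw [LinearMap.comp_apply, K.cL_mL _ _ hd'] at h0
  have hdc := dom_c hd'
  rw [show y - i' • tw 0 - one = y - one - i' • tw 0 by abel] at h0 hdc
  rw [← h0]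
  exact chain_indep hg hi hi' hd hdc

end GRep

end LocalConifold

namespace LocalConifold

open WQuiver

theorem mxx_le_iff {m : ℤ} (hm : m ≤ 1) (y : Weight) (e : ℤ) : mxx m y ≤ e ↔ dom m y e := by
  unfold mxx mx dom
  omega

theorem dom_mxx {m : ℤ} (hm : m ≤ 1) (y : Weight) : dom m y (mxx m y) :=
  (mxx_le_iff hm y _).1 le_rfl

theorem mxx_sub_one_le {m : ℤ} (hm : m ≤ 1) (y : Weight) : mxx m (y - one) ≤ mxx m y + 1 :=
  (mxx_le_iff hm _ _).2 (dom_c (dom_mxx hm y))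

/-- The function `max(0, -i, -j)`. -/
def lo (y : Weight) : ℤ := mx (y 1) (y 2) 0

theorem lo_le_iff (y : Weight) (e : ℤ) : lo y ≤ e ↔ 0 ≤ e ∧ 0 ≤ y 1 + e ∧ 0 ≤ y 2 + e := by
  unfold lo mx
  omega

/-- The points at the level `m` with `lo < min(-k, -l)`. -/
def Inner (m : ℤ) (y : Weight) : Prop := lo y < -(y 1 + y 2 - y 0 - m) ∧ lo y < - y 0

/-- The points at the level `m` with `lo ≤ min(-k, -l)`. -/
def WeakInner (m : ℤ) (y : Weight) : Prop := lo y ≤ -(y 1 + y 2 - y 0 - m) ∧ lo y ≤ - y 0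

theorem mnn_eq {m : ℤ} {y : Weight} (h : WeakInner m y) : mnn m y = lo y := by
  unfold WeakInner lo mx at h
  unfold mnn mxx lo mx
  omega

theorem edgeSquares_mnn {f g : KT} {m m' : ℤ} {s : Weight} (h : EdgeSquares f g lo lo s)
    (hf : ∀ w, f w ≠ 0 → Inner m w) (hg : ∀ w, g w ≠ 0 → Inner m' w)
    (hs : ∀ w, Inner m w → WeakInner m' (w + s)) (hs' : ∀ w, Inner m' (w + s) → WeakInner m w) :
    EdgeSquares f g (mnn m) (mnn m') s := by
  have hw : ∀ m w, Inner m w → WeakInner m w := fun m w h => ⟨h.1.le, h.2.le⟩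
  intro w
  by_cases h0 : f w = g (w + s)
  · rw [h0]
    ring
  · have h1 : WeakInner m w ∧ WeakInner m' (w + s) := by
      by_cases h1 : f w = 0
      · have h2 := hg (w + s) fun hc => h0 (by rw [h1, hc])
        exact ⟨hs' w h2, hw _ _ h2⟩
      · exact ⟨hw _ _ (hf w h1), hs w (hf w h1)⟩
    rw [mnn_eq h1.1, mnn_eq h1.2]
    exact h w

theorem allEdgeSquares_mnn {f g : KT} {m : ℤ} (h : AllEdgeSquares f g lo lo)
    (hf : ∀ w, f w ≠ 0 → Inner m w) (hg : ∀ w, g w ≠ 0 → Inner (m + 1) w) :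
    AllEdgeSquares f g (mnn m) (mnn (m + 1)) := by
  obtain ⟨h1, h2, h3, h4⟩ := h
  simp only [List.forall_mem_cons, List.not_mem_nil, false_imp_iff, implies_true, and_true] at h1 h2
  obtain ⟨a1, a2, a3, a4⟩ := h1
  obtain ⟨b1, b2, b3, b4⟩ := h2
  constructor
  · simp only [List.forall_mem_cons, List.not_mem_nil, false_imp_iff, implies_true, and_true]
    refine ⟨edgeSquares_mnn a1 hf hg ?_ ?_, edgeSquares_mnn a2 hf hg ?_ ?_,
      edgeSquares_mnn a3 hf hg ?_ ?_, edgeSquares_mnn a4 hf hg ?_ ?_⟩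
    all_goals
      intro w hw
      simp only [Inner, WeakInner, lo, mx, Pi.add_apply, tw_apply] at *
      omega
  · simp only [List.forall_mem_cons, List.not_mem_nil, false_imp_iff, implies_true, and_true]
    refine ⟨edgeSquares_mnn b1 hg hf ?_ ?_, edgeSquares_mnn b2 hg hf ?_ ?_,
      edgeSquares_mnn b3 hg hf ?_ ?_, edgeSquares_mnn b4 hg hf ?_ ?_⟩
    all_goals
      intro w hw
      simp only [Inner, WeakInner, lo, mx, Pi.add_apply, Pi.zero_apply, tw_apply] at *
      omega
  · refine edgeSquares_mnn h3 hf hf ?_ ?_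
    all_goals
      intro w hw
      simp only [Inner, WeakInner, lo, mx, Pi.add_apply, tw_apply] at *
      omega
  · refine edgeSquares_mnn h4 hg hg ?_ ?_
    all_goals
      intro w hw
      simp only [Inner, WeakInner, lo, mx, Pi.add_apply, tw_apply] at *
      omega

theorem exists_dom_iff {j₀ ρ : ℤ} (hj : j₀ ≤ 0) (hρ : 0 ≤ ρ) (y : Weight) (e : ℤ) :
    (∃ i ∈ idx ρ, dom j₀ (y - i • tw 0) e) ↔ dom (j₀ - ρ) y e := by
  constructor
  · rintro ⟨i, hi, hd⟩
    rw [mem_idx] at hi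
    have := GRep.dom_sub_smul.1 hd
    unfold dom
    omega
  · intro hd
    refine ⟨max 0 (-(y 1 + y 2 - y 0 - j₀ + e)), ?_, ?_⟩
    · rw [mem_idx]
      unfold dom at hd
      omega
    · rw [GRep.dom_sub_smul]
      unfold dom at hd
      omega

theorem exists_dom_of_neg {j₀ ρ : ℤ} (hj : j₀ ≤ 0) (hρ : ρ < 0) (y : Weight) (e : ℤ)
    (he : lo y ≤ e) : (∃ i ∈ idx ρ, dom j₀ (y - i • tw 0) e) ∨
      (0 ≤ y 0 + e ∨ 0 ≤ y 1 + y 2 - y 0 - (j₀ - ρ) + e) := by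
  rw [lo_le_iff] at he
  by_cases h : 0 ≤ y 0 + e ∨ 0 ≤ y 1 + y 2 - y 0 - (j₀ - ρ) + e
  · exact Or.inr h
  · refine Or.inl ⟨y 0 + e, ?_, ?_⟩
    · rw [mem_idx]
      omega
    · rw [GRep.dom_sub_smul]
      omega

theorem lo_sub_one (y : Weight) : lo (y - one) ≤ lo y + 1 := by
  simp only [lo, mx, one, Pi.sub_apply, Pi.add_apply, tw_apply]
  omega

theorem lo_a (j : Fin 2) (y : Weight) : lo (y + ![tw 1, tw 2] j) ≤ lo y := by
  fin_cases j <;> simp [lo, mx, tw_apply] <;> omega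

theorem lo_b (j : Fin 2) (y : Weight) : lo (y + ![0, tw 0] j) = lo y := by
  fin_cases j <;> simp [lo, mx, tw_apply]

/-- The dimension of the image of a projection is the number of the non-vanishing vectors in a
spanning sequence. -/
theorem exists_count_of_projection {E : Type*} [AddCommGroup E] [Module ℂ E]
    [FiniteDimensional ℂ E] (P T : Module.End ℂ E) (v : ℤ → E) (q : ℤ)
    (hv : ∀ e, q ≤ e → P (v e) = v e ∧ T (v e) = v (e + 1))
    (hspan : ∀ g : Module.Dual ℂ E, (∀ e, q ≤ e → g (v e) = 0) → ∀ x, g (P x) = 0)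
    (hz : ∃ N : ℕ, ∀ e, (N : ℤ) ≤ e → q ≤ e → v e = 0) :
    ∃ h, q ≤ h ∧ (Module.finrank ℂ (LinearMap.range P) : ℤ) = h - q ∧
      ∀ e, q ≤ e → (v e = 0 ↔ h ≤ e) := by
  have hmem : ∀ n : ℕ, v (q + n) ∈ LinearMap.range P := fun n => ⟨_, (hv _ (by omega)).1⟩
  obtain ⟨h, h1, h2⟩ := exists_finrank_eq_of_shift (W := LinearMap.range P)
    (fun n => ⟨v (q + n), hmem n⟩)
    (fun g hg => by
      obtain ⟨g', rfl⟩ : ∃ g' : Module.Dual ℂ E, g = g' ∘ₗ (LinearMap.range P).subtype := by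
        obtain ⟨g', hg'⟩ := LinearMap.exists_extend g
        exact ⟨g', hg'.symm⟩
      refine LinearMap.ext ?_
      rintro ⟨_, x, rfl⟩
      refine hspan g' (fun e he => ?_) x
      obtain ⟨n, rfl⟩ := Int.le.dest he
      exact hg n)
    (fun g => ⟨g ∘ₗ P.rangeRestrict ∘ₗ T ∘ₗ (LinearMap.range P).subtype, fun n => by
      simp only [LinearMap.comp_apply]
      congr 1
      refine Subtype.ext ?_
      have h3 := (hv (q + n + 1) (by omega)).1
      simp only [Submodule.subtype_apply, (hv (q + n) (by omega)).2, LinearMap.codRestrict_apply,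
        h3]
      push_cast
      rw [add_assoc]⟩)
    (by
      obtain ⟨N, hN⟩ := hz
      exact ⟨(N - q).toNat, Subtype.ext (hN _ (by omega) (by omega))⟩)
  refine ⟨q + h, by omega, by rw [h1]; ring, fun e he => ?_⟩
  have := h2 (e - q).toNat
  rw [← Subtype.coe_inj] at this
  simp only [ZeroMemClass.coe_zero, show q + ((e - q).toNat : ℤ) = e by omega] at this
  rw [this]
  omega

namespace GRep

variable {L U : Type} [AddCommGroup L] [Module ℂ L] [AddCommGroup U] [Module ℂ U] {j₀ : ℤ}
variable (K : GRep j₀ L U)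

theorem mutDim_apply (ρ : ℤ) (y : Weight) : mutDim K.gL K.gU ρ y =
    if 0 ≤ ρ then ∑ i ∈ idx ρ, K.gL (y - i • tw 0) - ∑ i ∈ idx (ρ - 1), K.gU (y - (i + 1) • tw 0)
    else ∑ i ∈ idx (ρ - 1), K.gU (y - (i + 1) • tw 0) - ∑ i ∈ idx ρ, K.gL (y - i • tw 0) := by
  classical
  have h0 : ∑ i ∈ idx (ρ - 1), K.gU (y - (i + 1) • tw 0) =
      ∑ i ∈ (idx (ρ - 1)).image (· + 1), K.gU (y - i • tw 0) :=
    (Finset.sum_image (f := fun i => K.gU (y - i • tw 0)) (g := (· + 1))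
      fun i _ j _ h => add_right_cancel h).symm
  have hev : ∀ s : Finset ℤ, (∑ i ∈ s, tr (i • tw 0) (K.gL - K.gU)) y =
      ∑ i ∈ s, K.gL (y - i • tw 0) - ∑ i ∈ s, K.gU (y - i • tw 0) := by
    intro s
    rw [Finsupp.finset_sum_apply, ← Finset.sum_sub_distrib]
    exact Finset.sum_congr rfl fun i _ => tr_apply _ _ _
  rw [mutDim, Finsupp.sub_apply, Finsupp.add_apply, hev, hev, h0]
  split_ifs with h
  · have h1 : Finset.Icc 0 ρ = idx ρ := by ext i; rw [mem_idx, Finset.mem_Icc]; omega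
    have h2 : Finset.Ioo ρ 0 = ∅ := by
      ext i
      simp only [Finset.mem_Ioo, Finset.notMem_empty, iff_false]
      omega
    have h3 : idx ρ = insert 0 ((idx (ρ - 1)).image (· + 1)) := by
      ext i
      simp only [Finset.mem_insert, Finset.mem_image, mem_idx]
      constructor
      · intro hi
        by_cases h0 : i = 0
        · exact Or.inl h0
        · exact Or.inr ⟨i - 1, by omega, by omega⟩
      · rintro (rfl | ⟨j, hj, rfl⟩) <;> omega
    have h4 : (0 : ℤ) ∉ (idx (ρ - 1)).image (· + 1) := by
      simp only [Finset.mem_image, mem_idx]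
      rintro ⟨j, hj, hj'⟩
      omega
    rw [h1, h2, h3, Finset.sum_insert h4, Finset.sum_insert h4, zero_smul, sub_zero]
    simp
    ring
  · have h1 : Finset.Ioo ρ 0 = idx ρ := by ext i; rw [mem_idx, Finset.mem_Ioo]; omega
    have h2 : Finset.Icc 0 ρ = ∅ := by
      ext i
      simp only [Finset.mem_Icc, Finset.notMem_empty, iff_false]
      omega
    have h3 : (idx (ρ - 1)).image (· + 1) = insert 0 (idx ρ) := by
      ext i
      simp only [Finset.mem_insert, Finset.mem_image, mem_idx]
      constructor
      · rintro ⟨j, hj, rfl⟩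
        omega
      · intro hi
        exact ⟨i - 1, by omega, by omega⟩
    have h4 : (0 : ℤ) ∉ idx ρ := by
      rw [mem_idx]
      omega
    rw [h1, h2, h3, Finset.sum_insert h4, zero_smul, sub_zero]
    simp
    ring

variable {K} [FiniteDimensional ℂ L] [FiniteDimensional ℂ U] {θL θU : ℝ} {ρ : ℤ}

theorem isCount_of_nonneg (hK : K.Semistable θL θU) (hj : j₀ ≤ 0) (hρ : 0 ≤ ρ)
    (hg : GoodIdx θL θU ρ) : IsCount (mutDim K.gL K.gU ρ) (mxx (j₀ - ρ)) (K.van ρ) := by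
  intro y
  rw [mutDim_apply, if_pos hρ]
  have hm : j₀ - ρ ≤ 1 := by omega
  refine exists_count hK hg y (fun i hi e hd => ?_) (fun e he => Or.inl ?_)
  · exact (mxx_le_iff hm _ _).2 ((exists_dom_iff hj hρ _ _).1 ⟨i, hi, hd⟩)
  · exact (exists_dom_iff hj hρ _ _).2 ((mxx_le_iff hm _ _).1 he)

theorem isCount_of_neg (hK : K.Semistable θL θU) (hj : j₀ ≤ 0) (hρ : ρ < 0)
    (hg : GoodIdx θL θU ρ) : IsCount (-mutDim K.gL K.gU ρ) lo (K.van ρ) := by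
  intro y
  obtain ⟨h, h1, h2, h3⟩ := exists_count hK hg y (q := lo y) (fun i hi e hd => by
      rw [lo_le_iff]
      have := GRep.dom_sub_smul.1 hd
      omega)
    (fun e he => by
      rcases exists_dom_of_neg hj hρ y e he with h | h
      · exact Or.inl h
      · exact Or.inr (van_of_pos hρ (by omega)))
  refine ⟨h, h1, ?_, h3⟩
  rw [Pi.neg_apply, mutDim_apply, if_neg (by omega)]
  omega

theorem countSystem_of_pos (hK : K.Semistable θL θU) (hj : j₀ ≤ 0) (hρ : 0 < ρ)
    (hg : GoodIdx θL θU ρ) (hg' : GoodIdx θL θU (ρ - 1)) :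
    CountSystem (mutDim K.gL K.gU ρ) (mutDim K.gL K.gU (ρ - 1)) (mxx (j₀ - ρ)) (mxx (j₀ - ρ + 1))
      (K.van ρ) (K.van (ρ - 1)) := by
  have hm : j₀ - ρ ≤ 1 := by omega
  have hm' : j₀ - ρ + 1 ≤ 1 := by omega
  have e1 : j₀ - (ρ - 1) = j₀ - ρ + 1 := by ring
  have hd : ∀ y e, mxx (j₀ - ρ) y ≤ e → ∃ i ∈ idx ρ, dom j₀ (y - i • tw 0) e := fun y e he =>
    (exists_dom_iff hj hρ.le _ _).2 ((mxx_le_iff hm _ _).1 he)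
  have hd' : ∀ y e, mxx (j₀ - ρ + 1) y ≤ e → ∃ i ∈ idx (ρ - 1), dom j₀ (y - i • tw 0) e :=
    fun y e he => (exists_dom_iff hj (by omega) _ _).2 (by
      rw [e1]
      exact (mxx_le_iff hm' _ _).1 he)
  refine ⟨isCount_of_nonneg hK hj hρ.le hg, ?_, fun j y => ⟨?_, fun e he hv => ?_⟩,
    fun j y => ⟨?_, fun e he hv => ?_⟩, fun y => ⟨mxx_sub_one_le hm y, fun e he hv => ?_⟩,
    fun y => ⟨mxx_sub_one_le hm' y, fun e he hv => ?_⟩⟩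
  · rw [← e1]
    exact isCount_of_nonneg hK hj (by omega) hg'
  · exact (mxx_le_iff hm' _ _).2 (dom_a (dom_mxx hm y) j)
  · exact van_a hρ.ne' hv j (Or.inl (hd y e he))
  · exact (mxx_le_iff hm _ _).2 (dom_b (dom_mxx hm' y) j)
  · fin_cases j
    · have := van_b0 hv (Or.inl (hd' y e he))
      change K.van ρ (y + 0) e
      rwa [add_zero]
    · exact van_b1 hv (Or.inl (hd' y e he))
  · exact van_c hv (Or.inl (hd y e he))
  · exact van_c hv (Or.inl (hd' y e he))

theorem countSystem_of_neg (hK : K.Semistable θL θU) (hj : j₀ ≤ 0) (hρ : ρ < 0)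
    (hg : GoodIdx θL θU ρ) (hg' : GoodIdx θL θU (ρ - 1)) :
    CountSystem (-mutDim K.gL K.gU ρ) (-mutDim K.gL K.gU (ρ - 1)) lo lo
      (K.van ρ) (K.van (ρ - 1)) := by
  have hd := fun y e (he : lo y ≤ e) => exists_dom_of_neg hj hρ y e he
  have hd' := fun y e (he : lo y ≤ e) => exists_dom_of_neg hj (show ρ - 1 < 0 by omega) y e he
  refine ⟨isCount_of_neg hK hj hρ hg, isCount_of_neg hK hj (by omega) hg',
    fun j y => ⟨lo_a j y, fun e he hv => ?_⟩,
    fun j y => ⟨(lo_b j y).le, fun e he hv => ?_⟩, fun y => ⟨lo_sub_one y, fun e he hv => ?_⟩,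
    fun y => ⟨lo_sub_one y, fun e he hv => ?_⟩⟩
  · refine van_a hρ.ne hv j ((hd y e he).imp_right fun h => van_of_pos (by omega) ?_)
    fin_cases j <;> simp [tw_apply] <;> omega
  · fin_cases j
    · have := van_b0 hv ((hd' y e he).imp_right fun h => van_of_pos (by omega) (by omega))
      change K.van ρ (y + 0) e
      rwa [add_zero]
    · refine van_b1 hv ((hd' y e he).imp_right fun h => van_of_pos (by omega) ?_)
      simp [tw_apply]
      omega
  · refine van_c hv ((hd y e he).imp_right fun h => van_of_pos (by omega) ?_)
    simp [one, tw_apply]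
    omega
  · refine van_c hv ((hd' y e he).imp_right fun h => van_of_pos (by omega) ?_)
    simp [one, tw_apply]
    omega

theorem inner_of_ne_zero (hK : K.Semistable θL θU) (hj : j₀ ≤ 0) (hρ : ρ < 0)
    (hg : GoodIdx θL θU ρ) {y : Weight} (h : (-mutDim K.gL K.gU ρ) y ≠ 0) : Inner (j₀ - ρ) y := by
  obtain ⟨n, h1, h2, h3⟩ := isCount_of_neg hK hj hρ hg y
  by_contra hc
  have h4 := (h3 (lo y) le_rfl).1 (van_of_pos hρ (by unfold Inner at hc; omega))
  exact h (by rw [Finsupp.neg_apply] at *; rw [Pi.neg_apply] at h2; omega)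

theorem countSystem_of_gen (hj : j₀ ≤ 0) (hK : K.gen.SL = ⊤) (hK' : K.gen.SU = ⊤) :
    CountSystem K.gL K.gU (mxx j₀) (mxx (j₀ + 1)) (fun y e => K.mL y e = 0)
      (fun y e => K.mU y e = 0) := by
  have hm : j₀ ≤ 1 := by omega
  have hm' : j₀ + 1 ≤ 1 := by omega
  refine ⟨fun y => ?_, fun y => ?_, fun j y => ⟨?_, fun e he hv => ?_⟩,
    fun j y => ⟨?_, fun e he hv => ?_⟩, fun y => ⟨mxx_sub_one_le hm y, fun e he hv => ?_⟩,
    fun y => ⟨mxx_sub_one_le hm' y, fun e he hv => ?_⟩⟩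
  · refine exists_count_of_projection (K.prL y)
      (K.b 1 ∘ₗ K.a 1 ∘ₗ K.b 0 ∘ₗ K.a 0 ∘ₗ K.cL) (K.mL y) (mxx j₀ y)
      (fun e he => ?_) (fun g hg x => ?_) ?_
    · have hd := (mxx_le_iff hm _ _).1 he
      exact ⟨K.prL_mL _ _ hd, loop_mL hd⟩
    · have : K.gen.SL ≤ LinearMap.ker (g ∘ₗ K.prL y) := by
        refine Submodule.span_le.2 ?_
        rintro _ ⟨w, e, hd, rfl⟩
        rw [SetLike.mem_coe, LinearMap.mem_ker, LinearMap.comp_apply]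
        by_cases hw : y = w
        · subst hw
          rw [K.prL_mL _ _ hd]
          exact hg e ((mxx_le_iff hm _ _).2 hd)
        · rw [← K.prL_mL _ _ hd, K.prL_ne _ _ _ hw, map_zero]
      exact this (hK ▸ Submodule.mem_top)
    · obtain ⟨N, hN⟩ := exists_monomial_eq_zero K.nil_cL K.cL_mL
      exact ⟨N, fun e he he' => hN _ _ he ((mxx_le_iff hm _ _).1 he')⟩
  · refine exists_count_of_projection (K.prU y)
      (K.a 1 ∘ₗ K.b 1 ∘ₗ K.a 0 ∘ₗ K.b 0 ∘ₗ K.cU) (K.mU y) (mxx (j₀ + 1) y)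
      (fun e he => ?_) (fun g hg x => ?_) ?_
    · have hd := (mxx_le_iff hm' _ _).1 he
      refine ⟨K.prU_mU _ _ hd, ?_⟩
      simp only [LinearMap.comp_apply]
      rw [K.cU_mU _ _ hd, K.b_mU _ _ _ (dom_c hd), K.a_mL _ _ _ (dom_b (dom_c hd) 0),
        K.b_mU _ _ _ (dom_a (dom_b (dom_c hd) 0) 0),
        K.a_mL _ _ _ (dom_b (dom_a (dom_b (dom_c hd) 0) 0) 1)]
      congr 1
      simp [one]
      abel
    · have : K.gen.SU ≤ LinearMap.ker (g ∘ₗ K.prU y) := by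
        refine Submodule.span_le.2 ?_
        rintro _ ⟨w, e, hd, rfl⟩
        rw [SetLike.mem_coe, LinearMap.mem_ker, LinearMap.comp_apply]
        by_cases hw : y = w
        · subst hw
          rw [K.prU_mU _ _ hd]
          exact hg e ((mxx_le_iff hm' _ _).2 hd)
        · rw [← K.prU_mU _ _ hd, K.prU_ne _ _ _ hw, map_zero]
      exact this (hK' ▸ Submodule.mem_top)
    · obtain ⟨N, hN⟩ := exists_monomial_eq_zero K.nil_cU K.cU_mU
      exact ⟨N, fun e he he' => hN _ _ he ((mxx_le_iff hm' _ _).1 he')⟩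
  · exact (mxx_le_iff hm' _ _).2 (dom_a (dom_mxx hm y) j)
  · dsimp only at *
    rw [← K.a_mL _ _ _ ((mxx_le_iff hm _ _).1 he), hv, map_zero]
  · exact (mxx_le_iff hm _ _).2 (dom_b (dom_mxx hm' y) j)
  · dsimp only at *
    rw [← K.b_mU _ _ _ ((mxx_le_iff hm' _ _).1 he), hv, map_zero]
  · rw [← K.cL_mL _ _ ((mxx_le_iff hm _ _).1 he), hv, map_zero]
  · rw [← K.cU_mU _ _ ((mxx_le_iff hm' _ _).1 he), hv, map_zero]

end GRep

end LocalConifold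

namespace LocalConifold

open WQuiver

theorem IsCount.eq {F F' q : Weight → ℤ} {v v' : Weight → ℤ → Prop} (h : IsCount F q v)
    (h' : IsCount F' q v') (hv : ∀ y e, q y ≤ e → (v y e ↔ v' y e)) : F = F' := by
  funext y
  obtain ⟨n, h1, h2, h3⟩ := h y
  obtain ⟨n', h1', h2', h3'⟩ := h' y
  have e1 := (h3' n h1).1 ((hv y n h1).1 ((h3 n h1).2 le_rfl))
  have e2 := (h3 n' h1').1 ((hv y n' h1').2 ((h3' n' h1').2 le_rfl))
  rw [h2, h2']
  omega

theorem IsCount.iff {F q : Weight → ℤ} {v v' : Weight → ℤ → Prop} (h : IsCount F q v)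
    (h' : IsCount F q v') (y : Weight) (e : ℤ) (he : q y ≤ e) : v y e ↔ v' y e := by
  obtain ⟨n, h1, h2, h3⟩ := h y
  obtain ⟨n', h1', h2', h3'⟩ := h' y
  rw [h3 e he, h3' e he]
  omega

theorem mutDim_injective {L U L' U' : KT} (ρ : ℤ) (h : mutDim L U ρ = mutDim L' U' ρ)
    (h' : mutDim L U (ρ - 1) = mutDim L' U' (ρ - 1)) : L = L' ∧ U = U' := by
  have key := eq_of_succ (f := fun ρ => mutDim L U ρ = mutDim L' U' ρ ∧
      mutDim L U (ρ - 1) = mutDim L' U' (ρ - 1)) (fun ρ => by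
    have e1 := mutDim_mutation L U ρ
    have e2 := mutDim_mutation L' U' ρ
    rw [add_sub_cancel_right]
    refine propext ⟨fun ⟨h1, h2⟩ => ⟨h2, ?_⟩, fun ⟨h1, h2⟩ => ⟨?_, h1⟩⟩
    · rw [e1, e2, h2, add_right_inj] at h1
      have h3 := congrArg (tr (-tw 0)) h1
      rw [tr_tr, tr_tr, neg_add_cancel, tr_zero, tr_zero] at h3
      exact sub_right_injective h3
    · rw [e1, e2, h1, h2]) ρ
  have h0 := key.mp ⟨h, h'⟩
  rwa [mutDim_zero, mutDim_zero, zero_sub, mutDim_neg_one, mutDim_neg_one] at h0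

/-- The stability parameters to which the description by mutations applies. -/
def Regime (θL θU : ℝ) : Prop :=
  (θL < 0 ∧ θU < 0) ∨ (∃ ρ, 0 < ρ ∧ GoodIdx θL θU ρ ∧ GoodIdx θL θU (ρ - 1)) ∨
    ∃ ρ, ρ < 0 ∧ GoodIdx θL θU ρ ∧ GoodIdx θL θU (ρ - 1)

namespace GRep

section

variable {L U : Type} [AddCommGroup L] [Module ℂ L] [AddCommGroup U] [Module ℂ U] {j₀ : ℤ}
variable {K : GRep j₀ L U} [FiniteDimensional ℂ L] [FiniteDimensional ℂ U] {θL θU : ℝ}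

theorem gen_eq_top (hK : K.Semistable θL θU) (hL : θL < 0) (hU : θU < 0) :
    K.gen.SL = ⊤ ∧ K.gen.SU = ⊤ := by
  have h := hK.theta_le_top K.gen ⟨le_rfl, le_rfl⟩
  rw [KSub.theta_top, KSub.theta] at h
  have h1 := Submodule.finrank_le K.gen.SL
  have h2 := Submodule.finrank_le K.gen.SU
  have h1' := mul_le_mul_of_nonpos_left (Nat.cast_le (α := ℝ).2 h1) hL.le
  have h2' := mul_le_mul_of_nonpos_left (Nat.cast_le (α := ℝ).2 h2) hU.le
  constructor
  · refine Submodule.eq_top_of_finrank_eq (Nat.cast_injective (R := ℝ) ?_)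
    exact mul_left_cancel₀ hL.ne (by linarith)
  · refine Submodule.eq_top_of_finrank_eq (Nat.cast_injective (R := ℝ) ?_)
    exact mul_left_cancel₀ hU.ne (by linarith)

theorem eulerSq_eq (hK : K.Semistable θL θU) (hj : j₀ ≤ 0) (hΘ : Regime θL θU) :
    eulerSq K.gL K.gU =
      - (ev K.gL (psi j₀) - ev K.gU fun w => psi (j₀ - 1) (w + tw 0)) := by
  rcases hΘ with ⟨hL, hU⟩ | ⟨ρ, hρ, hg, hg'⟩ | ⟨ρ, hρ, hg, hg'⟩
  · obtain ⟨h1, h2⟩ := gen_eq_top hK hL hU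
    exact (countSystem_of_gen hj h1 h2).allEdgeSquares.eulerSq_eq
  · exact (countSystem_of_pos hK hj hρ hg hg').allEdgeSquares.eulerSq_mutDim
  · refine (allEdgeSquares_mnn (countSystem_of_neg hK hj hρ hg hg').allEdgeSquares
      (fun w hw => inner_of_ne_zero hK hj hρ hg hw) (fun w hw => ?_)).eulerSq_mutDim_of_mnn
    have := inner_of_ne_zero hK hj (by omega) hg' hw
    rwa [show j₀ - (ρ - 1) = j₀ - ρ + 1 by ring] at this

end

variable {L U L' U' L'' U'' : Type} [AddCommGroup L] [Module ℂ L] [AddCommGroup U] [Module ℂ U]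
  [AddCommGroup L'] [Module ℂ L'] [AddCommGroup U'] [Module ℂ U'] [AddCommGroup L'']
  [Module ℂ L''] [AddCommGroup U''] [Module ℂ U''] {j₀ : ℤ}
  [FiniteDimensional ℂ L] [FiniteDimensional ℂ U] [FiniteDimensional ℂ L']
  [FiniteDimensional ℂ U'] [FiniteDimensional ℂ L''] [FiniteDimensional ℂ U'']

/-- Representations with the same graded dimensions have the same graded dimensions as any
representation in which a monomial vanishes if and only if it vanishes in both of them. -/
theorem gdim_eq_of_van {K : GRep j₀ L U} {K' : GRep j₀ L' U'} {Y : GRep j₀ L'' U''} {θL θU : ℝ}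
    (hK : K.Semistable θL θU) (hK' : K'.Semistable θL θU) (hY : Y.Semistable θL θU) (hj : j₀ ≤ 0)
    (hΘ : Regime θL θU) (hL : K.gL = K'.gL) (hU : K.gU = K'.gU)
    (hmL : ∀ w e, dom j₀ w e → (Y.mL w e = 0 ↔ K.mL w e = 0 ∧ K'.mL w e = 0))
    (hmU : ∀ w e, dom (j₀ + 1) w e → (Y.mU w e = 0 ↔ K.mU w e = 0 ∧ K'.mU w e = 0))
    (hvan : ∀ ρ y e, GoodIdx θL θU ρ → (Y.van ρ y e ↔ K.van ρ y e ∧ K'.van ρ y e)) :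
    Y.gL = K.gL ∧ Y.gU = K.gU := by
  have key : ∀ {F F' : KT} {q : Weight → ℤ} {v v' v'' : Weight → ℤ → Prop},
      IsCount F q v → IsCount F q v' → IsCount F' q v'' →
      (∀ y e, q y ≤ e → (v'' y e ↔ v y e ∧ v' y e)) → F' = F := by
    intro F F' q v v' v'' h h' h'' hv
    refine DFunLike.coe_injective (h''.eq h fun y e he => ?_)
    rw [hv y e he, ← h.iff h' y e he, and_self]
  rcases hΘ with ⟨hL', hU'⟩ | ⟨ρ, hρ, hg, hg'⟩ | ⟨ρ, hρ, hg, hg'⟩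
  · obtain ⟨h1, h2⟩ := gen_eq_top hK hL' hU'
    obtain ⟨h1', h2'⟩ := gen_eq_top hK' hL' hU'
    obtain ⟨h1'', h2''⟩ := gen_eq_top hY hL' hU'
    have c1 := countSystem_of_gen hj h1 h2
    have c2 := countSystem_of_gen hj h1' h2'
    have c3 := countSystem_of_gen hj h1'' h2''
    rw [← hL, ← hU] at c2
    exact ⟨key c1.count c2.count c3.count fun y e he =>
        hmL _ _ ((mxx_le_iff (by omega) _ _).1 he),
      key c1.count' c2.count' c3.count' fun y e he =>
        hmU _ _ ((mxx_le_iff (by omega) _ _).1 he)⟩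
  · have c1 := countSystem_of_pos hK hj hρ hg hg'
    have c2 := countSystem_of_pos hK' hj hρ hg hg'
    have c3 := countSystem_of_pos hY hj hρ hg hg'
    rw [← hL, ← hU] at c2
    exact mutDim_injective ρ (key c1.count c2.count c3.count fun y e _ => hvan _ _ _ hg)
      (key c1.count' c2.count' c3.count' fun y e _ => hvan _ _ _ hg')
  · have c1 := countSystem_of_neg hK hj hρ hg hg'
    have c2 := countSystem_of_neg hK' hj hρ hg hg'
    have c3 := countSystem_of_neg hY hj hρ hg hg'
    rw [← hL, ← hU] at c2
    exact mutDim_injective ρ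
      (neg_injective (key c1.count c2.count c3.count fun y e _ => hvan _ _ _ hg))
      (neg_injective (key c1.count' c2.count' c3.count' fun y e _ => hvan _ _ _ hg'))

end GRep

theorem exists_sum_eq {E : Type*} [AddCommGroup E] [Module ℂ E] {pr : Weight → Module.End ℂ E}
    (hne : ∀ w w' x, w ≠ w' → pr w (pr w' x) = 0) (hs : ∃ S : Finset Weight, ∀ x, ∑ w ∈ S, pr w x = x) :
    ∃ S : Finset Weight, ∀ T, S ⊆ T → ∀ x, ∑ w ∈ T, pr w x = x := by
  obtain ⟨S, hS⟩ := hs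
  refine ⟨S, fun T hT x => ?_⟩
  rw [← Finset.sum_subset hT fun w _ hw => ?_, hS]
  rw [← hS x, map_sum]
  exact Finset.sum_eq_zero fun w' hw' => hne _ _ _ fun h => hw (h ▸ hw')

/-- Restriction along an injective map. -/
theorem isNilpotent_of_injective {E F : Type*} [AddCommGroup E] [Module ℂ E] [AddCommGroup F]
    [Module ℂ F] {S : Module.End ℂ E} {T : Module.End ℂ F} {j : E →ₗ[ℂ] F}
    (hj : Function.Injective j) (h : ∀ x, j (S x) = T (j x)) (hT : IsNilpotent T) :
    IsNilpotent S := by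
  obtain ⟨n, hn⟩ := hT
  refine ⟨n, LinearMap.ext fun x => hj ?_⟩
  have h1 : ∀ n : ℕ, j ((S ^ n) x) = (T ^ n) (j x) := by
    intro n
    induction n with
    | zero => rfl
    | succ n ih => rw [pow_succ', pow_succ', Module.End.mul_apply, Module.End.mul_apply, h, ih]
  rw [h1, hn, LinearMap.zero_apply, LinearMap.zero_apply, map_zero]

theorem isNilpotent_prodMap {E F : Type*} [AddCommGroup E] [Module ℂ E] [AddCommGroup F]
    [Module ℂ F] {S : Module.End ℂ E} {T : Module.End ℂ F} (hS : IsNilpotent S)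
    (hT : IsNilpotent T) : IsNilpotent (S.prodMap T) := by
  obtain ⟨m, hm⟩ := hS
  obtain ⟨n, hn⟩ := hT
  have h1 : ∀ k : ℕ, S.prodMap T ^ k = (S ^ k).prodMap (T ^ k) := by
    intro k
    induction k with
    | zero => rfl
    | succ k ih => rw [pow_succ, pow_succ, pow_succ, ih, LinearMap.prodMap_mul]
  refine ⟨m + n, ?_⟩
  rw [h1, pow_add, pow_add, hm, hn, zero_mul, mul_zero, LinearMap.prodMap_zero]

namespace GRep

variable {L U L' U' : Type} [AddCommGroup L] [Module ℂ L] [AddCommGroup U] [Module ℂ U]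
  [AddCommGroup L'] [Module ℂ L'] [AddCommGroup U'] [Module ℂ U'] {j₀ : ℤ}

/-- The direct sum of graded representations, with the diagonal framing. -/
def prod (K : GRep j₀ L U) (K' : GRep j₀ L' U') : GRep j₀ (L × L') (U × U') where
  a i := (K.a i).prodMap (K'.a i)
  b i := (K.b i).prodMap (K'.b i)
  cL := K.cL.prodMap K'.cL
  cU := K.cU.prodMap K'.cU
  aba i j k x := Prod.ext (K.aba i j k x.1) (K'.aba i j k x.2)
  bab i j k x := Prod.ext (K.bab i j k x.1) (K'.bab i j k x.2)
  ca i x := Prod.ext (K.ca i x.1) (K'.ca i x.2)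
  cb i x := Prod.ext (K.cb i x.1) (K'.cb i x.2)
  nil_ab i j := isNilpotent_prodMap (K.nil_ab i j) (K'.nil_ab i j)
  nil_ba i j := isNilpotent_prodMap (K.nil_ba i j) (K'.nil_ba i j)
  nil_cL := isNilpotent_prodMap K.nil_cL K'.nil_cL
  nil_cU := isNilpotent_prodMap K.nil_cU K'.nil_cU
  prL w := (K.prL w).prodMap (K'.prL w)
  prU w := (K.prU w).prodMap (K'.prU w)
  prL_prL w x := Prod.ext (K.prL_prL w x.1) (K'.prL_prL w x.2)
  prU_prU w x := Prod.ext (K.prU_prU w x.1) (K'.prU_prU w x.2)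
  prL_ne w w' x h := Prod.ext (K.prL_ne w w' x.1 h) (K'.prL_ne w w' x.2 h)
  prU_ne w w' x h := Prod.ext (K.prU_ne w w' x.1 h) (K'.prU_ne w w' x.2 h)
  sumL := by
    obtain ⟨S, hS⟩ := exists_sum_eq K.prL_ne K.sumL
    obtain ⟨S', hS'⟩ := exists_sum_eq K'.prL_ne K'.sumL
    classical
    refine ⟨S ∪ S', fun x => Prod.ext ?_ ?_⟩
    · rw [Prod.fst_sum]
      exact hS _ Finset.subset_union_left x.1
    · rw [Prod.snd_sum]
      exact hS' _ Finset.subset_union_right x.2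
  sumU := by
    obtain ⟨S, hS⟩ := exists_sum_eq K.prU_ne K.sumU
    obtain ⟨S', hS'⟩ := exists_sum_eq K'.prU_ne K'.sumU
    classical
    refine ⟨S ∪ S', fun x => Prod.ext ?_ ?_⟩
    · rw [Prod.fst_sum]
      exact hS _ Finset.subset_union_left x.1
    · rw [Prod.snd_sum]
      exact hS' _ Finset.subset_union_right x.2
  prL_b i w x := Prod.ext (K.prL_b i w x.1) (K'.prL_b i w x.2)
  prU_a i w x := Prod.ext (K.prU_a i w x.1) (K'.prU_a i w x.2)
  prL_c w x := Prod.ext (K.prL_c w x.1) (K'.prL_c w x.2)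
  prU_c w x := Prod.ext (K.prU_c w x.1) (K'.prU_c w x.2)
  mL w e := (K.mL w e, K'.mL w e)
  mU w e := (K.mU w e, K'.mU w e)
  prL_mL w e h := Prod.ext (K.prL_mL w e h) (K'.prL_mL w e h)
  prU_mU w e h := Prod.ext (K.prU_mU w e h) (K'.prU_mU w e h)
  a_mL i w e h := Prod.ext (K.a_mL i w e h) (K'.a_mL i w e h)
  b_mU i w e h := Prod.ext (K.b_mU i w e h) (K'.b_mU i w e h)
  cL_mL w e h := Prod.ext (K.cL_mL w e h) (K'.cL_mL w e h)
  cU_mU w e h := Prod.ext (K.cU_mU w e h) (K'.cU_mU w e h)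

/-- Homogeneous subrepresentations. -/
structure IsGraded (K : GRep j₀ L U) (Y : KSub K.toKRep) : Prop where
  prL_mem : ∀ w, ∀ x ∈ Y.SL, K.prL w x ∈ Y.SL
  prU_mem : ∀ w, ∀ x ∈ Y.SU, K.prU w x ∈ Y.SU

open Classical in
/-- The graded representation given by a homogeneous subrepresentation which contains the image
of the framing. -/
noncomputable def restrict (K : GRep j₀ L U) {Y : KSub K.toKRep} (hY : K.IsGraded Y) (hg : K.gen ≤ Y) :
    GRep j₀ Y.SL Y.SU where
  a i := (K.a i).restrict (Y.a_mem i)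
  b i := (K.b i).restrict (Y.b_mem i)
  cL := K.cL.restrict Y.cL_mem
  cU := K.cU.restrict Y.cU_mem
  aba i j k x := Subtype.ext (K.aba i j k x)
  bab i j k x := Subtype.ext (K.bab i j k x)
  ca i x := Subtype.ext (K.ca i x)
  cb i x := Subtype.ext (K.cb i x)
  nil_ab i j := isNilpotent_of_injective (Submodule.subtype_injective _) (fun _ => rfl) (K.nil_ab i j)
  nil_ba i j := isNilpotent_of_injective (Submodule.subtype_injective _) (fun _ => rfl) (K.nil_ba i j)
  nil_cL := isNilpotent_of_injective (Submodule.subtype_injective _) (fun _ => rfl) K.nil_cL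
  nil_cU := isNilpotent_of_injective (Submodule.subtype_injective _) (fun _ => rfl) K.nil_cU
  prL w := (K.prL w).restrict (hY.prL_mem w)
  prU w := (K.prU w).restrict (hY.prU_mem w)
  prL_prL w x := Subtype.ext (K.prL_prL w x)
  prU_prU w x := Subtype.ext (K.prU_prU w x)
  prL_ne w w' x h := Subtype.ext (K.prL_ne w w' x h)
  prU_ne w w' x h := Subtype.ext (K.prU_ne w w' x h)
  sumL := by
    obtain ⟨S, hS⟩ := K.sumL
    refine ⟨S, fun x => Subtype.ext ?_⟩
    rw [AddSubmonoidClass.coe_finset_sum]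
    exact hS x
  sumU := by
    obtain ⟨S, hS⟩ := K.sumU
    refine ⟨S, fun x => Subtype.ext ?_⟩
    rw [AddSubmonoidClass.coe_finset_sum]
    exact hS x
  prL_b i w x := Subtype.ext (K.prL_b i w x)
  prU_a i w x := Subtype.ext (K.prU_a i w x)
  prL_c w x := Subtype.ext (K.prL_c w x)
  prU_c w x := Subtype.ext (K.prU_c w x)
  mL w e := if h : dom j₀ w e then ⟨K.mL w e, hg.1 (Submodule.subset_span ⟨w, e, h, rfl⟩)⟩ else 0
  mU w e := if h : dom (j₀ + 1) w e then ⟨K.mU w e, hg.2 (Submodule.subset_span ⟨w, e, h, rfl⟩)⟩ else 0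
  prL_mL w e h := by rw [dif_pos h]; exact Subtype.ext (K.prL_mL w e h)
  prU_mU w e h := by rw [dif_pos h]; exact Subtype.ext (K.prU_mU w e h)
  a_mL i w e h := by rw [dif_pos h, dif_pos (dom_a h i)]; exact Subtype.ext (K.a_mL i w e h)
  b_mU i w e h := by rw [dif_pos h, dif_pos (dom_b h i)]; exact Subtype.ext (K.b_mU i w e h)
  cL_mL w e h := by rw [dif_pos h, dif_pos (dom_c h)]; exact Subtype.ext (K.cL_mL w e h)
  cU_mU w e h := by rw [dif_pos h, dif_pos (dom_c h)]; exact Subtype.ext (K.cU_mU w e h)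

theorem restrict_mL (K : GRep j₀ L U) {Y : KSub K.toKRep} (hY : K.IsGraded Y) (hg : K.gen ≤ Y)
    {w : Weight} {e : ℤ} (h : dom j₀ w e) : ((K.restrict hY hg).mL w e : L) = K.mL w e := by
  have : (K.restrict hY hg).mL w e = _ := dif_pos h
  rw [this]

theorem restrict_mU (K : GRep j₀ L U) {Y : KSub K.toKRep} (hY : K.IsGraded Y) (hg : K.gen ≤ Y)
    {w : Weight} {e : ℤ} (h : dom (j₀ + 1) w e) : ((K.restrict hY hg).mU w e : U) = K.mU w e := by
  have : (K.restrict hY hg).mU w e = _ := dif_pos h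
  rw [this]

/-- A subrepresentation of a subrepresentation. -/
noncomputable def ofRestrict (K : GRep j₀ L U) {Y : KSub K.toKRep} (hY : K.IsGraded Y) (hg : K.gen ≤ Y)
    (X : KSub (K.restrict hY hg).toKRep) : KSub K.toKRep where
  SL := X.SL.map Y.SL.subtype
  SU := X.SU.map Y.SU.subtype
  a_mem i := by
    rintro _ ⟨x, hx, rfl⟩
    exact ⟨_, X.a_mem i x hx, rfl⟩
  b_mem i := by
    rintro _ ⟨x, hx, rfl⟩
    exact ⟨_, X.b_mem i x hx, rfl⟩
  cL_mem := by
    rintro _ ⟨x, hx, rfl⟩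
    exact ⟨_, X.cL_mem x hx, rfl⟩
  cU_mem := by
    rintro _ ⟨x, hx, rfl⟩
    exact ⟨_, X.cU_mem x hx, rfl⟩

theorem theta_ofRestrict (K : GRep j₀ L U) {Y : KSub K.toKRep} (hY : K.IsGraded Y)
    (hg : K.gen ≤ Y) (X : KSub (K.restrict hY hg).toKRep) (θL θU : ℝ) :
    (K.ofRestrict hY hg X).theta θL θU = X.theta θL θU := by
  have e1 := Submodule.finrank_map_subtype_eq Y.SL X.SL
  have e2 := Submodule.finrank_map_subtype_eq Y.SU X.SU
  rw [KSub.theta, KSub.theta, ← e1, ← e2]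
  rfl

theorem semistable_restrict (K : GRep j₀ L U) {Y : KSub K.toKRep} (hY : K.IsGraded Y)
    (hg : K.gen ≤ Y) {θL θU : ℝ} (h0 : ∀ X : KSub K.toKRep, X.theta θL θU ≤ 0)
    (hmax : ∀ X : KSub K.toKRep, K.gen ≤ X → X.theta θL θU ≤ Y.theta θL θU) :
    (K.restrict hY hg).Semistable θL θU := by
  refine ⟨fun X => by rw [← theta_ofRestrict]; exact h0 _, fun X hX => ?_⟩
  rw [← theta_ofRestrict, KSub.theta_top]
  refine hmax _ ⟨Submodule.span_le.2 ?_, Submodule.span_le.2 ?_⟩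
  · rintro _ ⟨w, e, h, rfl⟩
    refine ⟨(K.restrict hY hg).mL w e, hX.1 (Submodule.subset_span ⟨w, e, h, rfl⟩), ?_⟩
    exact restrict_mL K hY hg h
  · rintro _ ⟨w, e, h, rfl⟩
    refine ⟨(K.restrict hY hg).mU w e, hX.2 (Submodule.subset_span ⟨w, e, h, rfl⟩), ?_⟩
    exact restrict_mU K hY hg h

/-- Chains of functionals on a subrepresentation of maximal slope extend. -/
theorem van_restrict_of_van [FiniteDimensional ℂ L] [FiniteDimensional ℂ U] {K : GRep j₀ L U}
    {Y : KSub K.toKRep} (hY : K.IsGraded Y) (hg : K.gen ≤ Y) {θL θU : ℝ}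
    (hmax : ∀ X : KSub K.toKRep, K.gen ≤ X → X.theta θL θU ≤ Y.theta θL θU) {ρ : ℤ}
    (hρ : GoodIdx θL θU ρ) {y : Weight} {e : ℤ} (h : K.van ρ y e) :
    (K.restrict hY hg).van ρ y e := by
  classical
  intro f hf i hi hd
  have hex : ∀ i, ∃ g : Module.Dual ℂ L, (∀ x : Y.SL, g x = f i x) ∧ (i ∉ idx ρ → g = 0) := by
    intro i
    by_cases hi : i ∈ idx ρ
    · obtain ⟨g, hg⟩ := LinearMap.exists_extend (f i)
      exact ⟨g, fun x => LinearMap.congr_fun hg x, fun h => absurd hi h⟩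
    · exact ⟨0, fun x => by rw [hf.eq_zero i hi]; rfl, fun _ => rfl⟩
  choose F hF hF0 using hex
  let P : Submodule ℂ (ChainL K ρ y) := Submodule.pi Set.univ fun i => Y.SL.comap (Submodule.subtype _)
  have hPR : chainPair K ρ y F ∈ (P ⊓ LinearMap.range (chainMap K ρ y)).dualAnnihilator := by
    rw [Submodule.mem_dualAnnihilator]
    rintro _ ⟨hP, u, rfl⟩
    have hu := mem_of_chain hρ (H := Y) (fun X hX => hmax X ⟨hg.1.trans hX.1, hg.2.trans hX.2⟩)
      (x := fun i => extU K ρ y i u) (fun i hi => extU_of_notMem K ρ y hi u)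
      (fun i hi => hP ⟨i, hi⟩ trivial)
    rw [chainPair_chainMap K ρ y hF0]
    refine Finset.sum_eq_zero fun j hj => ?_
    have h1 := hF (j + 1) ⟨_, Y.b_mem 0 _ (hu j)⟩
    have h2 := hF j ⟨_, Y.b_mem 1 _ (hu j)⟩
    have h3 := hf.comm j hj ⟨_, hu j⟩
    rw [h1, h2, sub_eq_zero]
    exact h3
  rw [Subspace.dualAnnihilator_inf_eq, Submodule.mem_sup] at hPR
  obtain ⟨F1, h1, F2, h2, h12⟩ := hPR
  rw [Submodule.mem_dualAnnihilator] at h1 h2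
  have hch := isChain_toChain K ρ y F2 fun u => h2 _ (LinearMap.mem_range_self _ u)
  have h3 := h _ hch i hi hd
  have h4 := chainPair_single K ρ y (toChain K ρ y F2) ⟨i, hi⟩ ⟨_, _, K.prL_mL _ _ hd⟩
  rw [chainPair_toChain, h3] at h4
  have h5 : F1 (LinearMap.single ℂ (fun i : idx ρ => LinearMap.range (K.prL (y - (i : ℤ) • tw 0)))
      ⟨i, hi⟩ ⟨_, _, K.prL_mL _ _ hd⟩) = 0 := by
    refine h1 _ fun j _ => ?_
    rw [LinearMap.single_apply]
    by_cases hj : j = ⟨i, hi⟩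
    · subst hj
      rw [Pi.single_eq_same]
      exact hg.1 (Submodule.subset_span ⟨_, _, hd, rfl⟩)
    · rw [Pi.single_eq_of_ne hj]
      exact Submodule.zero_mem _
  have h6 := chainPair_single K ρ y F ⟨i, hi⟩ ⟨_, _, K.prL_mL _ _ hd⟩
  rw [← h12, LinearMap.add_apply, h5, h4, add_zero] at h6
  have h7 := hF i ((K.restrict hY hg).mL (y - i • tw 0) e)
  rw [restrict_mL K hY hg hd] at h7
  rw [← h7]
  exact h6.symm

theorem van_prod {K : GRep j₀ L U} {K' : GRep j₀ L' U'} {ρ : ℤ} {y : Weight} {e : ℤ}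
    (h : K.van ρ y e) (h' : K'.van ρ y e) : (K.prod K').van ρ y e := by
  intro f hf i hi hd
  have h1 := h (fun i => f i ∘ₗ LinearMap.inl ℂ L L')
    ⟨fun i hi => by rw [hf.eq_zero i hi]; rfl, fun i hi u => by
      have := hf.comm i hi (u, 0)
      change f (i + 1) (K.b 0 u, K'.b 0 0) = f i (K.b 1 u, K'.b 1 0) at this
      rw [map_zero, map_zero] at this
      exact this⟩ i hi hd
  have h2 := h' (fun i => f i ∘ₗ LinearMap.inr ℂ L L')
    ⟨fun i hi => by rw [hf.eq_zero i hi]; rfl, fun i hi u => by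
      have := hf.comm i hi (0, u)
      change f (i + 1) (K.b 0 0, K'.b 0 u) = f i (K.b 1 0, K'.b 1 u) at this
      rw [map_zero, map_zero] at this
      exact this⟩ i hi hd
  change f i (K.mL _ _, K'.mL _ _) = 0
  rw [← zero_add (K'.mL _ _), ← add_zero (K.mL _ _), ← Prod.mk_add_mk, map_add]
  exact (congrArg₂ (· + ·) h1 h2).trans (add_zero 0)

end GRep

end LocalConifold

namespace LocalConifold

open WQuiver

/-- A point of the torus at which the characters take different values. -/
noncomputable def genericPoint : Torus :=
  ⟨![Units.mk0 2 two_ne_zero, Units.mk0 3 three_ne_zero, Units.mk0 5 (by norm_num),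
    (Units.mk0 30 (by norm_num))⁻¹], by
    rw [Fin.prod_univ_four]
    ext
    simp
    norm_num⟩

theorem char_genericPoint (w : Weight) :
    genericPoint.char w = (((2 : ℚ) ^ w 0 * 3 ^ w 1 * 5 ^ w 2 : ℚ) : ℂ) := by
  rw [Torus.char, Fin.prod_univ_three]
  simp [genericPoint]

theorem char_genericPoint_injective : Function.Injective genericPoint.char := by
  intro w w' h
  rw [char_genericPoint, char_genericPoint, Rat.cast_inj] at h
  have hv : ∀ (p : ℕ) [Fact p.Prime] (w : Weight),
      padicValRat p ((2 : ℚ) ^ w 0 * 3 ^ w 1 * 5 ^ w 2) =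
        w 0 * padicValNat p 2 + w 1 * padicValNat p 3 + w 2 * padicValNat p 5 := by
    intro p _ w
    have e2 := padicValRat.of_nat (p := p) (n := 2)
    have e3 := padicValRat.of_nat (p := p) (n := 3)
    have e5 := padicValRat.of_nat (p := p) (n := 5)
    rw [Nat.cast_ofNat] at e2 e3 e5
    rw [padicValRat.mul (by positivity) (by positivity), padicValRat.mul (by positivity)
      (by positivity), padicValRat.zpow, padicValRat.zpow, padicValRat.zpow, e2, e3, e5]
  haveI : Fact (Nat.Prime 5) := ⟨by norm_num⟩
  have e2 := congrArg (padicValRat 2) h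
  have e3 := congrArg (padicValRat 3) h
  have e5 := congrArg (padicValRat 5) h
  have n23 : padicValNat 2 3 = 0 := padicValNat.eq_zero_of_not_dvd (by norm_num)
  have n25 : padicValNat 2 5 = 0 := padicValNat.eq_zero_of_not_dvd (by norm_num)
  have n32 : padicValNat 3 2 = 0 := padicValNat.eq_zero_of_not_dvd (by norm_num)
  have n35 : padicValNat 3 5 = 0 := padicValNat.eq_zero_of_not_dvd (by norm_num)
  have n52 : padicValNat 5 2 = 0 := padicValNat.eq_zero_of_not_dvd (by norm_num)
  have n53 : padicValNat 5 3 = 0 := padicValNat.eq_zero_of_not_dvd (by norm_num)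
  rw [hv, hv, padicValNat_self, n23, n25] at e2
  rw [hv, hv, padicValNat_self, n32, n35] at e3
  rw [hv, hv, padicValNat_self, n52, n53] at e5
  ext i
  fin_cases i <;> simp <;> omega

theorem char_ne_zero (t : Torus) (w : Weight) : t.char w ≠ 0 := Units.ne_zero _

section Grading

variable {E F : Type*} [AddCommGroup E] [Module ℂ E] [AddCommGroup F] [Module ℂ F]
  {pr : Weight → Module.End ℂ E} {pr' : Weight → Module.End ℂ F}

theorem exists_scale (hne : ∀ w w' x, w ≠ w' → pr w (pr w' x) = 0)
    (hs : ∃ S : Finset Weight, ∀ x, ∑ w ∈ S, pr w x = x) (c : Weight → ℂ) :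
    ∃ D : Module.End ℂ E, ∀ w x, D (pr w x) = c w • pr w x := by
  obtain ⟨S, hS⟩ := hs
  refine ⟨∑ w ∈ S, c w • pr w, fun w x => ?_⟩
  rw [LinearMap.sum_apply]
  conv_rhs => rw [← hS (pr w x), Finset.smul_sum]
  refine Finset.sum_congr rfl fun w' _ => ?_
  by_cases h : w' = w
  · rw [h]; rfl
  · rw [LinearMap.smul_apply, hne _ _ _ h, smul_zero, smul_zero]

theorem scale_comm (hs : ∃ S : Finset Weight, ∀ x, ∑ w ∈ S, pr w x = x) {t : Torus}
    {D : Module.End ℂ E} {D' : Module.End ℂ F} (hD : ∀ w x, D (pr w x) = t.char w • pr w x)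
    (hD' : ∀ w x, D' (pr' w x) = t.char w • pr' w x) {α : Weight} {T : E →ₗ[ℂ] F}
    (hT : ∀ w x, pr' (w + α) (T x) = T (pr w x)) (x : E) : D' (T x) = t.char α • T (D x) := by
  obtain ⟨S, hS⟩ := hs
  rw [← hS x, map_sum, map_sum, map_sum, map_sum, Finset.smul_sum]
  refine Finset.sum_congr rfl fun w _ => ?_
  rw [hD, ← hT, hD', hT, map_smul, smul_smul, t.char_add, mul_comm]

theorem scale_injective (hs : ∃ S : Finset Weight, ∀ x, ∑ w ∈ S, pr w x = x)
    (hne : ∀ w w' x, w ≠ w' → pr w (pr w' x) = 0) {c : Weight → ℂ} (hc : ∀ w, c w ≠ 0)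
    {D : Module.End ℂ E} (hD : ∀ w x, D (pr w x) = c w • pr w x) : Function.Injective D := by
  obtain ⟨D', hD'⟩ := exists_scale hne hs fun w => (c w)⁻¹
  obtain ⟨S, hS⟩ := hs
  refine Function.LeftInverse.injective (g := D') fun x => ?_
  conv_lhs => rw [← hS x]
  conv_rhs => rw [← hS x]
  rw [map_sum, map_sum]
  refine Finset.sum_congr rfl fun w _ => ?_
  rw [hD, map_smul, hD', smul_smul, mul_inv_cancel₀ (hc w), one_smul]

/-- A subspace which is invariant under a generic element is homogeneous. -/
theorem pr_mem_of_scale (hne : ∀ w w' x, w ≠ w' → pr w (pr w' x) = 0)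
    (hs : ∃ S : Finset Weight, ∀ x, ∑ w ∈ S, pr w x = x) {c : Weight → ℂ}
    (hc : Function.Injective c) {D : Module.End ℂ E} (hD : ∀ w x, D (pr w x) = c w • pr w x)
    {Y : Submodule ℂ E} (hY : ∀ x ∈ Y, D x ∈ Y) (w : Weight) (x : E) (hx : x ∈ Y) : pr w x ∈ Y := by
  classical
  obtain ⟨S, hS⟩ := exists_sum_eq hne hs
  set p := Lagrange.interpolate (insert w S) c (Pi.single w 1) with hp
  have h1 : ∀ n : ℕ, (D ^ n) x ∈ Y := by
    intro n
    induction n with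
    | zero => exact hx
    | succ n ih => rw [pow_succ', Module.End.mul_apply]; exact hY _ ih
  have h2 : ∀ u, Polynomial.aeval D p (pr u x) = p.eval (c u) • pr u x := by
    intro u
    have h3 : ∀ n : ℕ, (D ^ n) (pr u x) = c u ^ n • pr u x := by
      intro n
      induction n with
      | zero => simp
      | succ n ih => rw [pow_succ', Module.End.mul_apply, ih, map_smul, hD, smul_smul, pow_succ]
    rw [Polynomial.aeval_eq_sum_range, Polynomial.eval_eq_sum_range, LinearMap.sum_apply,
      Finset.sum_smul]
    refine Finset.sum_congr rfl fun n _ => ?_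
    rw [LinearMap.smul_apply, h3, smul_smul]
  have h4 : Polynomial.aeval D p x = pr w x := by
    conv_lhs => rw [← hS _ (Finset.subset_insert w S) x]
    rw [map_sum, Finset.sum_eq_single_of_mem w (Finset.mem_insert_self _ _)]
    · rw [h2, hp, Lagrange.eval_interpolate_at_node _ hc.injOn (Finset.mem_insert_self _ _),
        Pi.single_eq_same, one_smul]
    · intro u hu hne
      rw [h2, hp, Lagrange.eval_interpolate_at_node _ hc.injOn hu, Pi.single_eq_of_ne hne, zero_smul]
  rw [← h4, Polynomial.aeval_eq_sum_range, LinearMap.sum_apply]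
  exact Y.sum_mem fun n _ => Y.smul_mem _ (h1 n)

theorem finrank_eq_sum_pr [FiniteDimensional ℂ E] (hpr : ∀ w x, pr w (pr w x) = pr w x)
    (hne : ∀ w w' x, w ≠ w' → pr w (pr w' x) = 0) {S : Finset Weight}
    (hS : ∀ x, ∑ w ∈ S, pr w x = x) :
    Module.finrank ℂ E = ∑ w ∈ S, Module.finrank ℂ (LinearMap.range (pr w)) := by
  have h : Function.Bijective
      (LinearMap.pi fun w : S => (pr w).rangeRestrict : E →ₗ[ℂ] ∀ w : S, LinearMap.range (pr w)) := by
    constructor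
    · refine (injective_iff_map_eq_zero _).2 fun x hx => ?_
      rw [← hS x]
      refine Finset.sum_eq_zero fun w hw => ?_
      exact congrArg Subtype.val (congrFun hx ⟨w, hw⟩)
    · intro y
      refine ⟨∑ w, (y w : E), funext fun w => Subtype.ext ?_⟩
      change pr w (∑ w, (y w : E)) = y w
      rw [map_sum, Finset.sum_eq_single w]
      · obtain ⟨x, hx⟩ := (y w).2
        rw [← hx, hpr]
      · intro w' _ h
        obtain ⟨x, hx⟩ := (y w').2
        rw [← hx]
        exact hne _ _ _ fun hc => h (Subtype.ext hc.symm)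
      · intro h
        exact absurd (Finset.mem_univ _) h
  rw [(LinearEquiv.ofBijective _ h).finrank_eq, Module.finrank_pi_fintype,
    Finset.sum_coe_sort S fun w => Module.finrank ℂ (LinearMap.range (pr w))]

end Grading

namespace GRep

variable {L U L' U' : Type} [AddCommGroup L] [Module ℂ L] [AddCommGroup U] [Module ℂ U]
  [AddCommGroup L'] [Module ℂ L'] [AddCommGroup U'] [Module ℂ U'] {j₀ : ℤ}
  [FiniteDimensional ℂ L] [FiniteDimensional ℂ U]

theorem finrank_L (K : GRep j₀ L U) : (Module.finrank ℂ L : ℤ) = K.gL.sum fun _ n => n := by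
  obtain ⟨S, hS⟩ := exists_sum_eq K.prL_ne K.sumL
  classical
  rw [finrank_eq_sum_pr K.prL_prL K.prL_ne (hS (S ∪ K.gL.support) Finset.subset_union_left),
    Finsupp.sum_of_support_subset _ Finset.subset_union_right _ fun _ _ => rfl, Nat.cast_sum]
  rfl

theorem finrank_U (K : GRep j₀ L U) : (Module.finrank ℂ U : ℤ) = K.gU.sum fun _ n => n := by
  obtain ⟨S, hS⟩ := exists_sum_eq K.prU_ne K.sumU
  classical
  rw [finrank_eq_sum_pr K.prU_prU K.prU_ne (hS (S ∪ K.gU.support) Finset.subset_union_left),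
    Finsupp.sum_of_support_subset _ Finset.subset_union_right _ fun _ _ => rfl, Nat.cast_sum]
  rfl

/-- There is a homogeneous subrepresentation of maximal slope which contains the image of the
framing. -/
theorem exists_graded_max (K : GRep j₀ L U) (θL θU : ℝ) : ∃ Y : KSub K.toKRep, K.gen ≤ Y ∧
    (∀ X : KSub K.toKRep, K.gen ≤ X → X.theta θL θU ≤ Y.theta θL θU) ∧ K.IsGraded Y := by
  let s : Set (ℕ × ℕ) := {p | ∃ X : KSub K.toKRep, K.gen ≤ X ∧
    Module.finrank ℂ X.SL = p.1 ∧ Module.finrank ℂ X.SU = p.2}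
  have hs : s.Finite := ((Set.finite_Iic (Module.finrank ℂ L)).prod
    (Set.finite_Iic (Module.finrank ℂ U))).subset fun p hp => by
      obtain ⟨X, -, h1, h2⟩ := hp
      exact ⟨h1 ▸ X.SL.finrank_le, h2 ▸ X.SU.finrank_le⟩
  obtain ⟨⟨m, n⟩, ⟨Y, hY, hm, hn⟩, hmax⟩ := Set.exists_max_image s
    (fun p => (toLex (θL * p.1 + θU * p.2, - ((p.1 : ℤ) + p.2)) : ℝ ×ₗ ℤ)) hs
    ⟨(_, _), K.gen, ⟨le_rfl, le_rfl⟩, rfl, rfl⟩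
  have key : ∀ X : KSub K.toKRep, K.gen ≤ X → X.theta θL θU < Y.theta θL θU ∨
      (X.theta θL θU = Y.theta θL θU ∧ Module.finrank ℂ Y.SL + Module.finrank ℂ Y.SU ≤
        Module.finrank ℂ X.SL + Module.finrank ℂ X.SU) := by
    intro X hX
    have h := hmax (Module.finrank ℂ X.SL, Module.finrank ℂ X.SU) ⟨X, hX, rfl, rfl⟩
    rw [Prod.Lex.toLex_le_toLex] at h
    dsimp only at h hm hn
    rw [← hm, ← hn] at h
    refine h.imp id (And.imp id fun h => ?_)
    omega
  have hle : ∀ X : KSub K.toKRep, K.gen ≤ X → X.theta θL θU ≤ Y.theta θL θU := fun X hX =>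
    (key X hX).elim le_of_lt fun h => h.1.le
  obtain ⟨D, hD⟩ := exists_scale K.prL_ne K.sumL genericPoint.char
  obtain ⟨D', hD'⟩ := exists_scale K.prU_ne K.sumU genericPoint.char
  have iD := scale_injective K.sumL K.prL_ne (char_ne_zero _) hD
  have iD' := scale_injective K.sumU K.prU_ne (char_ne_zero _) hD'
  have hmap : ∀ {E F : Type} [AddCommGroup E] [Module ℂ E] [AddCommGroup F] [Module ℂ F]
      {D : Module.End ℂ E} {D' : Module.End ℂ F} {T : E →ₗ[ℂ] F} {α : Weight}
      (_ : ∀ x, D' (T x) = genericPoint.char α • T (D x)) {P : Submodule ℂ E} {R : Submodule ℂ F}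
      (_ : ∀ x ∈ P, T x ∈ R), ∀ x ∈ P.map D, T x ∈ R.map D' := by
    rintro E F _ _ _ _ D D' T α h P R hPR _ ⟨x, hx, rfl⟩
    refine ⟨(genericPoint.char α)⁻¹ • T x, R.smul_mem _ (hPR x hx), ?_⟩
    rw [map_smul, h, smul_smul, inv_mul_cancel₀ (char_ne_zero _ _), one_smul]
  let X : KSub K.toKRep :=
    { SL := Y.SL.map D
      SU := Y.SU.map D'
      a_mem := fun i => hmap (scale_comm K.sumL hD hD' (K.prU_a i)) (Y.a_mem i)
      b_mem := fun i => hmap (scale_comm K.sumU hD' hD (K.prL_b i)) (Y.b_mem i)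
      cL_mem := hmap (scale_comm K.sumL hD hD (α := -one)
        (fun w x => by rw [← sub_eq_add_neg]; exact K.prL_c w x)) Y.cL_mem
      cU_mem := hmap (scale_comm K.sumU hD' hD' (α := -one)
        (fun w x => by rw [← sub_eq_add_neg]; exact K.prU_c w x)) Y.cU_mem }
  have hX : K.gen ≤ X := by
    refine ⟨Submodule.span_le.2 ?_, Submodule.span_le.2 ?_⟩
    · rintro _ ⟨w, e, h, rfl⟩
      refine ⟨(genericPoint.char w)⁻¹ • K.mL w e,
        Y.SL.smul_mem _ (hY.1 (Submodule.subset_span ⟨w, e, h, rfl⟩)), ?_⟩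
      rw [← K.prL_mL w e h, map_smul, hD, smul_smul, inv_mul_cancel₀ (char_ne_zero _ _), one_smul]
    · rintro _ ⟨w, e, h, rfl⟩
      refine ⟨(genericPoint.char w)⁻¹ • K.mU w e,
        Y.SU.smul_mem _ (hY.2 (Submodule.subset_span ⟨w, e, h, rfl⟩)), ?_⟩
      rw [← K.prU_mU w e h, map_smul, hD', smul_smul, inv_mul_cancel₀ (char_ne_zero _ _), one_smul]
  let I : KSub K.toKRep :=
    { SL := Y.SL ⊓ X.SL
      SU := Y.SU ⊓ X.SU
      a_mem := fun i x hx => ⟨Y.a_mem i x hx.1, X.a_mem i x hx.2⟩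
      b_mem := fun i x hx => ⟨Y.b_mem i x hx.1, X.b_mem i x hx.2⟩
      cL_mem := fun x hx => ⟨Y.cL_mem x hx.1, X.cL_mem x hx.2⟩
      cU_mem := fun x hx => ⟨Y.cU_mem x hx.1, X.cU_mem x hx.2⟩ }
  have hsup : ∀ {E F : Type} [AddCommGroup E] [Module ℂ E] [AddCommGroup F] [Module ℂ F]
      {T : E →ₗ[ℂ] F} {P P' : Submodule ℂ E} {R R' : Submodule ℂ F} (_ : ∀ x ∈ P, T x ∈ R)
      (_ : ∀ x ∈ P', T x ∈ R'), ∀ x ∈ P ⊔ P', T x ∈ R ⊔ R' := by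
    intro E F _ _ _ _ T P P' R R' h h'
    exact sup_le (a := P) (b := P') (c := (R ⊔ R').comap T)
      (fun x hx => Submodule.mem_sup_left (h x hx)) fun x hx => Submodule.mem_sup_right (h' x hx)
  let J : KSub K.toKRep :=
    { SL := Y.SL ⊔ X.SL
      SU := Y.SU ⊔ X.SU
      a_mem := fun i => hsup (Y.a_mem i) (X.a_mem i)
      b_mem := fun i => hsup (Y.b_mem i) (X.b_mem i)
      cL_mem := hsup Y.cL_mem X.cL_mem
      cU_mem := hsup Y.cU_mem X.cU_mem }
  have hXY : Module.finrank ℂ X.SL = Module.finrank ℂ Y.SL := by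
    have := finrank_map_add_finrank_ker D Y.SL
    rwa [LinearMap.ker_eq_bot.2 iD, bot_inf_eq, finrank_bot, add_zero] at this
  have hXY' : Module.finrank ℂ X.SU = Module.finrank ℂ Y.SU := by
    have := finrank_map_add_finrank_ker D' Y.SU
    rwa [LinearMap.ker_eq_bot.2 iD', bot_inf_eq, finrank_bot, add_zero] at this
  have hIJ : I.theta θL θU + J.theta θL θU = Y.theta θL θU + Y.theta θL θU := by
    have e1 := Submodule.finrank_sup_add_finrank_inf_eq Y.SL X.SL
    have e2 := Submodule.finrank_sup_add_finrank_inf_eq Y.SU X.SU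
    rw [hXY] at e1
    rw [hXY'] at e2
    have e1' := congrArg (Nat.cast (R := ℝ)) e1
    have e2' := congrArg (Nat.cast (R := ℝ)) e2
    push_cast at e1' e2'
    simp only [KSub.theta]
    linear_combination θL * e1' + θU * e2'
  have hJ := hle J ⟨hY.1.trans le_sup_left, hY.2.trans le_sup_left⟩
  have hdim : Module.finrank ℂ Y.SL + Module.finrank ℂ Y.SU ≤
      Module.finrank ℂ I.SL + Module.finrank ℂ I.SU := by
    rcases key I ⟨le_inf hY.1 hX.1, le_inf hY.2 hX.2⟩ with h | h
    · linarith
    · exact h.2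
  have l1 : Module.finrank ℂ I.SL ≤ Module.finrank ℂ Y.SL := Submodule.finrank_mono inf_le_left
  have l2 : Module.finrank ℂ I.SU ≤ Module.finrank ℂ Y.SU := Submodule.finrank_mono inf_le_left
  have g1 : Y.SL ≤ X.SL := inf_eq_left.1 (Submodule.eq_of_le_of_finrank_eq inf_le_left
    (show Module.finrank ℂ I.SL = _ by omega))
  have g2 : Y.SU ≤ X.SU := inf_eq_left.1 (Submodule.eq_of_le_of_finrank_eq inf_le_left
    (show Module.finrank ℂ I.SU = _ by omega))
  have h1 := Submodule.eq_of_le_of_finrank_eq g1 hXY.symm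
  have h2 := Submodule.eq_of_le_of_finrank_eq g2 hXY'.symm
  refine ⟨Y, hY, hle, pr_mem_of_scale K.prL_ne K.sumL char_genericPoint_injective hD fun x hx => ?_,
    pr_mem_of_scale K.prU_ne K.sumU char_genericPoint_injective hD' fun x hx => ?_⟩
  · rw [h1]; exact ⟨x, hx, rfl⟩
  · rw [h2]; exact ⟨x, hx, rfl⟩

theorem van_of_van_restrict_prod {K : GRep j₀ L U} {K' : GRep j₀ L' U'}
    {Y : KSub (K.prod K').toKRep} (hY : (K.prod K').IsGraded Y) (hg : (K.prod K').gen ≤ Y) {ρ : ℤ}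
    {y : Weight} {e : ℤ} (h : ((K.prod K').restrict hY hg).van ρ y e) :
    K.van ρ y e ∧ K'.van ρ y e := by
  constructor
  · intro f hf i hi hd
    have h1 := h (fun i => f i ∘ₗ LinearMap.fst ℂ L L' ∘ₗ Y.SL.subtype)
      ⟨fun i hi => by rw [hf.eq_zero i hi]; rfl, fun i hi u => hf.comm i hi u.1.1⟩ i hi hd
    have h2 := restrict_mL _ hY hg hd
    rw [LinearMap.comp_apply, LinearMap.comp_apply, Submodule.subtype_apply, h2] at h1
    exact h1
  · intro f hf i hi hd
    have h1 := h (fun i => f i ∘ₗ LinearMap.snd ℂ L L' ∘ₗ Y.SL.subtype)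
      ⟨fun i hi => by rw [hf.eq_zero i hi]; rfl, fun i hi u => hf.comm i hi u.1.2⟩ i hi hd
    have h2 := restrict_mL _ hY hg hd
    rw [LinearMap.comp_apply, LinearMap.comp_apply, Submodule.subtype_apply, h2] at h1
    exact h1

variable [FiniteDimensional ℂ L'] [FiniteDimensional ℂ U']

theorem finrank_prod_eq {E F : Type} [AddCommGroup E] [Module ℂ E] [AddCommGroup F] [Module ℂ F]
    [FiniteDimensional ℂ E] [FiniteDimensional ℂ F] (P : Submodule ℂ (E × F)) :
    Module.finrank ℂ P = Module.finrank ℂ (P.map (LinearMap.fst ℂ E F)) +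
      Module.finrank ℂ (P.comap (LinearMap.inr ℂ E F)) := by
  have h1 := finrank_map_add_finrank_ker (LinearMap.fst ℂ E F) P
  have h2 := finrank_map_add_finrank_ker (LinearMap.inr ℂ E F) (P.comap (LinearMap.inr ℂ E F))
  rw [LinearMap.ker_eq_bot.2 LinearMap.inr_injective, bot_inf_eq, finrank_bot, add_zero,
    Submodule.map_comap_eq, LinearMap.range_inr] at h2
  omega

theorem theta_prod_le {K : GRep j₀ L U} {K' : GRep j₀ L' U'} {θL θU : ℝ}
    (h : ∀ X : KSub K.toKRep, X.theta θL θU ≤ 0) (h' : ∀ X : KSub K'.toKRep, X.theta θL θU ≤ 0)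
    (X : KSub (K.prod K').toKRep) : X.theta θL θU ≤ 0 := by
  have h1 := h
    { SL := X.SL.map (LinearMap.fst ℂ L L')
      SU := X.SU.map (LinearMap.fst ℂ U U')
      a_mem := by rintro i _ ⟨x, hx, rfl⟩; exact ⟨_, X.a_mem i x hx, rfl⟩
      b_mem := by rintro i _ ⟨x, hx, rfl⟩; exact ⟨_, X.b_mem i x hx, rfl⟩
      cL_mem := by rintro _ ⟨x, hx, rfl⟩; exact ⟨_, X.cL_mem x hx, rfl⟩
      cU_mem := by rintro _ ⟨x, hx, rfl⟩; exact ⟨_, X.cU_mem x hx, rfl⟩ }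
  have h2 := h'
    { SL := X.SL.comap (LinearMap.inr ℂ L L')
      SU := X.SU.comap (LinearMap.inr ℂ U U')
      a_mem := by
        intro i x hx
        have := X.a_mem i _ hx
        change (K.a i 0, K'.a i x) ∈ X.SU at this
        rwa [map_zero] at this
      b_mem := by
        intro i x hx
        have := X.b_mem i _ hx
        change (K.b i 0, K'.b i x) ∈ X.SL at this
        rwa [map_zero] at this
      cL_mem := by
        intro x hx
        have := X.cL_mem _ hx
        change (K.cL 0, K'.cL x) ∈ X.SL at this
        rwa [map_zero] at this
      cU_mem := by
        intro x hx
        have := X.cU_mem _ hx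
        change (K.cU 0, K'.cU x) ∈ X.SU at this
        rwa [map_zero] at this }
  simp only [KSub.theta] at h1 h2 ⊢
  rw [finrank_prod_eq X.SL, finrank_prod_eq X.SU]
  push_cast
  linarith

/-- Two semistable representations with the same graded dimensions have a common extension of the
same dimension. -/
theorem exists_correspondence {K : GRep j₀ L U} {K' : GRep j₀ L' U'} {θL θU : ℝ}
    (hK : K.Semistable θL θU) (hK' : K'.Semistable θL θU) (hj : j₀ ≤ 0) (hΘ : Regime θL θU)
    (hL : K.gL = K'.gL) (hU : K.gU = K'.gU) :
    ∃ Y : KSub (K.prod K').toKRep, (K.prod K').gen ≤ Y ∧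
      Module.finrank ℂ Y.SL = Module.finrank ℂ L ∧ Module.finrank ℂ Y.SU = Module.finrank ℂ U := by
  obtain ⟨Y, hg, hmax, hY⟩ := (K.prod K').exists_graded_max θL θU
  have hs := semistable_restrict _ hY hg
    (theta_prod_le hK.theta_le_zero hK'.theta_le_zero) hmax
  obtain ⟨h1, h2⟩ := gdim_eq_of_van hK hK' hs hj hΘ hL hU
    (fun w e h => by
      have := restrict_mL _ hY hg h
      rw [← Submodule.coe_eq_zero, this]
      exact Prod.mk_eq_zero)
    (fun w e h => by
      have := restrict_mU _ hY hg h
      rw [← Submodule.coe_eq_zero, this]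
      exact Prod.mk_eq_zero)
    (fun ρ y e hρ => ⟨van_of_van_restrict_prod hY hg, fun h =>
      van_restrict_of_van hY hg hmax hρ (van_prod h.1 h.2)⟩)
  refine ⟨Y, hg, Nat.cast_injective (R := ℤ) ?_, Nat.cast_injective (R := ℤ) ?_⟩
  · rw [finrank_L ((K.prod K').restrict hY hg), finrank_L K, h1]
  · rw [finrank_U ((K.prod K').restrict hY hg), finrank_U K, h2]

end GRep

end LocalConifold

namespace LocalConifold

open WQuiver

section GenEigenspaces

variable {E F : Type*} [AddCommGroup E] [Module ℂ E] [FiniteDimensional ℂ E] [AddCommGroup F]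
  [Module ℂ F]

theorem eq_of_eqOn_maxGenEigenspace (g : Module.End ℂ E) {S T : E →ₗ[ℂ] F}
    (h : ∀ μ, ∀ x ∈ g.maxGenEigenspace μ, S x = T x) : S = T := by
  rw [← LinearMap.eqLocus_eq_top, eq_top_iff, ← Module.End.iSup_maxGenEigenspace_eq_top g]
  exact iSup_le h

theorem exists_scale_maxGenEigenspace (g : Module.End ℂ E) (c : ℂ → ℂ) :
    ∃ D : Module.End ℂ E, ∀ μ, ∀ x ∈ g.maxGenEigenspace μ, D x = c μ • x := by
  classical
  have h := DirectSum.isInternal_submodule_of_iSupIndep_of_iSup_eq_top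
    (Module.End.independent_maxGenEigenspace g) (Module.End.iSup_maxGenEigenspace_eq_top g)
  refine ⟨DirectSum.toModule ℂ ℂ E (fun μ => c μ • (g.maxGenEigenspace μ).subtype) ∘ₗ
    (LinearEquiv.ofBijective (DirectSum.coeLinearMap g.maxGenEigenspace) h).symm.toLinearMap,
    fun μ x hx => ?_⟩
  have h1 : (LinearEquiv.ofBijective (DirectSum.coeLinearMap g.maxGenEigenspace) h).symm x =
      DirectSum.lof ℂ ℂ (fun μ => g.maxGenEigenspace μ) μ ⟨x, hx⟩ := by
    rw [LinearEquiv.symm_apply_eq]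
    exact (DirectSum.coeLinearMap_lof g.maxGenEigenspace μ ⟨x, hx⟩).symm
  rw [LinearMap.comp_apply, LinearEquiv.coe_coe, h1, DirectSum.toModule_lof]
  rfl

end GenEigenspaces

namespace FramedRep

variable {Q : WQuiver} {δ : Vtx → ℕ} {V : FramedRep Q δ} {Θ : ℝ × ℝ}

/-- Endomorphisms up to scalars of a stable representation which kill the framing vanish. -/
theorem IsStable.eq_zero (h : V.IsStable Θ) (f : ∀ i, Module.End ℂ (Fin (δ i) → ℂ))
    (hf : ∀ {i j : Vtx} (e : Q.Arrow i j), ∃ r : ℂ, r ≠ 0 ∧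
      ∀ v, f j (V.map e v) = r • V.map e (f i v))
    (hs : f .v0 V.framing = 0) (i : Vtx) : f i = 0 := by
  by_contra hi
  let K : V.Sub := ⟨fun i => LinearMap.ker (f i), fun {i j} e v hv => by
    obtain ⟨r, -, h1⟩ := hf e
    rw [LinearMap.mem_ker] at hv ⊢
    rw [h1, hv, map_zero, smul_zero]⟩
  let I : V.Sub := ⟨fun i => LinearMap.range (f i), fun {i j} e v hv => by
    obtain ⟨r, hr, h1⟩ := hf e
    obtain ⟨x, rfl⟩ := hv
    refine ⟨r⁻¹ • V.map e x, ?_⟩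
    rw [map_smul, h1, smul_smul, inv_mul_cancel₀ hr, one_smul]⟩
  have h1 := h.1 I ⟨i, fun hc => hi (LinearMap.range_eq_bot.1 hc)⟩
  have h2 := h.2 K hs ⟨i, fun hc => hi (LinearMap.ker_eq_top.1 hc)⟩
  have e0 := congrArg (Nat.cast (R := ℝ)) (LinearMap.finrank_range_add_finrank_ker (f .v0))
  have e1 := congrArg (Nat.cast (R := ℝ)) (LinearMap.finrank_range_add_finrank_ker (f .v1))
  rw [Module.finrank_fin_fun] at e0 e1
  push_cast at e0 e1
  simp only [Sub.slope, K, I] at h1 h2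
  rw [← e0, ← e1] at h2
  linarith

/-- The decomposition of a representation into its weight spaces. -/
structure Grading (V : FramedRep Q δ) where
  pr : ∀ i : Vtx, Weight → Module.End ℂ (Fin (δ i) → ℂ)
  pr_pr : ∀ i w x, pr i w (pr i w x) = pr i w x
  pr_ne : ∀ i w w' x, w ≠ w' → pr i w (pr i w' x) = 0
  sum : ∀ i, ∃ S : Finset Weight, ∀ x, ∑ w ∈ S, pr i w x = x
  pr_map : ∀ {i j : Vtx} (e : Q.Arrow i j) w x,
    pr j (w + Q.deg e) (V.map e x) = V.map e (pr i w x)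
  pr_framing : pr .v0 0 V.framing = V.framing
  range_pr : ∀ i w, LinearMap.range (pr i w) = V.weightSpace i w

theorem IsStable.nonempty_grading (h : V.IsStable Θ) (hF : V.IsFixed) : Nonempty V.Grading := by
  classical
  obtain ⟨φ⟩ := hF genericPoint
  let g (i : Vtx) : Module.End ℂ (Fin (δ i) → ℂ) := (φ.g i).toLinearMap
  let χ := genericPoint.char
  have hχ := char_genericPoint_injective
  have hmap : ∀ {i j : Vtx} (e : Q.Arrow i j) μ x, x ∈ (g i).maxGenEigenspace μ →
      V.map e x ∈ (g j).maxGenEigenspace (χ (Q.deg e) * μ) := by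
    intro i j e μ x hx
    rw [Module.End.mem_maxGenEigenspace] at hx ⊢
    obtain ⟨n, hn⟩ := hx
    have h1 : ∀ n : ℕ, ((g j - (χ (Q.deg e) * μ) • 1) ^ n) (V.map e x) =
        χ (Q.deg e) ^ n • V.map e (((g i - μ • 1) ^ n) x) := by
      intro n
      induction n with
      | zero => simp
      | succ n ih =>
        rw [pow_succ', Module.End.mul_apply, ih, pow_succ' (g i - μ • 1), Module.End.mul_apply]
        generalize ((g i - μ • 1) ^ n) x = y
        have h2 : g j (V.map e y) = χ (Q.deg e) • V.map e (g i y) := φ.map_comm e y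
        simp only [map_smul, LinearMap.sub_apply, LinearMap.smul_apply, Module.End.one_apply, h2,
          map_sub, smul_sub, smul_smul]
        rw [pow_succ]
        congr 2
        ring
    exact ⟨n, by rw [h1, hn, map_zero, smul_zero]⟩
  have hg : ∀ i μ x, x ∈ (g i).maxGenEigenspace μ → g i x ∈ (g i).maxGenEigenspace μ :=
    fun i μ => Module.End.mapsTo_maxGenEigenspace_of_comm (Commute.refl (g i)) μ
  have hone : ∀ i μ x, g i x = μ • x → x ∈ (g i).maxGenEigenspace μ := by
    intro i μ x hx
    rw [Module.End.mem_maxGenEigenspace]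
    refine ⟨1, ?_⟩
    rw [pow_one, LinearMap.sub_apply, hx, LinearMap.smul_apply, Module.End.one_apply, sub_self]
  have hs1 : V.framing ∈ (g .v0).maxGenEigenspace (χ 0) :=
    hone _ _ _ ((φ.framing_comm).trans 
      (by rw [show χ 0 = 1 from genericPoint.char_zero, one_smul]))
  choose D hD using fun i =>
    exists_scale_maxGenEigenspace (g i) fun μ => if ∃ w, χ w = μ then μ⁻¹ else 0
  have hz := h.eq_zero (fun i => D i * g i - 1) (fun {i j} e => ⟨1, one_ne_zero, fun v => by
      refine LinearMap.congr_fun (eq_of_eqOn_maxGenEigenspace (g i)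
        (S := (D j * g j - 1) ∘ₗ V.map e) (T := (1 : ℂ) • (V.map e ∘ₗ (D i * g i - 1))) ?_) v
      intro μ x hx
      have h1 : g j (V.map e x) = χ (Q.deg e) • V.map e (g i x) := φ.map_comm e x
      have h2 : (∃ w, χ w = χ (Q.deg e) * μ) ↔ ∃ w, χ w = μ := by
        constructor
        · rintro ⟨w, hw⟩
          refine ⟨w - Q.deg e, mul_left_cancel₀ (char_ne_zero genericPoint (Q.deg e)) ?_⟩
          change genericPoint.char _ * genericPoint.char _ = _
          rw [← genericPoint.char_add, add_sub_cancel]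
          exact hw
        · rintro ⟨w, rfl⟩
          exact ⟨Q.deg e + w, genericPoint.char_add _ _⟩
      rw [one_smul, LinearMap.comp_apply, LinearMap.comp_apply, LinearMap.sub_apply,
        LinearMap.sub_apply, Module.End.mul_apply, Module.End.mul_apply, Module.End.one_apply,
        Module.End.one_apply, hD j _ _ (hg j _ _ (hmap e μ x hx)), hD i _ _ (hg i _ _ hx), h1,
        map_sub, map_smul, smul_smul]
      simp only [h2]
      split_ifs
      · rw [mul_inv, mul_right_comm, inv_mul_cancel₀ (char_ne_zero genericPoint _), one_mul]
      · rw [zero_mul]⟩) (by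
    rw [LinearMap.sub_apply, Module.End.mul_apply, hD _ _ _ (hg _ _ _ hs1), if_pos ⟨0, rfl⟩,
      Module.End.one_apply, sub_eq_zero]
    change (genericPoint.char 0)⁻¹ • φ.g .v0 V.framing = _
    rw [genericPoint.char_zero, inv_one, one_smul, φ.framing_comm])
  have heig : ∀ i μ x, x ∈ (g i).maxGenEigenspace μ → x ≠ 0 → (∃ w, χ w = μ) ∧ g i x = μ • x := by
    intro i μ x hx hx0
    have h1 := LinearMap.congr_fun (hz i) x
    rw [LinearMap.sub_apply, Module.End.mul_apply, hD i _ _ (hg i _ _ hx), Module.End.one_apply,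
      LinearMap.zero_apply, sub_eq_zero] at h1
    split_ifs at h1 with h2
    · refine ⟨h2, ?_⟩
      obtain ⟨w, rfl⟩ := h2
      rw [← h1, smul_smul, mul_inv_cancel₀ (char_ne_zero _ _), one_smul, h1]
    · rw [zero_smul] at h1
      exact absurd h1.symm hx0
  choose P hP using fun i w =>
    exists_scale_maxGenEigenspace (g i) fun μ => if χ w = μ then 1 else 0
  have hPP : ∀ i w w' x, P i w (P i w' x) = (if w = w' then (1 : ℂ) else 0) • P i w' x := by
    intro i w w' x
    refine LinearMap.congr_fun (eq_of_eqOn_maxGenEigenspace (g i) (S := P i w * P i w')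
      (T := (if w = w' then (1 : ℂ) else 0) • P i w') fun μ x hx => ?_) x
    rw [Module.End.mul_apply, LinearMap.smul_apply, hP i w' μ x hx, map_smul, hP i w μ x hx,
      smul_smul, smul_smul]
    by_cases h1 : χ w' = μ
    · have h2 : χ w = μ ↔ w = w' := by rw [← h1]; exact hχ.eq_iff
      simp only [h2, mul_comm]
    · rw [if_neg h1, zero_mul, mul_zero]
  have hsum : ∀ i, ∃ S : Finset Weight, ∀ x, ∑ w ∈ S, P i w x = x := by
    intro i
    have hfin : {w | (g i).HasEigenvalue (χ w)}.Finite :=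
      (Module.End.finite_hasEigenvalue (g i)).preimage hχ.injOn
    refine ⟨hfin.toFinset, fun x => ?_⟩
    rw [← LinearMap.sum_apply]
    refine LinearMap.congr_fun (eq_of_eqOn_maxGenEigenspace (g i) (T := LinearMap.id)
      fun μ x hx => ?_) x
    by_cases hx0 : x = 0
    · rw [hx0, map_zero, map_zero]
    obtain ⟨⟨w, rfl⟩, h2⟩ := heig i μ x hx hx0
    rw [LinearMap.sum_apply, Finset.sum_eq_single_of_mem w]
    · rw [hP i w _ x hx, if_pos rfl, one_smul, LinearMap.id_apply]
    · rw [Set.Finite.mem_toFinset]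
      exact Module.End.hasEigenvalue_of_hasEigenvector ⟨Module.End.mem_eigenspace_iff.2 h2, hx0⟩
    · intro w' _ hne
      rw [hP i w' _ x hx, if_neg fun hc => hne (hχ hc), zero_smul]
  have hne : ∀ i w w' x, w ≠ w' → P i w (P i w' x) = 0 := fun i w w' x h1 => by
    rw [hPP, if_neg h1, zero_smul]
  have hpm : ∀ {i j : Vtx} (e : Q.Arrow i j) w x,
      P j (w + Q.deg e) (V.map e x) = V.map e (P i w x) := by
    intro i j e w x
    refine LinearMap.congr_fun (eq_of_eqOn_maxGenEigenspace (g i)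
      (S := P j (w + Q.deg e) ∘ₗ V.map e) (T := V.map e ∘ₗ P i w) fun μ x hx => ?_) x
    rw [LinearMap.comp_apply, LinearMap.comp_apply, hP j _ _ _ (hmap e μ x hx), hP i w μ x hx,
      map_smul]
    have h1 : χ (w + Q.deg e) = χ (Q.deg e) * μ ↔ χ w = μ := by
      change genericPoint.char _ = genericPoint.char _ * _ ↔ _
      rw [genericPoint.char_add, mul_comm]
      exact mul_right_inj' (char_ne_zero _ _)
    simp only [h1]
  have hpf : P .v0 0 V.framing = V.framing := by rw [hP _ 0 _ _ hs1, if_pos rfl, one_smul]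
  refine ⟨⟨P, fun i w x => by rw [hPP, if_pos rfl, one_smul], hne, hsum, hpm, hpf,
    fun i w => le_antisymm ?_ fun x hx => ⟨x, ?_⟩⟩⟩
  · rintro _ ⟨x, rfl⟩ t φ'
    choose D' hD' using fun i => exists_scale (hne i) (hsum i) t.char
    have h1 := h.eq_zero (fun i => (φ'.g i).toLinearMap - D' i) (fun {i j} e =>
      ⟨t.char (Q.deg e), char_ne_zero _ _, fun v => by
        rw [LinearMap.sub_apply, LinearMap.sub_apply, scale_comm (hsum i) (hD' i) (hD' j) (hpm e),
          map_sub, smul_sub]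
        exact congrArg (· - _) (φ'.map_comm e v)⟩) (by
      rw [LinearMap.sub_apply, ← hpf, hD', t.char_zero, one_smul, hpf, sub_eq_zero]
      exact φ'.framing_comm) i
    have h2 := LinearMap.congr_fun h1 (P i w x)
    rw [LinearMap.sub_apply, LinearMap.zero_apply, sub_eq_zero, hD'] at h2
    exact h2
  · rw [hP i w _ x (hone i _ x (hx genericPoint φ)), if_pos rfl, one_smul]

namespace Grading

theorem finiteSupport (P : V.Grading) : FiniteSupport V.grMod := by
  refine ⟨fun x => inferInstanceAs (Module.Finite ℂ (V.weightSpace x.vtx x.wt)), fun i => ?_⟩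
  obtain ⟨S, hS⟩ := P.sum i
  refine S.finite_toSet.subset fun w hw => ?_
  by_contra hc
  refine hw ⟨fun x y => ?_⟩
  have h1 : ∀ x : V.weightSpace i w, x = 0 := by
    intro x
    obtain ⟨y, hy⟩ := (P.range_pr i w).ge x.2
    refine Subtype.ext (hy.symm.trans ?_)
    rw [← hS y, map_sum]
    exact Finset.sum_eq_zero fun w' hw' => P.pr_ne _ _ _ _ fun h => hc (h ▸ hw')
  exact (h1 x).trans (h1 y).symm

theorem gdim_apply (P : V.Grading) (i : Vtx) (w : Weight) :
    gdim V.grMod i w = Module.finrank ℂ (LinearMap.range (P.pr i w)) := by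
  rw [P.finiteSupport.gdim_apply, P.range_pr]
  rfl

theorem sum_gdim (P : V.Grading) (i : Vtx) : ((gdim V.grMod i).sum fun _ n => n) = δ i := by
  obtain ⟨S, hS⟩ := exists_sum_eq (P.pr_ne i) (P.sum i)
  classical
  have h := finrank_eq_sum_pr (P.pr_pr i) (P.pr_ne i)
    (hS (S ∪ (gdim V.grMod i).support) Finset.subset_union_left)
  rw [Module.finrank_fin_fun] at h
  rw [Finsupp.sum_of_support_subset _ Finset.subset_union_right _ fun _ _ => rfl, h, Nat.cast_sum]
  exact Finset.sum_congr rfl fun w _ => P.gdim_apply i w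

/-- The weights are bounded, since the representation is generated by the framing up to
connected components. -/
theorem natAbs_le (P : V.Grading) (h : V.IsStable Θ) (hQ : ∀ {i j : Vtx} (e : Q.Arrow i j) k, |Q.deg e k| ≤ 1)
    {i : Vtx} {w : Weight} (hw : P.pr i w ≠ 0) (k : Fin 3) :
    (w k).natAbs ≤ δ .v0 + δ .v1 + 1 := by
  classical
  let nrm (w : Weight) : ℕ := Finset.univ.sup fun k => (w k).natAbs
  choose S hS using P.sum
  let T (i : Vtx) : Finset Weight := (S i).filter fun w => P.pr i w ≠ 0
  have hT : ∀ i w, P.pr i w ≠ 0 → w ∈ T i := by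
    intro i w hw
    refine Finset.mem_filter.2 ⟨?_, hw⟩
    by_contra hc
    refine hw (LinearMap.ext fun x => ?_)
    rw [← hS i x, map_sum]
    exact Finset.sum_eq_zero fun w' hw' => P.pr_ne _ _ _ _ fun h => hc (h ▸ hw')
  have hcard : ∀ i, (T i).card ≤ δ i := by
    intro i
    have h1 := finrank_eq_sum_pr (P.pr_pr i) (P.pr_ne i) (hS i)
    rw [Module.finrank_fin_fun] at h1
    rw [h1, Finset.card_eq_sum_ones]
    refine (Finset.sum_le_sum fun w hw => ?_).trans
      (Finset.sum_le_sum_of_subset (Finset.filter_subset _ _))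
    rw [Nat.succ_le_iff, Nat.pos_iff_ne_zero, Ne, Submodule.finrank_eq_zero, LinearMap.range_eq_bot]
    exact (Finset.mem_filter.1 hw).2
  obtain ⟨m, hm, hm'⟩ := Finset.exists_mem_notMem_of_card_lt_card
    (s := (T .v0).image nrm ∪ (T .v1).image nrm) (t := Finset.Icc 1 (δ .v0 + δ .v1 + 1)) (by
      refine (Finset.card_union_le _ _).trans_lt ?_
      have h0 := Finset.card_image_le (s := T .v0) (f := nrm)
      have h1 := Finset.card_image_le (s := T .v1) (f := nrm)
      have h2 := hcard .v0
      have h3 := hcard .v1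
      rw [Nat.card_Icc]
      omega)
  rw [Finset.mem_Icc] at hm
  have hgap : ∀ i w, P.pr i w ≠ 0 → nrm w ≠ m := by
    intro i w hw hc
    refine hm' (Finset.mem_union.2 ?_)
    cases i
    · exact Or.inl (Finset.mem_image.2 ⟨w, hT _ _ hw, hc⟩)
    · exact Or.inr (Finset.mem_image.2 ⟨w, hT _ _ hw, hc⟩)
  have hle : ∀ w w' : Weight, (∀ k, |w k - w' k| ≤ 1) → nrm w ≤ nrm w' + 1 := by
    intro w w' h
    refine Finset.sup_le fun k _ => ?_
    have h1 : (w' k).natAbs ≤ nrm w' := Finset.le_sup (f := fun k => (w' k).natAbs) (Finset.mem_univ k)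
    have h2 := h k
    rw [abs_le] at h2
    omega
  choose f hf using fun i => exists_scale (P.pr_ne i) (P.sum i) fun w => if m < nrm w then 1 else 0
  have hz := h.eq_zero f (fun {i j} e => ⟨1, one_ne_zero, fun v => by
      rw [one_smul, ← hS i v, map_sum, map_sum, map_sum, map_sum]
      refine Finset.sum_congr rfl fun w _ => ?_
      rw [hf, ← P.pr_map, hf, map_smul, ← P.pr_map]
      by_cases h1 : P.pr j (w + Q.deg e) (V.map e v) = 0
      · rw [h1, smul_zero, smul_zero]
      · have h2 := hgap j (w + Q.deg e) fun hc => h1 (by rw [hc]; rfl)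
        have h3 := hgap i w fun hc => h1 (by rw [P.pr_map, hc]; exact map_zero _)
        have h4 := hle (w + Q.deg e) w fun k => by
          rw [Pi.add_apply, add_sub_cancel_left]; exact hQ e k
        have h5 := hle w (w + Q.deg e) fun k => by
          rw [Pi.add_apply, sub_add_cancel_left, abs_neg]; exact hQ e k
        have h6 : m < nrm (w + Q.deg e) ↔ m < nrm w := by omega
        simp only [h6]⟩) (by
    have h0 : nrm 0 = 0 := by simp [nrm]
    rw [← P.pr_framing, hf, if_neg (by omega), zero_smul])
  have h1 : ¬ m < nrm w := by
    intro hc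
    refine hw (LinearMap.ext fun x => ?_)
    have := LinearMap.congr_fun (hz i) (P.pr i w x)
    rwa [hf, if_pos hc, one_smul] at this
  have h2 : (w k).natAbs ≤ nrm w := Finset.le_sup (f := fun k => (w k).natAbs) (Finset.mem_univ k)
  omega

end Grading

end FramedRep

theorem weightSpace_pushforward {δ : Vtx → ℕ} (J : FramedRep quiverZ δ) (i : Vtx) (w : Weight) :
    (pushforward J).weightSpace i w = J.weightSpace i w := by
  ext x
  constructor
  · intro hx t f
    refine hx t ⟨f.g, fun {i j} e v => ?_, f.framing_comm⟩
    cases e with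
    | a i => exact f.map_comm (ArrowZ.a i) v
    | b i => exact f.map_comm (ArrowZ.b i) v
    | c => exact (map_zero _).trans (smul_zero _).symm
    | d => exact (map_zero _).trans (smul_zero _).symm
  · intro hx t f
    refine hx t ⟨f.g, fun {i j} e v => ?_, f.framing_comm⟩
    cases e with
    | a i => exact f.map_comm (ArrowX.a i) v
    | b i => exact f.map_comm (ArrowX.b i) v

open Classical in
theorem gdim_pushforward {δ : Vtx → ℕ} (J : FramedRep quiverZ δ) :
    gdim (pushforward J).grMod = gdim J.grMod := by
  have h : ∀ i w, Module.finrank ℂ ((pushforward J).grMod.obj (pt ⟨i, w⟩)) =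
      Module.finrank ℂ (J.grMod.obj (pt ⟨i, w⟩)) := by
    intro i w
    change Module.finrank ℂ ((pushforward J).weightSpace i w) = Module.finrank ℂ (J.weightSpace i w)
    rw [weightSpace_pushforward]
  have key : ∀ {f g : Weight → ℤ} (_ : f = g),
      (if h : f.support.Finite then Finsupp.ofSupportFinite f h else 0) =
        if h : g.support.Finite then Finsupp.ofSupportFinite g h else 0 := by
    rintro f _ rfl
    rfl
  exact funext fun i => key (funext fun w => congrArg Nat.cast (h i w))

theorem finiteSupport_of_pushforward {δ : Vtx → ℕ} {J : FramedRep quiverZ δ}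
    (h : FiniteSupport (pushforward J).grMod) : FiniteSupport J.grMod := by
  refine ⟨fun x => inferInstanceAs (Module.Finite ℂ (J.weightSpace x.vtx x.wt)), fun i => ?_⟩
  refine (h.2 i).subset fun w hw => ?_
  change ¬ Subsingleton ((pushforward J).weightSpace i w)
  rw [weightSpace_pushforward]
  exact hw

/-- A stable representation of the quiver of `X` on which the loops kill the framing comes from
the quiver of `Z`. -/
theorem exists_pushforward {δ : Vtx → ℕ} {V : FramedRep quiverX δ} {Θ : ℝ × ℝ} (h : V.IsStable Θ)
    (hc : V.map ArrowX.c V.framing = 0) : ∃ J : FramedRep quiverZ δ, V = pushforward J := by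
  let f : ∀ i, Module.End ℂ (Fin (δ i) → ℂ) := fun i => match i with
    | .v0 => V.map ArrowX.c
    | .v1 => V.map ArrowX.d
  have hz := h.eq_zero f (fun {i j} e => ⟨1, one_ne_zero, fun v => by
    rw [one_smul]
    cases e with
    | a i => exact LinearMap.congr_fun (V.relation _ _ (RelX.da i)) v
    | b i => exact LinearMap.congr_fun (V.relation _ _ (RelX.cb i)) v
    | c => rfl
    | d => rfl⟩) hc
  refine ⟨⟨fun i j e => match i, j, e with
      | _, _, .a i => V.map (ArrowX.a i)
      | _, _, .b i => V.map (ArrowX.b i), V.framing, fun {i j} p q hpq => ?_⟩, ?_⟩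
  · cases hpq with
    | aba i => exact V.relation _ _ (RelX.aba i)
    | bab i => exact V.relation _ _ (RelX.bab i)
  · refine FramedRep.ext ?_ rfl
    funext i j e
    cases e with
    | a i => rfl
    | b i => rfl
    | c => exact hz .v0
    | d => exact hz .v1

end LocalConifold

namespace LocalConifold

open WQuiver

theorem exists_sign_change {a b : ℝ} (ha : 0 < a) (hb : b < 0) (h : ∀ n : ℕ, a + n * b ≠ 0) :
    ∃ n : ℕ, 0 < a + n * b ∧ a + (n + 1) * b < 0 := by
  have hex : ∃ n : ℕ, a + n * b < 0 := by
    obtain ⟨n, hn⟩ := exists_nat_gt (a / -b)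
    refine ⟨n, ?_⟩
    rw [div_lt_iff₀ (by linarith)] at hn
    linarith
  classical
  obtain ⟨n, hn⟩ : ∃ n, Nat.find hex = n + 1 := by
    refine Nat.exists_eq_succ_of_ne_zero fun hc => ?_
    have := Nat.find_spec hex
    rw [hc, Nat.cast_zero, zero_mul, add_zero] at this
    exact lt_asymm ha this
  refine ⟨n, lt_of_le_of_ne (not_lt.1 (Nat.find_min hex (by omega))) (h n).symm, ?_⟩
  have := Nat.find_spec hex
  rw [hn] at this
  exact_mod_cast this

theorem regime_of_ne {θL θU : ℝ} (hL : θL < 0) (hU : 0 < θU) (hs : θL + θU ≠ 0)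
    (h1 : ∀ k : ℕ, (k : ℝ) * θL + (k + 1) * θU ≠ 0)
    (h2 : ∀ k : ℕ, ((k : ℝ) + 1) * θL + k * θU ≠ 0) : Regime θL θU := by
  rcases hs.lt_or_gt with hs | hs
  · obtain ⟨n, hn, hn'⟩ := exists_sign_change (a := θU) (b := θL + θU) hU hs fun n hc =>
      h1 n (by linear_combination hc)
    have hcl : ∀ N : ℕ, N ≤ n + 1 → ClosedCond θL θU N := fun N hN => ⟨hL, fun k _ hk' => by
      have h3 : (k : ℝ) ≤ n + 1 := by exact_mod_cast hk'.trans hN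
      nlinarith⟩
    have hop : ∀ N : ℕ, n + 1 ≤ N → OpenCond (-θU) (-θL) N := fun N hN =>
      ⟨by linarith, by linarith, by
        have h3 : (n : ℝ) + 1 ≤ N := by exact_mod_cast hN
        nlinarith⟩
    refine Or.inr (Or.inl ⟨n + 1, by omega, Or.inl ⟨by omega, hcl _ ?_, hop _ ?_⟩,
      Or.inl ⟨by omega, hcl _ ?_, hop _ ?_⟩⟩) <;> omega
  · obtain ⟨n, hn, hn'⟩ := exists_sign_change (a := -θL) (b := -(θL + θU)) (by linarith)
      (by linarith) fun n hc => h2 n (by linear_combination -hc)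
    have hcl : ∀ N : ℕ, N ≤ n + 1 → ClosedCond (-θU) (-θL) N := fun N hN =>
      ⟨by linarith, fun k _ hk' => by
        have h3 : (k : ℝ) ≤ n + 1 := by exact_mod_cast hk'.trans hN
        nlinarith⟩
    have hop : ∀ N : ℕ, n + 1 ≤ N → OpenCond θL θU N := fun N hN => ⟨hL, hs, by
        have h3 : (n : ℝ) + 1 ≤ N := by exact_mod_cast hN
        nlinarith⟩
    refine Or.inr (Or.inr ⟨-(n + 1), by omega, Or.inr ⟨by omega, hop _ ?_, hcl _ ?_⟩,
      Or.inr ⟨by omega, hop _ ?_, hcl _ ?_⟩⟩) <;> omega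

theorem regime_of_notMem_walls {Θ : ℝ × ℝ} (hΘ : Θ ∉ walls) :
    (0 ≤ Θ.1 ∧ 0 ≤ Θ.2) ∨ Regime Θ.1 Θ.2 ∨ Regime Θ.2 Θ.1 := by
  obtain ⟨x, y⟩ := Θ
  dsimp only
  have hw : x ≠ y → (∀ k : ℕ, (k : ℝ) * x + (k + 1) * y ≠ 0) ∧
      (∀ k : ℕ, ((k : ℝ) + 1) * x + k * y ≠ 0) ∧ x + y ≠ 0 := by
    intro hne
    refine ⟨fun k hk => hΘ ⟨hne, Or.inr (Or.inl ⟨k, hk⟩)⟩, fun k hk =>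
      hΘ ⟨hne, Or.inl ⟨k + 1, by omega, ?_⟩⟩, fun hk => hΘ ⟨hne, Or.inr (Or.inr hk)⟩⟩
    push_cast
    rw [add_sub_cancel_right]
    exact hk
  rcases lt_or_ge x 0 with hx | hx <;> rcases lt_or_ge y 0 with hy | hy
  · exact Or.inr (Or.inl (Or.inl ⟨hx, hy⟩))
  · obtain ⟨h1, h2, h3⟩ := hw (by linarith)
    have h4 := h1 0
    simp only [Nat.cast_zero, zero_mul, zero_add, one_mul] at h4
    exact Or.inr (Or.inl (regime_of_ne hx (lt_of_le_of_ne hy h4.symm) h3 h1 h2))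
  · obtain ⟨h1, h2, h3⟩ := hw (by linarith)
    have h4 := h2 0
    simp only [Nat.cast_zero, zero_mul, zero_add, one_mul, add_zero] at h4
    exact Or.inr (Or.inr (regime_of_ne hy (lt_of_le_of_ne hx h4.symm) (by rwa [add_comm])
      (fun k => by rw [add_comm]; exact h2 k) fun k => by rw [add_comm]; exact h1 k))
  · exact Or.inl ⟨hx, hy⟩

theorem corr_of_equiv {f g f' g' : KT} {τ σ : Weight ≃ Weight} (hf : ∀ w, f' w = f (τ w))
    (hg : ∀ w, g' w = g (σ w)) {s s' : Weight} (h : ∀ w, σ (w + s) = τ w + s') :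
    corr f' g' s = corr f g s' := by
  have e : f' = Finsupp.equivMapDomain τ.symm f := by
    ext w
    rw [hf, Finsupp.equivMapDomain_apply, Equiv.symm_symm]
  rw [corr, e, Finsupp.sum_equivMapDomain, corr]
  refine Finsupp.sum_congr fun w _ => ?_
  rw [hg, h, Equiv.apply_symm_apply]

/-- An operator which shifts the weights in one direction is nilpotent. -/
theorem isNilpotent_of_shift {E : Type*} [AddCommGroup E] [Module ℂ E]
    {pr : Weight → Module.End ℂ E} (hne : ∀ w w' x, w ≠ w' → pr w (pr w' x) = 0)
    (hs : ∃ S : Finset Weight, ∀ x, ∑ w ∈ S, pr w x = x) {T : Module.End ℂ E} {α : Weight}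
    (hα : α 1 + α 2 ≠ 0) (hT : ∀ w x, pr (w + α) (T x) = T (pr w x)) : IsNilpotent T := by
  obtain ⟨S, hS⟩ := hs
  have h1 : ∀ (n : ℕ) w x, pr (w + n • α) ((T ^ n) x) = (T ^ n) (pr w x) := by
    intro n
    induction n with
    | zero => intro w x; simp
    | succ n ih =>
      intro w x
      rw [pow_succ', Module.End.mul_apply, Module.End.mul_apply, ← ih, succ_nsmul, ← add_assoc, hT]
  have h2 : ∀ w, pr w ≠ 0 → w ∈ S := by
    intro w hw
    by_contra hc
    refine hw (LinearMap.ext fun x => ?_)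
    rw [← hS x, map_sum]
    exact Finset.sum_eq_zero fun w' hw' => hne _ _ _ fun h => hc (h ▸ hw')
  obtain ⟨B, hB⟩ := (S.image fun w => |w 1 + w 2|).exists_le
  refine ⟨(2 * B + 1).toNat, LinearMap.ext fun x => ?_⟩
  rw [← hS x, map_sum]
  refine Finset.sum_eq_zero fun w hw => ?_
  rw [← h1]
  have h3 : pr (w + (2 * B + 1).toNat • α) = 0 := by
    by_contra hc
    have h4 := hB _ (Finset.mem_image_of_mem _ (h2 _ hc))
    have h5 := hB _ (Finset.mem_image_of_mem _ hw)
    have h0 : 0 ≤ B := (abs_nonneg _).trans h5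
    have h7 : ∀ k, (w + (2 * B + 1).toNat • α) k = w k + (2 * B + 1) * α k := fun k => by
      rw [Pi.add_apply, Pi.smul_apply, nsmul_eq_mul, Int.toNat_of_nonneg (by omega)]
    rw [h7, h7] at h4
    rw [abs_le] at h4 h5
    rcases hα.lt_or_gt with h6 | h6 <;> nlinarith
  rw [h3]
  rfl

namespace FramedRep

variable {δ : Vtx → ℕ} {Θ : ℝ × ℝ}

open Classical in
/-- The image of the framing under the monomial of given weight and number of loops. -/
noncomputable def mono (V : FramedRep quiverX δ) (y : quiverX.Cover) (p : ℕ) : Fin (δ y.vtx) → ℂ :=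
  if h : ∃ P : Quiver.Path (⟨.v0, 0⟩ : quiverX.Cover) y, cnt P = p then
    pathMap (A := quiverX.Arrow) (i := .v0) (j := y.vtx) V.map (quiverX.proj.mapPath h.choose)
      V.framing else 0

variable {V : FramedRep quiverX δ}

theorem framing_mem_weightSpace (G : V.Grading) : V.framing ∈ V.weightSpace .v0 0 := by
  rw [← G.range_pr, ← G.pr_framing]
  exact LinearMap.mem_range_self _ _

theorem mono_eq (G : V.Grading) {y : quiverX.Cover}
    (P : Quiver.Path (⟨.v0, 0⟩ : quiverX.Cover) y) :
    V.mono y (cnt P) = pathMap (A := quiverX.Arrow) (i := .v0) (j := y.vtx) V.map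
      (quiverX.proj.mapPath P) V.framing := by
  have h : ∃ P' : Quiver.Path (⟨.v0, 0⟩ : quiverX.Cover) y, cnt P' = cnt P := ⟨P, rfl⟩
  rw [mono, dif_pos h]
  have h1 := pmor_eq_of_cnt _ _ h.choose_spec
  have h2 := congrArg (fun f => Subtype.val (p := fun u => u ∈ V.weightSpace y.vtx y.wt)
    ((V.grMod.map f).hom ⟨V.framing, framing_mem_weightSpace G⟩)) h1
  exact (V.lift_weightPrefunctor _ _).symm.trans (h2.trans (V.lift_weightPrefunctor _ _))

theorem mono_mem (G : V.Grading) (y : quiverX.Cover) (p : ℕ) :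
    V.mono y p ∈ V.weightSpace y.vtx y.wt := by
  by_cases h : ∃ P : Quiver.Path (⟨.v0, 0⟩ : quiverX.Cover) y, cnt P = p
  · obtain ⟨P, rfl⟩ := h
    rw [mono_eq G]
    have := V.lift_weightPrefunctor P ⟨V.framing, framing_mem_weightSpace G⟩
    rw [← this]
    exact Subtype.property _
  · rw [mono, dif_neg h]
    exact Submodule.zero_mem _

theorem map_mono (G : V.Grading) {y z : quiverX.Cover} (e : y ⟶ z) {p : ℕ}
    (h : ex (⟨.v0, 0⟩ : quiverX.Cover) 0 ≤ ex y p) :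
    V.map e.1 (V.mono y p) = V.mono z (p + Toric.cdeg e.1) := by
  have hn : 0 ≤ ht y p := by
    simp only [ex, expo_le_iff, lev_v0] at h
    simp only [ht]
    simp at h
    omega
  obtain ⟨P, hP⟩ := exists_path (ht y p).toNat ⟨.v0, 0⟩ y 0 p
    (by rw [Int.toNat_of_nonneg hn]; simp [ht, lev]) h (Or.inl trivial)
  rw [zero_add] at hP
  subst hP
  rw [mono_eq G]
  exact (mono_eq G (P.cons e)).symm

theorem mono_origin (G : V.Grading) : V.mono ⟨.v0, 0⟩ 0 = V.framing :=
  mono_eq G (.nil : Quiver.Path (⟨.v0, 0⟩ : quiverX.Cover) ⟨.v0, 0⟩)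

/-- Stable representations are isomorphic if there is a correspondence between them of the same
dimension which contains the framings. -/
theorem IsStable.nonempty_iso {Q : WQuiver} {V W : FramedRep Q δ} (hV : V.IsStable Θ)
    (hW : W.IsStable Θ)
    (R : ∀ i, Submodule ℂ ((Fin (δ i) → ℂ) × (Fin (δ i) → ℂ)))
    (hR : ∀ {i j : Vtx} (e : Q.Arrow i j) v, v ∈ R i → (V.map e v.1, W.map e v.2) ∈ R j)
    (hs : (V.framing, W.framing) ∈ R .v0) (hd : ∀ i, Module.finrank ℂ (R i) = δ i) :
    Nonempty (Iso V W) := by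
  have key : ∀ {V W : FramedRep Q δ} (_ : V.IsStable Θ) (_ : W.IsStable Θ)
      (R : ∀ i, Submodule ℂ ((Fin (δ i) → ℂ) × (Fin (δ i) → ℂ)))
      (_ : ∀ {i j : Vtx} (e : Q.Arrow i j) v, v ∈ R i → (V.map e v.1, W.map e v.2) ∈ R j)
      (_ : (V.framing, W.framing) ∈ R .v0) (_ : ∀ i, Module.finrank ℂ (R i) = δ i) (i : Vtx),
      ∀ y, (0, y) ∈ R i → y = 0 := by
    intro V W hV hW R hR hs hd i y hy
    by_contra hy0
    let S : V.Sub := ⟨fun i => (R i).map (LinearMap.fst ℂ _ _), by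
      rintro i j e _ ⟨v, hv, rfl⟩
      exact ⟨_, hR e v hv, rfl⟩⟩
    let T : W.Sub := ⟨fun i => (R i).comap (LinearMap.inr ℂ _ _), by
      intro i j e v hv
      have := hR e _ hv
      rw [LinearMap.inr_apply, map_zero] at this
      exact this⟩
    have hdim := fun i => (GRep.finrank_prod_eq (R i)).symm.trans (hd i)
    have h1 := hW.1 T ⟨i, fun hc => hy0 ((Submodule.mem_bot ℂ).1 (hc ▸ hy))⟩
    have h2 := hV.2 S ⟨_, hs, rfl⟩ ⟨i, fun hc => hy0 (by
      have h3 := hdim i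
      rw [show (R i).map (LinearMap.fst ℂ _ _) = ⊤ from hc, finrank_top, Module.finrank_fin_fun,
        Nat.add_eq_left, Submodule.finrank_eq_zero] at h3
      exact (Submodule.mem_bot ℂ).1 (h3 ▸ hy))⟩
    have e0 := congrArg (Nat.cast (R := ℝ)) (hdim .v0)
    have e1 := congrArg (Nat.cast (R := ℝ)) (hdim .v1)
    push_cast at e0 e1
    simp only [Sub.slope, S, T] at h1 h2
    rw [← e0, ← e1] at h2
    linarith
  have k1 := key hV hW R hR hs hd
  have k2 := key hW hV (fun i => (R i).map (LinearEquiv.prodComm ℂ _ _).toLinearMap)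
    (by
      rintro i j e _ ⟨v, hv, rfl⟩
      exact ⟨_, hR e v hv, rfl⟩) ⟨_, hs, rfl⟩
    (fun i => by rw [LinearEquiv.finrank_map_eq, hd])
  have b1 : ∀ i, Function.Bijective ((LinearMap.fst ℂ _ _).domRestrict (R i)) := by
    intro i
    have hinj : Function.Injective ((LinearMap.fst ℂ _ _).domRestrict (R i)) := by
      refine (injective_iff_map_eq_zero _).2 fun x hx => ?_
      obtain ⟨⟨x, y⟩, hxy⟩ := x
      obtain rfl : x = 0 := hx
      exact Subtype.ext (Prod.ext rfl (k1 i y hxy))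
    exact ⟨hinj, (LinearMap.injective_iff_surjective_of_finrank_eq_finrank
      (by rw [hd, Module.finrank_fin_fun])).1 hinj⟩
  have b2 : ∀ i, Function.Bijective ((LinearMap.snd ℂ _ _).domRestrict (R i)) := by
    intro i
    have hinj : Function.Injective ((LinearMap.snd ℂ _ _).domRestrict (R i)) := by
      refine (injective_iff_map_eq_zero _).2 fun x hx => ?_
      obtain ⟨⟨x, y⟩, hxy⟩ := x
      obtain rfl : y = 0 := hx
      exact Subtype.ext (Prod.ext (k2 i x ⟨_, hxy, rfl⟩) rfl)
    exact ⟨hinj, (LinearMap.injective_iff_surjective_of_finrank_eq_finrank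
      (by rw [hd, Module.finrank_fin_fun])).1 hinj⟩
  have h3 : ∀ i (z : R i), ((LinearEquiv.ofBijective _ (b1 i)).symm.trans
      (LinearEquiv.ofBijective _ (b2 i))) z.1.1 = z.1.2 := by
    intro i z
    have : (LinearEquiv.ofBijective _ (b1 i)).symm z.1.1 = z := by
      rw [LinearEquiv.symm_apply_eq]
      rfl
    rw [LinearEquiv.trans_apply, this]
    rfl
  refine ⟨⟨fun i => (LinearEquiv.ofBijective _ (b1 i)).symm.trans
    (LinearEquiv.ofBijective _ (b2 i)), fun {i j} e v => ?_, h3 .v0 ⟨_, hs⟩⟩⟩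
  obtain ⟨z, rfl⟩ := (b1 i).2 v
  exact (h3 j ⟨_, hR e z.1 z.2⟩).trans (congrArg (W.map e) (h3 i z).symm)

end FramedRep

end LocalConifold

namespace LocalConifold

open WQuiver

/-- A choice of the first vertex of the quiver of `X`, and of coordinates on the weight lattices
for which the arrows have the weights of a graded representation. -/
structure Orientation (j₀ : ℤ) where
  u : Vtx
  v : Vtx
  α : Fin 2 → ArrowX u v
  β : Fin 2 → ArrowX v u
  γu : ArrowX u u
  γv : ArrowX v v
  τu : Weight ≃ Weight
  τv : Weight ≃ Weight
  deg_α : ∀ i w, τv (w + ![tw 1, tw 2] i) = τu w + (α i).deg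
  deg_β : ∀ i w, τu (w + ![0, tw 0] i) = τv w + (β i).deg
  deg_γu : ∀ w, τu (w - one) = τu w + γu.deg
  deg_γv : ∀ w, τv (w - one) = τv w + γv.deg
  cdeg_α : ∀ i, ArrowX.cdeg (α i) = 0
  cdeg_β : ∀ i, ArrowX.cdeg (β i) = 0
  cdeg_γu : ArrowX.cdeg γu = 1
  cdeg_γv : ArrowX.cdeg γv = 1
  dom_u : ∀ w e, dom j₀ w e → 0 ≤ e ∧
    ex (⟨.v0, 0⟩ : quiverX.Cover) 0 ≤ ex (⟨u, τu w⟩ : quiverX.Cover) e.toNat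
  dom_v : ∀ w e, dom (j₀ + 1) w e → 0 ≤ e ∧
    ex (⟨.v0, 0⟩ : quiverX.Cover) 0 ≤ ex (⟨v, τv w⟩ : quiverX.Cover) e.toNat
  origin : (∃ w, dom j₀ w 0 ∧ (⟨u, τu w⟩ : quiverX.Cover) = ⟨.v0, 0⟩) ∨
    ∃ w, dom (j₀ + 1) w 0 ∧ (⟨v, τv w⟩ : quiverX.Cover) = ⟨.v0, 0⟩
  extend : ∀ {M : Vtx → Type} (x : M u) (y : M v), ∃ f : ∀ i, M i, f u = x ∧ f v = y
  vtx_cases : ∀ {p : Vtx → Prop}, p u → p v → ∀ i, p i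
  arrow_cases : ∀ {p : ∀ i j, ArrowX i j → Prop}, (∀ i, p u v (α i)) → (∀ i, p v u (β i)) →
    p u u γu → p v v γv → ∀ {i j} e, p i j e
  aba : ∀ {δ : Vtx → ℕ} (V : FramedRep quiverX δ) i j k x,
    V.map (α i) (V.map (β k) (V.map (α j) x)) = V.map (α j) (V.map (β k) (V.map (α i) x))
  bab : ∀ {δ : Vtx → ℕ} (V : FramedRep quiverX δ) i j k x,
    V.map (β i) (V.map (α k) (V.map (β j) x)) = V.map (β j) (V.map (α k) (V.map (β i) x))
  ca : ∀ {δ : Vtx → ℕ} (V : FramedRep quiverX δ) i x,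
    V.map γv (V.map (α i) x) = V.map (α i) (V.map γu x)
  cb : ∀ {δ : Vtx → ℕ} (V : FramedRep quiverX δ) i x,
    V.map γu (V.map (β i) x) = V.map (β i) (V.map γv x)
  θ : ℝ × ℝ → ℝ × ℝ
  slope_eq : ∀ (Θ : ℝ × ℝ) (f : Vtx → ℝ),
    Θ.1 * f .v0 + Θ.2 * f .v1 = (θ Θ).1 * f u + (θ Θ).2 * f v
  eulerSq_eq : ∀ (f : Vtx → KT) (L U : KT), (∀ w, L w = f u (τu w)) → (∀ w, U w = f v (τv w)) →
    - (ev L (psi j₀) - ev U fun w => psi (j₀ - 1) (w + tw 0)) = f .v0 0 ∧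
      eulerSq L U = eulerSq (f .v0) (f .v1)

theorem relX_aba {δ : Vtx → ℕ} (V : FramedRep quiverX δ) (i j k : Fin 2) (x : Fin (δ .v0) → ℂ) :
    V.map (ArrowX.a i) (V.map (ArrowX.b k) (V.map (ArrowX.a j) x)) =
      V.map (ArrowX.a j) (V.map (ArrowX.b k) (V.map (ArrowX.a i) x)) := by
  have h := LinearMap.congr_fun (V.relation _ _ (RelX.aba k)) x
  fin_cases i <;> fin_cases j
  exacts [rfl, h.symm, h, rfl]

theorem relX_bab {δ : Vtx → ℕ} (V : FramedRep quiverX δ) (i j k : Fin 2) (x : Fin (δ .v1) → ℂ) :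
    V.map (ArrowX.b i) (V.map (ArrowX.a k) (V.map (ArrowX.b j) x)) =
      V.map (ArrowX.b j) (V.map (ArrowX.a k) (V.map (ArrowX.b i) x)) := by
  have h := LinearMap.congr_fun (V.relation _ _ (RelX.bab k)) x
  fin_cases i <;> fin_cases j
  exacts [rfl, h.symm, h, rfl]

theorem weight_ext {w w' : Weight} (h0 : w 0 = w' 0) (h1 : w 1 = w' 1) (h2 : w 2 = w' 2) :
    w = w' := by
  funext i
  fin_cases i <;> assumption

/-- The orientation which starts with the framed vertex. -/
def orientationZero : Orientation 0 where
  u := .v0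
  v := .v1
  α := .a
  β := .b
  γu := .c
  γv := .d
  τu := Equiv.refl _
  τv := Equiv.refl _
  deg_α _ _ := rfl
  deg_β _ _ := rfl
  deg_γu w := by
    rw [Equiv.refl_apply, Equiv.refl_apply, ArrowX.deg, tw_three, sub_eq_add_neg]
    simp only [one, neg_add, sub_eq_add_neg]
  deg_γv w := by
    rw [Equiv.refl_apply, Equiv.refl_apply, ArrowX.deg, tw_three, sub_eq_add_neg]
    simp only [one, neg_add, sub_eq_add_neg]
  cdeg_α _ := rfl
  cdeg_β _ := rfl
  cdeg_γu := rfl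
  cdeg_γv := rfl
  dom_u w e h := by
    simp only [dom] at h
    simp only [ex, expo_le_iff, lev_v0, Equiv.refl_apply, Pi.zero_apply]
    omega
  dom_v w e h := by
    simp only [dom] at h
    simp only [ex, expo_le_iff, lev_v0, lev_v1, Equiv.refl_apply, Pi.zero_apply]
    omega
  origin := Or.inl ⟨0, by simp [dom], rfl⟩
  extend x y := ⟨fun i => match i with
    | .v0 => x
    | .v1 => y, rfl, rfl⟩
  vtx_cases h h' i := match i with
    | .v0 => h
    | .v1 => h'
  arrow_cases ha hb hc hd i j e := match i, j, e with
    | _, _, .a i => ha i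
    | _, _, .b i => hb i
    | _, _, .c => hc
    | _, _, .d => hd
  aba := relX_aba
  bab := relX_bab
  ca V i x := LinearMap.congr_fun (V.relation _ _ (RelX.da i)) x
  cb V i x := LinearMap.congr_fun (V.relation _ _ (RelX.cb i)) x
  θ := id
  slope_eq _ _ := rfl
  eulerSq_eq f L U hL hU := by
    obtain rfl : L = f .v0 := Finsupp.ext hL
    obtain rfl : U = f .v1 := Finsupp.ext hU
    exact ⟨by rw [ev_psi_zero, neg_neg], rfl⟩

/-- The change of coordinates for the orientation which starts with the unframed vertex. -/
def swapEquiv (l : ℤ) : Weight ≃ Weight where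
  toFun w := ![w 2, w 1 - w 0 + w 2 + l, w 0]
  invFun w := ![w 2, w 1 + w 2 - w 0 - l, w 0]
  left_inv w := weight_ext (by simp) (by simp; ring) (by simp)
  right_inv w := weight_ext (by simp) (by simp; ring) (by simp)

theorem swapEquiv_apply (l : ℤ) (w : Weight) : swapEquiv l w 0 = w 2 ∧
    swapEquiv l w 1 = w 1 - w 0 + w 2 + l ∧ swapEquiv l w 2 = w 0 := ⟨rfl, rfl, rfl⟩

theorem swapEquiv_add {l l' : ℤ} {s s' : Weight} (h0 : s' 0 = s 2)
    (h1 : s' 1 = s 1 - s 0 + s 2 + l' - l) (h2 : s' 2 = s 0) (w : Weight) :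
    swapEquiv l' (w + s) = swapEquiv l w + s' := by
  obtain ⟨e0, e1, e2⟩ := swapEquiv_apply l w
  obtain ⟨f0, f1, f2⟩ := swapEquiv_apply l' (w + s)
  refine weight_ext ?_ ?_ ?_
  · rw [f0, Pi.add_apply, Pi.add_apply, e0, h0]
  · rw [f1, Pi.add_apply, Pi.add_apply, Pi.add_apply, Pi.add_apply, e1, h1]
    ring
  · rw [f2, Pi.add_apply, Pi.add_apply, e2, h2]

/-- The orientation which starts with the unframed vertex. -/
def orientationOne : Orientation (-1) where
  u := .v1
  v := .v0
  α := .b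
  β := .a
  γu := .d
  γv := .c
  τu := swapEquiv 1
  τv := swapEquiv 0
  deg_α i w := by
    fin_cases i <;> exact swapEquiv_add (by simp [ArrowX.deg, tw_apply])
      (by simp [ArrowX.deg, tw_apply]) (by simp [ArrowX.deg, tw_apply]) w
  deg_β i w := by
    fin_cases i <;> exact swapEquiv_add (by simp [ArrowX.deg, tw_apply])
      (by simp [ArrowX.deg, tw_apply]) (by simp [ArrowX.deg, tw_apply]) w
  deg_γu w := by
    rw [sub_eq_add_neg]
    exact swapEquiv_add (by simp [ArrowX.deg, tw_apply, one])
      (by simp [ArrowX.deg, tw_apply, one]) (by simp [ArrowX.deg, tw_apply, one]) w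
  deg_γv w := by
    rw [sub_eq_add_neg]
    exact swapEquiv_add (by simp [ArrowX.deg, tw_apply, one])
      (by simp [ArrowX.deg, tw_apply, one]) (by simp [ArrowX.deg, tw_apply, one]) w
  cdeg_α _ := rfl
  cdeg_β _ := rfl
  cdeg_γu := rfl
  cdeg_γv := rfl
  dom_u w e h := by
    obtain ⟨e0, e1, e2⟩ := swapEquiv_apply 1 w
    simp only [dom] at h
    simp only [ex, expo_le_iff, lev_v0, lev_v1, Pi.zero_apply, e0, e1, e2]
    omega
  dom_v w e h := by
    obtain ⟨e0, e1, e2⟩ := swapEquiv_apply 0 w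
    simp only [dom] at h
    simp only [ex, expo_le_iff, lev_v0, Pi.zero_apply, e0, e1, e2]
    omega
  origin := Or.inr ⟨0, by simp [dom], congrArg (WQuiver.Cover.mk (Q := quiverX) .v0)
    (weight_ext rfl rfl rfl)⟩
  extend x y := ⟨fun i => match i with
    | .v0 => y
    | .v1 => x, rfl, rfl⟩
  vtx_cases h h' i := match i with
    | .v0 => h'
    | .v1 => h
  arrow_cases hb ha hd hc i j e := match i, j, e with
    | _, _, .a i => ha i
    | _, _, .b i => hb i
    | _, _, .c => hc
    | _, _, .d => hd
  aba := relX_bab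
  bab := relX_aba
  ca V i x := LinearMap.congr_fun (V.relation _ _ (RelX.cb i)) x
  cb V i x := LinearMap.congr_fun (V.relation _ _ (RelX.da i)) x
  θ := Prod.swap
  slope_eq _ _ := add_comm _ _
  eulerSq_eq f L U hL hU := by
    have h0 : swapEquiv 0 0 = 0 := weight_ext rfl rfl rfl
    refine ⟨by rw [ev_psi_neg_one, neg_neg, hU, h0], ?_⟩
    have h11 : ∀ {s s' : Weight}, s' 0 = s 2 → s' 1 = s 1 - s 0 + s 2 + 1 - 1 → s' 2 = s 0 →
        corr L L s = corr (f .v1) (f .v1) s' :=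
      fun a b c => corr_of_equiv hL hL (swapEquiv_add a b c)
    have h10 : ∀ {s s' : Weight}, s' 0 = s 2 → s' 1 = s 1 - s 0 + s 2 + 0 - 1 → s' 2 = s 0 →
        corr L U s = corr (f .v1) (f .v0) s' :=
      fun a b c => corr_of_equiv hL hU (swapEquiv_add a b c)
    have h01 : ∀ {s s' : Weight}, s' 0 = s 2 → s' 1 = s 1 - s 0 + s 2 + 1 - 0 → s' 2 = s 0 →
        corr U L s = corr (f .v0) (f .v1) s' :=
      fun a b c => corr_of_equiv hU hL (swapEquiv_add a b c)
    have h00 : ∀ {s s' : Weight}, s' 0 = s 2 → s' 1 = s 1 - s 0 + s 2 + 0 - 0 → s' 2 = s 0 →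
        corr U U s = corr (f .v0) (f .v0) s' :=
      fun a b c => corr_of_equiv hU hU (swapEquiv_add a b c)
    have k1 := h11 (s := 0) (s' := 0) (by simp) (by simp) (by simp)
    have k2 := h10 (s := tw 1) (s' := 0) (by simp [tw_apply]) (by simp [tw_apply]) (by simp [tw_apply])
    have k3 := h10 (s := tw 2) (s' := tw 0) (by simp [tw_apply]) (by simp [tw_apply])
      (by simp [tw_apply])
    have k4 := h10 (s := tw 1 + tw 2) (s' := tw 0 + tw 1) (by simp [tw_apply]) (by simp [tw_apply])
      (by simp [tw_apply])
    have k5 := h10 (s := tw 0 + tw 1 + tw 2) (s' := tw 0 + tw 2) (by simp [tw_apply])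
      (by simp [tw_apply]) (by simp [tw_apply])
    have k6 := h11 (s := tw 0 + tw 1 + tw 2) (s' := tw 0 + tw 1 + tw 2) (by simp [tw_apply])
      (by simp [tw_apply]) (by simp [tw_apply])
    have k7 := h00 (s := 0) (s' := 0) (by simp) (by simp) (by simp)
    have k8 := h01 (s := 0) (s' := tw 1) (by simp [tw_apply]) (by simp [tw_apply]) (by simp [tw_apply])
    have k9 := h01 (s := tw 0) (s' := tw 2) (by simp [tw_apply]) (by simp [tw_apply])
      (by simp [tw_apply])
    have k10 := h01 (s := tw 0 + tw 1) (s' := tw 1 + tw 2) (by simp [tw_apply])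
      (by simp [tw_apply]) (by simp [tw_apply])
    have k11 := h01 (s := tw 0 + tw 2) (s' := tw 0 + tw 1 + tw 2) (by simp [tw_apply])
      (by simp [tw_apply]) (by simp [tw_apply])
    have k12 := h00 (s := tw 0 + tw 1 + tw 2) (s' := tw 0 + tw 1 + tw 2) (by simp [tw_apply])
      (by simp [tw_apply]) (by simp [tw_apply])
    rw [eulerSq, k1, k2, k3, k4, k5, k6, k7, k8, k9, k10, k11, k12, eulerSq]
    ring

namespace Orientation

open FramedRep

variable {j₀ : ℤ} (o : Orientation j₀) {δ : Vtx → ℕ} {V : FramedRep quiverX δ}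

theorem sum_pr (G : V.Grading) (i : Vtx) (τ : Weight ≃ Weight) :
    ∃ S : Finset Weight, ∀ x, ∑ w ∈ S, G.pr i (τ w) x = x := by
  obtain ⟨S, hS⟩ := G.sum i
  refine ⟨S.map τ.symm.toEmbedding, fun x => ?_⟩
  rw [Finset.sum_map]
  simpa using hS x

theorem pr_ne (G : V.Grading) (i : Vtx) (τ : Weight ≃ Weight) (w w' : Weight) (x : Fin (δ i) → ℂ)
    (h : w ≠ w') : G.pr i (τ w) (G.pr i (τ w') x) = 0 :=
  G.pr_ne _ _ _ _ fun hc => h (τ.injective hc)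

theorem pr_mono (G : V.Grading) (y : quiverX.Cover) (p : ℕ) :
    G.pr y.vtx y.wt (V.mono y p) = V.mono y p := by
  obtain ⟨x, hx⟩ := (G.range_pr _ _).ge (mono_mem G y p)
  rw [← hx, G.pr_pr]

/-- The graded representation of a framed representation. -/
noncomputable def gRep (G : V.Grading) : GRep j₀ (Fin (δ o.u) → ℂ) (Fin (δ o.v) → ℂ) :=
  have hβ : ∀ i w x, G.pr o.u (o.τu (w + ![0, tw 0] i)) (V.map (o.β i) x) =
      V.map (o.β i) (G.pr o.v (o.τv w) x) := fun i w x => by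
    rw [o.deg_β]; exact G.pr_map _ _ _
  have hα : ∀ i w x, G.pr o.v (o.τv (w + ![tw 1, tw 2] i)) (V.map (o.α i) x) =
      V.map (o.α i) (G.pr o.u (o.τu w) x) := fun i w x => by
    rw [o.deg_α]; exact G.pr_map _ _ _
  have hu : ∀ w x, G.pr o.u (o.τu (w - one)) (V.map o.γu x) = V.map o.γu (G.pr o.u (o.τu w) x) :=
    fun w x => by rw [o.deg_γu]; exact G.pr_map _ _ _
  have hv : ∀ w x, G.pr o.v (o.τv (w - one)) (V.map o.γv x) = V.map o.γv (G.pr o.v (o.τv w) x) :=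
    fun w x => by rw [o.deg_γv]; exact G.pr_map _ _ _
  { a := fun i => V.map (o.α i)
    b := fun i => V.map (o.β i)
    cL := V.map o.γu
    cU := V.map o.γv
    aba := fun i j k x => o.aba V i j k x
    bab := fun i j k x => o.bab V i j k x
    ca := fun i x => o.ca V i x
    cb := fun i x => o.cb V i x
    nil_ab := fun i j => isNilpotent_of_shift (pr_ne G _ o.τv) (sum_pr G _ o.τv)
      (α := ![0, tw 0] j + ![tw 1, tw 2] i)
      (by fin_cases i <;> fin_cases j <;> simp [tw_apply])
      fun w x => by rw [← add_assoc]; exact (hα i _ _).trans (congrArg _ (hβ j w x))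
    nil_ba := fun i j => isNilpotent_of_shift (pr_ne G _ o.τu) (sum_pr G _ o.τu)
      (α := ![tw 1, tw 2] i + ![0, tw 0] j)
      (by fin_cases i <;> fin_cases j <;> simp [tw_apply])
      fun w x => by rw [← add_assoc]; exact (hβ j _ _).trans (congrArg _ (hα i w x))
    nil_cL := isNilpotent_of_shift (pr_ne G _ o.τu) (sum_pr G _ o.τu) (α := -one)
      (by simp [one, tw_apply]) fun w x => by rw [← sub_eq_add_neg]; exact hu w x
    nil_cU := isNilpotent_of_shift (pr_ne G _ o.τv) (sum_pr G _ o.τv) (α := -one)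
      (by simp [one, tw_apply]) fun w x => by rw [← sub_eq_add_neg]; exact hv w x
    prL := fun w => G.pr o.u (o.τu w)
    prU := fun w => G.pr o.v (o.τv w)
    prL_prL := fun w x => G.pr_pr _ _ x
    prU_prU := fun w x => G.pr_pr _ _ x
    prL_ne := pr_ne G _ o.τu
    prU_ne := pr_ne G _ o.τv
    sumL := sum_pr G _ o.τu
    sumU := sum_pr G _ o.τv
    prL_b := hβ
    prU_a := hα
    prL_c := hu
    prU_c := hv
    mL := fun w e => V.mono ⟨o.u, o.τu w⟩ e.toNat
    mU := fun w e => V.mono ⟨o.v, o.τv w⟩ e.toNat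
    prL_mL := fun w e _ => pr_mono G ⟨o.u, o.τu w⟩ e.toNat
    prU_mU := fun w e _ => pr_mono G ⟨o.v, o.τv w⟩ e.toNat
    a_mL := fun i w e h => (map_mono G (y := ⟨o.u, o.τu w⟩) (z := ⟨o.v, _⟩)
      ⟨o.α i, o.deg_α i w⟩ (o.dom_u w e h).2).trans
        (congrArg (fun n => V.mono _ (e.toNat + n)) (o.cdeg_α i))
    b_mU := fun i w e h => (map_mono G (y := ⟨o.v, o.τv w⟩) (z := ⟨o.u, _⟩)
      ⟨o.β i, o.deg_β i w⟩ (o.dom_v w e h).2).trans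
        (congrArg (fun n => V.mono _ (e.toNat + n)) (o.cdeg_β i))
    cL_mL := fun w e h => (map_mono G (y := ⟨o.u, o.τu w⟩) (z := ⟨o.u, _⟩)
      ⟨o.γu, o.deg_γu w⟩ (o.dom_u w e h).2).trans
        ((congrArg (fun n => V.mono _ (e.toNat + n)) o.cdeg_γu).trans
          (congrArg (V.mono _) (Int.toNat_add (o.dom_u w e h).1 zero_le_one).symm))
    cU_mU := fun w e h => (map_mono G (y := ⟨o.v, o.τv w⟩) (z := ⟨o.v, _⟩)
      ⟨o.γv, o.deg_γv w⟩ (o.dom_v w e h).2).trans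
        ((congrArg (fun n => V.mono _ (e.toNat + n)) o.cdeg_γv).trans
          (congrArg (V.mono _) (Int.toNat_add (o.dom_v w e h).1 zero_le_one).symm)) }

theorem gRep_gL (G : V.Grading) (w : Weight) : (o.gRep G).gL w = gdim V.grMod o.u (o.τu w) :=
  (G.gdim_apply _ _).symm

theorem gRep_gU (G : V.Grading) (w : Weight) : (o.gRep G).gU w = gdim V.grMod o.v (o.τv w) :=
  (G.gdim_apply _ _).symm

theorem exists_sub (G : V.Grading) (X : KSub (o.gRep G).toKRep) :
    ∃ S : V.Sub, S.U o.u = X.SL ∧ S.U o.v = X.SU := by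
  obtain ⟨f, hu, hv⟩ := o.extend (M := fun i => Submodule ℂ (Fin (δ i) → ℂ)) X.SL X.SU
  refine ⟨⟨f, fun {i j} e => ?_⟩, hu, hv⟩
  revert i j e
  refine o.arrow_cases (p := fun i j e => ∀ v ∈ f i, V.map e v ∈ f j) ?_ ?_ ?_ ?_
  · rw [hu, hv]; exact X.a_mem
  · rw [hu, hv]; exact X.b_mem
  · rw [hu]; exact X.cL_mem
  · rw [hv]; exact X.cU_mem

/-- The framing is one of the monomials. -/
theorem origin_mem {p : quiverX.Cover → Prop}
    (hu : ∀ w, dom j₀ w 0 → p ⟨o.u, o.τu w⟩) (hv : ∀ w, dom (j₀ + 1) w 0 → p ⟨o.v, o.τv w⟩) :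
    p ⟨.v0, 0⟩ := by
  rcases o.origin with ⟨w, h, e⟩ | ⟨w, h, e⟩
  · exact e ▸ hu w h
  · exact e ▸ hv w h

theorem semistable (G : V.Grading) {Θ : ℝ × ℝ} (h : V.IsStable Θ) :
    (o.gRep G).Semistable (o.θ Θ).1 (o.θ Θ).2 := by
  have hs : ∀ (X : KSub (o.gRep G).toKRep) (S : V.Sub), S.U o.u = X.SL → S.U o.v = X.SU →
      S.slope Θ = X.theta (o.θ Θ).1 (o.θ Θ).2 := by
    intro X S hu hv
    rw [KSub.theta, ← hu, ← hv]
    exact o.slope_eq Θ fun i => Module.finrank ℂ (S.U i)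
  constructor
  · intro X
    obtain ⟨S, hu, hv⟩ := o.exists_sub G X
    by_cases hS : ∃ i, S.U i ≠ ⊥
    · exact (hs X S hu hv ▸ h.1 S hS).le
    · push Not at hS
      rw [KSub.theta, ← hu, ← hv, hS, hS, finrank_bot, finrank_bot]
      simp
  · intro X hX
    obtain ⟨S, hu, hv⟩ := o.exists_sub G X
    by_cases hS : ∃ i, S.U i ≠ ⊤
    · have hm := o.origin_mem (p := fun y => V.mono y 0 ∈ S.U y.vtx)
        (fun w hw => by
          change V.mono ⟨o.u, o.τu w⟩ 0 ∈ S.U o.u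
          rw [hu]
          exact hX.1 (Submodule.subset_span ⟨w, 0, hw, rfl⟩))
        (fun w hw => by
          change V.mono ⟨o.v, o.τv w⟩ 0 ∈ S.U o.v
          rw [hv]
          exact hX.2 (Submodule.subset_span ⟨w, 0, hw, rfl⟩))
      dsimp only at hm
      rw [mono_origin G] at hm
      have h1 := h.2 S hm hS
      rw [hs X S hu hv] at h1
      rw [KSub.theta_top, Module.finrank_fin_fun, Module.finrank_fin_fun]
      exact (h1.trans_eq (o.slope_eq Θ fun i => δ i)).le
    · push Not at hS
      rw [KSub.theta_top, KSub.theta, ← hu, ← hv, hS, hS, finrank_top, finrank_top]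

theorem eulerSq_gdim (hj : j₀ ≤ 0) (G : V.Grading) {Θ : ℝ × ℝ} (h : V.IsStable Θ)
    (hΘ : Regime (o.θ Θ).1 (o.θ Θ).2) :
    eulerSq (gdim V.grMod .v0) (gdim V.grMod .v1) = gdim V.grMod .v0 0 := by
  obtain ⟨h1, h2⟩ := o.eulerSq_eq (gdim V.grMod) _ _ (o.gRep_gL G) (o.gRep_gU G)
  rw [← h2, ← h1, (GRep.eulerSq_eq (o.semistable G h) hj hΘ)]

theorem nonempty_iso (hj : j₀ ≤ 0) {W : FramedRep quiverX δ} (G : V.Grading) (G' : W.Grading)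
    {Θ : ℝ × ℝ} (h : V.IsStable Θ) (h' : W.IsStable Θ) (hΘ : Regime (o.θ Θ).1 (o.θ Θ).2)
    (hd : gdim V.grMod = gdim W.grMod) : Nonempty (Iso V W) := by
  obtain ⟨Y, hY, hL, hU⟩ := GRep.exists_correspondence (o.semistable G h) (o.semistable G' h') hj hΘ
    (Finsupp.ext fun w => by rw [o.gRep_gL, o.gRep_gL, hd])
    (Finsupp.ext fun w => by rw [o.gRep_gU, o.gRep_gU, hd])
  rw [Module.finrank_fin_fun] at hL hU
  obtain ⟨f, hu, hv⟩ := o.extend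
    (M := fun i => Submodule ℂ ((Fin (δ i) → ℂ) × (Fin (δ i) → ℂ))) Y.SL Y.SU
  refine h.nonempty_iso h' f (fun {i j} e => ?_) ?_
    (o.vtx_cases (by rw [hu, hL]) (by rw [hv, hU]))
  · revert i j e
    refine o.arrow_cases
      (p := fun i j e => ∀ v ∈ f i, (V.map e v.1, W.map e v.2) ∈ f j) ?_ ?_ ?_ ?_
    · rw [hu, hv]; exact Y.a_mem
    · rw [hu, hv]; exact Y.b_mem
    · rw [hu]; exact Y.cL_mem
    · rw [hv]; exact Y.cU_mem
  · rw [← mono_origin G, ← mono_origin G']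
    refine o.origin_mem (p := fun y => (V.mono y 0, W.mono y 0) ∈ f y.vtx) (fun w hw => ?_)
      fun w hw => ?_
    · change (V.mono ⟨o.u, o.τu w⟩ 0, W.mono ⟨o.u, o.τu w⟩ 0) ∈ f o.u
      rw [hu]
      exact hY.1 (Submodule.subset_span ⟨w, 0, hw, rfl⟩)
    · change (V.mono ⟨o.v, o.τv w⟩ 0, W.mono ⟨o.v, o.τv w⟩ 0) ∈ f o.v
      rw [hv]
      exact hY.2 (Submodule.subset_span ⟨w, 0, hw, rfl⟩)

end Orientation

namespace FramedRep

variable {δ : Vtx → ℕ} {V W : FramedRep quiverX δ} {Θ : ℝ × ℝ}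

theorem IsStable.eq_zero_of_nonneg (h : V.IsStable Θ) (hΘ : 0 ≤ Θ.1 ∧ 0 ≤ Θ.2) (i : Vtx) :
    δ i = 0 := by
  by_contra hi
  have := h.1 ⟨fun _ => ⊤, fun _ _ _ => trivial⟩ ⟨i, fun hc => hi (by
    have h1 := congrArg (fun S : Submodule ℂ (Fin (δ i) → ℂ) => Module.finrank ℂ S) hc
    dsimp only at h1
    rwa [finrank_top, finrank_bot, Module.finrank_fin_fun] at h1)⟩
  refine this.not_ge ?_
  have := hΘ.1
  have := hΘ.2
  unfold Sub.slope
  positivity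

/-- The Euler pairing of a stable representation with itself, in weight `0`. -/
theorem IsStable.eulerSq_gdim (h : V.IsStable Θ) (hΘ : Θ ∉ walls) (G : V.Grading) :
    eulerSq (gdim V.grMod .v0) (gdim V.grMod .v1) = gdim V.grMod .v0 0 := by
  rcases regime_of_notMem_walls hΘ with h0 | h1 | h1
  · have hz : ∀ i, gdim V.grMod i = 0 := by
      intro i
      ext w
      have h1 := (LinearMap.range (G.pr i w)).finrank_le
      rw [Module.finrank_fin_fun] at h1
      have h2 := h.eq_zero_of_nonneg h0 i
      rw [G.gdim_apply, Finsupp.zero_apply]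
      omega
    rw [hz, hz]
    simp [eulerSq, corr]
  · exact orientationZero.eulerSq_gdim le_rfl G h h1
  · exact orientationOne.eulerSq_gdim (by norm_num) G h h1

/-- Stable representations in the fixed locus are determined by their graded dimensions. -/
theorem IsStable.nonempty_iso_of_gdim (h : V.IsStable Θ) (h' : W.IsStable Θ) (hΘ : Θ ∉ walls)
    (G : V.Grading) (G' : W.Grading) (hd : gdim V.grMod = gdim W.grMod) : Nonempty (Iso V W) := by
  rcases regime_of_notMem_walls hΘ with h0 | h1 | h1
  · have hz := h.eq_zero_of_nonneg h0
    have hs : ∀ i (x y : Fin (δ i) → ℂ), x = y := fun i x y =>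
      funext fun k => absurd (k.2.trans_eq (hz i)) (Nat.not_lt_zero _)
    exact ⟨⟨fun i => LinearEquiv.refl _ _, fun _ _ => hs _ _ _, hs _ _ _⟩⟩
  · exact orientationZero.nonempty_iso le_rfl G G' h h' h1 hd
  · exact orientationOne.nonempty_iso (by norm_num) G G' h h' h1 hd

end FramedRep

end LocalConifold

namespace LocalConifold

open WQuiver

section EulerClasses

theorem KT.dual_apply (V : KT) (w : Weight) : V.dual w = V (-w) := rfl

theorem KT.isSquareRoot_iff {R V : KT} : R.IsSquareRoot V ↔ ∀ w, R w + R (-w) = V w := by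
  rw [KT.IsSquareRoot, Finsupp.ext_iff]
  rfl

theorem KT.exists_isSquareRoot {X : KT} {r : Weight → ℤ} (h : ∀ u, X u = r u + r (-u)) :
    ∃ R : KT, R.IsSquareRoot X := by
  refine ⟨Finsupp.onFinset X.support (fun u => if X u = 0 then 0 else r u) fun u hu => ?_,
    KT.isSquareRoot_iff.2 fun u => ?_⟩
  · rw [Finsupp.mem_support_iff]
    intro hc
    exact hu (if_pos hc)
  · have hs : X (-u) = X u := by rw [h, h, neg_neg, add_comm]
    rw [Finsupp.onFinset_apply, Finsupp.onFinset_apply, hs]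
    split_ifs with h0
    · rw [h0, add_zero]
    · exact (h u).symm

theorem c₁_add (w w' : Weight) : c₁ (w + w') = c₁ w + c₁ w' := by
  simp only [c₁, Pi.add_apply, Int.cast_add, add_mul, Finset.sum_add_distrib]

theorem c₁_neg (w : Weight) : c₁ (-w) = - c₁ w := by
  simp only [c₁, Pi.neg_apply, Int.cast_neg, neg_mul, Finset.sum_neg_distrib]

theorem c₁_ne_zero {w : Weight} (hw : w ≠ 0) : c₁ w ≠ 0 := by
  intro h
  refine hw (funext fun i => ?_)
  have h1 : c₁ w = algebraMap (MvPolynomial (Fin 3) ℚ) LamField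
      (∑ i, (w i : MvPolynomial (Fin 3) ℚ) * MvPolynomial.X i) := by
    simp only [c₁, map_sum, map_mul, map_intCast]
  rw [h1, FaithfulSMul.algebraMap_eq_zero_iff] at h
  have h2 := congrArg (MvPolynomial.eval (Pi.single i (1 : ℚ))) h
  simp only [map_sum, map_mul, map_intCast, MvPolynomial.eval_X, map_zero] at h2
  rw [Finset.sum_eq_single i (fun j _ hj => by rw [Pi.single_eq_of_ne hj, mul_zero])
    (fun h => absurd (Finset.mem_univ i) h), Pi.single_eq_same, mul_one] at h2
  exact_mod_cast h2

theorem euler_eq_prod {V : KT} {S : Finset Weight} (h : V.support ⊆ S) :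
    euler V = ∏ w ∈ S, c₁ w ^ V w :=
  Finsupp.prod_of_support_subset V h _ fun _ _ => zpow_zero _

theorem euler_add {V : KT} (hV : V 0 = 0) (W : KT) : euler (V + W) = euler V * euler W := by
  classical
  rw [euler_eq_prod (Finsupp.support_add (g₁ := V) (g₂ := W)),
    euler_eq_prod (Finset.subset_union_left (s₁ := V.support) (s₂ := W.support)),
    euler_eq_prod (Finset.subset_union_right (s₁ := V.support) (s₂ := W.support)),
    ← Finset.prod_mul_distrib]
  refine Finset.prod_congr rfl fun w _ => ?_
  rw [Finsupp.add_apply]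
  by_cases hw : w = 0
  · rw [hw, hV, zero_add, zpow_zero, one_mul]
  · exact zpow_add₀ (c₁_ne_zero hw) _ _

/-- The Euler class of an antiselfdual class is a sign. -/
theorem euler_of_add_dual {D : KT} (h : D + D.dual = 0) : ∃ ε : ℤˣ, euler D = ((ε : ℤ) : LamField) := by
  classical
  have hD : ∀ w, D (-w) = - D w := fun w => by
    have := DFunLike.congr_fun h w
    rw [Finsupp.add_apply, KT.dual_apply, Finsupp.zero_apply] at this
    omega
  have h0 : D 0 = 0 := by
    have := hD 0
    rw [neg_zero] at this
    omega
  have hsum : ∑ w ∈ D.support, D w = 0 := by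
    have h1 : ∑ w ∈ D.support, D w = ∑ w ∈ D.support, D (-w) := by
      refine Finset.sum_nbij' (fun w => -w) (fun w => -w) ?_ ?_ ?_ ?_ ?_ <;>
        simp [hD]
    simp only [hD, Finset.sum_neg_distrib] at h1
    omega
  have hsq : euler D * euler D = 1 := by
    have h1 : euler D = ∏ w ∈ D.support, c₁ (-w) ^ D (-w) := by
      rw [euler, Finsupp.prod]
      refine Finset.prod_nbij' (fun w => -w) (fun w => -w) ?_ ?_ ?_ ?_ ?_ <;>
        simp [hD]
    conv_lhs =>
      arg 1
      rw [h1]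
    rw [euler, Finsupp.prod, ← Finset.prod_mul_distrib]
    have h2 : ∀ w ∈ D.support, c₁ (-w) ^ D (-w) * c₁ w ^ D w = (-1 : LamField) ^ D (w) := by
      intro w hw
      have hw0 : w ≠ 0 := fun hc => Finsupp.mem_support_iff.1 hw (hc ▸ h0)
      rw [hD, c₁_neg, neg_eq_neg_one_mul, mul_zpow, mul_assoc, ← zpow_add₀ (c₁_ne_zero hw0),
        neg_add_cancel, zpow_zero, mul_one, zpow_neg, ← inv_zpow, inv_neg, inv_one]
    rw [Finset.prod_congr rfl h2]
    have h3 : ∀ S : Finset Weight, ∏ w ∈ S, (-1 : LamField) ^ D w = (-1) ^ ∑ w ∈ S, D w := by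
      intro S
      induction S using Finset.induction_on with
      | empty => simp
      | insert w S hw ih =>
        rw [Finset.prod_insert hw, Finset.sum_insert hw, ih, zpow_add₀ (by simp)]
    rw [h3, hsum, zpow_zero]
  rcases mul_self_eq_one_iff.1 hsq with h1 | h1
  · exact ⟨1, by rw [h1]; simp⟩
  · exact ⟨-1, by rw [h1]; simp⟩

theorem eulerTaut_eq {V : KT} (hV : ∀ w, 0 ≤ V w) : eulerTaut V =
    algebraMap (Polynomial LamField) Lam
      (V.prod fun w k => (Polynomial.X - Polynomial.C (c₁ w)) ^ k.toNat) := by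
  rw [eulerTaut, Finsupp.prod, Finsupp.prod, map_prod]
  refine Finset.prod_congr rfl fun w _ => ?_
  rw [map_pow, map_sub, RatFunc.algebraMap_X, RatFunc.algebraMap_C, ← zpow_natCast,
    Int.toNat_of_nonneg (hV w)]
  rfl

theorem specializesTo_algebraMap (p : Polynomial LamField) (a : LamField) :
    SpecializesTo (algebraMap (Polynomial LamField) Lam p) a (p.eval a) := by
  refine ⟨?_, ?_⟩
  · rw [RatFunc.denom_algebraMap, Polynomial.eval_one]
    exact one_ne_zero
  · rw [RatFunc.eval_algebraMap, Algebra.algebraMap_self, RingHom.id_apply]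
    rfl

theorem specializesTo_mul_eulerTaut {V : KT} (hV : ∀ w, 0 ≤ V w) (x a : LamField) :
    SpecializesTo (RatFunc.C x * eulerTaut V) a (x * V.prod fun w k => (a - c₁ w) ^ k) := by
  have h := specializesTo_algebraMap
    (Polynomial.C x * V.prod fun w k => (Polynomial.X - Polynomial.C (c₁ w)) ^ k.toNat) a
  rw [map_mul, RatFunc.algebraMap_C, ← eulerTaut_eq hV, Polynomial.eval_mul, Polynomial.eval_C,
    Finsupp.prod, Polynomial.eval_prod] at h
  convert h using 2
  refine Finset.prod_congr rfl fun w _ => ?_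
  rw [Polynomial.eval_pow, Polynomial.eval_sub, Polynomial.eval_X, Polynomial.eval_C, ← zpow_natCast,
    Int.toNat_of_nonneg (hV w)]

open Classical in
/-- The normalised tautological class tends to `1`. -/
theorem inftyValuation_eulerTaut {V : KT} {n : ℤ} (hn : (V.sum fun _ k => k) = n) :
    RatFunc.inftyValuation LamField (eulerTaut V * mPar ^ (-n) - 1) < 1 := by
  set v := RatFunc.inftyValuation LamField
  have hX : mPar ≠ 0 := RatFunc.X_ne_zero
  have hone : v 1 = 1 := map_one v
  have hval : ∀ {x : Lam}, v (x - 1) < 1 → v x = 1 := by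
    intro x hx
    have := v.map_add_eq_of_lt_right (x := x - 1) (y := 1) (by rwa [hone])
    rwa [sub_add_cancel, hone] at this
  have hmul : ∀ x y : Lam, v (x - 1) < 1 → v (y - 1) < 1 → v (x * y - 1) < 1 := by
    intro x y hx hy
    rw [show x * y - 1 = x * (y - 1) + (x - 1) by ring]
    refine v.map_add_lt ?_ hx
    rw [map_mul, hval hx, one_mul]
    exact hy
  have hinv : ∀ x : Lam, v (x - 1) < 1 → v (x⁻¹ - 1) < 1 := by
    intro x hx
    have h1 := hval hx
    have h0 : x ≠ 0 := fun hc => by rw [hc, map_zero] at h1; exact zero_ne_one h1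
    rw [show x⁻¹ - 1 = - (x⁻¹ * (x - 1)) by field_simp; ring, v.map_neg, map_mul, map_inv₀, h1,
      inv_one, one_mul]
    exact hx
  have hpow : ∀ (x : Lam) (k : ℕ), v (x - 1) < 1 → v (x ^ k - 1) < 1 := by
    intro x k hx
    induction k with
    | zero => rw [pow_zero, sub_self, map_zero]; exact zero_lt_one
    | succ k ih => rw [pow_succ]; exact hmul _ _ ih hx
  have hzpow : ∀ (x : Lam) (k : ℤ), v (x - 1) < 1 → v (x ^ k - 1) < 1 := by
    intro x k hx
    obtain ⟨k, rfl | rfl⟩ := k.eq_nat_or_neg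
    · rw [zpow_natCast]; exact hpow x k hx
    · rw [zpow_neg, zpow_natCast]; exact hinv _ (hpow x k hx)
  have hfac : ∀ c : LamField, v ((mPar - RatFunc.C c) * mPar⁻¹ - 1) < 1 := by
    intro c
    rw [sub_mul, mul_inv_cancel₀ hX, sub_sub_cancel_left, v.map_neg, map_mul, map_inv₀,
      show v mPar = WithZero.exp 1 from RatFunc.inftyValuation.X LamField]
    by_cases hc : c = 0
    · rw [hc, map_zero, map_zero, zero_mul]
      exact zero_lt_one
    · rw [show v (RatFunc.C c) = 1 from RatFunc.inftyValuation.C LamField hc, one_mul,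
        ← WithZero.exp_neg, ← WithZero.exp_zero, WithZero.exp_lt_exp]
      norm_num
  have hprod : eulerTaut V * mPar ^ (-n) =
      ∏ w ∈ V.support, ((mPar - RatFunc.C (c₁ w)) * mPar⁻¹) ^ V w := by
    have h3 : ∀ S : Finset Weight, ∏ w ∈ S, (mPar⁻¹) ^ V w = mPar ^ (- ∑ w ∈ S, V w) := by
      intro S
      induction S using Finset.induction_on with
      | empty => simp
      | insert w S hw ih =>
        rw [Finset.prod_insert hw, Finset.sum_insert hw, ih, neg_add, zpow_add₀ hX, inv_zpow']
    simp only [mul_zpow]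
    rw [Finset.prod_mul_distrib, h3, ← hn]
    rfl
  rw [hprod]
  exact Finset.prod_induction _ (fun x => v (x - 1) < 1) hmul
    (by rw [sub_self, map_zero]; exact zero_lt_one) fun w _ => hzpow _ _ (hfac _)

end EulerClasses

section Pairings

variable {δ : Vtx → ℕ}

theorem chiXFF_spec {V : FramedRep quiverX δ} (h : FiniteSupport V.grMod) :
    PairingDefined 4 V.grMod V.grMod ∧ ∀ u, chiXFF V u =
      eulerForm (gdim V.grMod) (gdim V.grMod) u + eulerForm (gdim V.grMod) (gdim V.grMod) (-u) :=
  pairing_of_hasLoop (Q := quiverX) trivial h h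

theorem chiXF_spec {V : FramedRep quiverX δ} (h : FiniteSupport V.grMod) :
    PairingDefined 4 quiverX.structureSheaf V.grMod ∧ chiXF V = gdim V.grMod .v0 :=
  ⟨(pairing_proj₀ 4 h).1, Finsupp.ext (pairing_proj₀ 4 h).2⟩

theorem chiZFF_spec {J : FramedRep quiverZ δ} (h : FiniteSupport J.grMod) :
    PairingDefined 3 J.grMod J.grMod ∧
      ∀ u, chiZFF J u = eulerForm (gdim J.grMod) (gdim J.grMod) u :=
  pairing_of_not_hasLoop (Q := quiverZ) id h h

theorem chiZF_spec {J : FramedRep quiverZ δ} (h : FiniteSupport J.grMod) :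
    PairingDefined 3 quiverZ.structureSheaf J.grMod ∧ chiZF J = gdim J.grMod .v0 :=
  ⟨(pairing_proj₀ 3 h).1, Finsupp.ext (pairing_proj₀ 3 h).2⟩

theorem chiZFO_spec {J : FramedRep quiverZ δ} (h : FiniteSupport J.grMod) :
    PairingDefined 3 J.grMod quiverZ.structureSheaf ∧
      ∀ u, chiZFO J u = - gdim J.grMod .v0 (tw 3 - u) :=
  pairing_structureSheaf (Q := quiverZ) id h

theorem WQuiver.FiniteSupport.gdim_nonneg {Q : WQuiver} {M : Q.GrMod} (h : FiniteSupport M) (i : Vtx)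
    (w : Weight) : 0 ≤ gdim M i w := by
  rw [h.gdim_apply]
  exact Nat.cast_nonneg _

/-- The Euler class of the Serre dual part of the obstruction theory on `Z`. -/
theorem euler_neg_chiZFO {J : FramedRep quiverZ δ} (h : FiniteSupport J.grMod) :
    euler (- chiZFO J) = (gdim J.grMod .v0).prod fun w k => (lam 3 - c₁ w) ^ k := by
  have h1 : - chiZFO J = Finsupp.equivMapDomain (Equiv.subLeft (tw 3)) (gdim J.grMod .v0) := by
    ext u
    rw [Finsupp.neg_apply, (chiZFO_spec h).2, neg_neg, Finsupp.equivMapDomain_apply,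
      Equiv.subLeft_symm_apply, sub_eq_neg_add]
  rw [h1, euler, Finsupp.prod_equivMapDomain]
  refine Finset.prod_congr rfl fun w _ => ?_
  dsimp only
  rw [lam, Equiv.subLeft_apply, sub_eq_add_neg, c₁_add, c₁_neg, ← sub_eq_add_neg]

end Pairings

section FixedLoci

variable {Θ : ℝ × ℝ} {n d : ℤ}

theorem FixedLocus.isStable (I : FixedLocus Θ n d) : I.rep.IsStable Θ := I.2.2.2.1

theorem FixedLocus.nonempty_grading (I : FixedLocus Θ n d) : Nonempty I.rep.Grading :=
  I.isStable.nonempty_grading I.2.2.2.2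

theorem FixedLocus.finiteSupport (I : FixedLocus Θ n d) : FiniteSupport I.rep.grMod :=
  I.nonempty_grading.some.finiteSupport

theorem quiverX_deg_le {i j : Vtx} (e : quiverX.Arrow i j) (k : Fin 3) : |quiverX.deg e k| ≤ 1 := by
  cases e with
  | a i => fin_cases i <;> fin_cases k <;> simp [quiverX, ArrowX.deg, tw]
  | b i => fin_cases i <;> fin_cases k <;> simp [quiverX, ArrowX.deg, tw]
  | c => fin_cases k <;> simp [quiverX, ArrowX.deg, tw]
  | d => fin_cases k <;> simp [quiverX, ArrowX.deg, tw]

theorem FixedLocus.gdim_injective (hΘ : Θ ∉ walls) {I I' : FixedLocus Θ n d}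
    (h : gdim I.rep.grMod = gdim I'.rep.grMod) : I = I' := by
  have h1 := I.isStable.nonempty_iso_of_gdim I'.isStable hΘ I.nonempty_grading.some
    I'.nonempty_grading.some h
  have h2 : (⟦I.rep⟧ : _root_.Quotient (FramedRep.setoid quiverX (dimVec n d))) = ⟦I'.rep⟧ :=
    _root_.Quotient.sound h1
  refine Subtype.ext ?_
  rwa [FixedLocus.rep, FixedLocus.rep, Quotient.out_eq, Quotient.out_eq] at h2

theorem finite_fixedLocus (hΘ : Θ ∉ walls) (n d : ℤ) : Finite (FixedLocus Θ n d) := by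
  set N : ℕ := dimVec n d .v0 + dimVec n d .v1 + 1
  have hle : ∀ (I : FixedLocus Θ n d) i w, gdim I.rep.grMod i w ∈ Set.Icc (0 : ℤ) N := by
    intro I i w
    refine ⟨I.finiteSupport.gdim_nonneg i w, ?_⟩
    obtain ⟨G⟩ := I.nonempty_grading
    have h1 := (LinearMap.range (G.pr i w)).finrank_le
    rw [Module.finrank_fin_fun] at h1
    rw [G.gdim_apply]
    cases i <;> omega
  have hzero : ∀ (I : FixedLocus Θ n d) i w, (∃ k, ¬ w k ∈ Set.Icc (-N : ℤ) N) →
      gdim I.rep.grMod i w = 0 := by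
    rintro I i w ⟨k, hk⟩
    obtain ⟨G⟩ := I.nonempty_grading
    have h1 : G.pr i w = 0 := by
      by_contra hc
      have := G.natAbs_le I.isStable quiverX_deg_le hc k
      rw [Set.mem_Icc] at hk
      omega
    rw [G.gdim_apply, h1, LinearMap.range_zero, finrank_bot]
    rfl
  refine Finite.of_injective (β := (Fin 3 → Set.Icc (-N : ℤ) N) →
      Set.Icc (0 : ℤ) N × Set.Icc (0 : ℤ) N)
    (fun I w => (⟨_, hle I .v0 fun k => w k⟩, ⟨_, hle I .v1 fun k => w k⟩)) fun I I' h => ?_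
  refine FixedLocus.gdim_injective hΘ (funext fun i => Finsupp.ext fun w => ?_)
  by_cases hw : ∀ k, w k ∈ Set.Icc (-N : ℤ) N
  · have h1 := congrFun h fun k => ⟨w k, hw k⟩
    cases i
    · exact congrArg Subtype.val (congrArg Prod.fst h1)
    · exact congrArg Subtype.val (congrArg Prod.snd h1)
  · push Not at hw
    rw [hzero I i w hw, hzero I' i w hw]

theorem FixedLocus.eulerForm_zero (hΘ : Θ ∉ walls) (I : FixedLocus Θ n d) :
    eulerForm (gdim I.rep.grMod) (gdim I.rep.grMod) 0 = gdim I.rep.grMod .v0 0 := by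
  rw [eulerForm_self]
  exact I.isStable.eulerSq_gdim hΘ I.nonempty_grading.some

theorem FixedLocus.sub_apply_zero (hΘ : Θ ∉ walls) (I : FixedLocus Θ n d) {R : KT}
    (hR : R.IsSquareRoot (chiXFF I.rep)) : (- chiXF I.rep + R) 0 = 0 := by
  have h := KT.isSquareRoot_iff.1 hR 0
  rw [(chiXFF_spec I.finiteSupport).2, neg_zero, I.eulerForm_zero hΘ] at h
  rw [Finsupp.add_apply, Finsupp.neg_apply, (chiXF_spec I.finiteSupport).2]
  omega

theorem FixedLocus.sum_chiXF (I : FixedLocus Θ n d) : ((chiXF I.rep).sum fun _ k => k) = n := by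
  obtain ⟨G⟩ := I.nonempty_grading
  rw [(chiXF_spec G.finiteSupport).2, G.sum_gdim]
  exact Int.toNat_of_nonneg I.2.1

theorem FixedLocus.chiXF_nonneg (I : FixedLocus Θ n d) (w : Weight) : 0 ≤ chiXF I.rep w := by
  rw [(chiXF_spec I.finiteSupport).2]
  exact I.finiteSupport.gdim_nonneg _ _

theorem nonempty_signChoice : Nonempty (SignChoice Θ) := by
  have h : ∀ {n d : ℤ} (I : FixedLocus Θ n d), ∃ R : KT, R.IsSquareRoot (chiXFF I.rep) :=
    fun I => KT.exists_isSquareRoot (chiXFF_spec I.finiteSupport).2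
  exact ⟨⟨fun I => (h I).choose, fun I => (h I).choose_spec, fun _ => 1⟩⟩

/-- A fixed point which is not supported on `Z` has the weight of the last coordinate. -/
theorem FixedLocus.chiXF_tw_three (I : FixedLocus Θ n d)
    (h : ¬ ∃ J : FramedRep quiverZ (dimVec n d), I.rep = pushforward J) : chiXF I.rep (tw 3) ≠ 0 := by
  obtain ⟨G⟩ := I.nonempty_grading
  rw [(chiXF_spec I.finiteSupport).2, G.gdim_apply]
  intro hc
  rw [Nat.cast_eq_zero, Submodule.finrank_eq_zero] at hc
  refine h (exists_pushforward I.isStable ?_)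
  have h1 := I.rep.map_mem_weightSpace (Q := quiverX) ArrowX.c (w := 0) (w' := tw 3)
    (zero_add _).symm (FramedRep.framing_mem_weightSpace G)
  rw [← G.range_pr, hc] at h1
  exact (Submodule.mem_bot ℂ).1 h1

section Pushforward

variable {I : FixedLocus Θ n d} {J : FramedRep quiverZ (dimVec n d)}

theorem finiteSupport_of_rep_eq (hJ : I.rep = pushforward J) : FiniteSupport J.grMod :=
  finiteSupport_of_pushforward (hJ ▸ I.finiteSupport)

theorem gdim_of_rep_eq (hJ : I.rep = pushforward J) : gdim I.rep.grMod = gdim J.grMod := by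
  rw [hJ]
  exact gdim_pushforward J

theorem isSquareRoot_chiZFF (hJ : I.rep = pushforward J) :
    (chiZFF J).IsSquareRoot (chiXFF I.rep) := by
  have h := (chiZFF_spec (finiteSupport_of_rep_eq hJ)).2
  rw [← gdim_of_rep_eq hJ] at h
  exact KT.isSquareRoot_iff.2 fun u => by rw [h, h, (chiXFF_spec I.finiteSupport).2]

theorem chiZII₀_eq (hJ : I.rep = pushforward J) :
    chiZII₀ J = (- chiXF I.rep + chiZFF J) + - chiZFO J := by
  rw [chiZII₀, (chiZF_spec (finiteSupport_of_rep_eq hJ)).2, (chiXF_spec I.finiteSupport).2,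
    gdim_of_rep_eq hJ]
  abel

theorem eulerDefined_chiZII₀ (hΘ : Θ ∉ walls) (hJ : I.rep = pushforward J) :
    (chiZII₀ J).EulerDefined := by
  have hf := finiteSupport_of_rep_eq hJ
  rw [KT.EulerDefined, chiZII₀_eq hJ, Finsupp.add_apply,
    I.sub_apply_zero hΘ (isSquareRoot_chiZFF hJ), zero_add, Finsupp.neg_apply, (chiZFO_spec hf).2,
    neg_neg]
  exact hf.gdim_nonneg _ _

theorem euler_chiZII₀ (hΘ : Θ ∉ walls) (hJ : I.rep = pushforward J) :
    euler (chiZII₀ J) = euler (- chiXF I.rep + chiZFF J) *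
      (chiXF I.rep).prod fun w k => (lam 3 - c₁ w) ^ k := by
  rw [chiZII₀_eq hJ, euler_add (I.sub_apply_zero hΘ (isSquareRoot_chiZFF hJ)),
    euler_neg_chiZFO (finiteSupport_of_rep_eq hJ), (chiXF_spec I.finiteSupport).2,
    gdim_of_rep_eq hJ]

theorem euler_halfChi (hΘ : Θ ∉ walls) {R R' : KT} (hR : R.IsSquareRoot (chiXFF I.rep))
    (hR' : R'.IsSquareRoot (chiXFF I.rep)) : ∃ ε : ℤˣ,
      euler (- chiXF I.rep + R) = ((ε : ℤ) : LamField) * euler (- chiXF I.rep + R') := by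
  have h : (R - R') + (R - R').dual = 0 := by
    ext w
    have h1 := KT.isSquareRoot_iff.1 hR w
    have h2 := KT.isSquareRoot_iff.1 hR' w
    rw [Finsupp.add_apply, KT.dual_apply, Finsupp.sub_apply, Finsupp.sub_apply, Finsupp.zero_apply]
    omega
  obtain ⟨ε, hε⟩ := euler_of_add_dual h
  refine ⟨ε, ?_⟩
  rw [← hε, ← euler_add]
  · congr 1
    abel
  · have := DFunLike.congr_fun h 0
    rw [Finsupp.add_apply, KT.dual_apply, Finsupp.zero_apply, neg_zero] at this
    omega

end Pushforward

theorem specializesTo_contribution (o : SignChoice Θ) (I : FixedLocus Θ n d) :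
    SpecializesTo (o.contribution I) (lam 3)
      (o.eulerHalf I * (chiXF I.rep).prod fun w k => (lam 3 - c₁ w) ^ k) :=
  specializesTo_mul_eulerTaut I.chiXF_nonneg _ _

theorem seriesTendsTo_tautInv (hΘ : Θ ∉ walls) (o : SignChoice Θ) :
    SeriesTendsTo (substQ o.tautInv) o.plainInv := by
  classical
  intro n d
  haveI := finite_fixedLocus hΘ n d
  haveI := Fintype.ofFinite (FixedLocus Θ n d)
  rw [TendsToAtInfinity, substQ, SignChoice.tautInv, SignChoice.plainInv,
    finsum_eq_sum_of_fintype, finsum_eq_sum_of_fintype, Finset.sum_mul, map_sum,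
    ← Finset.sum_sub_distrib]
  refine Valuation.map_sum_lt' _ zero_lt_one fun I _ => ?_
  rw [SignChoice.contribution, mul_assoc, ← mul_sub_one, map_mul]
  have h1 := inftyValuation_eulerTaut I.sum_chiXF
  by_cases hc : o.eulerHalf I = 0
  · rw [hc, map_zero, map_zero, zero_mul]
    exact zero_lt_one
  · rw [RatFunc.inftyValuation.C LamField hc, one_mul]
    convert h1

end FixedLoci

end LocalConifold

open LocalConifold in
theorem proposition3p5 (Θ : ℝ × ℝ) (hΘ : Θ ∉ walls) :
    -- All objects in the two claims are well defined.
    ((∀ n d : ℤ, Finite (FixedLocus Θ n d)) ∧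
      Nonempty (SignChoice Θ) ∧
      (∀ (n d : ℤ) (I : FixedLocus Θ n d),
        WQuiver.PairingDefined 4 I.rep.grMod I.rep.grMod ∧
        WQuiver.PairingDefined 4 quiverX.structureSheaf I.rep.grMod ∧
        (∀ o : SignChoice Θ, (o.halfChi I).EulerDefined) ∧
        (∀ J : FramedRep quiverZ (dimVec n d), I.rep = pushforward J →
          WQuiver.PairingDefined 3 J.grMod J.grMod ∧
          WQuiver.PairingDefined 3 quiverZ.structureSheaf J.grMod ∧
          WQuiver.PairingDefined 3 J.grMod quiverZ.structureSheaf ∧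
          (chiZII₀ J).EulerDefined))) ∧
    -- (1) Dimensional reduction.
    (∀ (n d : ℤ) (I : FixedLocus Θ n d),
      (∀ J : FramedRep quiverZ (dimVec n d), I.rep = pushforward J →
        (chiZFF J).IsSquareRoot (chiXFF I.rep) ∧
        SpecializesTo
          (RatFunc.C (euler (- chiXF I.rep + chiZFF J)) * eulerTaut (chiXF I.rep)) (lam 3)
          (euler (chiZII₀ J)) ∧
        ∀ o : SignChoice Θ, ∃ ε : ℤˣ,
          SpecializesTo (o.contribution I) (lam 3) (((ε : ℤ) : LamField) * euler (chiZII₀ J))) ∧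
      ((¬ ∃ J : FramedRep quiverZ (dimVec n d), I.rep = pushforward J) →
        ∀ o : SignChoice Θ, SpecializesTo (o.contribution I) (lam 3) 0)) ∧
    -- (2) Insertion-free limit.
    (∀ o : SignChoice Θ, SeriesTendsTo (substQ o.tautInv) o.plainInv) := by 
  refine ⟨⟨finite_fixedLocus hΘ, nonempty_signChoice, fun n d I => ⟨(chiXFF_spec I.finiteSupport).1,
    (chiXF_spec I.finiteSupport).1, fun o => (I.sub_apply_zero hΘ (o.isSquareRoot I)).ge,
    fun J hJ => ⟨(chiZFF_spec (finiteSupport_of_rep_eq hJ)).1,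
      (chiZF_spec (finiteSupport_of_rep_eq hJ)).1, (chiZFO_spec (finiteSupport_of_rep_eq hJ)).1,
      eulerDefined_chiZII₀ hΘ hJ⟩⟩⟩, fun n d I => ⟨fun J hJ => ⟨isSquareRoot_chiZFF hJ, ?_,
    fun o => ?_⟩, fun h o => ?_⟩, seriesTendsTo_tautInv hΘ⟩
  · rw [euler_chiZII₀ hΘ hJ]
    exact specializesTo_mul_eulerTaut I.chiXF_nonneg _ _
  · obtain ⟨ε, hε⟩ := euler_halfChi hΘ (o.isSquareRoot I) (isSquareRoot_chiZFF hJ)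
    refine ⟨o.sign I * ε, ?_⟩
    have h := specializesTo_contribution o I
    rw [SignChoice.eulerHalf, SignChoice.halfChi, hε] at h
    rw [euler_chiZII₀ hΘ hJ, Units.val_mul, Int.cast_mul]
    simpa only [mul_assoc] using h
  · have h1 := specializesTo_contribution o I
    have h2 := I.chiXF_tw_three h
    rwa [Finsupp.prod, Finset.prod_eq_zero (Finsupp.mem_support_iff.2 h2)
      (by rw [lam, sub_self, zero_zpow _ h2]), mul_zero] at h1
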